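/- Let $n\ge 3$ and let $(M,g)$ be a smooth Riemannian $n$-manifold with Levi-Civita connection $\nabla$, and Riemann curvature $R(\xi,\eta)\zeta=\nabla_\xi\nabla_\eta\zeta-\nabla_\eta\nabla_\xi\zeta-\nabla_{[\xi,\eta]}\zeta$. Put $\operatorname{Ric}(\eta,\zeta)=\sum_i g(R(\xi_i,\eta)\zeta,\xi_i)$ for an orthonormal frame $(\xi_i)$, $\operatorname{Sc}=\operatorname{tr}_g\operatorname{Ric}$, and let $\mathsf P=\frac1{n-2}\bigl(\operatorname{Ric}-\frac1n\operatorname{Sc}\,g\bigr)+\frac1{2n(n-1)}\operatorname{Sc}\,g$ be the Schouten tensor, with $\mathsf P(\xi)$ the one-form $\mathsf P(\xi,\cdot)$. For a vector field $\eta$ and a one-form $\alpha$ let $\{\eta,\alpha\}(\zeta)=\alpha(\eta)\zeta+\alpha(\zeta)\eta-g(\zeta,\eta)\alpha^\#$. The Weyl curvature $W$ is defined by $R(\xi,\eta)(\zeta)=W(\xi,\eta)(\zeta)+\{\xi,\mathsf P(\eta)\}(\zeta)-\{\eta,\mathsf P(\xi)\}(\zeta)$, and the Cotton–York tensor by $Y(\xi,\eta)=\nabla_\xi(\mathsf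 P(\eta))-\nabla_\eta(\mathsf P(\xi))-\mathsf P([\xi,\eta])$, a one-form. Let $b(x,y)=x_0y_{n+1}+x_{n+1}y_0+\sum_{i=1}^n x_iy_i$ on $\mathbb R^{n+2}$. In block form of sizes $1,n,1$, the Lie algebra $\mathfrak o(b)$ of $O(b)$ consists of the matrices $\begin{pmatrix} a&Z&0\\ X&A&-Z^t\\ 0&-X^t&-a\end{pmatrix}$ with $a\in\mathbb R$, $X\in\mathbb R^n$, $Z\in\mathbb R^{n*}$, $A\in\mathfrak o(n)$; let $\mathfrak g_{-1}\cong\mathbb R^n$, $\mathfrak g_0$, $\mathfrak g_1\cong\mathbb R^{n*}$ be the parts given by $X$, $(a,A)$, $Z$, and let $E$ be the element with $a=1$ and $X=Z=A=0$. Let $\mathbb V$ be a finite-dimensional irreducible real (smooth) representation of $O(b)$. Then $\mathbb V=\bigoplus_{j=0}^N\mathbb V_j$, where $\mathbb V_j$ is the eigenspace of $E$ for the eigenvalue $\lambda+j$ and $\lambda$ is the lowest eigenvalue of $E$ on $\mathbb V$ (and $\mathbb V_j=0$ for $j\notin\{0,\dots,N\}$). Restrict to $O(n)\subset O(b)$ (the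 matrices $\operatorname{diag}(1,A,1)$) and let $\mathcal VM=\mathcal OM\times_{O(n)}\mathbb V=\bigoplus_j\mathcal V_jM$ be the bundle associated to the orthonormal frame bundle, with the connection $\nabla$ induced by the Levi-Civita connection. The infinitesimal actions of $\mathfrak g_{-1}$, $\mathfrak o(n)\subset\mathfrak g_0$ and $\mathfrak g_1$ on $\mathbb V$ induce actions $\bullet$ of $TM$, of the skew-symmetric endomorphisms $\mathfrak o(TM)$ and of $T^*M$ on $\mathcal VM$. The twisted connection is $\nabla^{\mathcal V}_\xi s=\nabla_\xi s+\xi\bullet s-\mathsf P(\xi)\bullet s$. For a connection $D$ on $\mathcal VM$ (that is, $D=\nabla$ or $D=\nabla^{\mathcal V}$), let $d^{D}:\Omega^k(M,\mathcal VM)\to\Omega^{k+1}(M,\mathcal VM)$ be the covariant exterior derivative $$d^D\phi(\xi_0,\dots,\xi_k)=\sum_i(-1)^iD_{\xi_i}\bigl(\phi(\xi_0,\dots,\widehat{\xi_i},\dots,\xi_k)\bigr)+\sum_{i<j}(-1)^{i+j}\phi([\xi_i,\xi_j],\xi_0,\dots,\widehat{\xi_i},\dots,\widehat{\xi_j},\dots,\xi_k).$$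 Let $k\ge0$, let $\phi\in\Omega^k(M,\mathcal VM)$, and let $\phi_i$ be the component of $\phi$ with values in $\mathcal V_iM$. (1) $d^{\nabla^{\mathcal V}}\phi=d^\nabla\phi+\partial\phi-\partial^{\mathsf P}\phi$, where $$\partial\phi(\xi_0,\dots,\xi_k)=\sum_{i=0}^k(-1)^i\,\xi_i\bullet\phi(\xi_0,\dots,\widehat{\xi_i},\dots,\xi_k),\qquad \partial^{\mathsf P}\phi(\xi_0,\dots,\xi_k)=\sum_{i=0}^k(-1)^i\,\mathsf P(\xi_i)\bullet\phi(\xi_0,\dots,\widehat{\xi_i},\dots,\xi_k).$$ In components, $(d^{\nabla^{\mathcal V}}\phi)_i=d^\nabla\phi_i+\partial\phi_{i+1}-\partial^{\mathsf P}\phi_{i-1}$ for all $i$. (2) For all $i$, $(d^{\nabla^{\mathcal V}}(d^{\nabla^{\mathcal V}}\phi))_i$ maps vector fields $\xi_0,\dots,\xi_{k+1}$ to $$\sum_{j<\ell}(-1)^{j+\ell+1}\Bigl(W(\xi_j,\xi_\ell)\bullet\phi_i(\xi_0,\dots,\widehat{\xi_j},\dots,\widehat{\xi_\ell},\dots,\xi_{k+1})-Y(\xi_j,\xi_\ell)\bullet\phi_{i-1}(\xi_0,\dots,\widehat{\xi_j},\dots,\widehat{\xi_\ell},\dots,\xi_{k+1})\Bigr).$$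 In particular, if the infinitesimal action of $\mathfrak o(b)$ on $\mathbb V$ is not zero, then $(\Omega^*(M,\mathcal VM),d^{\nabla^{\mathcal V}})$ is a complex if and only if $g$ is conformally flat, i.e. every point of $M$ has an open neighbourhood $U$ with a smooth function $f$ on $U$ such that the metric $e^{2f}g$ on $U$ has vanishing Riemann curvature. -/

import Mathlib

open scoped Manifold ContDiff Bundle

noncomputable section

namespace ConformalBGG

/-! ### The group `O(b)`, its Lie algebra and its representations -/

/-- Indices of the standard basis `e_0, e_1, …, e_n, e_{n+1}` of `ℝ^{n+2}`:
`inl ()` is `0`, `inr (inl i)` is one of `1, …, n`, and `inr (inr ())` is `n + 1`. -/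
abbrev Idx (n : ℕ) : Type := Unit ⊕ (Fin n ⊕ Unit)

/-- The Lorentzian form `b(x, y) = x_0 y_{n+1} + x_{n+1} y_0 + ∑ x_i y_i`. -/
def bForm {n : ℕ} (x y : Idx n → ℝ) : ℝ :=
  x (.inl ()) * y (.inr (.inr ())) + x (.inr (.inr ())) * y (.inl ())
    + ∑ i : Fin n, x (.inr (.inl i)) * y (.inr (.inl i))

/-- The orthogonal group `O(b)`. -/
def orthGroup (n : ℕ) : Subgroup (GL (Idx n) ℝ) where
  carrier := {C | ∀ x y, bForm (C.1.mulVec x) (C.1.mulVec y) = bForm x y}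
  one_mem' := by intro x y; simp
  mul_mem' := by
    intro C D hC hD x y
    have h := hC (D.1.mulVec x) (D.1.mulVec y)
    simp only [Matrix.mulVec_mulVec] at h
    simpa using h.trans (hD x y)
  inv_mem' := by
    intro C hC x y
    have h := hC ((C⁻¹).1.mulVec x) ((C⁻¹).1.mulVec y)
    have e : C.1 * (C⁻¹).1 = 1 := by
      rw [← Units.val_mul, mul_inv_cancel, Units.val_one]
    simp only [Matrix.mulVec_mulVec, e, Matrix.one_mulVec] at h
    exact h.symm

/-- Membership in the Lie algebra `o(b)`. -/
def InLieAlg {n : ℕ} (B : Matrix (Idx n) (Idx n) ℝ) : Prop :=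
  ∀ x y, bForm (B.mulVec x) y + bForm x (B.mulVec y) = 0

/-- The block diagonal matrix with blocks `a`, `A`, `c` of sizes `1`, `n`, `1`. -/
def blockDiag {n : ℕ} (a : ℝ) (A : Matrix (Fin n) (Fin n) ℝ) (c : ℝ) :
    Matrix (Idx n) (Idx n) ℝ :=
  Matrix.of fun p q =>
    match p, q with
    | .inl _, .inl _ => a
    | .inr (.inl i), .inr (.inl j) => A i j
    | .inr (.inr _), .inr (.inr _) => c
    | _, _ => 0

/-- The element of `g_{-1}` given by `X ∈ ℝ^n`. -/
def gMinus {n : ℕ} (X : Fin n → ℝ) : Matrix (Idx n) (Idx n) ℝ :=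
  Matrix.of fun p q =>
    match p, q with
    | .inr (.inl i), .inl _ => X i
    | .inr (.inr _), .inr (.inl j) => -X j
    | _, _ => 0

/-- The element of `g_1` given by `Z ∈ ℝ^{n*}`. -/
def gPlus {n : ℕ} (Z : Fin n → ℝ) : Matrix (Idx n) (Idx n) ℝ :=
  Matrix.of fun p q =>
    match p, q with
    | .inl _, .inr (.inl j) => Z j
    | .inr (.inl i), .inr (.inr _) => -Z i
    | _, _ => 0

/-- The element of `o(n) ⊂ g_0` given by a skew symmetric matrix `A`. -/
def gOrth {n : ℕ} (A : Matrix (Fin n) (Fin n) ℝ) : Matrix (Idx n) (Idx n) ℝ :=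
  blockDiag 0 A 0

/-- The grading element `E`. -/
def gradingElt (n : ℕ) : Matrix (Idx n) (Idx n) ℝ := blockDiag 1 0 (-1)

section Rep

variable {n : ℕ} {V : Type*} [NormedAddCommGroup V] [NormedSpace ℝ V] [FiniteDimensional ℝ V]

/-- Smoothness of a finite-dimensional representation of the Lie group `O(b)`. Since `O(b)` is a
closed embedded submanifold of the space of matrices, a function on it is smooth if and only if it
is the restriction of a smooth function of the matrix entries. -/
def IsSmoothRep (ρ : Representation ℝ (orthGroup n) V) : Prop :=
  ∃ F : (Idx n → Idx n → ℝ) → (V →L[ℝ] V), ContDiff ℝ ∞ F ∧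
    ∀ C : orthGroup n, F (fun p q => C.1.1 p q) = LinearMap.toContinuousLinearMap (ρ C)

open Classical in
/-- The operator `ρ(M)` for a matrix `M` in `O(b)` (and `0` for all other matrices). -/
def repMatrix (ρ : Representation ℝ (orthGroup n) V) (M : Matrix (Idx n) (Idx n) ℝ) :
    V →L[ℝ] V :=
  if h : ∃ C : orthGroup n, C.1.1 = M then LinearMap.toContinuousLinearMap (ρ h.choose) else 0

/-- The infinitesimal representation `B ↦ d/dt|_{t = 0} ρ(exp(tB))`; meaningful for `B ∈ o(b)`,
in which case `exp(tB) ∈ O(b)` for all `t`. -/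
def infAct (ρ : Representation ℝ (orthGroup n) V) (B : Matrix (Idx n) (Idx n) ℝ) : V →L[ℝ] V :=
  deriv (fun t : ℝ => repMatrix ρ (NormedSpace.exp (t • B))) 0

/-- The lowest eigenvalue of the grading element on `V`. -/
def lowestWeight (ρ : Representation ℝ (orthGroup n) V) : ℝ :=
  sInf {μ : ℝ | Module.End.HasEigenvalue (infAct ρ (gradingElt n)).toLinearMap μ}

/-- The component `V_j`: the eigenspace of `E` for the `j`-th eigenvalue counted from the
lowest one. It is zero if `j` is out of range. -/
def gradePart (ρ : Representation ℝ (orthGroup n) V) (j : ℤ) : Submodule ℝ V :=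
  Module.End.eigenspace (infAct ρ (gradingElt n)).toLinearMap (lowestWeight ρ + j)

open Classical in
/-- The projection of `V = ⨁ V_j` onto the summand `V_j`, along the sum of the other ones. -/
def gradeProj (ρ : Representation ℝ (orthGroup n) V) (j : ℤ) : V →ₗ[ℝ] V :=
  if h : IsCompl (gradePart ρ j) (⨆ i : ℤ, ⨆ _ : i ≠ j, gradePart ρ i) then
    (gradePart ρ j).subtype ∘ₗ Submodule.projectionOnto _ _ h
  else 0

end Rep

/-! ### Riemannian geometry -/

section Geometry

variable {n : ℕ} {M : Type*} [TopologicalSpace M]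
  [ChartedSpace (EuclideanSpace ℝ (Fin n)) M] [IsManifold (𝓡 n) ∞ M]

variable (n M) in
/-- Families of bilinear forms on the tangent spaces of an `n`-manifold. The constructions below
are local: at `x` they only depend on the family near `x`, where it will be a smooth Riemannian
metric. -/
abbrev MetricField : Type _ :=
  ∀ x : M, TangentSpace (𝓡 n) x →L[ℝ] TangentSpace (𝓡 n) x →L[ℝ] ℝ

variable (n M) in
/-- The space `𝔛(M)` of smooth vector fields. -/
abbrev VectorFields : Type _ :=
  ContMDiffSection (𝓡 n) (EuclideanSpace ℝ (Fin n)) ∞ (fun x : M => TangentSpace (𝓡 n) x)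

/-- The Lie bracket of smooth vector fields. -/
def bracket (X Y : VectorFields n M) : VectorFields n M :=
  ⟨VectorField.mlieBracket (𝓡 n) (fun x => X x) (fun x => Y x), by
    have : IsManifold (𝓡 n) (((⊤ : ℕ∞) : ℕ∞ω) + 1) M := ‹IsManifold (𝓡 n) ∞ M›
    have : IsManifold (𝓡 n) (minSmoothness ℝ 2) M := by
      rw [minSmoothness_of_isRCLikeNormedField]; infer_instance
    exact ContDiff.mlieBracket_vectorField (m := ⊤) (n := ⊤) X.contMDiff Y.contMDiff (by simp)⟩

/-- The product of a smooth function and a smooth vector field. -/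
def fieldSMul (f : C^∞⟮𝓡 n, M; 𝓘(ℝ, ℝ), ℝ⟯) (X : VectorFields n M) : VectorFields n M :=
  ⟨fun x => f x • X x, ContMDiff.smul_section f.contMDiff X.contMDiff⟩

/-- A vector field which is smooth near `x` and has the value `v` at `x`. -/
def ext {x : M} (v : TangentSpace (𝓡 n) x) (y : M) : TangentSpace (𝓡 n) y :=
  FiberBundle.extend (EuclideanSpace ℝ (Fin n)) v y

/-- The derivative `X · f` at `x`. -/
def dirDeriv {F : Type*} [NormedAddCommGroup F] [NormedSpace ℝ F]
    (X : ∀ x : M, TangentSpace (𝓡 n) x) (f : M → F) (x : M) : F :=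
  mvfderiv (𝓡 n) f x (X x)

open Classical in
/-- The tangent vector `w` with `g(w, v) = α(v)` for all `v`, which exists uniquely if `g` is
positive definite and `α` is linear. -/
def sharp (g : MetricField n M) (x : M) (α : TangentSpace (𝓡 n) x → ℝ) : TangentSpace (𝓡 n) x :=
  if h : ∃ w, ∀ v, g x w v = α v then h.choose else 0

/-- The right hand side of the Koszul formula for `2 g(∇_X Y, Z)`. -/
def koszul (g : MetricField n M) (X Y Z : ∀ x : M, TangentSpace (𝓡 n) x) (x : M) : ℝ :=
  dirDeriv X (fun y => g y (Y y) (Z y)) x + dirDeriv Y (fun y => g y (Z y) (X y)) x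
    - dirDeriv Z (fun y => g y (X y) (Y y)) x
    + g x (VectorField.mlieBracket (𝓡 n) X Y x) (Z x)
    - g x (VectorField.mlieBracket (𝓡 n) Y Z x) (X x)
    + g x (VectorField.mlieBracket (𝓡 n) Z X x) (Y x)

/-- The Levi-Civita connection `∇_X Y`, given by the Koszul formula. -/
def leviCivita (g : MetricField n M) (X Y : ∀ x : M, TangentSpace (𝓡 n) x) (x : M) :
    TangentSpace (𝓡 n) x :=
  sharp g x fun v => koszul g X Y (ext v) x / 2

/-- The Levi-Civita connection on one-forms, `(∇_X α)(v)` for a tangent vector `v` at `x`. -/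
def leviCivitaForm (g : MetricField n M) (X : ∀ x : M, TangentSpace (𝓡 n) x)
    (α : ∀ x : M, TangentSpace (𝓡 n) x → ℝ) (x : M) (v : TangentSpace (𝓡 n) x) : ℝ :=
  dirDeriv X (fun y => α y (ext v y)) x - α x (leviCivita g X (ext v) x)

/-- `R(X, Y)(Z) = ∇_X ∇_Y Z - ∇_Y ∇_X Z - ∇_{[X, Y]} Z` on vector fields. -/
def curvatureField (g : MetricField n M) (X Y Z : ∀ x : M, TangentSpace (𝓡 n) x) (x : M) :
    TangentSpace (𝓡 n) x :=
  leviCivita g X (leviCivita g Y Z) x - leviCivita g Y (leviCivita g X Z) x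
    - leviCivita g (VectorField.mlieBracket (𝓡 n) X Y) Z x

/-- The Riemann curvature tensor `R(u, v)(w)` at a point. -/
def riemann (g : MetricField n M) (x : M) (u v w : TangentSpace (𝓡 n) x) : TangentSpace (𝓡 n) x :=
  curvatureField g (ext u) (ext v) (ext w) x

/-- The orthonormal frames of the tangent space at `x`; the fiber of the orthonormal frame bundle
over `x`. -/
def Frame (g : MetricField n M) (x : M) : Type :=
  {u : Fin n → TangentSpace (𝓡 n) x // ∀ i j, g x (u i) (u j) = if i = j then 1 else 0}

open Classical in
/-- The trace `∑ T(ξ_i, ξ_i)` over an orthonormal frame at `x`. -/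
def metricTrace (g : MetricField n M) (x : M)
    (T : TangentSpace (𝓡 n) x → TangentSpace (𝓡 n) x → ℝ) : ℝ :=
  if h : Nonempty (Frame g x) then ∑ i, T (h.some.1 i) (h.some.1 i) else 0

/-- `Ric(v, w) = ∑ g(R(ξ_i, v)(w), ξ_i)`. -/
def ricci (g : MetricField n M) (x : M) (v w : TangentSpace (𝓡 n) x) : ℝ :=
  metricTrace g x fun a b => g x (riemann g x a v w) b

/-- The scalar curvature. -/
def scalarCurv (g : MetricField n M) (x : M) : ℝ := metricTrace g x (ricci g x)

/-- The Schouten tensor `P = (Ric - Sc g / n) / (n - 2) + Sc g / (2 n (n - 1))`. -/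
def schouten (g : MetricField n M) (x : M) (v w : TangentSpace (𝓡 n) x) : ℝ :=
  (ricci g x v w - scalarCurv g x / n * g x v w) / ((n : ℝ) - 2)
    + scalarCurv g x / (2 * n * ((n : ℝ) - 1)) * g x v w

/-- `{v, α}(w) = α(v) w + α(w) v - g(w, v) α^♯`. -/
def braceAct (g : MetricField n M) (x : M) (v : TangentSpace (𝓡 n) x)
    (α : TangentSpace (𝓡 n) x → ℝ) (w : TangentSpace (𝓡 n) x) : TangentSpace (𝓡 n) x :=
  α v • w + α w • v - g x w v • sharp g x α

/-- The Weyl curvature, `R(u, v)(w) = W(u, v)(w) + {u, P(v)}(w) - {v, P(u)}(w)`. -/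
def weyl (g : MetricField n M) (x : M) (u v w : TangentSpace (𝓡 n) x) : TangentSpace (𝓡 n) x :=
  riemann g x u v w - braceAct g x u (schouten g x v) w + braceAct g x v (schouten g x u) w

/-- The Cotton-York tensor `Y(ξ, η) = ∇_ξ P(η) - ∇_η P(ξ) - P([ξ, η])`, a one-form for all vector
fields `ξ` and `η`. -/
def cotton (g : MetricField n M) (X Y : ∀ x : M, TangentSpace (𝓡 n) x) (x : M)
    (w : TangentSpace (𝓡 n) x) : ℝ :=
  leviCivitaForm g X (fun y => schouten g y (Y y)) x w
    - leviCivitaForm g Y (fun y => schouten g y (X y)) x w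
    - schouten g x (VectorField.mlieBracket (𝓡 n) X Y x) w

/-- `g` is conformally flat: every point has an open neighbourhood `U` with a smooth function `f`
on `U` such that the metric `e^{2f} g` on `U` is flat. -/
def IsConformallyFlat (g : MetricField n M) : Prop :=
  ∀ x : M, ∃ U : Set M, IsOpen U ∧ x ∈ U ∧ ∃ f : M → ℝ, ContMDiffOn (𝓡 n) 𝓘(ℝ, ℝ) ∞ f U ∧
    ∀ y ∈ U, ∀ u v w : TangentSpace (𝓡 n) y,
      riemann (fun z => Real.exp (2 * f z) • g z) y u v w = 0

/-! ### The bundle `𝒱M = 𝒪M ×_{O(n)} V` -/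

variable {V : Type*} [NormedAddCommGroup V] [NormedSpace ℝ V] [FiniteDimensional ℝ V]

/-- Functions on the orthonormal frame bundle with values in `V`. Sections of the associated bundle
`𝒪M ×_{O(n)} V` are the smooth equivariant ones. -/
abbrev FrameFun (g : MetricField n M) (V : Type*) : Type _ := ∀ x : M, Frame g x → V

/-- The orthonormal frame `e` (a choice of a frame at every point) is smooth on `U`. -/
def SmoothFrameOn {g : MetricField n M} (e : ∀ x : M, Frame g x) (U : Set M) : Prop :=
  ∀ i : Fin n, ContMDiffOn (𝓡 n) (𝓡 n).tangent ∞
    (fun x => (⟨x, (e x).1 i⟩ : TangentBundle (𝓡 n) M)) U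

/-- `s` is a smooth section of `𝒱M`: it satisfies `s(u · A) = A⁻¹ s(u)` for `A ∈ O(n) ⊂ O(b)`
acting on frames by `(u · A)_j = ∑ A_ij u_i`, and it is smooth in local smooth orthonormal
frames. -/
structure IsSection {g : MetricField n M} (ρ : Representation ℝ (orthGroup n) V)
    (s : FrameFun g V) : Prop where
  equivariant : ∀ (x : M) (u u' : Frame g x) (A : Matrix (Fin n) (Fin n) ℝ) (C : orthGroup n),
    C.1.1 = blockDiag 1 A 1 → (∀ j, u'.1 j = ∑ i, A i j • u.1 i) → ρ C (s x u') = s x u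
  smooth : ∀ (U : Set M) (e : ∀ x : M, Frame g x), IsOpen U → SmoothFrameOn e U →
    ContMDiffOn (𝓡 n) 𝓘(ℝ, V) ∞ (fun x => s x (e x)) U

/-- `η • s` for a vector field `η`, where `η` corresponds in the frame `u` to the element of
`g_{-1} = ℝ^n` with coordinates `g(η, u_i)`. -/
def actField {g : MetricField n M} (ρ : Representation ℝ (orthGroup n) V)
    (X : ∀ x : M, TangentSpace (𝓡 n) x) (s : FrameFun g V) : FrameFun g V :=
  fun x u => infAct ρ (gMinus fun i => g x (X x) (u.1 i)) (s x u)

/-- `α • s` for a one-form `α`, where `α` corresponds in the frame `u` to the element of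
`g_1 = ℝ^{n*}` with coordinates `α(u_i)`. -/
def actForm {g : MetricField n M} (ρ : Representation ℝ (orthGroup n) V)
    (α : ∀ x : M, TangentSpace (𝓡 n) x → ℝ) (s : FrameFun g V) : FrameFun g V :=
  fun x u => infAct ρ (gPlus fun i => α x (u.1 i)) (s x u)

/-- `Φ • s` for a skew symmetric endomorphism field `Φ`, where `Φ` corresponds in the frame `u` to
its matrix `g(Φ(u_j), u_i)` in `o(n)`. -/
def actSkew {g : MetricField n M} (ρ : Representation ℝ (orthGroup n) V)
    (Φ : ∀ x : M, TangentSpace (𝓡 n) x → TangentSpace (𝓡 n) x) (s : FrameFun g V) :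
    FrameFun g V :=
  fun x u => infAct ρ (gOrth (Matrix.of fun i j => g x (Φ x (u.1 j)) (u.1 i))) (s x u)

/-- The induced Levi-Civita connection on `𝒱M` computed in the orthonormal frame `e`, at the point
`x`: the derivative of the function `s(e)` plus the action of the connection form
`ω_ij(X) = g(∇_X e_j, e_i)`. -/
def covDerivIn {g : MetricField n M} (ρ : Representation ℝ (orthGroup n) V)
    (e : ∀ x : M, Frame g x) (X : ∀ x : M, TangentSpace (𝓡 n) x) (s : FrameFun g V) (x : M) : V :=
  dirDeriv X (fun y => s y (e y)) x
    + infAct ρ (gOrth (Matrix.of fun i j =>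
        g x (leviCivita g X (fun y => (e y).1 j) x) ((e x).1 i))) (s x (e x))

open Classical in
/-- The induced Levi-Civita connection `∇_X s` on `𝒱M`. Its value on a frame `u` at `x` is computed
in any orthonormal frame `e` which is smooth near `x` and has the value `u` at `x`; such a frame
always exists, and on sections the result does not depend on it. -/
def covDeriv {g : MetricField n M} (ρ : Representation ℝ (orthGroup n) V)
    (X : ∀ x : M, TangentSpace (𝓡 n) x) (s : FrameFun g V) : FrameFun g V :=
  fun x u =>
    if h : ∃ e : ∀ y : M, Frame g y, (∃ U, IsOpen U ∧ x ∈ U ∧ SmoothFrameOn e U) ∧ e x = u then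
      covDerivIn ρ h.choose X s x
    else 0

/-- The twisted connection `∇^𝒱_X s = ∇_X s + X • s - P(X) • s`. -/
def twistedDeriv {g : MetricField n M} (ρ : Representation ℝ (orthGroup n) V)
    (X : ∀ x : M, TangentSpace (𝓡 n) x) (s : FrameFun g V) : FrameFun g V :=
  covDeriv ρ X s + actField ρ X s - actForm ρ (fun x => schouten g x (X x)) s

/-! ### Forms with values in `𝒱M` -/

/-- Maps from `k`-tuples of smooth vector fields to functions on the frame bundle; see `IsForm`. -/
abbrev PreForm (g : MetricField n M) (V : Type*) (k : ℕ) : Type _ :=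
  (Fin k → VectorFields n M) → FrameFun g V

/-- `φ ∈ Ω^k(M, 𝒱M)`: an alternating map from `k`-tuples of smooth vector fields to smooth sections
of `𝒱M` which is linear over smooth functions in each entry. -/
structure IsForm {g : MetricField n M} (ρ : Representation ℝ (orthGroup n) V) (k : ℕ)
    (φ : PreForm g V k) : Prop where
  isSection : ∀ ξ, IsSection ρ (φ ξ)
  map_add : ∀ (ξ : Fin k → VectorFields n M) (i : Fin k) (X Y : VectorFields n M),
    φ (Function.update ξ i (X + Y)) = φ (Function.update ξ i X) + φ (Function.update ξ i Y)
  map_smul : ∀ (ξ : Fin k → VectorFields n M) (i : Fin k) (f : C^∞⟮𝓡 n, M; 𝓘(ℝ, ℝ), ℝ⟯)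
    (X : VectorFields n M) (x : M) (u : Frame g x),
    φ (Function.update ξ i (fieldSMul f X)) x u = f x • φ (Function.update ξ i X) x u
  alternating : ∀ (ξ : Fin k → VectorFields n M) (i j : Fin k), ξ i = ξ j → i ≠ j → φ ξ = 0

/-- The component `φ_j` of `φ`, with values in `𝒱_jM`. -/
def component {g : MetricField n M} (ρ : Representation ℝ (orthGroup n) V) {k : ℕ} (j : ℤ)
    (φ : PreForm g V k) : PreForm g V k :=
  fun ξ x u => gradeProj ρ j (φ ξ x u)

/-- The tuple `ξ_0, …, ξ_{k+1}` with the entries number `i` and `j` omitted, for `i < j`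
(where `i` is given as an element of `Fin (k + 1)`). -/
def omitTwo {k : ℕ} {T : Type*} (ξ : Fin (k + 2) → T) (i : Fin (k + 1)) (j : Fin (k + 2)) :
    Fin k → T :=
  fun l => ξ (j.succAbove (i.succAbove l))

/-- The alternating sum `∑_i (-1)^i D(ξ_i, φ(ξ_0, …, ξ_i omitted, …, ξ_k))`. -/
def altSum {g : MetricField n M} (D : VectorFields n M → FrameFun g V → FrameFun g V) {k : ℕ}
    (φ : PreForm g V k) : PreForm g V (k + 1) :=
  fun ξ => ∑ i : Fin (k + 1), (-1 : ℝ) ^ (i : ℕ) • D (ξ i) (φ fun l => ξ (i.succAbove l))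

/-- The sum `∑_{i < j} (-1)^{i+j} φ([ξ_i, ξ_j], ξ_0, …, ξ_i and ξ_j omitted, …, ξ_k)`, which is
empty for `k = 0`. -/
def bracketSum {g : MetricField n M} : {k : ℕ} → PreForm g V k → PreForm g V (k + 1)
  | 0, _ => 0
  | _ + 1, φ => fun ξ => ∑ j, ∑ i with Fin.castSucc i < j,
      (-1 : ℝ) ^ ((i : ℕ) + (j : ℕ)) • φ (Fin.cons (bracket (ξ i.castSucc) (ξ j)) (omitTwo ξ i j))

/-- The covariant exterior derivative of the connection `D`. -/
def extD {g : MetricField n M} (D : VectorFields n M → FrameFun g V → FrameFun g V) {k : ℕ}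
    (φ : PreForm g V k) : PreForm g V (k + 1) :=
  altSum D φ + bracketSum φ

/-- `d^∇` for the Levi-Civita connection. -/
def dNabla {g : MetricField n M} (ρ : Representation ℝ (orthGroup n) V) {k : ℕ}
    (φ : PreForm g V k) : PreForm g V (k + 1) :=
  extD (fun X s => covDeriv ρ (fun x => X x) s) φ

/-- `d^{∇^𝒱}`, the twisted covariant exterior derivative. -/
def dTwisted {g : MetricField n M} (ρ : Representation ℝ (orthGroup n) V) {k : ℕ}
    (φ : PreForm g V k) : PreForm g V (k + 1) :=
  extD (fun X s => twistedDeriv ρ (fun x => X x) s) φ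

/-- `∂φ(ξ_0, …, ξ_k) = ∑_i (-1)^i ξ_i • φ(ξ_0, …, ξ_i omitted, …, ξ_k)`. -/
def del {g : MetricField n M} (ρ : Representation ℝ (orthGroup n) V) {k : ℕ}
    (φ : PreForm g V k) : PreForm g V (k + 1) :=
  altSum (fun X s => actField ρ (fun x => X x) s) φ

/-- `∂^P φ(ξ_0, …, ξ_k) = ∑_i (-1)^i P(ξ_i) • φ(ξ_0, …, ξ_i omitted, …, ξ_k)`. -/
def delP {g : MetricField n M} (ρ : Representation ℝ (orthGroup n) V) {k : ℕ}
    (φ : PreForm g V k) : PreForm g V (k + 1) :=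
  altSum (fun X s => actForm ρ (fun x => schouten g x (X x)) s) φ

/-- The twisted de Rham sequence is a complex: `d^{∇^𝒱}` maps `Ω^k(M, 𝒱M)` to `Ω^{k+1}(M, 𝒱M)` and
squares to zero. -/
def TwistedIsComplex (g : MetricField n M) (ρ : Representation ℝ (orthGroup n) V) : Prop :=
  ∀ (k : ℕ) (φ : PreForm g V k), IsForm ρ k φ →
    IsForm ρ (k + 1) (dTwisted ρ φ) ∧ dTwisted ρ (dTwisted ρ φ) = 0

end Geometry

end ConformalBGG

end

open ConformalBGG

/-! The guiding object is the conformal Cartan connection. In a local orthonormal frame `e` a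
section of the bundle is a `V`-valued function, and the twisted connection becomes `X · s + Ω(X) s`,
where `Ω = ω + θ - P` is the `o(b)`-valued one-form `cartanMat` built from the connection form `ω`
(in `o(n)`), the coframe `θ` (in `g_{-1}`) and the Schouten tensor (in `g_1`); see `twisted_eq`. Its
curvature `dΩ + [Ω, Ω]/2` is computed degree by degree in `cartan_structure`. The `g_{-1}`-part is
the torsion and vanishes. The `o(n)`-part is `R` corrected by the brackets of `g_1` with `g_{-1}`,
that is `W`. The `E`-part vanishes because `P` is symmetric, and the `g_1`-part is `-Y`. Since the
infinitesimal action respects brackets (`infAct_bracket`), the curvature of the twisted connection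
is `W • - Y •` (`twisted_curvature`).

That the square of a covariant exterior derivative is the action of the curvature is pure algebra.
It is proved for alternating maps on a Lie ring by induction on the degree, from Cartan's formula
`ι_X d = L_X - d ι_X` (`extAlt_extAlt`). Formula (1) is an expansion of the definitions, and the
formulas in components hold because `g_{-1}`, `o(n)`, `g_1` have degrees `-1`, `0`, `1` with respect
to `E`.

The grading of `V` rests on an `sl₂` triple with neutral element `2E`, which provides a real
eigenvalue `k/2` of `E` (`exists_weight`). The sum of the eigenspaces with eigenvalue in `k/2 + ℤ`
is stable under generators of `O(b)`, hence is all of `V` by irreducibility (`exists_grading`).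

If the sequence is a complex, then applying `d² = 0` to sections with arbitrary value at a point
shows that `W(X, Y)` and `Y(X, Y)` act in the same way on `V`. A nonzero infinitesimal action is
injective on `o(n) ⊕ g_1` (`infAct_faithful`), so `W` and `Y` vanish. Then `Ω` is flat and has a
parallel frame near every point (`exists_parallel_frame`). The last column of this frame is a null
parallel tractor `(a, m, σ)` with `σ = 1` at the point, and `f = -log σ` satisfies `∇df - df ⊗ df +
|df|² g / 2 = P` (`confHess_scale`). By the formula for the curvature of `e^{2f} g`
(`riemann_confMetric`), the new curvature is `W = 0`.

Conversely, if `e^{2f} g` is flat, the same formula expresses `R` through the tensor `H = ∇df - df ⊗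
df + |df|² g / 2`. Contraction gives `H = P` because `n ≥ 3` (`schouten_eq_of_riemann`), so `W = 0`,
and the Ricci identity for the gradient of `f` gives `Y = 0` (`weyl_cotton_eq_zero`). -/

open scoped Manifold ContDiff Bundle Topology
open Filter
namespace ConformalBGG
noncomputable section
set_option linter.unusedSectionVars false

/-! ### Parallel sections of flat connections near the origin of a normed space. -/

section FlatConnection

open Set Metric

variable {E : Type*} [NormedAddCommGroup E] [NormedSpace ℝ E]
  {F : Type*} [NormedAddCommGroup F] [NormedSpace ℝ F]

/-- Grönwall's inequality on the unit interval for a curve starting at zero. -/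
theorem norm_le_of_deriv_bound {c c' : ℝ → F} {ε : ℝ} (hε : 0 ≤ ε)
    (hc : ∀ t ∈ Icc (0 : ℝ) 1, HasDerivWithinAt c (c' t) (Icc 0 1) t) (h0 : c 0 = 0)
    (hb : ∀ t ∈ Icc (0 : ℝ) 1, ‖c' t‖ ≤ ‖c t‖ + ε) : ∀ t ∈ Icc (0 : ℝ) 1, ‖c t‖ ≤ 2 * ε := by
  intro t ht
  have h := norm_le_gronwallBound_of_norm_deriv_right_le (δ := 0) (K := 1) (ε := ε)
    (fun t ht => (hc t ht).continuousWithinAt)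
    (fun t ht => (hc t (Ico_subset_Icc_self ht)).mono_of_mem_nhdsWithin
      (Icc_mem_nhdsGE_of_mem ht)) (by simp [h0])
    (fun t ht => by simpa using hb t (Ico_subset_Icc_self ht)) t ht
  refine h.trans ?_
  rw [gronwallBound_of_K_ne_0 one_ne_zero]
  -- Grönwall gives `ε (exp t - 1)`, and `e - 1 ≤ 2` on the unit interval.
  have h1 : Real.exp (1 * (t - 0)) ≤ 3 := by
    refine (Real.exp_le_exp.2 (by simpa using ht.2)).trans ?_
    exact Real.exp_one_lt_d9.le.trans (by norm_num)
  simp only [zero_mul, zero_add, div_one]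
  nlinarith

variable {A : Type*} [NormedRing A] [NormedAlgebra ℝ A]

/-- Solutions of the linear equation `γ' = -P(t) γ` with small coefficients. -/
theorem exists_linear_ode [CompleteSpace A] {P : ℝ → A}
    (hP : ContinuousOn P (Icc 0 1)) (hb : ∀ t ∈ Icc (0 : ℝ) 1, ‖P t‖ ≤ 1 / 2) (s₀ : A) :
    ∃ γ : ℝ → A, γ 0 = s₀ ∧
      (∀ t ∈ Icc (0 : ℝ) 1, HasDerivWithinAt γ (- (P t * γ t)) (Icc 0 1) t) ∧
      ∀ t ∈ Icc (0 : ℝ) 1, ‖γ t‖ ≤ 2 * ‖s₀‖ + 1 := by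
  obtain ⟨γ, h0, hγ⟩ := IsPicardLindelof.exists_eq_forall_mem_Icc_hasDerivWithinAt₀
    (f := fun t y => - (P t * y)) (t₀ := (⟨0, by simp⟩ : Icc (0 : ℝ) 1)) (x₀ := s₀)
    -- On the ball of radius `‖s₀‖ + 1` about `s₀` one has `‖y‖ ≤ 2‖s₀‖ + 1`, so the right-hand side
    -- is at most `(2‖s₀‖ + 1) / 2 ≤ L` and a solution stays in the ball for unit time.
    (a := ‖s₀‖₊ + 1) (L := ‖s₀‖₊ + 1) (K := 1)
    { lipschitzOnWith := fun t ht => LipschitzOnWith.of_dist_le_mul fun y _ z _ => by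
        rw [dist_eq_norm, dist_eq_norm, ← neg_sub', norm_neg, ← mul_sub]
        refine (norm_mul_le _ _).trans ?_
        have := hb t ht
        push_cast
        gcongr
        linarith
      continuousOn := fun y _ => (hP.mul continuousOn_const).neg
      norm_le := fun t ht y hy => by
        rw [norm_neg]
        refine (norm_mul_le _ _).trans ?_
        have h1 := hb t ht
        have h2 : ‖y‖ ≤ ‖s₀‖ + (‖s₀‖ + 1) := by
          have := norm_le_norm_add_norm_sub' y s₀
          rw [mem_closedBall, dist_eq_norm] at hy
          push_cast at hy
          linarith
        push_cast
        calc ‖P t‖ * ‖y‖ ≤ 1 / 2 * (‖s₀‖ + (‖s₀‖ + 1)) := by gcongr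
          _ ≤ _ := by linarith [norm_nonneg s₀]
      mul_max_le := by simp }
  refine ⟨γ, h0, hγ, fun t ht => ?_⟩
  have h := norm_le_of_deriv_bound (c := fun t => γ t - s₀) (ε := ‖s₀‖ / 2) (by positivity)
    (fun t ht => (hγ t ht).sub_const s₀) (by simpa using sub_eq_zero.2 h0)
    (fun t ht => by
      rw [norm_neg]
      refine (norm_mul_le _ _).trans ?_
      have h1 := hb t ht
      have h2 := norm_le_norm_sub_add (γ t) s₀
      calc ‖P t‖ * ‖γ t‖ ≤ 1 / 2 * (‖γ t - s₀‖ + ‖s₀‖) := by gcongr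
        _ ≤ _ := by linarith [norm_nonneg (γ t - s₀)]) t ht
  have h2 := norm_le_norm_sub_add (γ t) s₀
  linarith [norm_nonneg s₀]

variable {B : E → E →L[ℝ] A} {R K : ℝ}

/-- The derivative `v ↦ -b(v) s` prescribed by the equation of a parallel section. -/
def parallelDeriv (b : E →L[ℝ] A) (s : A) : E →L[ℝ] A :=
  -((ContinuousLinearMap.mul ℝ A).flip s).comp b

theorem parallelDeriv_apply (b : E →L[ℝ] A) (s : A) (v : E) : parallelDeriv b s v = -(b v * s) := rfl

/-- A quantitative form of flatness near the origin. -/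
structure IsFlatBall (B : E → E →L[ℝ] A) (R K : ℝ) : Prop where
  pos : 0 < R
  le_one : R ≤ 1
  one_le : 1 ≤ K
  small : K * R ≤ 1 / 2
  diff : ∀ z ∈ ball (0 : E) R, DifferentiableAt ℝ B z
  bound : ∀ z ∈ ball (0 : E) R, ‖B z‖ ≤ K
  deriv_bound : ∀ z ∈ ball (0 : E) R, ‖fderiv ℝ B z‖ ≤ K
  deriv_lip : ∀ z ∈ ball (0 : E) R, ∀ w ∈ ball (0 : E) R,
    ‖fderiv ℝ B z - fderiv ℝ B w‖ ≤ K * ‖z - w‖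
  flat : ∀ z ∈ ball (0 : E) R, ∀ v w, fderiv ℝ B z v w - fderiv ℝ B z w v
    + (B z v * B z w - B z w * B z v) = 0

theorem smul_mem_ball_zero {x : E} (hx : x ∈ ball (0 : E) R) {t : ℝ} (ht : t ∈ Icc (0 : ℝ) 1) :
    t • x ∈ ball (0 : E) R := by
  rw [mem_ball_zero_iff] at hx ⊢
  rw [norm_smul, Real.norm_of_nonneg ht.1]
  nlinarith [ht.2, norm_nonneg x]

namespace IsFlatBall

theorem lip (h : IsFlatBall B R K) {z w : E} (hz : z ∈ ball (0 : E) R) (hw : w ∈ ball (0 : E) R) :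
    ‖B w - B z‖ ≤ K * ‖w - z‖ :=
  (convex_ball (0 : E) R).norm_image_sub_le_of_norm_fderiv_le h.diff h.deriv_bound hz hw

theorem taylor (h : IsFlatBall B R K) {z w : E} (hz : z ∈ ball (0 : E) R)
    (hw : w ∈ ball (0 : E) R) : ‖B w - B z - fderiv ℝ B z (w - z)‖ ≤ K * ‖w - z‖ * ‖w - z‖ := by
  have hseg : segment ℝ z w ⊆ ball (0 : E) R := (convex_ball (0 : E) R).segment_subset hz hw
  refine (convex_segment z w).norm_image_sub_le_of_norm_fderiv_le' (𝕜 := ℝ)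
    (fun y hy => h.diff y (hseg hy)) (fun y hy => ?_) (left_mem_segment ℝ z w)
    (right_mem_segment ℝ z w)
  refine (h.deriv_lip y (hseg hy) z hz).trans ?_
  have := norm_sub_le_of_mem_segment hy
  have := h.one_le
  gcongr

theorem ray_bound (h : IsFlatBall B R K) {x : E} (hx : x ∈ ball (0 : E) R) {t : ℝ}
    (ht : t ∈ Icc (0 : ℝ) 1) : ‖B (t • x) x‖ ≤ 1 / 2 := by
  have h1 := h.bound _ (smul_mem_ball_zero hx ht)
  have h2 : ‖x‖ ≤ R := (mem_ball_zero_iff.1 hx).le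
  have := h.one_le
  exact ((B (t • x)).le_opNorm x).trans
    ((mul_le_mul h1 h2 (norm_nonneg x) (by linarith)).trans h.small)

theorem ray_hasDerivAt (h : IsFlatBall B R K) {x : E} (hx : x ∈ ball (0 : E) R) {t : ℝ}
    (ht : t ∈ Icc (0 : ℝ) 1) :
    HasDerivAt (fun t : ℝ => B (t • x)) (fderiv ℝ B (t • x) x) t := by
  have h1 := (h.diff _ (smul_mem_ball_zero hx ht)).hasFDerivAt
  have h2 : HasDerivAt (fun t : ℝ => t • x) x t := by simpa using (hasDerivAt_id t).smul_const x
  exact h1.comp_hasDerivAt t h2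

theorem ray_sub (h : IsFlatBall B R K) {x y : E} (hx : x ∈ ball (0 : E) R)
    (hy : y ∈ ball (0 : E) R) {t : ℝ} (ht : t ∈ Icc (0 : ℝ) 1) :
    ‖B (t • y) y - B (t • x) x‖ ≤ 2 * K * ‖y - x‖ := by
  have h1 := h.lip (smul_mem_ball_zero hx ht) (smul_mem_ball_zero hy ht)
  have h2 := h.bound _ (smul_mem_ball_zero hx ht)
  have hK := h.one_le
  have hy' : ‖y‖ ≤ 1 := (mem_ball_zero_iff.1 hy).le.trans h.le_one
  have e : B (t • y) y - B (t • x) x = (B (t • y) - B (t • x)) y + B (t • x) (y - x) := by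
    simp [map_sub]
  have h3 : ‖t • y - t • x‖ ≤ ‖y - x‖ := by
    rw [← smul_sub, norm_smul, Real.norm_of_nonneg ht.1]
    exact mul_le_of_le_one_left (norm_nonneg _) ht.2
  calc ‖B (t • y) y - B (t • x) x‖
      ≤ ‖B (t • y) - B (t • x)‖ * ‖y‖ + ‖B (t • x)‖ * ‖y - x‖ := by
        rw [e]
        exact (norm_add_le _ _).trans (add_le_add (ContinuousLinearMap.le_opNorm _ _)
          (ContinuousLinearMap.le_opNorm _ _))
    _ ≤ (K * ‖y - x‖) * 1 + K * ‖y - x‖ := by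
        gcongr
        exact h1.trans (by gcongr)
    _ = _ := by ring

/-- First-order expansion of `y ↦ B(ty) y` at `x`: the product rule gives the two linear terms, and
the Lipschitz bound on the derivative of `B` makes the remainder quadratic, uniformly in `t`. -/
theorem ray_taylor (h : IsFlatBall B R K) {x y : E} (hx : x ∈ ball (0 : E) R)
    (hy : y ∈ ball (0 : E) R) {t : ℝ} (ht : t ∈ Icc (0 : ℝ) 1) :
    ‖B (t • y) y - B (t • x) x - B (t • x) (y - x) - t • fderiv ℝ B (t • x) (y - x) x‖
      ≤ 2 * K * ‖y - x‖ ^ 2 := by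
  have h1 := h.taylor (smul_mem_ball_zero hx ht) (smul_mem_ball_zero hy ht)
  have h2 := h.deriv_bound _ (smul_mem_ball_zero hx ht)
  have hK := h.one_le
  have hy' : ‖y‖ ≤ 1 := (mem_ball_zero_iff.1 hy).le.trans h.le_one
  have h3 : ‖t • y - t • x‖ ≤ ‖y - x‖ := by
    rw [← smul_sub, norm_smul, Real.norm_of_nonneg ht.1]
    exact mul_le_of_le_one_left (norm_nonneg _) ht.2
  have e : B (t • y) y - B (t • x) x - B (t • x) (y - x) - t • fderiv ℝ B (t • x) (y - x) x
      = (B (t • y) - B (t • x) - fderiv ℝ B (t • x) (t • y - t • x)) y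
        + t • fderiv ℝ B (t • x) (y - x) (y - x) := by
    rw [← smul_sub, map_smul]
    simp only [map_sub, _root_.sub_apply, _root_.smul_apply, smul_sub]
    abel
  calc _ ≤ ‖B (t • y) - B (t • x) - fderiv ℝ B (t • x) (t • y - t • x)‖ * ‖y‖
        + 1 * (‖fderiv ℝ B (t • x)‖ * ‖y - x‖ * ‖y - x‖) := by
        rw [e]
        refine (norm_add_le _ _).trans (add_le_add (ContinuousLinearMap.le_opNorm _ _) ?_)
        rw [norm_smul, Real.norm_of_nonneg ht.1]
        refine mul_le_mul ht.2 (ContinuousLinearMap.le_opNorm₂ _ _ _) (norm_nonneg _) zero_le_one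
    _ ≤ (K * ‖y - x‖ * ‖y - x‖) * 1 + 1 * (K * ‖y - x‖ * ‖y - x‖) := by
        gcongr
        exact h1.trans (by gcongr)
    _ = _ := by ring

/-- Radial transport of a vector is parallel for a flat connection. -/
theorem hasFDerivAt_radial (h : IsFlatBall B R K) {s₀ : A} {γ : E → ℝ → A}
    (h0 : ∀ x ∈ ball (0 : E) R, γ x 0 = s₀)
    (hγ : ∀ x ∈ ball (0 : E) R, ∀ t ∈ Icc (0 : ℝ) 1,
      HasDerivWithinAt (γ x) (- (B (t • x) x * γ x t)) (Icc 0 1) t)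
    (hb : ∀ x ∈ ball (0 : E) R, ∀ t ∈ Icc (0 : ℝ) 1, ‖γ x t‖ ≤ 2 * ‖s₀‖ + 1)
    {x : E} (hx : x ∈ ball (0 : E) R) :
    HasFDerivAt (fun y => γ y 1) (parallelDeriv (B x) (γ x 1)) x := by
  set Γ := 2 * ‖s₀‖ + 1
  have hΓ : 0 ≤ Γ := by positivity
  have hK : 0 ≤ K := zero_le_one.trans h.one_le
  -- A first Grönwall estimate: the solutions along two rays differ by `O(‖y - x‖)`.
  have lip : ∀ y ∈ ball (0 : E) R, ∀ t ∈ Icc (0 : ℝ) 1,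
      ‖γ y t - γ x t‖ ≤ 2 * (2 * K * ‖y - x‖ * Γ) := by
    intro y hy
    refine norm_le_of_deriv_bound (by positivity) (fun t ht => (hγ y hy t ht).sub (hγ x hx t ht))
      (by simp [h0 x hx, h0 y hy]) fun t ht => ?_
    have e : -(B (t • y) y * γ y t) - -(B (t • x) x * γ x t)
        = -(B (t • y) y * (γ y t - γ x t) + (B (t • y) y - B (t • x) x) * γ x t) := by
      noncomm_ring
    rw [e, norm_neg]
    refine (norm_add_le _ _).trans (add_le_add ?_ ?_)
    · refine (norm_mul_le _ _).trans ?_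
      have := h.ray_bound hy ht
      exact mul_le_of_le_one_left (norm_nonneg _) (by linarith)
    · refine (norm_mul_le _ _).trans ?_
      exact mul_le_mul (h.ray_sub hx hy ht) (hb x hx t ht) (norm_nonneg _) (by positivity)
  -- The curve `c(t) = γ_y(t) - γ_x(t) + t B(tx)(y - x) γ_x(t)` starts at zero, and at `t = 1` it is
  -- the error of the claimed first-order expansion. Flatness gives `c' = -B(tx)x c + O(‖y - x‖²)`,
  -- so a second Grönwall estimate bounds it quadratically.
  have main : ∀ y ∈ ball (0 : E) R, ‖γ y 1 - γ x 1 - (parallelDeriv (B x) (γ x 1)) (y - x)‖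
      ≤ 2 * ((2 * K * Γ + 2 * K * (4 * K * Γ)) * ‖y - x‖ ^ 2) := by
    intro y hy
    have hd : ∀ t ∈ Icc (0 : ℝ) 1, HasDerivWithinAt
        (fun t => γ y t - γ x t + t • (B (t • x) (y - x) * γ x t))
        (-(B (t • y) y * γ y t) - -(B (t • x) x * γ x t)
          + (t • (fderiv ℝ B (t • x) x (y - x) * γ x t
            + B (t • x) (y - x) * -(B (t • x) x * γ x t))
            + (1 : ℝ) • (B (t • x) (y - x) * γ x t))) (Icc 0 1) t := by
      intro t ht
      refine ((hγ y hy t ht).sub (hγ x hx t ht)).add ?_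
      refine (hasDerivWithinAt_id t _).smul ?_
      have h1 : HasDerivWithinAt (fun t : ℝ => B (t • x) (y - x)) (fderiv ℝ B (t • x) x (y - x))
          (Icc 0 1) t := by
        have := (h.ray_hasDerivAt hx ht).hasDerivWithinAt (s := Icc 0 1)
        simpa using this.clm_apply (hasDerivWithinAt_const t _ (y - x))
      exact h1.mul (hγ x hx t ht)
    have := norm_le_of_deriv_bound (ε := (2 * K * Γ + 2 * K * (4 * K * Γ)) * ‖y - x‖ ^ 2)
      (by positivity) hd (by simp [h0 x hx, h0 y hy]) (fun t ht => ?_) 1 (by simp)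
    · have e1 : γ y 1 - γ x 1 - (parallelDeriv (B x) (γ x 1)) (y - x)
          = γ y 1 - γ x 1 + (1 : ℝ) • (B ((1 : ℝ) • x) (y - x) * γ x 1) := by
        rw [parallelDeriv_apply, one_smul, one_smul, sub_neg_eq_add]
      rw [e1]
      exact this
    -- The only use of flatness: the radial derivative of `B(y - x)` is exchanged for the
    -- transversal derivative of `B(x)` at the cost of a commutator, which is exactly what the
    -- product rule for `c` leaves over.
    have e1 : fderiv ℝ B (t • x) x (y - x) = fderiv ℝ B (t • x) (y - x) x
        - (B (t • x) x * B (t • x) (y - x) - B (t • x) (y - x) * B (t • x) x) := by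
      rw [← sub_eq_zero, ← h.flat _ (smul_mem_ball_zero hx ht) x (y - x)]
      abel
    have e : -(B (t • y) y * γ y t) - -(B (t • x) x * γ x t)
          + (t • (fderiv ℝ B (t • x) x (y - x) * γ x t
            + B (t • x) (y - x) * -(B (t • x) x * γ x t))
            + (1 : ℝ) • (B (t • x) (y - x) * γ x t))
        = -(B (t • x) x * (γ y t - γ x t + t • (B (t • x) (y - x) * γ x t))
          + ((B (t • y) y - B (t • x) x - B (t • x) (y - x)
              - t • fderiv ℝ B (t • x) (y - x) x) * γ x t
          + (B (t • y) y - B (t • x) x) * (γ y t - γ x t))) := by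
      rw [e1]
      generalize B (t • x) (y - x) = b
      generalize fderiv ℝ B (t • x) (y - x) x = d
      generalize B (t • x) x = p
      simp only [sub_mul, mul_sub, mul_add, mul_neg, smul_add, smul_sub, smul_neg, one_smul,
        smul_mul_assoc, mul_smul_comm, mul_assoc]
      abel
    rw [e, norm_neg]
    refine (norm_add_le _ _).trans (add_le_add ?_ ((norm_add_le _ _).trans ?_))
    · refine (norm_mul_le _ _).trans ?_
      have := h.ray_bound hx ht
      exact mul_le_of_le_one_left (norm_nonneg _) (by linarith)
    · have h1 := mul_le_mul (h.ray_taylor hx hy ht) (hb x hx t ht) (norm_nonneg _) (by positivity)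
      have h2 := mul_le_mul (h.ray_sub hx hy ht) (lip y hy t ht) (norm_nonneg _) (by positivity)
      refine (add_le_add ((norm_mul_le _ _).trans h1)
        ((norm_mul_le _ _).trans h2)).trans (le_of_eq ?_)
      ring
  refine .of_isLittleO ((Asymptotics.IsBigO.of_bound
    (2 * (2 * K * Γ + 2 * K * (4 * K * Γ))) ?_).trans_isLittleO
    (g := fun y => ‖y - x‖ ^ 2) ?_)
  · filter_upwards [isOpen_ball.mem_nhds hx] with y hy
    refine (main y hy).trans (le_of_eq ?_)
    rw [norm_pow, norm_norm]
    ring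
  · have h1 : (fun y : E => y - x) =o[𝓝 x] fun _ => (1 : ℝ) := by
      rw [Asymptotics.isLittleO_one_iff]
      have : Tendsto (fun y : E => y - x) (𝓝 x) (𝓝 (x - x)) :=
        (continuous_id.sub continuous_const).tendsto x
      simpa using this
    have h2 := h1.norm_left.mul_isBigO (Asymptotics.isBigO_refl (fun y : E => ‖y - x‖) (𝓝 x))
    have h3 : (fun y : E => ‖y - x‖ ^ 2) = fun y => ‖y - x‖ * ‖y - x‖ := by
      funext y; ring
    rw [h3]
    simpa using h2.norm_right

end IsFlatBall

/-- Bootstrapping: the derivative of `s` is bilinear in `B` and `s`, so every order of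
differentiability of `s` yields the next one. -/
theorem contDiffOn_of_parallel {s : E → A} {U : Set E} (hU : IsOpen U) (hB : ContDiffOn ℝ ∞ B U)
    (hs : ∀ x ∈ U, HasFDerivAt s (parallelDeriv (B x) (s x)) x) : ContDiffOn ℝ ∞ s U := by
  rw [contDiffOn_infty]
  intro m
  induction m with
  | zero => exact contDiffOn_zero.2 fun x hx => (hs x hx).continuousAt.continuousWithinAt
  | succ m ih =>
    push_cast
    rw [contDiffOn_succ_iff_fderiv_of_isOpen hU]
    refine ⟨fun x hx => (hs x hx).differentiableAt.differentiableWithinAt, by simp, ?_⟩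
    have h1 : ContDiffOn ℝ m (fun x => (ContinuousLinearMap.mul ℝ A).flip (s x)) U :=
      ((ContinuousLinearMap.mul ℝ A).flip.contDiff).comp_contDiffOn ih
    exact (h1.clm_comp (hB.of_le (by exact_mod_cast le_top))).neg.congr fun x hx => (hs x hx).fderiv

set_option synthInstance.maxHeartbeats 200000 in
/-- A flat connection on a trivial bundle has parallel sections with given values. -/
theorem exists_parallel [CompleteSpace A] (hB : ∀ᶠ z in 𝓝 (0 : E), ContDiffAt ℝ ∞ B z)
    (hflat : ∀ᶠ z in 𝓝 (0 : E), ∀ v w, fderiv ℝ B z v w - fderiv ℝ B z w v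
      + (B z v * B z w - B z w * B z v) = 0) (s₀ : A) :
    ∃ s : E → A, s 0 = s₀ ∧ ∀ᶠ z in 𝓝 (0 : E),
      ContDiffAt ℝ ∞ s z ∧ HasFDerivAt s (parallelDeriv (B z) (s z)) z := by
  have hB0 := hB.self_of_nhds
  have hD0 : ContDiffAt ℝ 1 (fderiv ℝ B) 0 := hB0.fderiv_right (by norm_cast)
  obtain ⟨K₁, T, hT, hK₁⟩ := hD0.exists_lipschitzOnWith
  have hb : ∀ᶠ z in 𝓝 (0 : E), ‖B z‖ < ‖B 0‖ + 1 :=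
    hB0.continuousAt.norm.eventually (gt_mem_nhds (lt_add_one _))
  have hdb : ∀ᶠ z in 𝓝 (0 : E), ‖fderiv ℝ B z‖ < ‖fderiv ℝ B 0‖ + 1 :=
    (ContinuousAt.norm (E := E →L[ℝ] E →L[ℝ] A) hD0.continuousAt).eventually
      (gt_mem_nhds (lt_add_one _))
  obtain ⟨R₀, hR₀, hall⟩ := Metric.eventually_nhds_iff_ball.1
    (hB.and (hflat.and (hb.and (hdb.and hT))))
  -- One constant dominating `1`, the norms of `B` and of its derivative near the origin, and the
  -- local Lipschitz constant `K₁` of the derivative. The radius is then cut down so that `K R ≤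
  -- 1/2`, which makes the coefficients along all rays small enough for `exists_linear_ode`.
  set K : ℝ := 1 + (‖B 0‖ + 1) + (‖fderiv ℝ B 0‖ + 1) + K₁
  have hK : 1 ≤ K := by
    have := norm_nonneg (B 0); have := norm_nonneg (fderiv ℝ B 0); have := K₁.coe_nonneg
    simp only [K]; linarith
  set R : ℝ := min R₀ (1 / (2 * K))
  have hRpos : 0 < R := lt_min hR₀ (by positivity)
  have hRK : R ≤ 1 / (2 * K) := min_le_right _ _
  have hsub : ball (0 : E) R ⊆ ball 0 R₀ := ball_subset_ball (min_le_left _ _)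
  have hn := norm_nonneg (B 0)
  have hn' := norm_nonneg (fderiv ℝ B 0)
  have hn'' := K₁.coe_nonneg
  have h : IsFlatBall B R K :=
    { pos := hRpos
      le_one := hRK.trans (by rw [div_le_one (by positivity)]; linarith)
      one_le := hK
      small := by
        calc K * R ≤ K * (1 / (2 * K)) := by gcongr
          _ = 1 / 2 := by field_simp
      diff := fun z hz => (hall z (hsub hz)).1.differentiableAt (by simp)
      bound := fun z hz => (hall z (hsub hz)).2.2.1.le.trans (by simp only [K]; linarith)
      deriv_bound := fun z hz => (hall z (hsub hz)).2.2.2.1.le.trans (by simp only [K]; linarith)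
      deriv_lip := fun z hz w hw => by
        have h1 := hK₁.dist_le_mul z (hall z (hsub hz)).2.2.2.2 w (hall w (hsub hw)).2.2.2.2
        rw [dist_eq_norm, dist_eq_norm] at h1
        refine h1.trans ?_
        gcongr
        simp only [K]; linarith
      flat := fun z hz => (hall z (hsub hz)).2.1 }
  have hsol : ∀ x : E, ∃ γ : ℝ → A, x ∈ ball (0 : E) R → γ 0 = s₀ ∧
      (∀ t ∈ Icc (0 : ℝ) 1, HasDerivWithinAt γ (- (B (t • x) x * γ t)) (Icc 0 1) t) ∧
      ∀ t ∈ Icc (0 : ℝ) 1, ‖γ t‖ ≤ 2 * ‖s₀‖ + 1 := by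
    intro x
    by_cases hx : x ∈ ball (0 : E) R
    · obtain ⟨γ, hγ⟩ := exists_linear_ode (P := fun t => B (t • x) x)
        (fun t ht => ((h.ray_hasDerivAt hx ht).continuousAt.clm_apply
          continuousAt_const).continuousWithinAt) (fun t ht => h.ray_bound hx ht) s₀
      exact ⟨γ, fun _ => hγ⟩
    · exact ⟨0, fun h => absurd h hx⟩
  choose γ hγ using hsol
  have hd : ∀ x ∈ ball (0 : E) R, HasFDerivAt (fun y => γ y 1) (parallelDeriv (B x) (γ x 1)) x :=
    fun x hx => h.hasFDerivAt_radial (fun x hx => (hγ x hx).1) (fun x hx => (hγ x hx).2.1)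
      (fun x hx => (hγ x hx).2.2) hx
  have hsm := contDiffOn_of_parallel isOpen_ball
    (fun z hz => (hall z (hsub hz)).1.contDiffWithinAt) hd
  have h0 : (0 : E) ∈ ball (0 : E) R := mem_ball_self hRpos
  refine ⟨fun y => γ y 1, ?_, ?_⟩
  -- Along the ray through the origin the coefficient `B(0) 0` vanishes, so the solution is
  -- constant.
  · have hc : ∀ t ∈ Icc (0 : ℝ) 1, HasDerivWithinAt (γ 0) 0 (Icc 0 1) t := fun t ht => by
      simpa using (hγ 0 h0).2.1 t ht
    have := norm_le_of_deriv_bound (c := fun t => γ 0 t - s₀) (c' := fun _ => 0) le_rfl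
      (fun t ht => (hc t ht).sub_const s₀) (by simp [(hγ 0 h0).1]) (by simp) 1 (by simp)
    simpa [sub_eq_zero] using this
  · filter_upwards [isOpen_ball.mem_nhds h0] with z hz
    exact ⟨hsm.contDiffAt (isOpen_ball.mem_nhds hz), hd z hz⟩

end FlatConnection
end
end ConformalBGG

open scoped Manifold ContDiff Bundle Topology
open Filter
namespace ConformalBGG
noncomputable section

set_option linter.unusedSectionVars false

/-! ### Calculus of functions and vector fields that are smooth near a point. -/

section Calculus

variable {n : ℕ} {M : Type*} [TopologicalSpace M]
  [ChartedSpace (EuclideanSpace ℝ (Fin n)) M] [IsManifold (𝓡 n) ∞ M]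
  {F : Type*} [NormedAddCommGroup F] [NormedSpace ℝ F]
  {F' : Type*} [NormedAddCommGroup F'] [NormedSpace ℝ F']

variable (n M) in
/-- Vector fields on `M` without any regularity. -/
abbrev RoughField : Type _ := ∀ x : M, TangentSpace (𝓡 n) x

/-- `f` is smooth in a neighbourhood of `x`. -/
def SmoothNear (n : ℕ) {M : Type*} [TopologicalSpace M]
    [ChartedSpace (EuclideanSpace ℝ (Fin n)) M] (f : M → F) (x : M) : Prop :=
  ∀ᶠ y in 𝓝 x, ContMDiffAt (𝓡 n) 𝓘(ℝ, F) ∞ f y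

/-- The vector field `X` is smooth in a neighbourhood of `x`. -/
def FieldNear (X : RoughField n M) (x : M) : Prop :=
  ∀ᶠ y in 𝓝 x, ContMDiffAt (𝓡 n) (𝓡 n).tangent ∞
    (fun y => (⟨y, X y⟩ : TangentBundle (𝓡 n) M)) y

variable {x : M} {f h : M → ℝ} {s t : M → F} {X Y Z : RoughField n M}

namespace SmoothNear

theorem self (hs : SmoothNear n s x) : ContMDiffAt (𝓡 n) 𝓘(ℝ, F) ∞ s x := hs.self_of_nhds

theorem mdiff (hs : SmoothNear n s x) : MDifferentiableAt (𝓡 n) 𝓘(ℝ, F) s x :=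
  hs.self.mdifferentiableAt (by simp)

/-- `ContMDiffAt` of order `∞` at a single point need not hold at nearby points, since the
neighbourhood may shrink with the order. Asking for it near `x` gives an open condition, so that
identities proved at `x` hold at all nearby points and can be differentiated again. -/
theorem eventually (hs : SmoothNear n s x) : ∀ᶠ y in 𝓝 x, SmoothNear n s y :=
  eventually_eventually_nhds.2 hs

theorem congr (hs : SmoothNear n s x) (e : t =ᶠ[𝓝 x] s) : SmoothNear n t x := by
  filter_upwards [hs, eventually_eventually_nhds.2 e] with y h1 h2
  exact h1.congr_of_eventuallyEq h2

theorem const (c : F) : SmoothNear n (fun _ : M => c) x := .of_forall fun _ => contMDiffAt_const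

theorem add (hs : SmoothNear n s x) (ht : SmoothNear n t x) :
    SmoothNear n (fun y => s y + t y) x := by
  filter_upwards [hs, ht] with y h1 h2 using h1.add h2

theorem sub (hs : SmoothNear n s x) (ht : SmoothNear n t x) :
    SmoothNear n (fun y => s y - t y) x := by
  filter_upwards [hs, ht] with y h1 h2 using h1.sub h2

theorem neg (hs : SmoothNear n s x) : SmoothNear n (fun y => - s y) x := by
  filter_upwards [hs] with y h1 using h1.neg

theorem smul (hf : SmoothNear n f x) (hs : SmoothNear n s x) :
    SmoothNear n (fun y => f y • s y) x := by
  filter_upwards [hf, hs] with y h1 h2 using h1.smul h2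

theorem mul (hf : SmoothNear n f x) (hs : SmoothNear n h x) :
    SmoothNear n (fun y => f y * h y) x := hf.smul hs

theorem sum {ι : Type*} {S : Finset ι} {s : ι → M → F} (hs : ∀ i ∈ S, SmoothNear n (s i) x) :
    SmoothNear n (fun y => ∑ i ∈ S, s i y) x := by
  filter_upwards [(Finset.eventually_all S).2 hs] with y h1
  exact contMDiffAt_finsetSum h1

theorem comp_contDiffAt {φ : F → F'} (hs : SmoothNear n s x)
    (hφ : ∀ᶠ y in 𝓝 x, ContDiffAt ℝ ∞ φ (s y)) : SmoothNear n (fun y => φ (s y)) x := by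
  filter_upwards [hs, hφ] with y h1 h2
  exact ContMDiffAt.comp y h2.contMDiffAt h1

theorem clm (L : F →L[ℝ] F') (hs : SmoothNear n s x) : SmoothNear n (fun y => L (s y)) x :=
  hs.comp_contDiffAt (.of_forall fun _ => L.contDiff.contDiffAt)

theorem clm_apply {L : M → F →L[ℝ] F'} (hL : SmoothNear n L x) (hs : SmoothNear n s x) :
    SmoothNear n (fun y => L y (s y)) x := by
  filter_upwards [hL, hs] with y h1 h2 using h1.clm_apply h2

theorem pi {ι : Type*} [Fintype ι] {s : M → ι → F} (hs : ∀ i, SmoothNear n (fun y => s y i) x) :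
    SmoothNear n s x := by
  filter_upwards [eventually_all.2 hs] with y h1
  exact contMDiffAt_pi_space.2 h1

theorem inv (hf : SmoothNear n f x) (h0 : f x ≠ 0) : SmoothNear n (fun y => (f y)⁻¹) x := by
  refine hf.comp_contDiffAt (φ := fun r : ℝ => r⁻¹) ?_
  filter_upwards [hf.mdiff.continuousAt.eventually_ne h0] with y hy using contDiffAt_inv ℝ hy

theorem sqrt (hf : SmoothNear n f x) (h0 : f x ≠ 0) : SmoothNear n (fun y => √(f y)) x := by
  refine hf.comp_contDiffAt (φ := Real.sqrt) ?_
  filter_upwards [hf.mdiff.continuousAt.eventually_ne h0] with y hy using Real.contDiffAt_sqrt hy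

theorem exp (hf : SmoothNear n f x) : SmoothNear n (fun y => Real.exp (f y)) x :=
  hf.comp_contDiffAt (.of_forall fun _ => Real.contDiff_exp.contDiffAt)

theorem log (hf : SmoothNear n f x) (h0 : f x ≠ 0) : SmoothNear n (fun y => Real.log (f y)) x := by
  refine hf.comp_contDiffAt (φ := Real.log) ?_
  filter_upwards [hf.mdiff.continuousAt.eventually_ne h0] with y hy using Real.contDiffAt_log.2 hy

end SmoothNear

theorem _root_.ContMDiffOn.smoothNear {U : Set M} (hs : ContMDiffOn (𝓡 n) 𝓘(ℝ, F) ∞ s U)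
    (hU : IsOpen U) (hx : x ∈ U) : SmoothNear n s x := by
  filter_upwards [hU.mem_nhds hx] with y hy using hs.contMDiffAt (hU.mem_nhds hy)

namespace FieldNear

theorem mdiff (hX : FieldNear X x) : MDifferentiableAt (𝓡 n) (𝓡 n).tangent
    (fun y => (⟨y, X y⟩ : TangentBundle (𝓡 n) M)) x :=
  hX.self_of_nhds.mdifferentiableAt (by simp)

theorem eventually (hX : FieldNear X x) : ∀ᶠ y in 𝓝 x, FieldNear X y :=
  eventually_eventually_nhds.2 hX

theorem congr (hX : FieldNear X x) (e : ∀ᶠ y in 𝓝 x, Y y = X y) : FieldNear Y x := by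
  filter_upwards [hX, eventually_eventually_nhds.2 e] with y h1 h2
  exact h1.congr_of_eventuallyEq (h2.mono fun z hz => by simp [hz])

theorem zero : FieldNear (0 : RoughField n M) x :=
  .of_forall fun _ => (Bundle.contMDiff_zeroSection ℝ (fun x : M => TangentSpace (𝓡 n) x)).contMDiffAt

theorem add (hX : FieldNear X x) (hY : FieldNear Y x) : FieldNear (X + Y) x := by
  filter_upwards [hX, hY] with y h1 h2 using h1.add_section h2

theorem sub (hX : FieldNear X x) (hY : FieldNear Y x) : FieldNear (X - Y) x := by
  filter_upwards [hX, hY] with y h1 h2 using h1.sub_section h2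

theorem smul (hf : SmoothNear n f x) (hX : FieldNear X x) : FieldNear (f • X) x := by
  filter_upwards [hf, hX] with y h1 h2 using h1.smul_section h2

theorem const_smul (c : ℝ) (hX : FieldNear X x) : FieldNear (c • X) x := by
  filter_upwards [hX] with y h1 using h1.const_smul_section

theorem sum {ι : Type*} {S : Finset ι} {X : ι → RoughField n M}
    (hX : ∀ i ∈ S, FieldNear (X i) x) : FieldNear (∑ i ∈ S, X i) x := by
  filter_upwards [(Finset.eventually_all S).2 hX] with y h1
  have := ContMDiffAt.sum_section h1
  simpa only [Finset.sum_apply] using this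

theorem ext (v : TangentSpace (𝓡 n) x) : FieldNear (ConformalBGG.ext v) x := by
  obtain ⟨s, hs, h⟩ := FiberBundle.exists_contMDiffOn_extend (k := ∞) (𝓡 n)
    (EuclideanSpace ℝ (Fin n)) (V := fun x : M => TangentSpace (𝓡 n) x) v
  filter_upwards [eventually_mem_nhds_iff.2 hs] with y hy using h.contMDiffAt hy

theorem bracket (hX : FieldNear X x) (hY : FieldNear Y x) :
    FieldNear (VectorField.mlieBracket (𝓡 n) X Y) x := by
  have : IsManifold (𝓡 n) (((⊤ : ℕ∞) : ℕ∞ω) + 1) M := ‹IsManifold (𝓡 n) ∞ M›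
  have : IsManifold (𝓡 n) (minSmoothness ℝ 2) M := by
    rw [minSmoothness_of_isRCLikeNormedField]; infer_instance
  filter_upwards [hX, hY] with y h1 h2
  exact ContMDiffAt.mlieBracket_vectorField (m := ⊤) (n := ⊤) h1 h2 (by simp)

end FieldNear

theorem VectorFields.near (X : VectorFields n M) (x : M) : FieldNear (fun y => X y) x :=
  .of_forall fun _ => X.contMDiff.contMDiffAt

@[simp] theorem ext_self (v : TangentSpace (𝓡 n) x) : ext v x = v :=
  FiberBundle.extend_apply_self _ v

/-! ### Directional derivatives -/

theorem dirDeriv_add (hs : SmoothNear n s x) (ht : SmoothNear n t x) :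
    dirDeriv X (fun y => s y + t y) x = dirDeriv X s x + dirDeriv X t x := by
  simp [dirDeriv, mvfderiv_fun_add hs.mdiff ht.mdiff]

theorem dirDeriv_sub (hs : SmoothNear n s x) (ht : SmoothNear n t x) :
    dirDeriv X (fun y => s y - t y) x = dirDeriv X s x - dirDeriv X t x := by
  simp [dirDeriv, mvfderiv_fun_sub hs.mdiff ht.mdiff]

theorem dirDeriv_neg : dirDeriv X (fun y => - s y) x = - dirDeriv X s x := by
  simp [dirDeriv, mvfderiv_fun_neg]

theorem dirDeriv_const (c : F) : dirDeriv X (fun _ => c) x = 0 := by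
  simp [dirDeriv, mvfderiv_const]

theorem dirDeriv_smul (hf : SmoothNear n f x) (hs : SmoothNear n s x) :
    dirDeriv X (fun y => f y • s y) x = f x • dirDeriv X s x + dirDeriv X f x • s x := by
  simp [dirDeriv, mvfderiv_fun_smul hf.mdiff hs.mdiff]

theorem dirDeriv_mul (hf : SmoothNear n f x) (hs : SmoothNear n h x) :
    dirDeriv X (fun y => f y * h y) x = f x * dirDeriv X h x + dirDeriv X f x * h x :=
  dirDeriv_smul hf hs

theorem dirDeriv_congr (e : s =ᶠ[𝓝 x] t) : dirDeriv X s x = dirDeriv X t x := by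
  simp only [dirDeriv, mvfderiv]
  rw [e.mfderiv_eq, e.self_of_nhds]

theorem dirDeriv_field_congr (e : X x = Y x) : dirDeriv X s x = dirDeriv Y s x := by
  simp only [dirDeriv, e]

theorem dirDeriv_add_field : dirDeriv (X + Y) s x = dirDeriv X s x + dirDeriv Y s x := by
  simp [dirDeriv]

theorem dirDeriv_smul_field : dirDeriv (f • X) s x = f x • dirDeriv X s x := by
  simp [dirDeriv]

theorem dirDeriv_sum {ι : Type*} {S : Finset ι} {s : ι → M → F}
    (hs : ∀ i ∈ S, SmoothNear n (s i) x) :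
    dirDeriv X (fun y => ∑ i ∈ S, s i y) x = ∑ i ∈ S, dirDeriv X (s i) x := by
  classical
  induction S using Finset.induction_on with
  | empty => simpa using dirDeriv_const (0 : F)
  | insert a S ha ih =>
    simp only [Finset.sum_insert ha]
    rw [dirDeriv_add (hs a (by simp)) (.sum fun i hi => hs i (by simp [hi])),
      ih fun i hi => hs i (by simp [hi])]

theorem dirDeriv_comp {φ : F → F'} {φ' : F →L[ℝ] F'} (hs : SmoothNear n s x)
    (hφ : HasFDerivAt φ φ' (s x)) : dirDeriv X (fun y => φ (s y)) x = φ' (dirDeriv X s x) := by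
  have := mfderiv_comp (I := 𝓡 n) (I' := 𝓘(ℝ, F)) (I'' := 𝓘(ℝ, F')) x
    hφ.differentiableAt.mdifferentiableAt hs.mdiff
  rw [mfderiv_eq_fderiv, hφ.fderiv] at this
  exact DFunLike.congr_fun this (X x)

theorem dirDeriv_clm (L : F →L[ℝ] F') (hs : SmoothNear n s x) :
    dirDeriv X (fun y => L (s y)) x = L (dirDeriv X s x) := dirDeriv_comp hs L.hasFDerivAt

theorem dirDeriv_clm_apply {L : M → F →L[ℝ] F'} (hL : SmoothNear n L x) (hs : SmoothNear n s x) :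
    dirDeriv X (fun y => L y (s y)) x = L x (dirDeriv X s x) + dirDeriv X L x (s x) := by
  have h := isBoundedBilinearMap_apply (𝕜 := ℝ) (E := F) (F := F')
  have e : SmoothNear n (fun y => (L y, s y)) x := by
    filter_upwards [hL, hs] with y h1 h2 using h1.prodMk_space h2
  have h1 := dirDeriv_comp (X := X) e (h.hasFDerivAt _)
  have h2 : dirDeriv X (fun y => (L y, s y)) x = (dirDeriv X L x, dirDeriv X s x) := by
    refine Prod.ext ?_ ?_
    · exact (dirDeriv_clm (X := X) (.fst ℝ _ _) e).symm
    · exact (dirDeriv_clm (X := X) (.snd ℝ _ _) e).symm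
  rw [h2] at h1
  simpa using h1

theorem SmoothNear.dirDeriv (hs : SmoothNear n s x) (hX : FieldNear X x) :
    SmoothNear n (dirDeriv X s) x := by
  filter_upwards [hs, hX] with y h1 h2
  have h3 := h1.mfderiv_const (m := ∞) (by simp)
  have h4 := ContMDiffAt.clm_apply_of_inCoordinates h3 h2 h1
  exact (contMDiff_snd_tangentBundle_modelSpace F 𝓘(ℝ, F)).contMDiffAt.comp y h4

/-! ### Brackets and tensoriality -/

local notation "⟦" X ", " Y "⟧" => VectorField.mlieBracket (𝓡 n) X Y

theorem bracket_add_right (hY : FieldNear Y x) (hZ : FieldNear Z x) :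
    ⟦X, Y + Z⟧ x = ⟦X, Y⟧ x + ⟦X, Z⟧ x :=
  VectorField.mlieBracket_add_right hY.mdiff hZ.mdiff

theorem bracket_add_left (hX : FieldNear X x) (hY : FieldNear Y x) :
    ⟦X + Y, Z⟧ x = ⟦X, Z⟧ x + ⟦Y, Z⟧ x :=
  VectorField.mlieBracket_add_left hX.mdiff hY.mdiff

theorem bracket_smul_right (hf : SmoothNear n f x) (hY : FieldNear Y x) :
    ⟦X, f • Y⟧ x = dirDeriv X f x • Y x + f x • ⟦X, Y⟧ x :=
  VectorField.mlieBracket_smul_right hf.mdiff hY.mdiff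

theorem bracket_smul_left (hf : SmoothNear n f x) (hX : FieldNear X x) :
    ⟦f • X, Y⟧ x = - dirDeriv Y f x • X x + f x • ⟦X, Y⟧ x :=
  VectorField.mlieBracket_smul_left hf.mdiff hX.mdiff

theorem bracket_swap : ⟦X, Y⟧ x = - ⟦Y, X⟧ x := VectorField.mlieBracket_swap_apply

theorem bracket_congr {X' Y' : RoughField n M} (hX : ∀ᶠ y in 𝓝 x, X y = X' y)
    (hY : ∀ᶠ y in 𝓝 x, Y y = Y' y) : ⟦X, Y⟧ x = ⟦X', Y'⟧ x :=
  Filter.EventuallyEq.mlieBracket_vectorField_eq hX hY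

theorem bracket_jacobi (hX : FieldNear X x) (hY : FieldNear Y x) (hZ : FieldNear Z x) :
    ⟦X, ⟦Y, Z⟧⟧ x = ⟦⟦X, Y⟧, Z⟧ x + ⟦Y, ⟦X, Z⟧⟧ x := by
  have : IsManifold (𝓡 n) (minSmoothness ℝ 3) M := by
    rw [minSmoothness_of_isRCLikeNormedField]
    exact IsManifold.of_le (n := ∞) (ENat.LEInfty.out (m := 3))
  have h2 : minSmoothness ℝ 2 ≤ ∞ := by
    rw [minSmoothness_of_isRCLikeNormedField]; exact ENat.LEInfty.out
  exact VectorField.leibniz_identity_mlieBracket_apply (hX.self_of_nhds.of_le h2)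
    (hY.self_of_nhds.of_le h2) (hZ.self_of_nhds.of_le h2)

/-- Derived from the Jacobi identity: subtracting `f` times the identity for `X, Y, Z` from that for
`X, Y, fZ` leaves the asserted relation multiplied by `Z`, and `Z` can be chosen nonzero at `x`
unless the tangent space is trivial. -/
theorem dirDeriv_bracket (hf : SmoothNear n f x) (hX : FieldNear X x) (hY : FieldNear Y x) :
    dirDeriv ⟦X, Y⟧ f x = dirDeriv X (dirDeriv Y f) x - dirDeriv Y (dirDeriv X f) x := by
  by_cases h0 : ∀ v : TangentSpace (𝓡 n) x, v = 0
  · simp [dirDeriv, h0 (X x), h0 (Y x), h0 (⟦X, Y⟧ x)]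
  push Not at h0
  obtain ⟨v, hv⟩ := h0
  set Z : RoughField n M := ext v
  have hZ : FieldNear Z x := .ext v
  have expand : ∀ {X Y : RoughField n M}, FieldNear X x → FieldNear Y x →
      ⟦X, ⟦Y, f • Z⟧⟧ x = dirDeriv X (dirDeriv Y f) x • Z x + dirDeriv Y f x • ⟦X, Z⟧ x
        + (dirDeriv X f x • ⟦Y, Z⟧ x + f x • ⟦X, ⟦Y, Z⟧⟧ x) := by
    intro X Y hX hY
    have e : ∀ᶠ y in 𝓝 x, ⟦Y, f • Z⟧ y = (dirDeriv Y f • Z + f • ⟦Y, Z⟧) y := by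
      filter_upwards [hf.eventually, hZ.eventually] with y h1 h2
      exact bracket_smul_right h1 h2
    rw [bracket_congr (.of_forall fun _ => rfl) e,
      bracket_add_right ((hZ.smul (hf.dirDeriv hY))) ((hY.bracket hZ).smul hf),
      bracket_smul_right (hf.dirDeriv hY) hZ, bracket_smul_right hf (hY.bracket hZ)]
  have h1 := bracket_jacobi hX hY (hZ.smul hf)
  rw [expand hX hY, expand hY hX, bracket_smul_right hf hZ, bracket_jacobi hX hY hZ] at h1
  have h2 : (dirDeriv ⟦X, Y⟧ f x - (dirDeriv X (dirDeriv Y f) x - dirDeriv Y (dirDeriv X f) x))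
      • Z x = 0 := by
    rw [sub_smul, sub_smul, sub_eq_zero]
    have := sub_eq_zero.2 h1
    rw [← sub_eq_zero, ← neg_eq_zero, ← this, smul_add]
    abel
  have h3 : Z x ≠ 0 := by simpa [Z] using hv
  exact sub_eq_zero.1 ((smul_eq_zero.1 h2).resolve_right h3)

/-- Linear functionals separate the points of `F` and commute with directional derivatives, which
reduces this to scalar functions. -/
theorem dirDeriv_bracket_vec [FiniteDimensional ℝ F] (hs : SmoothNear n s x) (hX : FieldNear X x)
    (hY : FieldNear Y x) :
    dirDeriv ⟦X, Y⟧ s x = dirDeriv X (dirDeriv Y s) x - dirDeriv Y (dirDeriv X s) x := by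
  refine (SeparatingDual.eq_iff_forall_dual_eq (R := ℝ)).2 fun L => ?_
  have h : ∀ {X Y : RoughField n M}, FieldNear Y x → dirDeriv X (dirDeriv Y fun y => L (s y)) x
      = L (dirDeriv X (dirDeriv Y s) x) := by
    intro X Y hY
    rw [← dirDeriv_clm L (hs.dirDeriv hY)]
    refine dirDeriv_congr ?_
    filter_upwards [hs.eventually] with y h1 using dirDeriv_clm L h1
  rw [map_sub, ← h hX, ← h hY, ← dirDeriv_clm L hs, dirDeriv_bracket (hs.clm L) hX hY]

/-- Coordinates of vector fields in a local frame near `x`. -/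
theorem exists_local_coordinates (x : M) : ∃ b : Fin n → RoughField n M, (∀ i, FieldNear (b i) x) ∧
    ∃ c : Fin n → ∀ y : M, TangentSpace (𝓡 n) y →ₗ[ℝ] ℝ,
      (∀ X, FieldNear X x → ∀ i, SmoothNear n (fun y => c i y (X y)) x) ∧
      ∀ᶠ y in 𝓝 x, ∀ v : TangentSpace (𝓡 n) y, v = ∑ i, c i y v • b i y := by
  set e := trivializationAt (EuclideanSpace ℝ (Fin n)) (fun x : M => TangentSpace (𝓡 n) x) x
  have hx : x ∈ e.baseSet := FiberBundle.mem_baseSet_trivializationAt' x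
  have hU : ∀ᶠ y in 𝓝 x, y ∈ e.baseSet := e.open_baseSet.mem_nhds hx
  set B := (EuclideanSpace.basisFun (Fin n) ℝ).toBasis
  refine ⟨e.localFrame B, fun i => ?_, e.localFrameCoeff (𝓡 n) B, fun X hX i => ?_, ?_⟩
  · filter_upwards [hU] with y hy using contMDiffAt_localFrame_of_mem ∞ e B i hy
  · filter_upwards [hU, hX] with y hy h using contMDiffAt_localFrameCoeff B hy h i
  · filter_upwards [hU] with y hy v
    have := Bundle.Trivialization.eq_sum_localFrameCoeff_smul (I := 𝓡 n) (b := B) (s := ext v) hy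
    simpa using this

/-- The tensoriality criterion: an operation on smooth fields which is additive and linear
over smooth functions depends only on the value of the field at `x`. -/
theorem tensorial_pointwise {A : Type*} [AddCommGroup A] [Module ℝ A] (Φ : RoughField n M → A)
    (hadd : ∀ X Y, FieldNear X x → FieldNear Y x → Φ (X + Y) = Φ X + Φ Y)
    (hsmul : ∀ (f : M → ℝ) X, SmoothNear n f x → FieldNear X x → Φ (f • X) = f x • Φ X)
    (hX : FieldNear X x) (hY : FieldNear Y x) (e : X x = Y x) : Φ X = Φ Y := by
  classical
  have hlocal : ∀ X Y, FieldNear X x → FieldNear Y x → (∀ᶠ y in 𝓝 x, X y = Y y) → Φ X = Φ Y := by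
    intro X Y hX hY e
    -- The indicator of the set where the fields agree is `1` near `x`, hence admissible as a
    -- coefficient, and `ψ X = ψ Y` everywhere. No cut-off function is needed because nothing is
    -- required away from `x`.
    set ψ : M → ℝ := fun y => if X y = Y y then 1 else 0 with hψ
    have h1 : SmoothNear n ψ x := (SmoothNear.const 1).congr (e.mono fun y hy => by simp [hψ, hy])
    have h2 : ψ • X = ψ • Y := by
      funext y
      by_cases h : X y = Y y <;> simp [hψ, h]
    have h3 : ψ x = 1 := by simp [hψ, e.self_of_nhds]
    have h4 := hsmul ψ X h1 hX
    rw [h2, hsmul ψ Y h1 hY, h3, one_smul, one_smul] at h4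
    exact h4.symm
  have hzero : Φ 0 = 0 := by simpa using hsmul 0 0 (SmoothNear.const 0) FieldNear.zero
  have hsum : ∀ (S : Finset (Fin n)) (X : Fin n → RoughField n M), (∀ i, FieldNear (X i) x) →
      Φ (∑ i ∈ S, X i) = ∑ i ∈ S, Φ (X i) := by
    intro S X h
    induction S using Finset.induction_on with
    | empty => simpa using hzero
    | insert a S ha ih =>
      rw [Finset.sum_insert ha, Finset.sum_insert ha, hadd _ _ (h a) (.sum fun i _ => h i), ih]
  obtain ⟨b, hb, c, hc, hbc⟩ := exists_local_coordinates (n := n) x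
  have key : ∀ X, FieldNear X x → Φ X = ∑ i, c i x (X x) • Φ (b i) := by
    intro X hX
    rw [hlocal X (∑ i, (fun y => c i y (X y)) • b i) hX
      (.sum fun i _ => (hb i).smul (hc X hX i)) ?_, hsum _ _ fun i => (hb i).smul (hc X hX i)]
    · exact Finset.sum_congr rfl fun i _ => hsmul _ _ (hc X hX i) (hb i)
    · filter_upwards [hbc] with y hy
      simpa using hy (X y)
  rw [key X hX, key Y hY, e]

end Calculus
end
end ConformalBGG

open scoped Manifold ContDiff Bundle Topology
open Filter
namespace ConformalBGG
noncomputable section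
set_option linter.unusedSectionVars false

/-! ### Riemannian metrics near a point, orthonormal frames and the Levi-Civita connection. -/

section Metric

variable {n : ℕ} {M : Type*} [TopologicalSpace M]
  [ChartedSpace (EuclideanSpace ℝ (Fin n)) M] [IsManifold (𝓡 n) ∞ M]

local notation "⟦" X ", " Y "⟧" => VectorField.mlieBracket (𝓡 n) X Y

instance tangentSpace_finiteDimensional (x : M) : FiniteDimensional ℝ (TangentSpace (𝓡 n) x) :=
  inferInstanceAs (FiniteDimensional ℝ (EuclideanSpace ℝ (Fin n)))

theorem finrank_tangentSpace (x : M) : Module.finrank ℝ (TangentSpace (𝓡 n) x) = n :=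
  (finrank_euclideanSpace_fin : Module.finrank ℝ (EuclideanSpace ℝ (Fin n)) = n)

/-- The function `g(X, Y)`. -/
def ip (g : MetricField n M) (X Y : RoughField n M) (y : M) : ℝ := g y (X y) (Y y)

/-- `g` is symmetric and positive definite at `x`, and smooth near `x`. -/
structure IsMetricAt (g : MetricField n M) (x : M) : Prop where
  symm : ∀ v w, g x v w = g x w v
  pos : ∀ v, v ≠ 0 → 0 < g x v v
  smooth : ∀ X Y, FieldNear X x → FieldNear Y x → SmoothNear n (ip g X Y) x

/-- `g` is a smooth Riemannian metric near `x`. -/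
def MetricNear (g : MetricField n M) (x : M) : Prop := ∀ᶠ y in 𝓝 x, IsMetricAt g y

variable {g : MetricField n M} {x : M} {X Y Z X' Y' : RoughField n M} {f : M → ℝ}

theorem MetricNear.eventually (hg : MetricNear g x) : ∀ᶠ y in 𝓝 x, MetricNear g y :=
  eventually_eventually_nhds.2 hg

theorem MetricNear.self (hg : MetricNear g x) : IsMetricAt g x := hg.self_of_nhds

theorem metricNear_of_contMDiff (g : Bundle.ContMDiffRiemannianMetric (𝓡 n) ∞
    (EuclideanSpace ℝ (Fin n)) (fun x : M => TangentSpace (𝓡 n) x)) (x : M) :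
    MetricNear g.inner x := by
  refine .of_forall fun y => ⟨g.symm y, g.pos y, fun X Y hX hY => ?_⟩
  let : Bundle.RiemannianBundle (fun x : M => TangentSpace (𝓡 n) x) := ⟨g.toRiemannianMetric⟩
  filter_upwards [hX, hY] with z h1 h2
  exact ContMDiffAt.inner_bundle (E := fun x : M => TangentSpace (𝓡 n) x) h1 h2

namespace IsMetricAt

theorem eq_of_inner (hg : IsMetricAt g x) {v w : TangentSpace (𝓡 n) x}
    (h : ∀ u, g x v u = g x w u) : v = w := by
  by_contra hne
  have := hg.pos (v - w) (sub_ne_zero.2 hne)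
  rw [map_sub] at this
  simp [h] at this

theorem inner_sharp (hg : IsMetricAt g x) {α : TangentSpace (𝓡 n) x → ℝ} (hα : IsLinearMap ℝ α)
    (v : TangentSpace (𝓡 n) x) : g x (sharp g x α) v = α v := by
  have hex : ∃ w, ∀ v, g x w v = α v := by
    set T : TangentSpace (𝓡 n) x →ₗ[ℝ] Module.Dual ℝ (TangentSpace (𝓡 n) x) :=
      ContinuousLinearMap.coeLM ℝ ∘ₗ (g x).toLinearMap
    have hinj : Function.Injective T := fun v w h =>
      hg.eq_of_inner fun u => LinearMap.congr_fun h u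
    have hsurj : Function.Surjective T :=
      (LinearMap.injective_iff_surjective_of_finrank_eq_finrank
        (Subspace.dual_finrank_eq (K := ℝ)).symm).1 hinj
    obtain ⟨w, hw⟩ := hsurj (hα.mk' α)
    exact ⟨w, fun v => LinearMap.congr_fun hw v⟩
  rw [sharp, dif_pos hex]
  exact hex.choose_spec v

theorem linearIndependent {k : ℕ} {u : Fin k → TangentSpace (𝓡 n) x}
    (hu : ∀ i j, g x (u i) (u j) = if i = j then 1 else 0) : LinearIndependent ℝ u := by
  rw [Fintype.linearIndependent_iff]
  intro c hc i
  have : g x (∑ j, c j • u j) (u i) = 0 := by simp [hc]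
  simpa [hu] using this

theorem expand (hg : IsMetricAt g x) {u : Fin n → TangentSpace (𝓡 n) x}
    (hu : ∀ i j, g x (u i) (u j) = if i = j then 1 else 0) (v : TangentSpace (𝓡 n) x) :
    v = ∑ i, g x v (u i) • u i := by
  by_cases hn : Nonempty (Fin n)
  · set b := basisOfLinearIndependentOfCardEqFinrank (linearIndependent hu)
      (by simp [finrank_tangentSpace])
    have hb : ∀ i, b i = u i := fun i => by simp [b]
    have h := b.sum_repr v
    simp only [hb] at h
    have h2 : ∀ i, g x v (u i) = b.repr v i := fun i => by
      conv_lhs => rw [← h]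
      simp [hu]
    simp only [h2, h]
  -- For `n = 0` the tangent space is trivial.
  · have : IsEmpty (Fin n) := not_nonempty_iff.1 hn
    have h0 : Module.finrank ℝ (TangentSpace (𝓡 n) x) = 0 := by
      rw [finrank_tangentSpace]; exact (Fintype.card_fin n).symm.trans Fintype.card_eq_zero
    have := Module.finrank_zero_iff.1 h0
    exact Subsingleton.elim _ _

theorem exists_orthonormal (hg : IsMetricAt g x) : ∃ u : Fin n → TangentSpace (𝓡 n) x,
    ∀ i j, g x (u i) (u j) = if i = j then 1 else 0 := by
  have : Invertible (2 : ℝ) := invertibleOfNonzero two_ne_zero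
  set B : LinearMap.BilinForm ℝ (TangentSpace (𝓡 n) x) :=
    ContinuousLinearMap.coeLM ℝ ∘ₗ (g x).toLinearMap
  have hB : LinearMap.IsSymm B := ⟨fun v w => hg.symm v w⟩
  obtain ⟨v, hv⟩ := LinearMap.BilinForm.exists_orthogonal_basis hB
  set w : Fin n → TangentSpace (𝓡 n) x := fun i => v (Fin.cast (finrank_tangentSpace x).symm i)
  have hw : ∀ i j, i ≠ j → g x (w i) (w j) = 0 := fun i j hij =>
    hv (fun h => hij (by simpa [Fin.ext_iff] using h))
  have hp : ∀ i, 0 < g x (w i) (w i) := fun i => hg.pos _ (v.ne_zero _)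
  refine ⟨fun i => (√(g x (w i) (w i)))⁻¹ • w i, fun i j => ?_⟩
  split_ifs with h
  · subst h
    have := (Real.sqrt_pos.2 (hp i)).ne'
    simp only [map_smul, smul_apply, smul_eq_mul]
    nth_rw 3 [← Real.mul_self_sqrt (hp i).le]
    field_simp
  · simp [hw i j h]

end IsMetricAt

/-- Orthonormal vectors at `x` extend to smooth orthonormal fields near `x`. -/
theorem MetricNear.exists_frame (hg : MetricNear g x) {k : ℕ} (u : Fin k → TangentSpace (𝓡 n) x)
    (hu : ∀ i j, g x (u i) (u j) = if i = j then 1 else 0) :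
    ∃ e : Fin k → RoughField n M, (∀ i, FieldNear (e i) x) ∧ (∀ i, e i x = u i) ∧
      ∀ᶠ y in 𝓝 x, ∀ i j, g y (e i y) (e j y) = if i = j then 1 else 0 := by
  induction k with
  | zero => exact ⟨fun i => i.elim0, fun i => i.elim0, fun i => i.elim0,
      .of_forall fun _ i => i.elim0⟩
  | succ k ih =>
    obtain ⟨e, he, hex, ho⟩ := ih (fun i => u i.castSucc) fun i j => by simpa using hu i.castSucc j.castSucc
    -- Gram–Schmidt against the fields already constructed. At `x` the projections vanish and the
    -- norm is `1`, so normalising keeps the prescribed value.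
    set w : RoughField n M := ext (u (Fin.last k)) - ∑ i, ip g (ext (u (Fin.last k))) (e i) • e i
      with hw
    have hwn : FieldNear w x := (FieldNear.ext _).sub
      (.sum fun i _ => (he i).smul (hg.self.smooth _ _ (.ext _) (he i)))
    have hwx : w x = u (Fin.last k) := by
      have : ∀ i, ip g (ext (u (Fin.last k))) (e i) x = 0 := fun i => by
        simp [ip, hex, hu, i.castSucc_lt_last.ne']
      simp [hw, this]
    have hnn : SmoothNear n (ip g w w) x := hg.self.smooth _ _ hwn hwn
    have hn1 : ip g w w x = 1 := by simp [ip, hwx, hu]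
    have hsq : SmoothNear n (fun y => (√(ip g w w y))⁻¹) x :=
      (hnn.sqrt (by simp [hn1])).inv (by simp [hn1])
    have hpos : ∀ᶠ y in 𝓝 x, 0 < ip g w w y :=
      hnn.mdiff.continuousAt.eventually (lt_mem_nhds (by simp [hn1]))
    refine ⟨Fin.snoc e ((fun y => (√(ip g w w y))⁻¹) • w), ?_, ?_, ?_⟩
    · intro i
      refine Fin.lastCases ?_ (fun i => ?_) i
      · simpa using hwn.smul hsq
      · simpa using he i
    · intro i
      refine Fin.lastCases ?_ (fun i => ?_) i
      · simp [hn1, hwx]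
      · simpa using hex i
    · filter_upwards [ho, hpos, hg] with y h1 h2 h3
      have hwe : ∀ j, g y (w y) (e j y) = 0 := fun j => by simp [hw, h1, ip]
      have hew : ∀ j, g y (e j y) (w y) = 0 := fun j => by rw [h3.symm, hwe]
      intro i j
      refine Fin.lastCases ?_ (fun i => ?_) i <;> refine Fin.lastCases ?_ (fun j => ?_) j
      · have := (Real.sqrt_pos.2 h2).ne'
        have h4 : g y (w y) (w y) = √(ip g w w y) * √(ip g w w y) :=
          (Real.mul_self_sqrt h2.le).symm
        simp only [Fin.snoc_last, Pi.smul_apply', map_smul, smul_apply,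
          smul_eq_mul, if_true, h4]
        field_simp
      · simp [hwe, j.castSucc_lt_last.ne']
      · simp [hew, i.castSucc_lt_last.ne]
      · simpa using h1 i j

theorem MetricNear.exists_orthonormal_frame (hg : MetricNear g x) :
    ∃ e : Fin n → RoughField n M, (∀ i, FieldNear (e i) x) ∧
      ∀ᶠ y in 𝓝 x, ∀ i j, g y (e i y) (e j y) = if i = j then 1 else 0 := by
  obtain ⟨u, hu⟩ := hg.self.exists_orthonormal
  obtain ⟨e, h1, -, h2⟩ := hg.exists_frame u hu
  exact ⟨e, h1, h2⟩

/-! ### The Levi-Civita connection -/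

theorem ip_add_left : ip g (X + Y) Z = fun y => ip g X Z y + ip g Y Z y := by
  funext y; simp [ip]

theorem ip_add_right : ip g X (Y + Z) = fun y => ip g X Y y + ip g X Z y := by
  funext y; simp [ip]

theorem ip_smul_left : ip g (f • X) Z = fun y => f y * ip g X Z y := by
  funext y; simp [ip]

theorem ip_smul_right : ip g X (f • Z) = fun y => f y * ip g X Z y := by
  funext y; simp [ip]

theorem MetricNear.ip_comm (hg : MetricNear g x) : ip g X Y =ᶠ[𝓝 x] ip g Y X := by
  filter_upwards [hg] with y hy using hy.symm _ _

theorem MetricNear.dirDeriv_ip_comm (hg : MetricNear g x) :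
    dirDeriv Z (ip g X Y) x = dirDeriv Z (ip g Y X) x := dirDeriv_congr hg.ip_comm

theorem koszul_eq : koszul g X Y Z x = dirDeriv X (ip g Y Z) x + dirDeriv Y (ip g Z X) x
    - dirDeriv Z (ip g X Y) x + g x (⟦X, Y⟧ x) (Z x) - g x (⟦Y, Z⟧ x) (X x)
    + g x (⟦Z, X⟧ x) (Y x) := rfl

theorem koszul_add_right (hg : MetricNear g x) (hX : FieldNear X x) (hY : FieldNear Y x)
    (hZ : FieldNear Z x) (hZ' : FieldNear X' x) :
    koszul g X Y (Z + X') x = koszul g X Y Z x + koszul g X Y X' x := by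
  have hs := hg.self.smooth
  rw [koszul_eq, koszul_eq, koszul_eq, ip_add_left, ip_add_right,
    dirDeriv_add (hs _ _ hY hZ) (hs _ _ hY hZ'), dirDeriv_add (hs _ _ hZ hX) (hs _ _ hZ' hX),
    dirDeriv_add_field, bracket_add_right hZ hZ', bracket_add_left hZ hZ']
  simp only [Pi.add_apply, map_add, add_apply]
  ring

theorem koszul_smul_right (hg : MetricNear g x) (hX : FieldNear X x) (hY : FieldNear Y x)
    (hf : SmoothNear n f x) (hZ : FieldNear Z x) :
    koszul g X Y (f • Z) x = f x * koszul g X Y Z x := by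
  have hs := hg.self.smooth
  rw [koszul_eq, koszul_eq, ip_smul_left, ip_smul_right,
    dirDeriv_mul hf (hs _ _ hY hZ), dirDeriv_mul hf (hs _ _ hZ hX),
    dirDeriv_smul_field, bracket_smul_right hf hZ, bracket_smul_left hf hZ]
  simp only [Pi.smul_apply', map_add, add_apply, map_smul, smul_eq_mul,
    smul_apply, ip, hg.self.symm (Z x) (Y x)]
  ring

theorem koszul_congr_right (hg : MetricNear g x) (hX : FieldNear X x) (hY : FieldNear Y x)
    (hZ : FieldNear Z x) (hZ' : FieldNear X' x) (e : Z x = X' x) :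
    koszul g X Y Z x = koszul g X Y X' x :=
  tensorial_pointwise (fun Z => koszul g X Y Z x)
    (fun _ _ h h' => koszul_add_right hg hX hY h h')
    (fun _ _ hf h => koszul_smul_right hg hX hY hf h) hZ hZ' e

/-- The Koszul expression is tensorial in its last argument. Hence it is a linear functional of the
value at `x`, which `sharp` represents, and `ext v` may be replaced by any field with value `v`. -/
theorem inner_leviCivita (hg : MetricNear g x) (hX : FieldNear X x) (hY : FieldNear Y x)
    (hZ : FieldNear Z x) : g x (leviCivita g X Y x) (Z x) = koszul g X Y Z x / 2 := by
  rw [leviCivita, hg.self.inner_sharp]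
  · rw [koszul_congr_right hg hX hY (.ext _) hZ (ext_self _)]
  · refine ⟨fun v w => ?_, fun c v => ?_⟩
    · rw [koszul_congr_right hg hX hY (.ext (v + w)) ((FieldNear.ext v).add (.ext w)) (by simp),
        koszul_add_right hg hX hY (.ext v) (.ext w)]
      ring
    · rw [koszul_congr_right hg hX hY (.ext (c • v)) ((FieldNear.ext v).smul (.const c))
        (by simp), koszul_smul_right hg hX hY (.const c) (.ext v), smul_eq_mul]
      ring

/-- A criterion for computing `∇_X Y`. -/
theorem leviCivita_eq_of (hg : MetricNear g x) (hX : FieldNear X x) (hY : FieldNear Y x)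
    {w : TangentSpace (𝓡 n) x} (h : ∀ Z, FieldNear Z x → 2 * g x w (Z x) = koszul g X Y Z x) :
    leviCivita g X Y x = w := by
  refine hg.self.eq_of_inner fun v => ?_
  have h1 := h (ext v) (.ext v)
  have h2 := inner_leviCivita hg hX hY (.ext v)
  rw [ext_self] at h1 h2
  linarith

theorem two_inner_leviCivita (hg : MetricNear g x) (hX : FieldNear X x) (hY : FieldNear Y x)
    (hZ : FieldNear Z x) : 2 * g x (leviCivita g X Y x) (Z x) = koszul g X Y Z x := by
  rw [inner_leviCivita hg hX hY hZ]; ring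

theorem leviCivita_add_right (hg : MetricNear g x) (hX : FieldNear X x) (hY : FieldNear Y x)
    (hZ : FieldNear Z x) :
    leviCivita g X (Y + Z) x = leviCivita g X Y x + leviCivita g X Z x := by
  refine leviCivita_eq_of hg hX (hY.add hZ) fun W hW => ?_
  have hs := hg.self.smooth
  rw [map_add, add_apply, mul_add, two_inner_leviCivita hg hX hY hW,
    two_inner_leviCivita hg hX hZ hW, koszul_eq, koszul_eq, koszul_eq, ip_add_left, ip_add_right,
    dirDeriv_add (hs _ _ hY hW) (hs _ _ hZ hW), dirDeriv_add (hs _ _ hX hY) (hs _ _ hX hZ),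
    dirDeriv_add_field, bracket_add_right hY hZ, bracket_add_left hY hZ]
  simp only [Pi.add_apply, map_add, add_apply]
  ring

theorem leviCivita_smul_right (hg : MetricNear g x) (hX : FieldNear X x) (hf : SmoothNear n f x)
    (hY : FieldNear Y x) :
    leviCivita g X (f • Y) x = f x • leviCivita g X Y x + dirDeriv X f x • Y x := by
  refine leviCivita_eq_of hg hX (hY.smul hf) fun W hW => ?_
  have hs := hg.self.smooth
  simp only [map_add, add_apply, map_smul, smul_apply,
    smul_eq_mul]
  have e := two_inner_leviCivita hg hX hY hW
  rw [koszul_eq] at e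
  rw [koszul_eq, ip_smul_left, ip_smul_right,
    dirDeriv_mul hf (hs _ _ hY hW), dirDeriv_mul hf (hs _ _ hX hY),
    dirDeriv_smul_field, bracket_smul_right hf hY, bracket_smul_left hf hY]
  simp only [Pi.smul_apply', map_add, add_apply, map_smul, smul_eq_mul,
    smul_apply, ip, hg.self.symm (Y x) (X x)] at e ⊢
  linear_combination f x * e

theorem leviCivita_add_left (hg : MetricNear g x) (hX : FieldNear X x) (hY : FieldNear Y x)
    (hZ : FieldNear Z x) :
    leviCivita g (X + Y) Z x = leviCivita g X Z x + leviCivita g Y Z x := by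
  refine leviCivita_eq_of hg (hX.add hY) hZ fun W hW => ?_
  have hs := hg.self.smooth
  rw [map_add, add_apply, mul_add, two_inner_leviCivita hg hX hZ hW,
    two_inner_leviCivita hg hY hZ hW, koszul_eq, koszul_eq, koszul_eq, ip_add_left, ip_add_right,
    dirDeriv_add (hs _ _ hW hX) (hs _ _ hW hY), dirDeriv_add (hs _ _ hX hZ) (hs _ _ hY hZ),
    dirDeriv_add_field, bracket_add_right hX hY, bracket_add_left hX hY]
  simp only [Pi.add_apply, map_add, add_apply]
  ring

theorem leviCivita_smul_left (hg : MetricNear g x) (hf : SmoothNear n f x) (hX : FieldNear X x)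
    (hY : FieldNear Y x) : leviCivita g (f • X) Y x = f x • leviCivita g X Y x := by
  refine leviCivita_eq_of hg (hX.smul hf) hY fun W hW => ?_
  have hs := hg.self.smooth
  simp only [map_smul, smul_apply, smul_eq_mul]
  have e := two_inner_leviCivita hg hX hY hW
  rw [koszul_eq] at e
  rw [koszul_eq, ip_smul_left, ip_smul_right,
    dirDeriv_mul hf (hs _ _ hW hX), dirDeriv_mul hf (hs _ _ hX hY),
    dirDeriv_smul_field, bracket_smul_right hf hX, bracket_smul_left hf hX]
  simp only [Pi.smul_apply', map_add, add_apply, map_smul, smul_eq_mul,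
    smul_apply, ip, hg.self.symm (X x) (W x)] at e ⊢
  linear_combination f x * e

theorem leviCivita_congr_left (hg : MetricNear g x) (hX : FieldNear X x) (hX' : FieldNear X' x)
    (hY : FieldNear Y x) (e : X x = X' x) : leviCivita g X Y x = leviCivita g X' Y x :=
  tensorial_pointwise (fun X => leviCivita g X Y x)
    (fun _ _ h h' => leviCivita_add_left hg h h' hY)
    (fun _ _ hf h => leviCivita_smul_left hg hf h hY) hX hX' e

theorem leviCivita_congr_right (hY : ∀ᶠ y in 𝓝 x, Y y = Y' y) :
    leviCivita g X Y x = leviCivita g X Y' x := by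
  simp only [leviCivita]
  congr 1
  funext v
  have h1 : ∀ Z : RoughField n M, ip g Y Z =ᶠ[𝓝 x] ip g Y' Z := fun Z => by
    filter_upwards [hY] with y hy; simp [ip, hy]
  have h2 : ∀ Z : RoughField n M, ip g Z Y =ᶠ[𝓝 x] ip g Z Y' := fun Z => by
    filter_upwards [hY] with y hy; simp [ip, hy]
  simp only [koszul_eq]
  rw [dirDeriv_congr (h1 _), dirDeriv_congr (h2 _), dirDeriv_field_congr hY.self_of_nhds,
    bracket_congr (.of_forall fun _ => rfl) hY, bracket_congr hY (.of_forall fun _ => rfl),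
    hY.self_of_nhds]

/-- In the sum of the Koszul formulas for `(X, Y; Z)` and `(X, Z; Y)` everything cancels except
twice the derivative of `g(Y, Z)`. -/
theorem dirDeriv_ip (hg : MetricNear g x) (hX : FieldNear X x) (hY : FieldNear Y x)
    (hZ : FieldNear Z x) : dirDeriv X (ip g Y Z) x
      = g x (leviCivita g X Y x) (Z x) + g x (Y x) (leviCivita g X Z x) := by
  have e1 := two_inner_leviCivita hg hX hY hZ
  have e2 := two_inner_leviCivita hg hX hZ hY
  rw [hg.self.symm (Y x)]
  rw [koszul_eq] at e1 e2
  rw [hg.dirDeriv_ip_comm (X := Z) (Y := Y), hg.dirDeriv_ip_comm (X := Y) (Y := X),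
    hg.dirDeriv_ip_comm (X := X) (Y := Z),
    bracket_swap (X := X) (Y := Z), bracket_swap (X := Z) (Y := Y),
    bracket_swap (X := Y) (Y := X)] at e2
  simp only [map_neg, neg_apply] at e2
  linarith

/-- In the difference of the Koszul formulas for `(X, Y; Z)` and `(Y, X; Z)` only the bracket of `X`
and `Y` survives. -/
theorem torsion_free (hg : MetricNear g x) (hX : FieldNear X x) (hY : FieldNear Y x) :
    ⟦X, Y⟧ x = leviCivita g X Y x - leviCivita g Y X x := by
  refine hg.self.eq_of_inner fun v => ?_
  have e1 := two_inner_leviCivita hg hX hY (.ext v)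
  have e2 := two_inner_leviCivita hg hY hX (.ext v)
  rw [koszul_eq] at e1 e2
  rw [hg.dirDeriv_ip_comm (X := Y) (Y := X), hg.dirDeriv_ip_comm (X := X) (Y := ext v),
    hg.dirDeriv_ip_comm (X := ext v) (Y := Y),
    bracket_swap (X := Y) (Y := X), bracket_swap (X := X) (Y := ext v),
    bracket_swap (X := ext v) (Y := Y)] at e2
  simp only [map_neg, neg_apply, ext_self] at e1 e2
  rw [map_sub, sub_apply]
  linarith

theorem smoothNear_koszul (hg : MetricNear g x) (hX : FieldNear X x) (hY : FieldNear Y x)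
    (hZ : FieldNear Z x) : SmoothNear n (koszul g X Y Z) x := by
  have hs := hg.self.smooth
  exact ((((((hs _ _ hY hZ).dirDeriv hX).add ((hs _ _ hZ hX).dirDeriv hY)).sub
    ((hs _ _ hX hY).dirDeriv hZ)).add (hs _ _ (hX.bracket hY) hZ)).sub
    (hs _ _ (hY.bracket hZ) hX)).add (hs _ _ (hZ.bracket hX) hY)

/-- The connection is defined pointwise through `sharp`. Smoothness becomes visible in a smooth
orthonormal frame, where its coefficients are Koszul expressions. -/
theorem FieldNear.nabla (hg : MetricNear g x) (hX : FieldNear X x) (hY : FieldNear Y x) :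
    FieldNear (leviCivita g X Y) x := by
  obtain ⟨e, he, ho⟩ := hg.exists_orthonormal_frame
  have h : FieldNear (∑ i, (fun y => koszul g X Y (e i) y / 2) • e i) x :=
    .sum fun i _ => (he i).smul (((smoothNear_koszul hg hX hY (he i)).mul (.const 2⁻¹)).congr
      (.of_forall fun y => div_eq_mul_inv _ _))
  refine h.congr ?_
  filter_upwards [ho, hg.eventually, hX.eventually, hY.eventually,
    eventually_all.2 fun i => (he i).eventually] with y h1 h2 h3 h4 h5
  have := h2.self.expand h1 (leviCivita g X Y y)
  rw [this]
  simp only [inner_leviCivita h2 h3 h4 (h5 _)]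
  simp

end Metric
end
end ConformalBGG

open scoped Manifold ContDiff Bundle Topology
open Filter
namespace ConformalBGG
noncomputable section
set_option linter.unusedSectionVars false

/-! ### The curvature tensor and its contractions. -/

section Curvature

variable {n : ℕ} {M : Type*} [TopologicalSpace M]
  [ChartedSpace (EuclideanSpace ℝ (Fin n)) M] [IsManifold (𝓡 n) ∞ M]

local notation "⟦" X ", " Y "⟧" => VectorField.mlieBracket (𝓡 n) X Y

variable {g : MetricField n M} {x : M} {X Y Z W X' Y' : RoughField n M} {f : M → ℝ}

theorem leviCivita_neg_left (hg : MetricNear g x) (hX : FieldNear X x) (hY : FieldNear Y x) :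
    leviCivita g (-X) Y x = - leviCivita g X Y x := by
  have := leviCivita_smul_left hg (.const (-1)) hX hY
  have e : ((fun _ : M => (-1 : ℝ)) • X : RoughField n M) = -X := by funext y; simp
  rw [e] at this
  simpa using this

theorem leviCivita_sub_right (hg : MetricNear g x) (hX : FieldNear X x) (hY : FieldNear Y x)
    (hZ : FieldNear Z x) :
    leviCivita g X (Y - Z) x = leviCivita g X Y x - leviCivita g X Z x := by
  have := leviCivita_add_right hg hX (hY.sub hZ) hZ
  rw [sub_add_cancel] at this
  rw [this, add_sub_cancel_right]

theorem leviCivita_sum_right (hg : MetricNear g x) (hX : FieldNear X x) {ι : Type*} (S : Finset ι)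
    {Y : ι → RoughField n M} (hY : ∀ i, FieldNear (Y i) x) :
    leviCivita g X (∑ i ∈ S, Y i) x = ∑ i ∈ S, leviCivita g X (Y i) x := by
  classical
  induction S using Finset.induction_on with
  | empty =>
    have := leviCivita_sub_right hg hX (FieldNear.zero (x := x)) FieldNear.zero
    simpa using this
  | insert a S ha ih =>
    rw [Finset.sum_insert ha, Finset.sum_insert ha,
      leviCivita_add_right hg hX (hY a) (.sum fun i _ => hY i), ih]

theorem curvatureField_swap (hg : MetricNear g x) (hX : FieldNear X x) (hY : FieldNear Y x)
    (hZ : FieldNear Z x) : curvatureField g X Y Z x = - curvatureField g Y X Z x := by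
  simp only [curvatureField]
  rw [VectorField.mlieBracket_swap, leviCivita_neg_left hg (hY.bracket hX) hZ]
  abel

theorem curvatureField_add_left (hg : MetricNear g x) (hX : FieldNear X x) (hX' : FieldNear X' x)
    (hY : FieldNear Y x) (hZ : FieldNear Z x) :
    curvatureField g (X + X') Y Z x = curvatureField g X Y Z x + curvatureField g X' Y Z x := by
  have e1 : ∀ᶠ y in 𝓝 x, leviCivita g (X + X') Z y = (leviCivita g X Z + leviCivita g X' Z) y := by
    filter_upwards [hg.eventually, hX.eventually, hX'.eventually, hZ.eventually] with y h1 h2 h3 h4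
    exact leviCivita_add_left h1 h2 h3 h4
  have e2 : ⟦X + X', Y⟧ x = (⟦X, Y⟧ + ⟦X', Y⟧) x := bracket_add_left hX hX'
  simp only [curvatureField]
  rw [leviCivita_add_left hg hX hX' (hY.nabla hg hZ), leviCivita_congr_right e1,
    leviCivita_add_right hg hY (hX.nabla hg hZ) (hX'.nabla hg hZ),
    leviCivita_congr_left hg ((hX.add hX').bracket hY) ((hX.bracket hY).add (hX'.bracket hY)) hZ e2,
    leviCivita_add_left hg (hX.bracket hY) (hX'.bracket hY) hZ]
  abel

theorem curvatureField_smul_left (hg : MetricNear g x) (hf : SmoothNear n f x)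
    (hX : FieldNear X x) (hY : FieldNear Y x) (hZ : FieldNear Z x) :
    curvatureField g (f • X) Y Z x = f x • curvatureField g X Y Z x := by
  have e1 : ∀ᶠ y in 𝓝 x, leviCivita g (f • X) Z y = (f • leviCivita g X Z) y := by
    filter_upwards [hg.eventually, hX.eventually, hf.eventually, hZ.eventually] with y h1 h2 h3 h4
    exact leviCivita_smul_left h1 h3 h2 h4
  have hd : SmoothNear n (fun y => - dirDeriv Y f y) x := (hf.dirDeriv hY).neg
  have e2 : ⟦f • X, Y⟧ x = ((fun y => - dirDeriv Y f y) • X + f • ⟦X, Y⟧) x :=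
    bracket_smul_left hf hX
  simp only [curvatureField]
  rw [leviCivita_smul_left hg hf hX (hY.nabla hg hZ), leviCivita_congr_right e1,
    leviCivita_smul_right hg hY hf (hX.nabla hg hZ),
    leviCivita_congr_left hg ((hX.smul hf).bracket hY)
      ((hX.smul hd).add ((hX.bracket hY).smul hf)) hZ e2,
    leviCivita_add_left hg (hX.smul hd) ((hX.bracket hY).smul hf) hZ,
    leviCivita_smul_left hg hd hX hZ, leviCivita_smul_left hg hf (hX.bracket hY) hZ]
  module

theorem curvatureField_add_right (hg : MetricNear g x) (hX : FieldNear X x) (hY : FieldNear Y x)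
    (hZ : FieldNear Z x) (hW : FieldNear W x) :
    curvatureField g X Y (Z + W) x = curvatureField g X Y Z x + curvatureField g X Y W x := by
  have e1 : ∀ {X}, FieldNear X x →
      ∀ᶠ y in 𝓝 x, leviCivita g X (Z + W) y = (leviCivita g X Z + leviCivita g X W) y := by
    intro X hX
    filter_upwards [hg.eventually, hX.eventually, hW.eventually, hZ.eventually] with y h1 h2 h3 h4
    exact leviCivita_add_right h1 h2 h4 h3
  simp only [curvatureField]
  rw [leviCivita_congr_right (e1 hX), leviCivita_congr_right (e1 hY),
    leviCivita_add_right hg hX (hY.nabla hg hZ) (hY.nabla hg hW),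
    leviCivita_add_right hg hY (hX.nabla hg hZ) (hX.nabla hg hW),
    leviCivita_add_right hg (hX.bracket hY) hZ hW]
  abel

theorem curvatureField_smul_right (hg : MetricNear g x) (hX : FieldNear X x) (hY : FieldNear Y x)
    (hf : SmoothNear n f x) (hZ : FieldNear Z x) :
    curvatureField g X Y (f • Z) x = f x • curvatureField g X Y Z x := by
  have e1 : ∀ {X}, FieldNear X x →
      ∀ᶠ y in 𝓝 x, leviCivita g X (f • Z) y = (f • leviCivita g X Z + dirDeriv X f • Z) y := by
    intro X hX
    filter_upwards [hg.eventually, hX.eventually, hf.eventually, hZ.eventually] with y h1 h2 h3 h4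
    exact leviCivita_smul_right h1 h2 h3 h4
  have e2 : ∀ {X Y}, FieldNear X x → FieldNear Y x →
      leviCivita g X (leviCivita g Y (f • Z)) x = f x • leviCivita g X (leviCivita g Y Z) x
        + dirDeriv X f x • leviCivita g Y Z x + (dirDeriv Y f x • leviCivita g X Z x
        + dirDeriv X (dirDeriv Y f) x • Z x) := by
    intro X Y hX hY
    rw [leviCivita_congr_right (e1 hY), leviCivita_add_right hg hX ((hY.nabla hg hZ).smul hf)
      (hZ.smul (hf.dirDeriv hY)), leviCivita_smul_right hg hX hf (hY.nabla hg hZ),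
      leviCivita_smul_right hg hX (hf.dirDeriv hY) hZ]
  simp only [curvatureField]
  rw [e2 hX hY, e2 hY hX, leviCivita_smul_right hg (hX.bracket hY) hf hZ,
    dirDeriv_bracket hf hX hY]
  module

/-- Differentiate `g(Z, W)` twice by metric compatibility. The mixed terms are symmetric in `X` and
`Y` and drop out of the commutator, and `dirDeriv_bracket` identifies that commutator with the
derivative along the bracket. -/
theorem inner_curvatureField (hg : MetricNear g x) (hX : FieldNear X x) (hY : FieldNear Y x)
    (hZ : FieldNear Z x) (hW : FieldNear W x) :
    g x (curvatureField g X Y Z x) (W x) = - g x (Z x) (curvatureField g X Y W x) := by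
  have e : ∀ {X Y}, FieldNear X x → FieldNear Y x → dirDeriv X (dirDeriv Y (ip g Z W)) x =
      g x (leviCivita g X (leviCivita g Y Z) x) (W x)
      + g x (leviCivita g Y Z x) (leviCivita g X W x)
      + (g x (leviCivita g X Z x) (leviCivita g Y W x)
      + g x (Z x) (leviCivita g X (leviCivita g Y W) x)) := by
    intro X Y hX hY
    have h : dirDeriv Y (ip g Z W) =ᶠ[𝓝 x] fun y => ip g (leviCivita g Y Z) W y
        + ip g Z (leviCivita g Y W) y := by
      filter_upwards [hg.eventually, hY.eventually, hZ.eventually, hW.eventually]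
        with y h1 h2 h3 h4 using dirDeriv_ip h1 h2 h3 h4
    rw [dirDeriv_congr h, dirDeriv_add (hg.self.smooth _ _ (hY.nabla hg hZ) hW)
      (hg.self.smooth _ _ hZ (hY.nabla hg hW)), dirDeriv_ip hg hX (hY.nabla hg hZ) hW,
      dirDeriv_ip hg hX hZ (hY.nabla hg hW)]
  have h := dirDeriv_bracket (hg.self.smooth _ _ hZ hW) hX hY
  rw [e hX hY, e hY hX, dirDeriv_ip hg (hX.bracket hY) hZ hW] at h
  simp only [curvatureField, map_sub, sub_apply]
  linarith

/-- Vanishing torsion turns the cyclic sum of second derivatives into brackets, and these cancel by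
the Jacobi identity. -/
theorem curvatureField_bianchi (hg : MetricNear g x) (hX : FieldNear X x) (hY : FieldNear Y x)
    (hZ : FieldNear Z x) : curvatureField g X Y Z x + curvatureField g Y Z X x
      + curvatureField g Z X Y x = 0 := by
  have e : ∀ {X Y Z}, FieldNear X x → FieldNear Y x → FieldNear Z x →
      leviCivita g X (leviCivita g Y Z) x - leviCivita g X (leviCivita g Z Y) x
        = leviCivita g ⟦Y, Z⟧ X x + ⟦X, ⟦Y, Z⟧⟧ x := by
    intro X Y Z hX hY hZ
    have h : ∀ᶠ y in 𝓝 x, ⟦Y, Z⟧ y = (leviCivita g Y Z - leviCivita g Z Y) y := by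
      filter_upwards [hg.eventually, hY.eventually, hZ.eventually] with y h1 h2 h3
      exact torsion_free h1 h2 h3
    rw [torsion_free hg hX (hY.bracket hZ), add_sub_cancel, leviCivita_congr_right h,
      leviCivita_sub_right hg hX (hY.nabla hg hZ) (hZ.nabla hg hY)]
  have h1 := e hX hY hZ
  have h2 := e hY hZ hX
  have h3 := e hZ hX hY
  have hj := bracket_jacobi hX hY hZ
  have b1 : ⟦⟦X, Y⟧, Z⟧ x = - ⟦Z, ⟦X, Y⟧⟧ x := bracket_swap
  have b2 : ⟦Y, ⟦X, Z⟧⟧ x = - ⟦Y, ⟦Z, X⟧⟧ x := by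
    have : (⟦X, Z⟧ : RoughField n M) = (fun _ : M => (-1 : ℝ)) • ⟦Z, X⟧ := by
      rw [VectorField.mlieBracket_swap]; funext y; simp
    rw [this, bracket_smul_right (.const _) (hZ.bracket hX), dirDeriv_const]
    simp
  rw [b1, b2] at hj
  simp only [curvatureField]
  have : (leviCivita g X (leviCivita g Y Z) x - leviCivita g X (leviCivita g Z Y) x)
    + (leviCivita g Y (leviCivita g Z X) x - leviCivita g Y (leviCivita g X Z) x)
    + (leviCivita g Z (leviCivita g X Y) x - leviCivita g Z (leviCivita g Y X) x)
    - (leviCivita g ⟦Y, Z⟧ X x + leviCivita g ⟦Z, X⟧ Y x + leviCivita g ⟦X, Y⟧ Z x) = 0 := by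
    rw [h1, h2, h3, hj]; abel
  rw [← this]
  abel

theorem FieldNear.curvature (hg : MetricNear g x) (hX : FieldNear X x) (hY : FieldNear Y x)
    (hZ : FieldNear Z x) : FieldNear (curvatureField g X Y Z) x :=
  ((hX.nabla hg (hY.nabla hg hZ)).sub (hY.nabla hg (hX.nabla hg hZ))).sub
    ((hX.bracket hY).nabla hg hZ)

/-- The curvature tensor may be computed with arbitrary smooth fields. -/
theorem riemann_eq (hg : MetricNear g x) (hX : FieldNear X x) (hY : FieldNear Y x)
    (hZ : FieldNear Z x) : riemann g x (X x) (Y x) (Z x) = curvatureField g X Y Z x := by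
  have h1 : ∀ {X X' Y Z}, FieldNear X x → FieldNear X' x → FieldNear Y x → FieldNear Z x →
      X x = X' x → curvatureField g X Y Z x = curvatureField g X' Y Z x :=
    fun {X X' Y Z} hX hX' hY hZ e => tensorial_pointwise (fun X => curvatureField g X Y Z x)
      (fun _ _ h h' => curvatureField_add_left hg h h' hY hZ)
      (fun _ _ hf h => curvatureField_smul_left hg hf h hY hZ) hX hX' e
  rw [riemann, h1 (.ext _) hX (.ext _) (.ext _) (ext_self _),
    curvatureField_swap hg hX (.ext _) (.ext _), h1 (.ext _) hY hX (.ext _) (ext_self _),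
    ← curvatureField_swap hg hX hY (.ext _)]
  exact tensorial_pointwise (fun Z => curvatureField g X Y Z x)
      (fun _ _ h h' => curvatureField_add_right hg hX hY h h')
      (fun _ _ hf h => curvatureField_smul_right hg hX hY hf h) (.ext _) hZ (ext_self _)

/-! ### Pointwise symmetries -/

variable {u v w z u' v' : TangentSpace (𝓡 n) x} {c : ℝ}

theorem riemann_swap (hg : MetricNear g x) : riemann g x u v w = - riemann g x v u w :=
  curvatureField_swap hg (.ext _) (.ext _) (.ext _)

theorem riemann_add_left (hg : MetricNear g x) :
    riemann g x (u + u') v w = riemann g x u v w + riemann g x u' v w := by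
  have := riemann_eq hg ((FieldNear.ext u).add (.ext u')) (.ext v) (.ext w)
  rw [curvatureField_add_left hg (.ext _) (.ext _) (.ext _) (.ext _)] at this
  simpa [riemann] using this

theorem riemann_smul_left (hg : MetricNear g x) :
    riemann g x (c • u) v w = c • riemann g x u v w := by
  have := riemann_eq hg ((FieldNear.ext u).smul (.const c)) (.ext v) (.ext w)
  rw [curvatureField_smul_left hg (.const c) (.ext _) (.ext _) (.ext _)] at this
  simpa [riemann] using this

theorem riemann_add_right (hg : MetricNear g x) :
    riemann g x v w (u + u') = riemann g x v w u + riemann g x v w u' := by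
  have := riemann_eq hg (.ext v) (.ext w) ((FieldNear.ext u).add (.ext u'))
  rw [curvatureField_add_right hg (.ext _) (.ext _) (.ext _) (.ext _)] at this
  simpa [riemann] using this

theorem riemann_smul_right (hg : MetricNear g x) :
    riemann g x v w (c • u) = c • riemann g x v w u := by
  have := riemann_eq hg (.ext v) (.ext w) ((FieldNear.ext u).smul (.const c))
  rw [curvatureField_smul_right hg (.ext _) (.ext _) (.const c) (.ext _)] at this
  simpa [riemann] using this

theorem riemann_skew (hg : MetricNear g x) :
    g x (riemann g x u v w) z = - g x (riemann g x u v z) w := by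
  have := inner_curvatureField hg (.ext u) (.ext v) (.ext w) (.ext z)
  rw [hg.self.symm (ext w x)] at this
  simpa [riemann] using this

theorem riemann_bianchi (hg : MetricNear g x) :
    riemann g x u v w + riemann g x v w u + riemann g x w u v = 0 :=
  curvatureField_bianchi hg (.ext _) (.ext _) (.ext _)

/-- A formal consequence of the two skew symmetries and four instances of the Bianchi identity,
combined linearly. -/
theorem riemann_pair (hg : MetricNear g x) :
    g x (riemann g x u v w) z = g x (riemann g x w z u) v := by
  have b : ∀ a b c d, g x (riemann g x a b c) d + g x (riemann g x b c a) d
      + g x (riemann g x c a b) d = 0 := fun a b c d => by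
    have := congrArg (fun z => g x z d) (riemann_bianchi hg (u := a) (v := b) (w := c))
    simpa using this
  have s1 : ∀ a b c d, g x (riemann g x a b c) d = - g x (riemann g x b a c) d :=
    fun a b c d => by rw [riemann_swap hg]; simp
  have s2 : ∀ a b c d, g x (riemann g x a b c) d = - g x (riemann g x a b d) c :=
    fun a b c d => riemann_skew hg
  linarith [b u v w z, b v w z u, b w z u v, b z u v w, s1 u v w z, s2 u v w z, s1 v w u z,
    s2 v w u z, s1 w u v z, s2 w u v z, s1 v w z u, s2 v w z u, s1 w z v u, s2 w z v u,
    s1 z v w u, s2 z v w u, s1 w z u v, s2 w z u v, s1 z u w v, s2 z u w v, s1 u w z v,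
    s2 u w z v, s1 z u v w, s2 z u v w, s1 u v z w, s2 u v z w, s1 v z u w, s2 v z u w]

/-! ### Ricci, scalar and Schouten curvature -/

theorem IsMetricAt.sum_inner (hg : IsMetricAt g x) {u : Fin n → TangentSpace (𝓡 n) x}
    (hu : ∀ i j, g x (u i) (u j) = if i = j then 1 else 0) (v w : TangentSpace (𝓡 n) x) :
    ∑ i, g x v (u i) * g x w (u i) = g x v w := by
  conv_rhs => rw [hg.expand hu w]
  simp [mul_comm]

/-- The definition evaluates on an arbitrarily chosen frame. Expanding that frame in `u` and using
`sum_inner` shows that the choice is irrelevant for bilinear `T`. -/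
theorem metricTrace_eq (hg : IsMetricAt g x) {u : Fin n → TangentSpace (𝓡 n) x}
    (hu : ∀ i j, g x (u i) (u j) = if i = j then 1 else 0)
    {T : TangentSpace (𝓡 n) x → TangentSpace (𝓡 n) x → ℝ}
    (hl : ∀ w, IsLinearMap ℝ fun v => T v w) (hr : ∀ v, IsLinearMap ℝ (T v)) :
    metricTrace g x T = ∑ i, T (u i) (u i) := by
  have hne : Nonempty (Frame g x) := ⟨⟨u, hu⟩⟩
  rw [metricTrace, dif_pos hne]
  obtain ⟨u', hu'⟩ := hne.some
  have sl : ∀ (c : Fin n → ℝ) w, T (∑ i, c i • u i) w = ∑ i, c i * T (u i) w := fun c w => by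
    have := map_sum ((hl w).mk' _) (fun i => c i • u i) Finset.univ
    simp only [IsLinearMap.mk'_apply] at this
    rw [this]
    simp [(hl w).map_smul]
  have sr : ∀ (c : Fin n → ℝ) w, T w (∑ i, c i • u i) = ∑ i, c i * T w (u i) := fun c w => by
    have := map_sum ((hr w).mk' _) (fun i => c i • u i) Finset.univ
    simp only [IsLinearMap.mk'_apply] at this
    rw [this]
    simp [(hr w).map_smul]
  have h1 : ∀ i, T (u' i) (u' i) = ∑ j, ∑ k, g x (u j) (u' i) * g x (u k) (u' i)
      * T (u j) (u k) := fun i => by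
    conv_lhs => rw [hg.expand hu (u' i)]
    rw [sl]
    refine Finset.sum_congr rfl fun j _ => ?_
    rw [sr, Finset.mul_sum]
    refine Finset.sum_congr rfl fun k _ => ?_
    rw [hg.symm (u' i), hg.symm (u' i)]; ring
  simp only [h1]
  rw [Finset.sum_comm]
  refine Finset.sum_congr rfl fun j _ => ?_
  rw [Finset.sum_comm]
  simp only [← Finset.sum_mul, hg.sum_inner hu', hu]
  simp

theorem ricci_eq (hg : MetricNear g x) {u : Fin n → TangentSpace (𝓡 n) x}
    (hu : ∀ i j, g x (u i) (u j) = if i = j then 1 else 0) (v w : TangentSpace (𝓡 n) x) :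
    ricci g x v w = ∑ i, g x (riemann g x (u i) v w) (u i) :=
  metricTrace_eq hg.self hu
    (fun _ => ⟨fun _ _ => by simp [riemann_add_left hg], fun _ _ => by simp [riemann_smul_left hg]⟩)
    fun _ => ⟨fun _ _ => by simp, fun _ _ => by simp⟩

theorem ricci_linear (hg : MetricNear g x) (v : TangentSpace (𝓡 n) x) :
    IsLinearMap ℝ (ricci g x v) := by
  obtain ⟨u, hu⟩ := hg.self.exists_orthonormal
  refine ⟨fun a b => ?_, fun c a => ?_⟩
  · simp [ricci_eq hg hu, riemann_add_right hg, Finset.sum_add_distrib]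
  · simp [ricci_eq hg hu, riemann_smul_right hg, Finset.mul_sum]

theorem ricci_symm (hg : MetricNear g x) : ricci g x v w = ricci g x w v := by
  obtain ⟨u, hu⟩ := hg.self.exists_orthonormal
  rw [ricci_eq hg hu, ricci_eq hg hu]
  refine Finset.sum_congr rfl fun i _ => ?_
  rw [riemann_pair hg, riemann_swap hg, riemann_skew hg]
  simp [riemann_skew hg (w := u i)]

theorem ricci_linear_left (hg : MetricNear g x) (w : TangentSpace (𝓡 n) x) :
    IsLinearMap ℝ fun v => ricci g x v w := by
  simpa only [ricci_symm hg (w := w)] using ricci_linear hg w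

theorem scalarCurv_eq (hg : MetricNear g x) {u : Fin n → TangentSpace (𝓡 n) x}
    (hu : ∀ i j, g x (u i) (u j) = if i = j then 1 else 0) :
    scalarCurv g x = ∑ i, ricci g x (u i) (u i) :=
  metricTrace_eq hg.self hu (ricci_linear_left hg) (ricci_linear hg)

theorem schouten_symm (hg : MetricNear g x) : schouten g x v w = schouten g x w v := by
  rw [schouten, schouten, ricci_symm hg, hg.self.symm]

theorem schouten_linear (hg : MetricNear g x) (v : TangentSpace (𝓡 n) x) :
    IsLinearMap ℝ (schouten g x v) := by
  refine ⟨fun a b => ?_, fun c a => ?_⟩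
  · simp only [schouten, (ricci_linear hg v).map_add, map_add]; ring
  · simp only [schouten, (ricci_linear hg v).map_smul, map_smul, smul_eq_mul]; ring

theorem schouten_linear_left (hg : MetricNear g x) (w : TangentSpace (𝓡 n) x) :
    IsLinearMap ℝ fun v => schouten g x v w := by
  simpa only [schouten_symm hg (w := w)] using schouten_linear hg w

/-- By independence of the frame, the traces can be taken at all nearby points in one smooth
orthonormal frame. -/
theorem smoothNear_schouten (hg : MetricNear g x) (hX : FieldNear X x) (hY : FieldNear Y x) :
    SmoothNear n (fun y => schouten g y (X y) (Y y)) x := by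
  obtain ⟨e, he, ho⟩ := hg.exists_orthonormal_frame
  have hs := hg.self.smooth
  have hric : ∀ {X Y}, FieldNear X x → FieldNear Y x →
      SmoothNear n (fun y => ricci g y (X y) (Y y)) x := by
    intro X Y hX hY
    refine (SmoothNear.sum (S := Finset.univ) fun i _ =>
      hs _ _ ((he i).curvature hg hX hY) (he i)).congr ?_
    filter_upwards [ho, hg.eventually, hX.eventually, hY.eventually,
      eventually_all.2 fun i => (he i).eventually] with y h1 h2 h3 h4 h5
    rw [ricci_eq h2 h1]
    exact Finset.sum_congr rfl fun i _ => by rw [riemann_eq h2 (h5 i) h3 h4]; rfl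
  have hsc : SmoothNear n (scalarCurv g) x := by
    refine (SmoothNear.sum (S := Finset.univ) fun i _ => hric (he i) (he i)).congr ?_
    filter_upwards [ho, hg.eventually] with y h1 h2 using scalarCurv_eq h2 h1
  refine ((((hric hX hY).sub ((hsc.mul (.const (n : ℝ)⁻¹)).mul (hs _ _ hX hY))).mul
    (.const ((n : ℝ) - 2)⁻¹)).add ((hsc.mul (.const (2 * n * ((n : ℝ) - 1))⁻¹)).mul
    (hs _ _ hX hY))).congr (.of_forall fun y => ?_)
  simp only [schouten, ip, div_eq_mul_inv]

end Curvature
end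
end ConformalBGG

open scoped Manifold ContDiff Bundle Topology
open Filter
namespace ConformalBGG
noncomputable section
set_option linter.unusedSectionVars false

/-! ### Conformal changes of the metric, and the vanishing of `W` and `Y` for conformally flat
metrics. -/

section Conformal

variable {n : ℕ} {M : Type*} [TopologicalSpace M]
  [ChartedSpace (EuclideanSpace ℝ (Fin n)) M] [IsManifold (𝓡 n) ∞ M]

local notation "⟦" X ", " Y "⟧" => VectorField.mlieBracket (𝓡 n) X Y

variable {g : MetricField n M} {x : M} {X Y Z W G : RoughField n M} {f : M → ℝ}

/-- The metric `e^{2f} g`. -/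
def confMetric (g : MetricField n M) (f : M → ℝ) : MetricField n M :=
  fun z => Real.exp (2 * f z) • g z

theorem ip_confMetric : ip (confMetric g f) X Y = fun y => Real.exp (2 * f y) * ip g X Y y := rfl

theorem SmoothNear.exp_two_mul (hf : SmoothNear n f x) :
    SmoothNear n (fun y => Real.exp (2 * f y)) x := ((SmoothNear.const 2).mul hf).exp

theorem dirDeriv_exp_two_mul (hf : SmoothNear n f x) :
    dirDeriv X (fun y => Real.exp (2 * f y)) x = 2 * Real.exp (2 * f x) * dirDeriv X f x := by
  have h := dirDeriv_comp (X := X) (φ := Real.exp) ((SmoothNear.const 2).mul hf)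
    (Real.hasDerivAt_exp _).hasFDerivAt
  rw [h, dirDeriv_mul (.const 2) hf, dirDeriv_const]
  simp
  ring

theorem MetricNear.confMetric (hg : MetricNear g x) (hf : SmoothNear n f x) :
    MetricNear (confMetric g f) x := by
  filter_upwards [hg, hf.eventually] with y h1 h2
  refine ⟨fun v w => ?_, fun v hv => ?_, fun X Y hX hY => ?_⟩
  · exact congrArg (Real.exp (2 * f y) * ·) (h1.symm v w)
  · exact mul_pos (Real.exp_pos _) (h1.pos v hv)
  · exact h2.exp_two_mul.mul (h1.smooth X Y hX hY)

/-- `G` is the gradient of `f` near `x`. -/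
structure IsGradient (g : MetricField n M) (f : M → ℝ) (G : RoughField n M) (x : M) : Prop where
  near : FieldNear G x
  eq : ∀ᶠ y in 𝓝 x, ∀ X : RoughField n M, dirDeriv X f y = ip g G X y

theorem exists_gradient (hg : MetricNear g x) (hf : SmoothNear n f x) :
    ∃ G, IsGradient g f G x := by
  obtain ⟨e, he, ho⟩ := hg.exists_orthonormal_frame
  refine ⟨∑ i, dirDeriv (e i) f • e i, .sum fun i _ => (he i).smul (hf.dirDeriv (he i)), ?_⟩
  filter_upwards [ho, hg] with y h1 h2 X
  have := congrArg (mvfderiv (𝓡 n) f y) (h2.expand h1 (X y))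
  simp only [map_sum, map_smul, smul_eq_mul] at this
  simp only [dirDeriv, this, ip, Finset.sum_apply, Pi.smul_apply', map_sum, map_smul,
    sum_apply, smul_apply, smul_eq_mul]
  exact Finset.sum_congr rfl fun i _ => by rw [h2.symm, mul_comm]

theorem IsGradient.eventually (hG : IsGradient g f G x) : ∀ᶠ y in 𝓝 x, IsGradient g f G y := by
  filter_upwards [hG.near.eventually, eventually_eventually_nhds.2 hG.eq] with y h1 h2
    using ⟨h1, h2⟩

/-- The Hessian is symmetric. -/
theorem IsGradient.hessian_symm (hg : MetricNear g x) (hf : SmoothNear n f x)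
    (hG : IsGradient g f G x) (hX : FieldNear X x) (hY : FieldNear Y x) :
    g x (leviCivita g X G x) (Y x) = g x (leviCivita g Y G x) (X x) := by
  have h := dirDeriv_bracket hf hX hY
  have e : ∀ X : RoughField n M, dirDeriv X f =ᶠ[𝓝 x] ip g G X := fun X =>
    hG.eq.mono fun y hy => hy X
  rw [dirDeriv_congr (e X), dirDeriv_congr (e Y), dirDeriv_ip hg hX hG.near hY,
    dirDeriv_ip hg hY hG.near hX, (e _).self_of_nhds, ip, torsion_free hg hX hY, map_sub] at h
  linarith

/-- The difference of the Levi-Civita connections of `e^{2f} g` and `g`. -/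
def confDiff (g : MetricField n M) (x : M) (G v w : TangentSpace (𝓡 n) x) :
    TangentSpace (𝓡 n) x := g x G v • w + g x G w • v - g x v w • G

/-- In the Koszul formula for `e^{2f} g` all terms scale by `e^{2f}`, and the three derivatives of
the factor produce the three terms of `confDiff`. -/
theorem leviCivita_confMetric (hg : MetricNear g x) (hf : SmoothNear n f x)
    (hG : IsGradient g f G x) (hX : FieldNear X x) (hY : FieldNear Y x) :
    leviCivita (confMetric g f) X Y x
      = leviCivita g X Y x + confDiff g x (G x) (X x) (Y x) := by
  refine leviCivita_eq_of (hg.confMetric hf) hX hY fun Z hZ => ?_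
  have hs := hg.self.smooth
  have e := two_inner_leviCivita hg hX hY hZ
  have d : ∀ X, dirDeriv X f x = g x (G x) (X x) := fun X => hG.eq.self_of_nhds X
  rw [koszul_eq] at e
  rw [koszul_eq, ip_confMetric, ip_confMetric, ip_confMetric,
    dirDeriv_mul hf.exp_two_mul (hs _ _ hY hZ), dirDeriv_mul hf.exp_two_mul (hs _ _ hZ hX),
    dirDeriv_mul hf.exp_two_mul (hs _ _ hX hY), dirDeriv_exp_two_mul hf, dirDeriv_exp_two_mul hf,
    dirDeriv_exp_two_mul hf, d, d, d]
  simp only [ConformalBGG.confMetric, confDiff, smul_apply, smul_eq_mul, map_add, add_apply,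
    map_sub, sub_apply, map_smul, ip]
  rw [hg.self.symm (Z x) (X x)]
  linear_combination Real.exp (2 * f x) * e

/-- The derivative of `confDiff` is computed by the product rule. -/
theorem leviCivita_confDiff (hg : MetricNear g x) (hG : FieldNear G x) (hX : FieldNear X x)
    (hY : FieldNear Y x) (hZ : FieldNear Z x) :
    leviCivita g X (fun y => confDiff g y (G y) (Y y) (Z y)) x
      = confDiff g x (G x) (leviCivita g X Y x) (Z x)
      + confDiff g x (G x) (Y x) (leviCivita g X Z x)
      + (g x (leviCivita g X G x) (Y x) • Z x + g x (leviCivita g X G x) (Z x) • Y x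
        - g x (Y x) (Z x) • leviCivita g X G x) := by
  have hs := hg.self.smooth
  have e : (fun y => confDiff g y (G y) (Y y) (Z y))
      = ip g G Y • Z + ip g G Z • Y - ip g Y Z • G := rfl
  rw [e, leviCivita_sub_right hg hX ((hZ.smul (hs _ _ hG hY)).add (hY.smul (hs _ _ hG hZ)))
    (hG.smul (hs _ _ hY hZ)),
    leviCivita_add_right hg hX (hZ.smul (hs _ _ hG hY)) (hY.smul (hs _ _ hG hZ)),
    leviCivita_smul_right hg hX (hs _ _ hG hY) hZ, leviCivita_smul_right hg hX (hs _ _ hG hZ) hY,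
    leviCivita_smul_right hg hX (hs _ _ hY hZ) hG, dirDeriv_ip hg hX hG hY,
    dirDeriv_ip hg hX hG hZ, dirDeriv_ip hg hX hY hZ]
  simp only [confDiff, ip]
  module

theorem FieldNear.confDiff (hg : MetricNear g x) (hG : FieldNear G x)
    (hY : FieldNear Y x) (hZ : FieldNear Z x) :
    FieldNear (fun y => ConformalBGG.confDiff g y (G y) (Y y) (Z y)) x := by
  have hs := hg.self.smooth
  exact ((hZ.smul (hs _ _ hG hY)).add (hY.smul (hs _ _ hG hZ))).sub (hG.smul (hs _ _ hY hZ))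

/-- The tensor `∇ df - df ⊗ df + |df|² g / 2` for a function with gradient `G`. -/
def confHess (g : MetricField n M) (G : RoughField n M) (x : M) (v w : TangentSpace (𝓡 n) x) : ℝ :=
  g x (leviCivita g (ext v) G x) w - g x (G x) v * g x (G x) w + g x (G x) (G x) / 2 * g x v w

theorem confHess_eq (hg : MetricNear g x) (hG : FieldNear G x) (hX : FieldNear X x)
    (w : TangentSpace (𝓡 n) x) : confHess g G x (X x) w
      = g x (leviCivita g X G x) w - g x (G x) (X x) * g x (G x) w
        + g x (G x) (G x) / 2 * g x (X x) w := by
  rw [confHess, leviCivita_congr_left hg (.ext _) hX hG (ext_self _)]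

theorem IsGradient.confHess_symm (hg : MetricNear g x) (hf : SmoothNear n f x)
    (hG : IsGradient g f G x) (v w : TangentSpace (𝓡 n) x) :
    confHess g G x v w = confHess g G x w v := by
  have := hG.hessian_symm hg hf (.ext v) (.ext w)
  rw [ext_self, ext_self] at this
  rw [confHess, confHess, this, hg.self.symm v w]
  ring

theorem confHess_linear (v : TangentSpace (𝓡 n) x) : IsLinearMap ℝ (confHess g G x v) :=
  ⟨fun a b => by simp only [confHess, map_add]; ring,
    fun c a => by simp only [confHess, map_smul, smul_eq_mul]; ring⟩

theorem IsMetricAt.sharp_eq (hg : IsMetricAt g x) {α : TangentSpace (𝓡 n) x → ℝ}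
    {w : TangentSpace (𝓡 n) x} (h : ∀ v, g x w v = α v) : sharp g x α = w := by
  have hα : IsLinearMap ℝ α := ⟨fun a b => by simp only [← h, map_add],
    fun c a => by simp only [← h, map_smul]⟩
  exact hg.eq_of_inner fun u => by rw [hg.inner_sharp hα, h]

/-- Writing the new connection as `∇ + C` with `C` given by `confDiff`, the curvature changes by the
skew part of `∇C` and by the commutator of `C` with itself. Symmetry of the Hessian removes the
multiples of `Z`, and the rest assembles into `braceAct` of the tensor `confHess`. -/
theorem curvatureField_confMetric (hg : MetricNear g x) (hf : SmoothNear n f x)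
    (hG : IsGradient g f G x) (hX : FieldNear X x) (hY : FieldNear Y x) (hZ : FieldNear Z x) :
    curvatureField (confMetric g f) X Y Z x = curvatureField g X Y Z x
      - braceAct g x (X x) (confHess g G x (Y x)) (Z x)
      + braceAct g x (Y x) (confHess g G x (X x)) (Z x) := by
  have hsharp : ∀ {X}, FieldNear X x → sharp g x (confHess g G x (X x))
      = leviCivita g X G x - g x (G x) (X x) • G x + (g x (G x) (G x) / 2) • X x := by
    intro X hX
    refine hg.self.sharp_eq fun v => ?_
    rw [confHess_eq hg hG.near hX]
    simp
  have e : ∀ {X}, FieldNear X x → ∀ᶠ y in 𝓝 x, leviCivita (confMetric g f) X Z y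
      = (leviCivita g X Z + fun y => confDiff g y (G y) (X y) (Z y)) y := by
    intro X hX
    filter_upwards [hg.eventually, hf.eventually, hG.eventually, hX.eventually, hZ.eventually]
      with y h1 h2 h3 h4 h5 using leviCivita_confMetric h1 h2 h3 h4 h5
  have e2 : ∀ {X Y}, FieldNear X x → FieldNear Y x →
      leviCivita (confMetric g f) X (leviCivita (confMetric g f) Y Z) x
      = leviCivita g X (leviCivita g Y Z) x
        + leviCivita g X (fun y => confDiff g y (G y) (Y y) (Z y)) x
        + confDiff g x (G x) (X x) (leviCivita g Y Z x + confDiff g x (G x) (Y x) (Z x)) := by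
    intro X Y hX hY
    rw [leviCivita_congr_right (e hY), leviCivita_confMetric hg hf hG hX
      ((hY.nabla hg hZ).add (hG.near.confDiff hg hY hZ)),
      leviCivita_add_right hg hX (hY.nabla hg hZ) (hG.near.confDiff hg hY hZ)]
    rfl
  simp only [curvatureField]
  rw [e2 hX hY, e2 hY hX, leviCivita_confDiff hg hG.near hX hY hZ,
    leviCivita_confDiff hg hG.near hY hX hZ,
    leviCivita_confMetric hg hf hG (hX.bracket hY) hZ, torsion_free hg hX hY]
  simp only [braceAct, hsharp hX, hsharp hY, confHess_eq hg hG.near hX,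
    confHess_eq hg hG.near hY, hG.hessian_symm hg hf hY hX, confDiff, map_add, map_sub,
    sub_apply, map_smul, smul_eq_mul, hg.self.symm (Y x) (X x),
    hg.self.symm (Z x), hg.self.symm (X x) (G x), hg.self.symm (Y x) (G x)]
  module

theorem riemann_confMetric (hg : MetricNear g x) (hf : SmoothNear n f x)
    (hG : IsGradient g f G x) (u v w : TangentSpace (𝓡 n) x) :
    riemann (confMetric g f) x u v w = riemann g x u v w
      - braceAct g x u (confHess g G x v) w + braceAct g x v (confHess g G x u) w := by
  have := curvatureField_confMetric hg hf hG (.ext u) (.ext v) (.ext w)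
  rw [ext_self, ext_self, ext_self] at this
  exact this

theorem inner_braceAct (hg : IsMetricAt g x) {u w z : TangentSpace (𝓡 n) x}
    {α : TangentSpace (𝓡 n) x → ℝ} (hα : IsLinearMap ℝ α) : g x (braceAct g x u α w) z
      = α u * g x w z + α w * g x u z - g x w u * α z := by
  simp [braceAct, hg.inner_sharp hα]

/-- If the curvature is built from a symmetric tensor `Q`, then `Q` is the Schouten tensor. -/
theorem schouten_eq_of_riemann (hn : 3 ≤ n) (hg : MetricNear g x)
    {Q : TangentSpace (𝓡 n) x → TangentSpace (𝓡 n) x → ℝ} (hQ : ∀ v, IsLinearMap ℝ (Q v))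
    (hs : ∀ v w, Q v w = Q w v)
    (h : ∀ u v w, riemann g x u v w = braceAct g x u (Q v) w - braceAct g x v (Q u) w)
    (v w : TangentSpace (𝓡 n) x) : schouten g x v w = Q v w := by
  obtain ⟨u, hu⟩ := hg.self.exists_orthonormal
  have hQe : ∀ v w, ∑ i, Q v (u i) * g x w (u i) = Q v w := fun v w => by
    have := map_sum ((hQ v).mk' _) (fun i => g x w (u i) • u i) Finset.univ
    simp only [IsLinearMap.mk'_apply, ← hg.self.expand hu] at this
    rw [this]
    exact Finset.sum_congr rfl fun i _ => by rw [(hQ v).map_smul, smul_eq_mul, mul_comm]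
  -- Contraction of the assumed form of `R`: the Ricci tensor is `(n - 2) Q + (tr Q) g`, and a
  -- second contraction gives the scalar curvature `(2n - 2) tr Q`.
  have hric : ∀ v w, ricci g x v w = (n - 2) * Q v w + (∑ i, Q (u i) (u i)) * g x v w := by
    intro v w
    have : ∀ i, g x (riemann g x (u i) v w) (u i) = Q v (u i) * g x w (u i) + Q v w
        - Q v (u i) * g x w (u i) - Q v (u i) * g x w (u i) - Q w (u i) * g x v (u i)
        + Q (u i) (u i) * g x v w := fun i => by
      rw [h, map_sub, sub_apply, inner_braceAct hg.self (hQ _), inner_braceAct hg.self (hQ _), hu,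
        hs (u i) v, hs (u i) w, hg.self.symm w v]
      simp only [if_true]
      ring
    rw [ricci_eq hg hu]
    simp only [this, Finset.sum_add_distrib, Finset.sum_sub_distrib, hQe, hs w v,
      Finset.sum_const, Finset.card_univ, Fintype.card_fin, nsmul_eq_mul, ← Finset.sum_mul]
    ring
  have hsc : scalarCurv g x = (2 * n - 2) * ∑ i, Q (u i) (u i) := by
    rw [scalarCurv_eq hg hu]
    simp only [hric, hu, if_true, Finset.sum_add_distrib, ← Finset.mul_sum, mul_one,
      Finset.sum_const, Finset.card_univ, Fintype.card_fin, nsmul_eq_mul]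
    ring
  -- Solving these relations for `Q` divides by `n - 2`, `n - 1` and `n`; this is where `n ≥ 3`
  -- enters.
  have hn' : (3 : ℝ) ≤ n := by exact_mod_cast hn
  have h2 : (n : ℝ) - 2 ≠ 0 := by linarith
  have h1 : (n : ℝ) - 1 ≠ 0 := by linarith
  have h0 : (n : ℝ) ≠ 0 := by linarith
  rw [schouten, hric, hsc]
  field_simp
  ring

/-- The definition evaluates on the extension `ext w`. The covariant derivative of `P(Y)` is
tensorial in its argument, so any smooth field with value `w` may be used, in particular the members
of a frame. -/
theorem cotton_eq (X Y Z : RoughField n M) (hX : FieldNear X x) (hY : FieldNear Y x)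
    (hZ : FieldNear Z x) (hg : MetricNear g x) : cotton g X Y x (Z x)
      = dirDeriv X (fun y => schouten g y (Y y) (Z y)) x - schouten g x (Y x) (leviCivita g X Z x)
      - (dirDeriv Y (fun y => schouten g y (X y) (Z y)) x
        - schouten g x (X x) (leviCivita g Y Z x)) - schouten g x (⟦X, Y⟧ x) (Z x) := by
  have key : ∀ {X Y}, FieldNear X x → FieldNear Y x →
      dirDeriv X (fun y => schouten g y (Y y) (ext (Z x) y)) x
        - schouten g x (Y x) (leviCivita g X (ext (Z x)) x)
      = dirDeriv X (fun y => schouten g y (Y y) (Z y)) x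
        - schouten g x (Y x) (leviCivita g X Z x) := by
    intro X Y hX hY
    refine tensorial_pointwise (fun Z => dirDeriv X (fun y => schouten g y (Y y) (Z y)) x
        - schouten g x (Y x) (leviCivita g X Z x)) (fun Z W hZ hW => ?_) (fun f Z hf hZ => ?_)
        (.ext _) hZ (ext_self _)
    · have e : (fun y => schouten g y (Y y) ((Z + W) y)) =ᶠ[𝓝 x]
          fun y => schouten g y (Y y) (Z y) + schouten g y (Y y) (W y) := by
        filter_upwards [hg.eventually] with y h1 using (schouten_linear h1 _).map_add _ _
      rw [dirDeriv_congr e, dirDeriv_add (smoothNear_schouten hg hY hZ)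
        (smoothNear_schouten hg hY hW), leviCivita_add_right hg hX hZ hW,
        (schouten_linear hg _).map_add]
      ring
    · have e : (fun y => schouten g y (Y y) ((f • Z) y)) =ᶠ[𝓝 x]
          fun y => f y * schouten g y (Y y) (Z y) := by
        filter_upwards [hg.eventually] with y h1 using (schouten_linear h1 _).map_smul _ _
      rw [dirDeriv_congr e, dirDeriv_mul hf (smoothNear_schouten hg hY hZ),
        leviCivita_smul_right hg hX hf hZ, (schouten_linear hg _).map_add,
        (schouten_linear hg _).map_smul, (schouten_linear hg _).map_smul]
      simp only [smul_eq_mul]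
      ring
  simp only [cotton, leviCivitaForm, key hX hY, key hY hX]

/-- Conformally flat metrics have vanishing Weyl and Cotton-York tensors. -/
theorem weyl_cotton_eq_zero (hn : 3 ≤ n) (hg : MetricNear g x) (hf : SmoothNear n f x)
    (hflat : ∀ᶠ y in 𝓝 x, ∀ u v w : TangentSpace (𝓡 n) y, riemann (confMetric g f) y u v w = 0) :
    (∀ u v w : TangentSpace (𝓡 n) x, weyl g x u v w = 0) ∧
    ∀ X Y : RoughField n M, FieldNear X x → FieldNear Y x →
      ∀ w : TangentSpace (𝓡 n) x, cotton g X Y x w = 0 := by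
  obtain ⟨G, hG⟩ := exists_gradient hg hf
  have hR : ∀ᶠ y in 𝓝 x, ∀ u v w : TangentSpace (𝓡 n) y, riemann g y u v w
      = braceAct g y u (confHess g G y v) w - braceAct g y v (confHess g G y u) w := by
    filter_upwards [hflat, hg.eventually, hf.eventually, hG.eventually] with y h1 h2 h3 h4 u v w
    have := riemann_confMetric h2 h3 h4 u v w
    rw [h1] at this
    rw [← sub_eq_zero, this]
    abel
  -- The identity holds on a whole neighbourhood and can therefore be differentiated to compute the
  -- Cotton–York tensor.
  have hP : ∀ᶠ y in 𝓝 x, ∀ v w : TangentSpace (𝓡 n) y,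
      schouten g y v w = confHess g G y v w := by
    filter_upwards [hR, hg.eventually, hf.eventually, hG.eventually] with y h1 h2 h3 h4
    exact schouten_eq_of_riemann hn h2 confHess_linear (h4.confHess_symm h2 h3) h1
  have hPx : ∀ v, schouten g x v = confHess g G x v := fun v => by
    funext w; exact hP.self_of_nhds v w
  refine ⟨fun u v w => ?_, fun X Y hX hY w => ?_⟩
  · rw [weyl, hR.self_of_nhds, hPx, hPx]; abel
  have hs := hg.self.smooth
  have hGn := hG.near
  have hd : ∀ {X Y}, FieldNear X x → FieldNear Y x →
      dirDeriv X (fun y => schouten g y (Y y) (ext w y)) x =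
      (g x (leviCivita g X (leviCivita g Y G) x) (ext w x)
        + g x (leviCivita g Y G x) (leviCivita g X (ext w) x))
      - (g x (G x) (Y x) * (g x (leviCivita g X G x) (ext w x)
          + g x (G x) (leviCivita g X (ext w) x))
        + (g x (leviCivita g X G x) (Y x) + g x (G x) (leviCivita g X Y x)) * g x (G x) (ext w x))
      + (2⁻¹ * g x (G x) (G x) * (g x (leviCivita g X Y x) (ext w x)
          + g x (Y x) (leviCivita g X (ext w) x))
        + g x (leviCivita g X G x) (G x) * g x (Y x) (ext w x)) := by
    intro X Y hX hY
    have hw := FieldNear.ext w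
    have e : (fun y => schouten g y (Y y) (ext w y)) =ᶠ[𝓝 x]
        fun y => ip g (leviCivita g Y G) (ext w) y - ip g G Y y * ip g G (ext w) y
          + 2⁻¹ * ip g G G y * ip g Y (ext w) y := by
      filter_upwards [hP, hg.eventually, hGn.eventually, hY.eventually] with y h1 h2 h3 h4
      rw [h1, confHess_eq h2 h3 h4]
      simp only [ip]
      ring
    have s1 := hs _ _ (hY.nabla hg hGn) hw
    have s2 := hs _ _ hGn hY
    have s3 := hs _ _ hGn hw
    have s4 := hs _ _ hGn hGn
    have s5 := hs _ _ hY hw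
    rw [dirDeriv_congr e, dirDeriv_add (s1.sub (s2.mul s3)) (((SmoothNear.const _).mul s4).mul s5),
      dirDeriv_sub s1 (s2.mul s3), dirDeriv_mul s2 s3,
      dirDeriv_mul ((SmoothNear.const _).mul s4) s5,
      dirDeriv_mul (.const _) s4, dirDeriv_const, dirDeriv_ip hg hX (hY.nabla hg hGn) hw,
      dirDeriv_ip hg hX hGn hY, dirDeriv_ip hg hX hGn hw, dirDeriv_ip hg hX hGn hGn,
      dirDeriv_ip hg hX hY hw, hg.self.symm (G x) (leviCivita g X G x)]
    simp only [ip]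
    ring
  have hw := FieldNear.ext w
  have hc := cotton_eq X Y (ext w) hX hY hw hg
  -- Ricci identity: the skew part of the second covariant derivative of the gradient `G` is `R(X,
  -- Y) G`, which `hR` expresses through `confHess`. This cancels the derivatives of the quadratic
  -- terms in the Cotton–York tensor.
  have hr := congrArg (fun z => g x z (ext w x)) (riemann_eq hg hX hY hGn)
  beta_reduce at hr
  rw [hR.self_of_nhds, map_sub, sub_apply, inner_braceAct hg.self (confHess_linear _),
    inner_braceAct hg.self (confHess_linear _), curvatureField] at hr
  rw [hd hX hY, hd hY hX] at hc
  have hb := hX.bracket hY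
  simp only [hPx, confHess_eq hg hGn hX, confHess_eq hg hGn hY, confHess_eq hg hGn hb,
    map_sub, sub_apply] at hc hr
  rw [torsion_free hg hX hY] at hc
  simp only [ext_self, map_sub, sub_apply] at hc hr
  have hh := hG.hessian_symm hg hf hX hY
  rw [hc]
  simp only [hg.self.symm (Y x) (X x), hg.self.symm (X x) (G x), hg.self.symm (Y x) (G x)] at hr hh ⊢
  linear_combination (-1 : ℝ) * hr - 2 * g x (G x) w * hh

end Conformal
end
end ConformalBGG

namespace ConformalBGG
noncomputable section
set_option linter.unusedSectionVars false

/-! ### The covariant exterior derivative on alternating maps of a Lie ring -/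

section Cochains

variable {L S : Type*} [LieRing L] [AddCommGroup S] (D : L →+ S →+ S) {k : ℕ}

open Function Matrix

theorem update_eq_insertNth {T : Type*} (ξ : Fin (k + 1) → T) (i : Fin (k + 1)) (a : T) :
    update ξ i a = i.insertNth a (fun l => ξ (i.succAbove l)) := by
  funext j
  refine i.succAboveCases ?_ (fun l => ?_) j <;> simp

/-- The sign is that of the cycle moving the first argument into slot `i`. -/
theorem alternating_vecCons_omit (φ : L [⋀^Fin (k + 1)]→ₗ[ℤ] S) (ξ : Fin (k + 1) → L)
    (i : Fin (k + 1)) (a : L) :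
    φ (vecCons a fun l => ξ (i.succAbove l)) = (-1 : ℤ) ^ (i : ℕ) • φ (update ξ i a) := by
  rw [update_eq_insertNth, φ.map_insertNth, smul_smul, ← mul_pow]
  simp

theorem alternating_vecCons_swap (φ : L [⋀^Fin (k + 2)]→ₗ[ℤ] S) (a b : L) (v : Fin k → L) :
    φ (vecCons a (vecCons b v)) = - φ (vecCons b (vecCons a v)) := by
  have h := φ.map_insertNth 1 b (vecCons a v)
  have e : (1 : Fin (k + 2)).insertNth b (vecCons a v) = vecCons a (vecCons b v) := by
    funext j
    refine Fin.cases ?_ (fun j => ?_) j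
    · have := Fin.insertNth_apply_succAbove (1 : Fin (k + 2)) (α := fun _ => L) b (vecCons a v) 0
      simpa using this
    · refine Fin.cases ?_ (fun j => ?_) j
      · exact Fin.insertNth_apply_same (1 : Fin (k + 2)) (α := fun _ => L) b (vecCons a v)
      · have := Fin.insertNth_apply_succAbove (1 : Fin (k + 2)) (α := fun _ => L) b
          (vecCons a v) j.succ
        have e2 : (1 : Fin (k + 2)).succAbove j.succ = j.succ.succ := by
          rw [← Fin.succ_zero_eq_one, Fin.succ_succAbove_succ]; simp
        rw [e2] at this
        simpa using this
  rw [← e, h]; simp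

/-- The Lie derivative of an alternating map. -/
def lieAct (X : L) (φ : L [⋀^Fin k]→ₗ[ℤ] S) : L [⋀^Fin k]→ₗ[ℤ] S :=
  { (D X).toIntLinearMap.compMultilinearMap φ.toMultilinearMap - ∑ i,
      φ.toMultilinearMap.compLinearMap
        (update (fun _ => LinearMap.id) i (AddMonoidHom.mk' (fun Y => ⁅X, Y⁆)
          (lie_add X)).toIntLinearMap) with
    map_eq_zero_of_eq' := by
      intro v a b hab hne
      have e : ∀ i, (fun l => (update (fun _ => LinearMap.id) i (AddMonoidHom.mk'
          (fun Y => ⁅X, Y⁆) (lie_add X)).toIntLinearMap : Fin k → L →ₗ[ℤ] L) l (v l))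
          = update v i ⁅X, v i⁆ := by
        intro i; funext l
        by_cases h : l = i
        · subst h; simp
        · simp [h]
      simp only [AlternatingMap.coe_multilinearMap, MultilinearMap.toFun_eq_coe,
        _root_.sub_apply, LinearMap.compMultilinearMap_apply,
        φ.map_eq_zero_of_eq v hab hne, map_zero, _root_.sum_apply, zero_sub,
        MultilinearMap.compLinearMap_apply, e]
      rw [neg_eq_zero, Finset.sum_eq_add a b hne]
      -- If the arguments `a` and `b` coincide, only the summands at `a` and `b` survive, and they
      -- are exchanged by a transposition.
      · have e2 : update v b ⁅X, v b⁆ = update v a ⁅X, v a⁆ ∘ Equiv.swap a b := by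
          funext l
          by_cases h1 : l = a
          · subst h1; simp [hab, hne, hne.symm]
          · by_cases h2 : l = b
            · subst h2; simp [hab]
            · simp [Equiv.swap_apply_of_ne_of_ne h1 h2, h1, h2]
        rw [e2, φ.map_swap _ hne, add_neg_cancel]
      · intro c _ hc
        exact φ.map_eq_zero_of_eq _ (by simp [hc.1.symm, hc.2.symm, hab]) hne
      · simp
      · simp }

theorem lieAct_apply (X : L) (φ : L [⋀^Fin k]→ₗ[ℤ] S) (ξ : Fin k → L) :
    lieAct D X φ ξ = D X (φ ξ) - ∑ i, φ (update ξ i ⁅X, ξ i⁆) := by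
  have e : ∀ i, (fun l => (update (fun _ => LinearMap.id) i (AddMonoidHom.mk'
      (fun Y => ⁅X, Y⁆) (lie_add X)).toIntLinearMap : Fin k → L →ₗ[ℤ] L) l (ξ l))
      = update ξ i ⁅X, ξ i⁆ := by
    intro i; funext l
    by_cases h : l = i
    · subst h; simp
    · simp [h]
  change ((D X).toIntLinearMap.compMultilinearMap φ.toMultilinearMap - ∑ i,
      φ.toMultilinearMap.compLinearMap
        (update (fun _ => LinearMap.id) i (AddMonoidHom.mk' (fun Y => ⁅X, Y⁆)
          (lie_add X)).toIntLinearMap)) ξ = _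
  simp only [_root_.sub_apply, LinearMap.compMultilinearMap_apply,
    _root_.sum_apply, MultilinearMap.compLinearMap_apply, e]
  rfl

/-- This is `[L_X, ι_Y] = ι_{[X, Y]}`, with contraction `ι_Y` given by `curryLeft`. It drives the
inductions on the degree below, together with Cartan's formula. -/
theorem lieAct_curryLeft (X Y : L) (φ : L [⋀^Fin (k + 1)]→ₗ[ℤ] S) :
    (lieAct D X φ).curryLeft Y = lieAct D X (φ.curryLeft Y) - φ.curryLeft ⁅X, Y⁆ := by
  ext ξ
  simp only [AlternatingMap.curryLeft_apply_apply, AlternatingMap.sub_apply, lieAct_apply,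
    Fin.sum_univ_succ, Matrix.cons_val_zero, Matrix.cons_val_succ]
  have e1 : update (vecCons Y ξ) 0 ⁅X, Y⁆ = vecCons ⁅X, Y⁆ ξ := by
    funext j; refine Fin.cases ?_ (fun j => ?_) j <;> simp
  have e2 : ∀ i : Fin k, update (vecCons Y ξ) i.succ ⁅X, ξ i⁆ = vecCons Y (update ξ i ⁅X, ξ i⁆) := by
    intro i; exact (Fin.cons_update (α := fun _ => L) Y ξ i _).symm
  rw [e1]
  simp only [e2]
  abel

theorem lieAct_add_left (X Y : L) (φ : L [⋀^Fin k]→ₗ[ℤ] S) :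
    lieAct D (X + Y) φ = lieAct D X φ + lieAct D Y φ := by
  ext ξ
  simp only [AlternatingMap.add_apply, lieAct_apply, map_add, AddMonoidHom.add_apply, add_lie,
    AlternatingMap.map_update_add, Finset.sum_add_distrib]
  abel

theorem lieAct_sub_right (X : L) (φ ψ : L [⋀^Fin k]→ₗ[ℤ] S) :
    lieAct D X (φ - ψ) = lieAct D X φ - lieAct D X ψ := by
  ext ξ
  simp only [AlternatingMap.sub_apply, lieAct_apply, map_sub, Finset.sum_sub_distrib]
  abel

/-- The curvature of `D`. -/
def curvOp (X Y : L) (s : S) : S := D X (D Y s) - D Y (D X s) - D ⁅X, Y⁆ s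

/-- Contraction with the first argument lowers the degree. The bracket terms that appear on the way
cancel by the Jacobi identity, and in degree zero the claim is the definition of the curvature. -/
theorem lieAct_commutator (X Y : L) (φ : L [⋀^Fin k]→ₗ[ℤ] S) (ξ : Fin k → L) :
    lieAct D X (lieAct D Y φ) ξ - lieAct D Y (lieAct D X φ) ξ - lieAct D ⁅X, Y⁆ φ ξ
      = curvOp D X Y (φ ξ) := by
  induction k with
  | zero => simp [lieAct_apply, curvOp]
  | succ k ih =>
    obtain ⟨Z, v, rfl⟩ : ∃ Z v, ξ = vecCons Z v := ⟨vecHead ξ, vecTail ξ, by simp⟩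
    have c : ∀ ψ : L [⋀^Fin (k + 1)]→ₗ[ℤ] S, ψ (vecCons Z v) = ψ.curryLeft Z v := fun _ => rfl
    rw [c, c, c, c, ← ih (φ.curryLeft Z) v]
    simp only [lieAct_curryLeft, lieAct_sub_right, AlternatingMap.sub_apply]
    have h : φ.curryLeft ⁅X, ⁅Y, Z⁆⁆ = φ.curryLeft ⁅⁅X, Y⁆, Z⁆ + φ.curryLeft ⁅Y, ⁅X, Z⁆⁆ := by
      rw [leibniz_lie, map_add]
    rw [h, AlternatingMap.add_apply]
    abel

/-- The sum `∑_{i < j} (-1)^{i+j} φ([ξ_i, ξ_j], …)`. -/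
def bracketTerm : {k : ℕ} → (L [⋀^Fin k]→ₗ[ℤ] S) → (Fin (k + 1) → L) → S
  | 0, _ => 0
  | _ + 1, φ => fun ξ => ∑ j, ∑ i with Fin.castSucc i < j,
      (-1 : ℤ) ^ ((i : ℕ) + (j : ℕ)) • φ (vecCons ⁅ξ i.castSucc, ξ j⁆ (omitTwo ξ i j))

/-- The formula for the covariant exterior derivative. -/
def extFormula (φ : L [⋀^Fin k]→ₗ[ℤ] S) (ξ : Fin (k + 1) → L) : S :=
  ∑ i : Fin (k + 1), (-1 : ℤ) ^ (i : ℕ) • D (ξ i) (φ fun l => ξ (i.succAbove l))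
    + bracketTerm φ ξ

theorem omitTwo_cons_zero {T : Type*} (X : T) (ξ : Fin (k + 1) → T) (l : Fin (k + 1)) :
    omitTwo (vecCons X ξ) 0 l.succ = fun m => ξ (l.succAbove m) := by
  funext m
  simp [omitTwo, Fin.succ_succAbove_succ]

theorem omitTwo_cons_succ {T : Type*} (X : T) (ξ : Fin (k + 2) → T) (j : Fin (k + 1))
    (l : Fin (k + 2)) : omitTwo (vecCons X ξ) j.succ l.succ = vecCons X (omitTwo ξ j l) := by
  funext m
  refine Fin.cases ?_ (fun m => ?_) m
  · simp [omitTwo]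
  · simp [omitTwo, Fin.succ_succAbove_succ]

/-- Reindexing of double sums over pairs of indices. -/
theorem sum_pairs_succ {A : Type*} [AddCommMonoid A] (F : Fin (k + 1) → Fin (k + 2) → A) :
    ∑ l : Fin (k + 2), ∑ j : Fin (k + 1) with Fin.castSucc j < l, F j l
      = ∑ l : Fin (k + 1), F 0 l.succ
        + ∑ l : Fin (k + 1), ∑ j : Fin k with Fin.castSucc j < l, F j.succ l.succ := by
  simp only [Finset.sum_filter]
  rw [Fin.sum_univ_succ]
  simp only [Fin.not_lt_zero, if_false, Finset.sum_const_zero, zero_add]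
  rw [← Finset.sum_add_distrib]
  refine Finset.sum_congr rfl fun l _ => ?_
  rw [Fin.sum_univ_succ]
  simp only [Fin.castSucc_zero, Fin.succ_pos, if_true, ← Fin.succ_castSucc, Fin.succ_lt_succ_iff]

/-- The pairs containing the index `0` give the bracket part of the Lie derivative along `X`. In the
other pairs `X` has to pass the inserted bracket, which costs the sign. -/
theorem bracketTerm_cons (φ : L [⋀^Fin (k + 1)]→ₗ[ℤ] S) (X : L) (ξ : Fin (k + 1) → L) :
    bracketTerm φ (vecCons X ξ) = - ∑ i, φ (update ξ i ⁅X, ξ i⁆)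
      - bracketTerm (φ.curryLeft X) ξ := by
  change (∑ j : Fin (k + 2), ∑ i : Fin (k + 1) with Fin.castSucc i < j, _) = _
  rw [sum_pairs_succ, sub_eq_add_neg]
  congr 1
  · rw [← Finset.sum_neg_distrib]
    refine Finset.sum_congr rfl fun l _ => ?_
    rw [omitTwo_cons_zero]
    simp only [Fin.castSucc_zero, Matrix.cons_val_zero, Matrix.cons_val_succ]
    rw [alternating_vecCons_omit, smul_smul, ← pow_add]
    have : ((0 : Fin (k + 1)) : ℕ) + (l.succ : ℕ) + l = 2 * l + 1 := by simp; ring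
    rw [this, pow_succ, pow_mul]
    simp
  · cases k with
    | zero => simp [bracketTerm]
    | succ k =>
      simp only [bracketTerm, ← Finset.sum_neg_distrib]
      refine Finset.sum_congr rfl fun l _ => Finset.sum_congr rfl fun j _ => ?_
      rw [omitTwo_cons_succ, alternating_vecCons_swap, ← Fin.succ_castSucc]
      simp only [Matrix.cons_val_succ, AlternatingMap.curryLeft_apply_apply, smul_neg, Fin.val_succ]
      rw [show (j : ℕ) + 1 + (l + 1) = j + l + 2 by ring, pow_add]
      simp

/-- Cartan's formula at the level of the explicit expression, before it is known to be alternating.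
-/
theorem extFormula_cons (φ : L [⋀^Fin (k + 1)]→ₗ[ℤ] S) (X : L) (ξ : Fin (k + 1) → L) :
    extFormula D φ (vecCons X ξ) = lieAct D X φ ξ - extFormula D (φ.curryLeft X) ξ := by
  have e : ∀ i : Fin (k + 1), (fun l => vecCons X ξ (i.succ.succAbove l))
      = vecCons X fun l => ξ (i.succAbove l) := by
    intro i; funext l
    refine Fin.cases ?_ (fun l => ?_) l
    · simp
    · simp [Fin.succ_succAbove_succ]
  rw [extFormula, extFormula, bracketTerm_cons, lieAct_apply, Fin.sum_univ_succ]
  simp only [e, Matrix.cons_val_succ, Matrix.cons_val_zero, Fin.succAbove_zero,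
    AlternatingMap.curryLeft_apply_apply, Fin.val_succ, pow_succ, Fin.val_zero, pow_zero, one_smul,
    mul_neg, mul_one, neg_smul, Finset.sum_neg_distrib]
  abel

theorem extFormula_zero (φ : L [⋀^Fin 0]→ₗ[ℤ] S) (ξ : Fin 1 → L) :
    extFormula D φ ξ = D (ξ 0) (φ ![]) := by
  have e : (fun l : Fin 0 => ξ ((0 : Fin 1).succAbove l)) = ![] := Subsingleton.elim _ _
  simp only [extFormula, bracketTerm, Fin.sum_univ_succ, Fin.sum_univ_zero, Fin.val_zero, pow_zero,
    one_smul, Pi.zero_apply, add_zero, e]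

theorem bracketTerm_add (φ ψ : L [⋀^Fin k]→ₗ[ℤ] S) (ξ : Fin (k + 1) → L) :
    bracketTerm (φ + ψ) ξ = bracketTerm φ ξ + bracketTerm ψ ξ := by
  cases k with
  | zero => simp [bracketTerm]
  | succ k => simp [bracketTerm, Finset.sum_add_distrib]

theorem extFormula_add (φ ψ : L [⋀^Fin k]→ₗ[ℤ] S) (ξ : Fin (k + 1) → L) :
    extFormula D (φ + ψ) ξ = extFormula D φ ξ + extFormula D ψ ξ := by
  simp only [extFormula, bracketTerm_add, AlternatingMap.add_apply, map_add, smul_add,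
    Finset.sum_add_distrib]
  abel

/-- A family of alternating maps `Ψ X`, additive in `X`, with `ι_X Ψ X = 0`
comes from an alternating map. -/
theorem exists_uncurry (Ψ : L →+ L [⋀^Fin k]→ₗ[ℤ] S)
    (h : ∀ (X : L) (v : Fin k → L) (j : Fin k), v j = X → Ψ X v = 0) :
    ∃ ψ : L [⋀^Fin (k + 1)]→ₗ[ℤ] S, ∀ X v, ψ (vecCons X v) = Ψ X v := by
  let T : L →ₗ[ℤ] MultilinearMap ℤ (fun _ : Fin k => L) S :=
    (AddMonoidHom.mk' (fun X => (Ψ X).toMultilinearMap) fun X Y => by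
      rw [map_add]; rfl).toIntLinearMap
  refine ⟨{ LinearMap.uncurryLeft (M := fun _ : Fin (k + 1) => L) T with
    map_eq_zero_of_eq' := ?_ }, fun X v => ?_⟩
  · intro v i j hij hne
    change Ψ (v 0) (fun l => v l.succ) = 0
    revert hne hij
    refine Fin.cases ?_ (fun i => ?_) i <;> refine Fin.cases ?_ (fun j => ?_) j
    · intro _ h; exact absurd rfl h
    · intro e _; exact h _ _ j e.symm
    · intro e _; exact h _ _ i e
    · intro e hne
      exact (Ψ (v 0)).map_eq_zero_of_eq _ (i := i) (j := j) e fun h => hne (by rw [h])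
  · change Ψ (vecCons X v 0) (fun l => vecCons X v l.succ) = _
    rfl

/-- Alternation of the explicit formula is not checked directly. The map is built by recursion on
the degree from `ι_X dφ = L_X φ - d ι_X φ`, for which only vanishing on arguments containing `X` has
to be verified. Additivity suffices here; linearity over functions is a separate matter, see
`extAlt_linear`. -/
theorem exists_extAlt (φ : L [⋀^Fin k]→ₗ[ℤ] S) :
    ∃ ψ : L [⋀^Fin (k + 1)]→ₗ[ℤ] S, ∀ ξ, ψ ξ = extFormula D φ ξ := by
  induction k with
  | zero =>
    refine (exists_uncurry (AddMonoidHom.mk' (fun X => lieAct D X φ)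
      fun X Y => lieAct_add_left D X Y φ) fun _ _ j => j.elim0).imp fun ψ h ξ => ?_
    obtain ⟨Z, v, rfl⟩ : ∃ Z v, ξ = vecCons Z v := ⟨vecHead ξ, vecTail ξ, by simp⟩
    rw [h, extFormula_zero]
    simp [lieAct_apply, Subsingleton.elim v ![]]
  | succ k ih =>
    choose d hd using ih
    have hadd : ∀ X Y, lieAct D (X + Y) φ - d (φ.curryLeft (X + Y))
        = (lieAct D X φ - d (φ.curryLeft X)) + (lieAct D Y φ - d (φ.curryLeft Y)) := by
      intro X Y; ext ξ
      simp only [AlternatingMap.add_apply, AlternatingMap.sub_apply, hd, map_add, extFormula_add,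
        lieAct_add_left]
      abel
    -- Contracting with `X` once more, `ι_X L_X φ = L_X ι_X φ` since `[X, X] = 0`, and `ι_X d ι_X φ
    -- = L_X ι_X φ` since `ι_X ι_X φ = 0`.
    have hself : ∀ X v, (lieAct D X φ - d (φ.curryLeft X)) (vecCons X v) = 0 := by
      intro X v
      have h1 : (lieAct D X φ) (vecCons X v) = lieAct D X (φ.curryLeft X) v := by
        have := DFunLike.congr_fun (lieAct_curryLeft D X X φ) v
        simpa using this
      rw [AlternatingMap.sub_apply, hd, h1]
      cases k with
      | zero =>
        rw [extFormula_zero]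
        simp [lieAct_apply, Subsingleton.elim v ![]]
      | succ k =>
        have h0 : (φ.curryLeft X).curryLeft X = 0 := by
          ext w
          exact φ.map_eq_zero_of_eq (vecCons X (vecCons X w)) (i := 0) (j := 1) rfl (by simp)
        rw [extFormula_cons, h0]
        have : extFormula D (0 : L [⋀^Fin k]→ₗ[ℤ] S) v = 0 := by
          simpa using extFormula_add D (0 : L [⋀^Fin k]→ₗ[ℤ] S) 0 v
        rw [this]; abel
    refine (exists_uncurry (AddMonoidHom.mk' (fun X => lieAct D X φ - d (φ.curryLeft X)) hadd)
      fun X v j hj => ?_).imp fun ψ h ξ => ?_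
    · have e : v = update v j X := by rw [← hj]; simp
      rw [e, update_eq_insertNth, AlternatingMap.map_insertNth]
      have := hself X fun l => v (j.succAbove l)
      simp only [AddMonoidHom.mk'_apply, this, smul_zero]
    · obtain ⟨Z, v, rfl⟩ : ∃ Z v, ξ = vecCons Z v := ⟨vecHead ξ, vecTail ξ, by simp⟩
      rw [h, extFormula_cons, AddMonoidHom.mk'_apply, AlternatingMap.sub_apply, hd]

/-- The covariant exterior derivative. -/
def extAlt (φ : L [⋀^Fin k]→ₗ[ℤ] S) : L [⋀^Fin (k + 1)]→ₗ[ℤ] S := (exists_extAlt D φ).choose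

theorem extAlt_apply (φ : L [⋀^Fin k]→ₗ[ℤ] S) (ξ : Fin (k + 1) → L) :
    extAlt D φ ξ = extFormula D φ ξ := (exists_extAlt D φ).choose_spec ξ

theorem extAlt_sub (φ ψ : L [⋀^Fin k]→ₗ[ℤ] S) : extAlt D (φ - ψ) = extAlt D φ - extAlt D ψ := by
  rw [eq_sub_iff_add_eq]
  ext ξ
  rw [AlternatingMap.add_apply, extAlt_apply, extAlt_apply, extAlt_apply, ← extFormula_add,
    sub_add_cancel]

/-- Cartan's formula `ι_X d = L_X - d ι_X`. -/
theorem extAlt_curryLeft (φ : L [⋀^Fin (k + 1)]→ₗ[ℤ] S) (X : L) :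
    (extAlt D φ).curryLeft X = lieAct D X φ - extAlt D (φ.curryLeft X) := by
  ext ξ
  simp only [AlternatingMap.curryLeft_apply_apply, extAlt_apply, AlternatingMap.sub_apply,
    extFormula_cons]

theorem extAlt_curryLeft_zero (φ : L [⋀^Fin 0]→ₗ[ℤ] S) (X : L) :
    (extAlt D φ).curryLeft X = lieAct D X φ := by
  ext ξ
  simp [extAlt_apply, extFormula_zero, lieAct_apply, Subsingleton.elim ξ ![]]

/-- The commutator `[L_X, d]` is the wedge product with the one-form `F(X, ·)`, where `F` is the
curvature. By induction on the degree, `lieAct_commutator` supplies the summand in which the first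
argument enters `F`. -/
theorem lieAct_extAlt (X : L) (φ : L [⋀^Fin k]→ₗ[ℤ] S) (ξ : Fin (k + 1) → L) :
    lieAct D X (extAlt D φ) ξ - extAlt D (lieAct D X φ) ξ = ∑ l : Fin (k + 1),
      (-1 : ℤ) ^ (l : ℕ) • curvOp D X (ξ l) (φ fun m => ξ (l.succAbove m)) := by
  induction k with
  | zero =>
    obtain ⟨Z, v, rfl⟩ : ∃ Z v, ξ = vecCons Z v := ⟨vecHead ξ, vecTail ξ, by simp⟩
    have c : ∀ ψ : L [⋀^Fin 1]→ₗ[ℤ] S, ψ (vecCons Z v) = ψ.curryLeft Z v := fun _ => rfl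
    rw [c, c, lieAct_curryLeft, extAlt_curryLeft_zero, extAlt_curryLeft_zero,
      extAlt_curryLeft_zero, AlternatingMap.sub_apply, sub_right_comm, lieAct_commutator]
    have e : (fun l : Fin 0 => vecCons Z v ((0 : Fin 1).succAbove l)) = v := Subsingleton.elim _ _
    simp only [Fin.sum_univ_succ, Fin.sum_univ_zero, Fin.val_zero,
      pow_zero, one_smul, Matrix.cons_val_zero, add_zero, e]
  | succ k ih =>
    obtain ⟨Z, v, rfl⟩ : ∃ Z v, ξ = vecCons Z v := ⟨vecHead ξ, vecTail ξ, by simp⟩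
    have c : ∀ ψ : L [⋀^Fin (k + 2)]→ₗ[ℤ] S, ψ (vecCons Z v) = ψ.curryLeft Z v := fun _ => rfl
    have e : ∀ i : Fin (k + 1), (fun l => vecCons Z v (i.succ.succAbove l))
        = vecCons Z fun l => v (i.succAbove l) := by
      intro i; funext l
      refine Fin.cases ?_ (fun l => ?_) l
      · simp
      · simp [Fin.succ_succAbove_succ]
    rw [Fin.sum_univ_succ]
    simp only [e, Matrix.cons_val_succ, Matrix.cons_val_zero, Fin.succAbove_zero, Fin.val_succ,
      pow_succ, Fin.val_zero, pow_zero, one_smul, mul_neg, mul_one, neg_smul,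
      Finset.sum_neg_distrib]
    have h1 := ih (φ.curryLeft Z) v
    simp only [AlternatingMap.curryLeft_apply_apply] at h1
    rw [← h1, ← lieAct_commutator, c, c, lieAct_curryLeft, extAlt_curryLeft, extAlt_curryLeft,
      extAlt_curryLeft, lieAct_curryLeft, lieAct_sub_right, extAlt_sub]
    simp only [AlternatingMap.sub_apply]
    abel

/-- The square of the covariant exterior derivative is given by the curvature. -/
theorem extAlt_extAlt (φ : L [⋀^Fin k]→ₗ[ℤ] S) (ξ : Fin (k + 2) → L) :
    extAlt D (extAlt D φ) ξ = ∑ l : Fin (k + 2), ∑ j : Fin (k + 1) with Fin.castSucc j < l,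
      (-1 : ℤ) ^ ((j : ℕ) + (l : ℕ) + 1) • curvOp D (ξ j.castSucc) (ξ l) (φ (omitTwo ξ j l)) := by
  have pw : ∀ {k : ℕ} (l : Fin (k + 1)), (-1 : ℤ) ^ (((0 : Fin (k + 1)) : ℕ) + (l.succ : ℕ) + 1)
      = (-1) ^ (l : ℕ) := fun l => by
    rw [show ((0 : Fin (_ + 1)) : ℕ) + (l.succ : ℕ) + 1 = l + 2 by simp, pow_add]; simp
  induction k with
  | zero =>
    obtain ⟨X, v, rfl⟩ : ∃ Z v, ξ = vecCons Z v := ⟨vecHead ξ, vecTail ξ, by simp⟩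
    have c : ∀ ψ : L [⋀^Fin 2]→ₗ[ℤ] S, ψ (vecCons X v) = ψ.curryLeft X v := fun _ => rfl
    rw [sum_pairs_succ]
    simp only [omitTwo_cons_zero, Fin.castSucc_zero, Matrix.cons_val_zero, Matrix.cons_val_succ, pw]
    rw [← lieAct_extAlt, c, extAlt_curryLeft, AlternatingMap.sub_apply, extAlt_curryLeft_zero]
    simp
  | succ k ih =>
    obtain ⟨X, v, rfl⟩ : ∃ Z v, ξ = vecCons Z v := ⟨vecHead ξ, vecTail ξ, by simp⟩
    have c : ∀ ψ : L [⋀^Fin (k + 3)]→ₗ[ℤ] S, ψ (vecCons X v) = ψ.curryLeft X v := fun _ => rfl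
    have pw' : ∀ j l : ℕ, (-1 : ℤ) ^ (j + 1 + (l + 1) + 1) = (-1) ^ (j + l + 1) := fun j l => by
      rw [show j + 1 + (l + 1) + 1 = j + l + 1 + 2 by ring, pow_add]; simp
    have h := ih (φ.curryLeft X) v
    rw [sum_pairs_succ]
    simp only [omitTwo_cons_zero, Fin.castSucc_zero, Matrix.cons_val_zero, Matrix.cons_val_succ,
      omitTwo_cons_succ, ← Fin.succ_castSucc, Fin.val_succ, pw']
    simp only [AlternatingMap.curryLeft_apply_apply] at h
    have pz : ∀ l : ℕ, (-1 : ℤ) ^ (((0 : Fin (k + 2)) : ℕ) + (l + 1) + 1) = (-1) ^ l := fun l => by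
      rw [show ((0 : Fin (k + 2)) : ℕ) + (l + 1) + 1 = l + 2 by simp, pow_add]; simp
    simp only [pz]
    -- Cartan's formula twice: `ι_X d d φ = [L_X, d] φ + d d ι_X φ`. The first term collects the
    -- pairs containing index `0`, the second the remaining pairs by induction.
    rw [← h, ← lieAct_extAlt, c, extAlt_curryLeft, extAlt_curryLeft, extAlt_sub,
      AlternatingMap.sub_apply, AlternatingMap.sub_apply]
    abel

/-- If `φ` is linear over a function (acting by `mL` on `L` and by `mS` on `S`),
then so is its covariant exterior derivative. -/
theorem extAlt_linear (mL : L →+ L) (mS : S →+ S) (eL : L → L → L) (eS : L → S →+ S)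
    (h1 : ∀ X s, D (mL X) s = mS (D X s)) (h2 : ∀ X s, D X (mS s) = mS (D X s) + eS X s)
    (h3 : ∀ X Y, ⁅X, mL Y⁆ = mL ⁅X, Y⁆ + eL X Y) (φ : L [⋀^Fin k]→ₗ[ℤ] S)
    (h4 : ∀ ξ i Y, φ (update ξ i (mL Y)) = mS (φ (update ξ i Y)))
    (h5 : ∀ ξ i Z Y, φ (update ξ i (eL Z Y)) = eS Z (φ (update ξ i Y)))
    (ξ : Fin (k + 1) → L) (i : Fin (k + 1)) (Y : L) :
    extAlt D φ (update ξ i (mL Y)) = mS (extAlt D φ (update ξ i Y)) := by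
  -- All slots are equivalent up to a sign, so the first one suffices. There the Leibniz terms `eS`
  -- from differentiating coefficients cancel against the terms `eL` from the brackets.
  have key : ∀ (X : L) (v : Fin k → L),
      extAlt D φ (vecCons (mL X) v) = mS (extAlt D φ (vecCons X v)) := by
    intro X v
    rw [extAlt_apply, extAlt_apply]
    cases k with
    | zero => simp [extFormula_zero, h1]
    | succ k =>
      have h4' : ∀ w : Fin k → L, φ (vecCons (mL X) w) = mS (φ (vecCons X w)) := fun w => by
        have := h4 (vecCons X w) 0 X
        have h0 := h4 (vecCons X w) 0 X
        have e : ∀ a, update (vecCons X w) 0 a = vecCons a w := fun a => by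
          funext j; refine Fin.cases ?_ (fun j => ?_) j <;> simp
        rwa [e, e] at h0
      have lb : ∀ Y, ⁅mL X, Y⁆ = mL ⁅X, Y⁆ - eL Y X := fun Y => by
        rw [← lie_skew, h3, ← lie_skew X Y, map_neg]; abel
      have hb : bracketTerm (φ.curryLeft (mL X)) v = mS (bracketTerm (φ.curryLeft X) v) := by
        cases k with
        | zero => simp [bracketTerm]
        | succ k => simp [bracketTerm, h4', map_sum, map_zsmul]
      rw [extFormula_cons, extFormula_cons, lieAct_apply, lieAct_apply]
      simp only [extFormula, hb, AlternatingMap.curryLeft_apply_apply, h4', h1, h2, lb,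
        AlternatingMap.map_update_sub, h5, smul_add, Finset.sum_add_distrib,
        Finset.sum_sub_distrib, map_sub, map_add, map_sum, map_zsmul, alternating_vecCons_omit,
        h4, smul_smul, ← mul_pow]
      simp only [mul_neg, mul_one, neg_neg, one_pow, one_smul]
      abel
  rw [update_eq_insertNth, update_eq_insertNth, AlternatingMap.map_insertNth,
    AlternatingMap.map_insertNth, key, map_zsmul]

end Cochains
end
end ConformalBGG

open scoped Manifold ContDiff Bundle Topology
open Filter
namespace ConformalBGG
noncomputable section
set_option linter.unusedSectionVars false

/-! ### The Lie algebra of `O(b)` -/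

section LieAlgebra

variable {n : ℕ}

open Matrix

theorem bForm_add_left (x x' y : Idx n → ℝ) : bForm (x + x') y = bForm x y + bForm x' y := by
  simp only [bForm, Pi.add_apply, add_mul, Finset.sum_add_distrib]; ring

theorem bForm_smul_left (c : ℝ) (x y : Idx n → ℝ) : bForm (c • x) y = c * bForm x y := by
  simp only [bForm, Pi.smul_apply, smul_eq_mul, mul_add, Finset.mul_sum]
  simp only [mul_assoc]

theorem bForm_comm (x y : Idx n → ℝ) : bForm x y = bForm y x := by
  simp only [bForm]
  rw [Finset.sum_congr rfl fun i _ => mul_comm (x _) (y _)]; ring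

theorem bForm_smul_right (c : ℝ) (x y : Idx n → ℝ) : bForm x (c • y) = c * bForm x y := by
  rw [bForm_comm, bForm_smul_left, bForm_comm]

variable (n) in
/-- The Gram matrix of `b`. -/
def gram : Matrix (Idx n) (Idx n) ℝ := Matrix.of fun p q =>
  match p, q with
  | .inl _, .inr (.inr _) => 1
  | .inr (.inr _), .inl _ => 1
  | .inr (.inl i), .inr (.inl j) => if i = j then 1 else 0
  | _, _ => 0

theorem gram_mulVec (x : Idx n → ℝ) (p : Idx n) : (gram n *ᵥ x) p =
    match p with
    | .inl _ => x (.inr (.inr ()))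
    | .inr (.inl i) => x (.inr (.inl i))
    | .inr (.inr _) => x (.inl ()) := by
  rcases p with _ | p | _ <;> simp [gram, mulVec, dotProduct, Fintype.sum_sum_type]

theorem bForm_eq (x y : Idx n → ℝ) : bForm x y = x ⬝ᵥ gram n *ᵥ y := by
  simp only [bForm, dotProduct, gram_mulVec, Fintype.sum_sum_type, Finset.univ_unique,
    Finset.sum_singleton]
  ring_nf

theorem gram_mul_gram : gram n * gram n = 1 := by
  rw [Matrix.ext_iff_mulVec]
  intro x
  rw [← Matrix.mulVec_mulVec, Matrix.one_mulVec]
  funext p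
  rcases p with _ | p | _ <;> simp only [gram_mulVec]

theorem inLieAlg_iff {B : Matrix (Idx n) (Idx n) ℝ} :
    InLieAlg B ↔ Bᵀ * gram n + gram n * B = 0 := by
  have e : ∀ x y, bForm (B *ᵥ x) y + bForm x (B *ᵥ y) = x ⬝ᵥ ((Bᵀ * gram n + gram n * B) *ᵥ y) := by
    intro x y
    rw [bForm_eq, bForm_eq, Matrix.add_mulVec, dotProduct_add, ← Matrix.mulVec_mulVec,
      ← Matrix.mulVec_mulVec, Matrix.dotProduct_mulVec x Bᵀ, Matrix.vecMul_transpose]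
  constructor
  · intro h
    rw [Matrix.ext_iff_mulVec]
    intro y
    rw [Matrix.zero_mulVec]
    refine dotProduct_eq_zero_iff.1 fun x => ?_
    rw [dotProduct_comm, ← e]
    exact h x y
  · intro h x y
    rw [e, h, Matrix.zero_mulVec, dotProduct_zero]

theorem InLieAlg.zero : InLieAlg (0 : Matrix (Idx n) (Idx n) ℝ) := by simp [inLieAlg_iff]

theorem InLieAlg.add {A B : Matrix (Idx n) (Idx n) ℝ} (hA : InLieAlg A) (hB : InLieAlg B) :
    InLieAlg (A + B) := by
  rw [inLieAlg_iff] at *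
  rw [Matrix.transpose_add, Matrix.add_mul, Matrix.mul_add, add_add_add_comm, hA, hB, add_zero]

theorem InLieAlg.smul {A : Matrix (Idx n) (Idx n) ℝ} (c : ℝ) (hA : InLieAlg A) :
    InLieAlg (c • A) := by
  rw [inLieAlg_iff] at *
  rw [Matrix.transpose_smul, Matrix.smul_mul, Matrix.mul_smul, ← smul_add, hA, smul_zero]

theorem InLieAlg.neg {A : Matrix (Idx n) (Idx n) ℝ} (hA : InLieAlg A) : InLieAlg (-A) := by
  simpa using hA.smul (-1)

theorem InLieAlg.sub {A B : Matrix (Idx n) (Idx n) ℝ} (hA : InLieAlg A) (hB : InLieAlg B) :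
    InLieAlg (A - B) := by
  rw [sub_eq_add_neg]; exact hA.add hB.neg

theorem InLieAlg.sum {ι : Type*} {s : Finset ι} {A : ι → Matrix (Idx n) (Idx n) ℝ}
    (hA : ∀ i ∈ s, InLieAlg (A i)) : InLieAlg (∑ i ∈ s, A i) := by
  classical
  induction s using Finset.induction_on with
  | empty => simpa using InLieAlg.zero
  | insert i s hi ih =>
    rw [Finset.sum_insert hi]
    exact (hA i (by simp)).add (ih fun j hj => hA j (by simp [hj]))

theorem InLieAlg.bracket {A B : Matrix (Idx n) (Idx n) ℝ} (hA : InLieAlg A) (hB : InLieAlg B) :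
    InLieAlg (A * B - B * A) := by
  intro x y
  have h1 := hA (B *ᵥ x) y
  have h2 := hB x (A *ᵥ y)
  have h3 := hB (A *ᵥ x) y
  have h4 := hA x (B *ᵥ y)
  have e : ∀ u v w : Idx n → ℝ, bForm (u - v) w = bForm u w - bForm v w := fun u v w => by
    have := bForm_add_left (u - v) v w
    rw [sub_add_cancel] at this; linarith
  rw [Matrix.sub_mulVec, Matrix.sub_mulVec, e, bForm_comm x, e, bForm_comm _ x, bForm_comm _ x]
  simp only [← Matrix.mulVec_mulVec]
  linarith

theorem InLieAlg.conj {B : Matrix (Idx n) (Idx n) ℝ} (hB : InLieAlg B) (C : orthGroup n) :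
    InLieAlg (C.1.1 * B * (C⁻¹).1.1) := by
  intro x y
  have e : ∀ z, C.1.1 *ᵥ ((C⁻¹).1.1 *ᵥ z) = z := fun z => by
    rw [Matrix.mulVec_mulVec, ← Units.val_mul, ← Subgroup.coe_mul, mul_inv_cancel]; simp
  have h := hB ((C⁻¹).1.1 *ᵥ x) ((C⁻¹).1.1 *ᵥ y)
  rw [← C.2 (B *ᵥ _), ← C.2 _ (B *ᵥ _), e, e] at h
  simpa only [← Matrix.mulVec_mulVec] using h

theorem inLieAlg_gMinus (X : Fin n → ℝ) : InLieAlg (gMinus X) := by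
  intro x y
  simp [bForm, gMinus, mulVec, dotProduct, Fintype.sum_sum_type, Finset.mul_sum, Finset.sum_mul]
  simp only [← Finset.sum_add_distrib, ← Finset.sum_neg_distrib]
  exact Finset.sum_eq_zero fun i _ => by ring

theorem inLieAlg_gPlus (Z : Fin n → ℝ) : InLieAlg (gPlus Z) := by
  intro x y
  simp [bForm, gPlus, mulVec, dotProduct, Fintype.sum_sum_type, Finset.mul_sum, Finset.sum_mul]
  simp only [← Finset.sum_add_distrib, ← Finset.sum_neg_distrib]
  exact Finset.sum_eq_zero fun i _ => by ring

theorem inLieAlg_blockDiag (a : ℝ) {A : Matrix (Fin n) (Fin n) ℝ} (hA : ∀ i j, A i j = - A j i) :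
    InLieAlg (blockDiag a A (-a)) := by
  intro x y
  simp only [bForm, blockDiag, mulVec, dotProduct, Fintype.sum_sum_type, Matrix.of_apply,
    Finset.univ_unique, Finset.sum_singleton, zero_mul, Finset.sum_const_zero, add_zero, zero_add,
    Finset.mul_sum, Finset.sum_mul]
  have : ∑ i, ∑ j, A i j * x (.inr (.inl j)) * y (.inr (.inl i))
      = - ∑ i, ∑ j, x (.inr (.inl i)) * (A i j * y (.inr (.inl j))) := by
    rw [Finset.sum_comm, ← Finset.sum_neg_distrib]
    refine Finset.sum_congr rfl fun i _ => ?_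
    rw [← Finset.sum_neg_distrib]
    refine Finset.sum_congr rfl fun j _ => ?_
    rw [hA j i]; ring
  rw [this]; ring

theorem inLieAlg_gOrth {A : Matrix (Fin n) (Fin n) ℝ} (hA : ∀ i j, A i j = - A j i) :
    InLieAlg (gOrth A) := by
  simpa [gOrth] using inLieAlg_blockDiag 0 hA

theorem inLieAlg_gradingElt : InLieAlg (gradingElt n) := inLieAlg_blockDiag 1 (by simp)

theorem InLieAlg.decompose {B : Matrix (Idx n) (Idx n) ℝ} (hB : InLieAlg B) :
    ∃ (a : ℝ) (A : Matrix (Fin n) (Fin n) ℝ) (X Z : Fin n → ℝ), (∀ i j, A i j = - A j i) ∧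
      B = a • gradingElt n + gOrth A + gMinus X + gPlus Z := by
  rw [inLieAlg_iff] at hB
  have h : ∀ p q, (Bᵀ * gram n + gram n * B) p q = 0 := fun p q => by rw [hB]; rfl
  have h1 : ∀ p q, ∑ r, B r p * gram n r q + ∑ r, gram n p r * B r q = 0 := h
  simp only [Fintype.sum_sum_type, gram, Matrix.of_apply] at h1
  have h00 := h1 (.inl ()) (.inl ())
  have h02 := h1 (.inl ()) (.inr (.inr ()))
  have h22 := h1 (.inr (.inr ())) (.inr (.inr ()))
  have h01 := fun i => h1 (.inl ()) (.inr (.inl i))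
  have h11 := fun i j => h1 (.inr (.inl i)) (.inr (.inl j))
  have h12 := fun i => h1 (.inr (.inl i)) (.inr (.inr ()))
  simp at h00 h02 h22 h01 h11 h12
  refine ⟨B (.inl ()) (.inl ()), Matrix.of fun i j => B (.inr (.inl i)) (.inr (.inl j)),
    fun i => B (.inr (.inl i)) (.inl ()), fun i => B (.inl ()) (.inr (.inl i)),
    fun i j => ?_, ?_⟩
  · have := h11 i j
    simp only [Matrix.of_apply]; linarith
  · ext p q
    rcases p with _ | i | _ <;> rcases q with _ | j | _ <;>
      simp [gradingElt, gOrth, blockDiag, gMinus, gPlus] <;>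
      first | linarith | linarith [h01 j] | linarith [h12 i]

theorem gMinus_add (X Y : Fin n → ℝ) : gMinus (X + Y) = gMinus X + gMinus Y := by
  ext p q
  rcases p with _ | i | _ <;> rcases q with _ | j | _ <;> simp [gMinus, add_comm]

theorem gMinus_smul (c : ℝ) (X : Fin n → ℝ) : gMinus (c • X) = c • gMinus X := by
  ext p q
  rcases p with _ | i | _ <;> rcases q with _ | j | _ <;> simp [gMinus]

theorem gPlus_add (X Y : Fin n → ℝ) : gPlus (X + Y) = gPlus X + gPlus Y := by
  ext p q
  rcases p with _ | i | _ <;> rcases q with _ | j | _ <;> simp [gPlus, add_comm]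

theorem gPlus_smul (c : ℝ) (X : Fin n → ℝ) : gPlus (c • X) = c • gPlus X := by
  ext p q
  rcases p with _ | i | _ <;> rcases q with _ | j | _ <;> simp [gPlus]

theorem gOrth_add (A B : Matrix (Fin n) (Fin n) ℝ) : gOrth (A + B) = gOrth A + gOrth B := by
  ext p q
  rcases p with _ | i | _ <;> rcases q with _ | j | _ <;> simp [gOrth, blockDiag]

theorem gOrth_smul (c : ℝ) (A : Matrix (Fin n) (Fin n) ℝ) : gOrth (c • A) = c • gOrth A := by
  ext p q
  rcases p with _ | i | _ <;> rcases q with _ | j | _ <;> simp [gOrth, blockDiag]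

theorem gradingElt_bracket_gMinus (X : Fin n → ℝ) :
    gradingElt n * gMinus X - gMinus X * gradingElt n = - gMinus X := by
  ext p q
  rcases p with _ | i | _ <;> rcases q with _ | j | _ <;>
    simp [gMinus, gradingElt, blockDiag, Matrix.mul_apply, Fintype.sum_sum_type]

theorem gradingElt_bracket_gPlus (Z : Fin n → ℝ) :
    gradingElt n * gPlus Z - gPlus Z * gradingElt n = gPlus Z := by
  ext p q
  rcases p with _ | i | _ <;> rcases q with _ | j | _ <;>
    simp [gPlus, gradingElt, blockDiag, Matrix.mul_apply, Fintype.sum_sum_type]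

theorem gradingElt_bracket_blockDiag (a c : ℝ) (A : Matrix (Fin n) (Fin n) ℝ) :
    gradingElt n * blockDiag a A c - blockDiag a A c * gradingElt n = 0 := by
  ext p q
  rcases p with _ | i | _ <;> rcases q with _ | j | _ <;>
    simp [gradingElt, blockDiag, Matrix.mul_apply, Fintype.sum_sum_type]

/-- This bracket has three uses: it yields the `sl₂` triple behind the grading, it shows that the
element `E` controls the kernel of the action, and its `o(n)`-part is the correction from `R` to
`W`. -/
theorem gPlus_bracket_gMinus (Z X : Fin n → ℝ) :
    gPlus Z * gMinus X - gMinus X * gPlus Z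
      = (∑ i, Z i * X i) • gradingElt n + gOrth (Matrix.of fun i j => Z i * X j - X i * Z j) := by
  ext p q
  rcases p with _ | i | _ <;> rcases q with _ | j | _ <;>
    simp [gradingElt, gOrth, blockDiag, gMinus, gPlus, Matrix.mul_apply, Fintype.sum_sum_type,
      mul_comm]

theorem gOrth_bracket_gMinus (A : Matrix (Fin n) (Fin n) ℝ) (hA : ∀ i j, A i j = - A j i)
    (X : Fin n → ℝ) : gOrth A * gMinus X - gMinus X * gOrth A = gMinus (A *ᵥ X) := by
  ext p q
  rcases p with _ | i | _ <;> rcases q with _ | j | _ <;>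
    simp [gOrth, blockDiag, gMinus, Matrix.mul_apply, Fintype.sum_sum_type, mulVec, dotProduct]
  rw [← Finset.sum_neg_distrib]
  exact Finset.sum_congr rfl fun i _ => by rw [hA j i]; ring

end LieAlgebra

end
end ConformalBGG

open scoped Manifold ContDiff Bundle Topology
open Filter
namespace ConformalBGG
noncomputable section
set_option linter.unusedSectionVars false

/-! ### The matrix exponential as a map from `o(b)` to `O(b)`. -/

section Exponential

variable {n : ℕ}

open Matrix NormedSpace

/-- Membership in `o(b)` says that conjugation by the Gram matrix sends `B` to `-Bᵀ`, so it sends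
`exp B` to the inverse of the transpose of `exp B`. -/
theorem bForm_exp {B : Matrix (Idx n) (Idx n) ℝ} (hB : InLieAlg B) (x y : Idx n → ℝ) :
    bForm (exp B *ᵥ x) (exp B *ᵥ y) = bForm x y := by
  have hu : IsUnit (gram n) := ⟨⟨gram n, gram n, gram_mul_gram, gram_mul_gram⟩, rfl⟩
  have hi : (gram n)⁻¹ = gram n := Matrix.inv_eq_right_inv gram_mul_gram
  have h1 : gram n * B * (gram n)⁻¹ = -Bᵀ := by
    rw [inLieAlg_iff] at hB
    rw [hi, eq_neg_of_add_eq_zero_right hB, Matrix.neg_mul, Matrix.mul_assoc, gram_mul_gram,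
      Matrix.mul_one]
  have h2 := Matrix.exp_conj (gram n) B hu
  rw [h1, Matrix.exp_neg, Matrix.exp_transpose, hi] at h2
  have h3 : (exp B)ᵀ * (gram n * exp B * gram n) = 1 := by
    rw [← h2]
    refine Matrix.mul_nonsing_inv _ ?_
    rw [Matrix.det_transpose, ← Matrix.isUnit_iff_isUnit_det]
    exact Matrix.isUnit_exp B
  have h4 : (exp B)ᵀ * gram n * exp B = gram n := by
    have := congrArg (fun C => C * gram n) h3
    beta_reduce at this
    rw [Matrix.one_mul, Matrix.mul_assoc, Matrix.mul_assoc (gram n * exp B), gram_mul_gram,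
      Matrix.mul_one, ← Matrix.mul_assoc] at this
    exact this
  rw [bForm_eq, bForm_eq]
  conv_rhs => rw [← h4, ← Matrix.mulVec_mulVec, ← Matrix.mulVec_mulVec, Matrix.dotProduct_mulVec,
    Matrix.vecMul_transpose]

/-- The exponential map of `O(b)`. -/
def expElt (B : Matrix (Idx n) (Idx n) ℝ) (hB : InLieAlg B) : orthGroup n :=
  ⟨(Matrix.isUnit_exp B).unit, fun x y => bForm_exp hB x y⟩

theorem expElt_coe (B : Matrix (Idx n) (Idx n) ℝ) (hB : InLieAlg B) :
    (expElt B hB).1.1 = exp B := rfl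

theorem orthGroup_ext {C D : orthGroup n} (h : C.1.1 = D.1.1) : C = D :=
  Subtype.ext (Units.ext h)

theorem expElt_add (B : Matrix (Idx n) (Idx n) ℝ) (hB : InLieAlg B) (s t : ℝ) :
    expElt ((s + t) • B) (hB.smul _) = expElt (s • B) (hB.smul _) * expElt (t • B) (hB.smul _) := by
  apply orthGroup_ext
  change exp _ = exp _ * exp _
  rw [add_smul, Matrix.exp_add_of_commute]
  exact ((Commute.refl B).smul_left s).smul_right t

theorem expElt_zero (B : Matrix (Idx n) (Idx n) ℝ) (hB : InLieAlg B) :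
    expElt ((0 : ℝ) • B) (hB.smul _) = 1 := by
  apply orthGroup_ext
  change exp _ = 1
  rw [zero_smul, exp_zero]

theorem expElt_conj (B : Matrix (Idx n) (Idx n) ℝ) (hB : InLieAlg B) (C : orthGroup n) (t : ℝ) :
    expElt (t • (C.1.1 * B * (C⁻¹).1.1)) ((hB.conj C).smul _)
      = C * expElt (t • B) (hB.smul _) * C⁻¹ := by
  apply orthGroup_ext
  change exp _ = C.1.1 * exp _ * (C⁻¹).1.1
  have := Matrix.exp_units_conj C.1 (t • B)
  rw [Matrix.mul_smul, Matrix.smul_mul] at this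
  exact this

section

attribute [local instance] Matrix.linftyOpNormedAddCommGroup Matrix.linftyOpNormedSpace
  Matrix.linftyOpNormedRing Matrix.linftyOpNormedAlgebra

/-- Stated for functions of two indices, the domain of the smooth extension in `IsSmoothRep`, so
that the auxiliary norm on matrices stays local to this section. -/
theorem hasDerivAt_exp_smul_zero (B : Matrix (Idx n) (Idx n) ℝ) :
    HasDerivAt (fun (t : ℝ) (p q : Idx n) => exp (t • B) p q) (fun p q => B p q) 0 := by
  have h := hasDerivAt_exp_smul_const B (0 : ℝ)
  rw [zero_smul, exp_zero, one_mul] at h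
  let T : Matrix (Idx n) (Idx n) ℝ →ₗ[ℝ] (Idx n → Idx n → ℝ) := (Matrix.ofLinearEquiv ℝ).symm.toLinearMap
  exact (LinearMap.toContinuousLinearMap T).hasFDerivAt.comp_hasDerivAt (0 : ℝ) h

theorem hasDerivAt_exp_conj (A B : Matrix (Idx n) (Idx n) ℝ) :
    HasDerivAt (fun (t : ℝ) (p q : Idx n) => (exp (t • A) * B * exp (t • (-A))) p q)
      (fun p q => (A * B - B * A) p q) 0 := by
  have h := hasDerivAt_exp_smul_const A (0 : ℝ)
  have h' := hasDerivAt_exp_smul_const (-A) (0 : ℝ)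
  have h2 := (h.mul_const B).mul h'
  simp only [zero_smul, exp_zero, one_mul, mul_one, Matrix.mul_neg, ← sub_eq_add_neg] at h2
  let T : Matrix (Idx n) (Idx n) ℝ →ₗ[ℝ] (Idx n → Idx n → ℝ) := (Matrix.ofLinearEquiv ℝ).symm.toLinearMap
  exact (LinearMap.toContinuousLinearMap T).hasFDerivAt.comp_hasDerivAt (0 : ℝ) h2

end

theorem exp_of_cube_eq_zero (N : Matrix (Idx n) (Idx n) ℝ) (h : N * N * N = 0) :
    exp N = 1 + N + (1 / 2 : ℝ) • (N * N) := by
  rw [NormedSpace.exp_eq_tsum ℝ]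
  beta_reduce
  rw [tsum_eq_sum (s := Finset.range 3)]
  · simp [Finset.sum_range_succ, pow_two]
  · intro m hm
    obtain ⟨r, rfl⟩ := Nat.exists_eq_add_of_le (not_lt.1 (by simpa using hm) : 3 ≤ m)
    rw [pow_add, pow_succ, pow_two, h]; simp

end Exponential

/-! ### The infinitesimal representation. -/

section Rep

variable {n : ℕ} {V : Type*} [NormedAddCommGroup V] [NormedSpace ℝ V] [FiniteDimensional ℝ V]
  {ρ : Representation ℝ (orthGroup n) V}

open Matrix NormedSpace

theorem repMatrix_coe (ρ : Representation ℝ (orthGroup n) V) (C : orthGroup n) :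
    repMatrix ρ C.1.1 = LinearMap.toContinuousLinearMap (ρ C) := by
  have h : ∃ D : orthGroup n, D.1.1 = C.1.1 := ⟨C, rfl⟩
  rw [repMatrix, dif_pos h, orthGroup_ext h.choose_spec]

/-- The infinitesimal action is the derivative at the unit of a smooth extension of the
representation. -/
theorem infAct_extension {F : (Idx n → Idx n → ℝ) → (V →L[ℝ] V)} (hF : ContDiff ℝ ∞ F)
    (hFC : ∀ C : orthGroup n, F (fun p q => C.1.1 p q) = LinearMap.toContinuousLinearMap (ρ C))
    {B : Matrix (Idx n) (Idx n) ℝ} (hB : InLieAlg B) :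
    infAct ρ B = fderiv ℝ F (fun p q => (1 : Matrix (Idx n) (Idx n) ℝ) p q) (fun p q => B p q) ∧
    ∀ hB : ∀ t : ℝ, InLieAlg (t • B), HasDerivAt
      (fun t : ℝ => LinearMap.toContinuousLinearMap (ρ (expElt (t • B) (hB t)))) (infAct ρ B) 0 := by
  have h1 : HasFDerivAt F (fderiv ℝ F fun p q => (1 : Matrix (Idx n) (Idx n) ℝ) p q)
      (fun p q => exp ((0 : ℝ) • B) p q) := by
    rw [zero_smul, exp_zero]
    exact (hF.differentiable (by simp)).differentiableAt.hasFDerivAt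
  have h2 := h1.comp_hasDerivAt (0 : ℝ) (hasDerivAt_exp_smul_zero B)
  have h3 : (fun t : ℝ => repMatrix ρ (exp (t • B)))
      = F ∘ fun (t : ℝ) (p q : Idx n) => exp (t • B) p q := by
    funext t
    rw [← expElt_coe _ (hB.smul t), repMatrix_coe, ← hFC]; rfl
  have h4 : infAct ρ B = (fderiv ℝ F fun p q => (1 : Matrix (Idx n) (Idx n) ℝ) p q)
      (fun p q => B p q) := by
    unfold infAct
    rw [h3]
    exact h2.deriv
  refine ⟨h4, fun hB' => ?_⟩
  rw [h4]
  refine h2.congr_of_eventuallyEq (Eventually.of_forall fun t => ?_)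
  exact (hFC _).symm

/-- The infinitesimal action is the restriction to `o(b)` of one linear map on all matrices, the
differential at the unit of a smooth extension. Linearity follows at once, without a manifold
structure on the group. -/
theorem exists_infAct (hρ : IsSmoothRep ρ) :
    ∃ L : (Idx n → Idx n → ℝ) →L[ℝ] V →L[ℝ] V, ∀ B, InLieAlg B →
      infAct ρ B = L (fun p q => B p q) ∧ ∀ hB : ∀ t : ℝ, InLieAlg (t • B),
      HasDerivAt (fun t : ℝ => LinearMap.toContinuousLinearMap (ρ (expElt (t • B) (hB t))))
        (infAct ρ B) 0 := by
  obtain ⟨F, hF, hFC⟩ := hρ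
  exact ⟨_, fun B hB => infAct_extension hF hFC hB⟩

theorem infAct_add (hρ : IsSmoothRep ρ) {A B : Matrix (Idx n) (Idx n) ℝ} (hA : InLieAlg A)
    (hB : InLieAlg B) : infAct ρ (A + B) = infAct ρ A + infAct ρ B := by
  obtain ⟨L, hL⟩ := exists_infAct hρ
  rw [(hL _ hA).1, (hL _ hB).1, (hL _ (hA.add hB)).1, ← map_add]; rfl

theorem infAct_smul (hρ : IsSmoothRep ρ) (c : ℝ) {A : Matrix (Idx n) (Idx n) ℝ}
    (hA : InLieAlg A) : infAct ρ (c • A) = c • infAct ρ A := by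
  obtain ⟨L, hL⟩ := exists_infAct hρ
  rw [(hL _ hA).1, (hL _ (hA.smul c)).1, ← map_smul]; rfl

theorem infAct_zero (hρ : IsSmoothRep ρ) : infAct ρ 0 = 0 := by
  simpa using infAct_smul hρ 0 (InLieAlg.zero (n := n))

theorem infAct_neg (hρ : IsSmoothRep ρ) {A : Matrix (Idx n) (Idx n) ℝ}
    (hA : InLieAlg A) : infAct ρ (-A) = - infAct ρ A := by
  simpa using infAct_smul hρ (-1) hA

theorem infAct_sub (hρ : IsSmoothRep ρ) {A B : Matrix (Idx n) (Idx n) ℝ} (hA : InLieAlg A)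
    (hB : InLieAlg B) : infAct ρ (A - B) = infAct ρ A - infAct ρ B := by
  rw [sub_eq_add_neg, infAct_add hρ hA hB.neg, infAct_neg hρ hB, sub_eq_add_neg]

theorem infAct_sum (hρ : IsSmoothRep ρ) {ι : Type*} {s : Finset ι}
    {A : ι → Matrix (Idx n) (Idx n) ℝ} (hA : ∀ i ∈ s, InLieAlg (A i)) :
    infAct ρ (∑ i ∈ s, A i) = ∑ i ∈ s, infAct ρ (A i) := by
  classical
  induction s using Finset.induction_on with
  | empty => simpa using infAct_zero hρ
  | insert i s hi ih =>
    rw [Finset.sum_insert hi, Finset.sum_insert hi, infAct_add hρ (hA i (by simp))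
      (InLieAlg.sum fun j hj => hA j (by simp [hj])), ih fun j hj => hA j (by simp [hj])]

/-- Differentiate `ρ(C exp(tB) C⁻¹) = ρ(C) ρ(exp(tB)) ρ(C⁻¹)` at `t = 0`. -/
theorem infAct_conj (hρ : IsSmoothRep ρ) {B : Matrix (Idx n) (Idx n) ℝ} (hB : InLieAlg B)
    (C : orthGroup n) (v : V) :
    infAct ρ (C.1.1 * B * (C⁻¹).1.1) v = ρ C (infAct ρ B (ρ C⁻¹ v)) := by
  obtain ⟨L, hL⟩ := exists_infAct hρ
  have h1 := (hL _ (hB.conj C)).2 fun t => (hB.conj C).smul t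
  have h2 := (hL _ hB).2 fun t => hB.smul t
  have h3 := ((hasDerivAt_const (0 : ℝ) (LinearMap.toContinuousLinearMap (ρ C))).clm_comp h2).clm_comp
    (hasDerivAt_const (0 : ℝ) (LinearMap.toContinuousLinearMap (ρ C⁻¹)))
  have h4 := h1.unique (h3.congr_of_eventuallyEq (Eventually.of_forall fun t => by
    beta_reduce
    rw [expElt_conj _ hB, map_mul ρ, map_mul ρ]; rfl))
  rw [h4, expElt_zero _ hB]
  simp

theorem infAct_conj' (hρ : IsSmoothRep ρ) {B : Matrix (Idx n) (Idx n) ℝ} (hB : InLieAlg B)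
    (C : orthGroup n) (v : V) :
    infAct ρ (C.1.1 * B * (C⁻¹).1.1) (ρ C v) = ρ C (infAct ρ B v) := by
  rw [infAct_conj hρ hB, ← Module.End.mul_apply (ρ C⁻¹), ← map_mul, inv_mul_cancel, map_one]; rfl

/-- Differentiate `infAct_conj` at `t = 0` with `C = exp(tA)`: conjugation of `B` yields the matrix
commutator, and conjugation of the operator yields the commutator of operators. -/
theorem infAct_bracket (hρ : IsSmoothRep ρ) {A B : Matrix (Idx n) (Idx n) ℝ} (hA : InLieAlg A)
    (hB : InLieAlg B) (v : V) :
    infAct ρ (A * B - B * A) v = infAct ρ A (infAct ρ B v) - infAct ρ B (infAct ρ A v) := by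
  obtain ⟨L, hL⟩ := exists_infAct hρ
  have h1 := (L.hasFDerivAt.comp_hasDerivAt (0 : ℝ) (hasDerivAt_exp_conj A B))
  have h2 := (hL _ hA).2 fun t => hA.smul t
  have h3 := (hL _ hA.neg).2 fun t => hA.neg.smul t
  have h4 := (h2.clm_comp (hasDerivAt_const (0 : ℝ) (infAct ρ B))).clm_comp h3
  have inv : ∀ t : ℝ, (expElt (t • A) (hA.smul t))⁻¹ = expElt (t • -A) (hA.neg.smul t) := by
    intro t
    rw [inv_eq_iff_mul_eq_one]
    apply orthGroup_ext
    change exp _ * exp _ = 1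
    rw [← Matrix.exp_add_of_commute, smul_neg, add_neg_cancel, exp_zero]
    rw [smul_neg]
    exact (Commute.refl _).neg_right
  have h5 := h1.unique (h4.congr_of_eventuallyEq (Eventually.of_forall fun t => by
    ext w
    have h6 := infAct_conj hρ hB (expElt (t • A) (hA.smul t)) w
    rw [(hL _ (hB.conj _)).1, inv] at h6
    exact h6))
  rw [(hL _ (hA.bracket hB)).1, h5]
  rw [expElt_zero _ hA, expElt_zero _ hA.neg]
  simp [infAct_neg hρ hA, sub_eq_add_neg]

/-- Uniqueness of one-parameter groups: multiplying `ρ(exp(tB))` by the inverse exponential of `t`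
times the generator gives a curve with zero derivative. -/
theorem rep_expElt (hρ : IsSmoothRep ρ) {B : Matrix (Idx n) (Idx n) ℝ} (hB : InLieAlg B) :
    LinearMap.toContinuousLinearMap (ρ (expElt B hB)) = exp (infAct ρ B) := by
  obtain ⟨L, hL⟩ := exists_infAct hρ
  have h0 := (hL _ hB).2 fun t => hB.smul t
  set R : ℝ → V →L[ℝ] V := fun t =>
    LinearMap.toContinuousLinearMap (ρ (expElt (t • B) (hB.smul t))) with hR
  have hadd : ∀ s t, R (s + t) = R s * R t := by
    intro s t
    simp only [hR, expElt_add B hB, map_mul]; rfl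
  have hR0 : R 0 = 1 := by
    simp only [hR, expElt_zero B hB, map_one]; rfl
  have hd : ∀ t, HasDerivAt R (R t * infAct ρ B) t := by
    intro t
    have h1 : HasDerivAt (fun s => R (s - t)) (infAct ρ B) t := by
      have h0' : HasDerivAt R (infAct ρ B) (t - t) := by rw [sub_self]; exact h0
      exact h0'.comp_sub_const t t
    refine ((hasDerivAt_const t (R t)).mul h1).congr_of_eventuallyEq
      (Eventually.of_forall fun s => ?_) |>.congr_deriv ?_
    · rw [Pi.mul_apply, ← hadd]; simp
    · simp
  have hc : ∀ t, HasDerivAt (fun t : ℝ => R t * exp (t • -infAct ρ B)) 0 t := by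
    intro t
    refine ((hd t).mul (hasDerivAt_exp_smul_const' (-infAct ρ B) t)).congr_deriv ?_
    rw [mul_assoc, ← mul_add]
    simp
  have h1 := is_const_of_deriv_eq_zero (fun t => (hc t).differentiableAt) (fun t => (hc t).deriv) 1 0
  simp only [hR0, zero_smul, exp_zero, one_mul, one_smul] at h1
  have h2 : exp (-infAct ρ B) * exp (infAct ρ B) = 1 := by
    have h3 : Commute (-infAct ρ B) (infAct ρ B) := (Commute.refl _).neg_left
    let _ : NormedAlgebra ℚ (V →L[ℝ] V) := NormedAlgebra.restrictScalars ℚ ℝ _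
    rw [← NormedSpace.exp_add_of_commute h3]; simp
  calc LinearMap.toContinuousLinearMap (ρ (expElt B hB)) = R 1 := by
        simp only [hR, one_smul]
    _ = R 1 * (exp (-infAct ρ B) * exp (infAct ρ B)) := by rw [h2, mul_one]
    _ = _ := by rw [← mul_assoc, h1, one_mul]

/-- Partial sums of the exponential series preserve `W`, and `W` is closed because it has finite
dimension. -/
theorem rep_expElt_mem (hρ : IsSmoothRep ρ) {B : Matrix (Idx n) (Idx n) ℝ} (hB : InLieAlg B)
    (W : Submodule ℝ V) (hW : ∀ v ∈ W, infAct ρ B v ∈ W) {v : V} (hv : v ∈ W) :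
    ρ (expElt B hB) v ∈ W := by
  have h1 : ρ (expElt B hB) v = exp (infAct ρ B) v := by
    rw [← rep_expElt hρ hB]; rfl
  rw [h1]
  have hp : ∀ m : ℕ, (infAct ρ B ^ m) v ∈ W := fun m => by
    induction m with
    | zero => simpa using hv
    | succ m ih => rw [pow_succ']; exact hW _ ih
  have h2 := NormedSpace.exp_series_hasSum_exp' (𝕂 := ℝ) (infAct ρ B)
  have h3 := h2.mapL (ContinuousLinearMap.apply ℝ V v)
  refine (Submodule.closed_of_finiteDimensional W).mem_of_tendsto h3
    (Eventually.of_forall fun s => W.sum_mem fun m _ => ?_)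
  simp only [ContinuousLinearMap.apply_apply, _root_.smul_apply]
  exact W.smul_mem _ (hp m)

end Rep
end
end ConformalBGG

open scoped Manifold ContDiff Bundle Topology
open Filter
namespace ConformalBGG
noncomputable section
set_option linter.unusedSectionVars false

/-! ### Generators of `O(b)`. -/

section Generators

variable {n : ℕ}

open Matrix NormedSpace

theorem gPlus_mulVec (Z : Fin n → ℝ) (x : Idx n → ℝ) (p : Idx n) : (gPlus Z *ᵥ x) p =
    match p with
    | .inl _ => ∑ j, Z j * x (.inr (.inl j))
    | .inr (.inl i) => - (Z i * x (.inr (.inr ())))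
    | .inr (.inr _) => 0 := by
  rcases p with _ | p | _ <;> simp [gPlus, mulVec, dotProduct, Fintype.sum_sum_type]

theorem gMinus_mulVec (X : Fin n → ℝ) (x : Idx n → ℝ) (p : Idx n) : (gMinus X *ᵥ x) p =
    match p with
    | .inl _ => 0
    | .inr (.inl i) => X i * x (.inl ())
    | .inr (.inr _) => - ∑ j, X j * x (.inr (.inl j)) := by
  rcases p with _ | p | _ <;> simp [gMinus, mulVec, dotProduct, Fintype.sum_sum_type]

theorem exp_mulVec_of_cube (N : Matrix (Idx n) (Idx n) ℝ) (h : ∀ x, N *ᵥ (N *ᵥ (N *ᵥ x)) = 0)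
    (x : Idx n → ℝ) : exp N *ᵥ x = x + N *ᵥ x + (1 / 2 : ℝ) • N *ᵥ (N *ᵥ x) := by
  have h3 : N * N * N = 0 := by
    rw [Matrix.ext_iff_mulVec]
    intro y
    rw [← Matrix.mulVec_mulVec, ← Matrix.mulVec_mulVec, h, Matrix.zero_mulVec]
  rw [exp_of_cube_eq_zero N h3, Matrix.add_mulVec, Matrix.add_mulVec, Matrix.one_mulVec,
    Matrix.smul_mulVec, Matrix.mulVec_mulVec]

theorem exp_gPlus_mulVec (Z : Fin n → ℝ) (x : Idx n → ℝ) (p : Idx n) :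
    (exp (gPlus Z) *ᵥ x) p = match p with
    | .inl _ => x (.inl ()) + ∑ j, Z j * x (.inr (.inl j))
        - (∑ j, Z j * Z j) * x (.inr (.inr ())) / 2
    | .inr (.inl i) => x (.inr (.inl i)) - Z i * x (.inr (.inr ()))
    | .inr (.inr _) => x (.inr (.inr ())) := by
  rw [exp_mulVec_of_cube]
  · rcases p with _ | p | _ <;>
      simp only [Pi.add_apply, Pi.smul_apply, gPlus_mulVec, smul_eq_mul, mul_neg,
        Finset.sum_neg_distrib, ← mul_assoc, ← Finset.sum_mul] <;> ring
  · intro x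
    funext p
    rcases p with _ | p | _ <;> simp [gPlus_mulVec, -Matrix.mulVec_mulVec]

theorem exp_gMinus_mulVec (X : Fin n → ℝ) (x : Idx n → ℝ) (p : Idx n) :
    (exp (gMinus X) *ᵥ x) p = match p with
    | .inl _ => x (.inl ())
    | .inr (.inl i) => x (.inr (.inl i)) + X i * x (.inl ())
    | .inr (.inr _) => x (.inr (.inr ())) - ∑ j, X j * x (.inr (.inl j))
        - (∑ j, X j * X j) * x (.inl ()) / 2 := by
  rw [exp_mulVec_of_cube]
  · rcases p with _ | p | _ <;>
      simp only [Pi.add_apply, Pi.smul_apply, gMinus_mulVec, smul_eq_mul,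
        ← mul_assoc, ← Finset.sum_mul] <;> ring
  · intro x
    funext p
    rcases p with _ | p | _ <;> simp [gMinus_mulVec, -Matrix.mulVec_mulVec]

theorem expElt_neg (B : Matrix (Idx n) (Idx n) ℝ) (hB : InLieAlg B) :
    expElt B hB * expElt (-B) hB.neg = 1 := by
  apply orthGroup_ext
  change exp _ * exp _ = 1
  rw [← Matrix.exp_add_of_commute _ _ (Commute.refl B).neg_right, add_neg_cancel, exp_zero]

variable (n) in
/-- The element of `O(b)` exchanging `e_0` and `e_{n+1}`. -/
def swapElt : orthGroup n :=
  ⟨⟨gram n, gram n, gram_mul_gram, gram_mul_gram⟩, fun x y => by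
    simp only [bForm, gram_mulVec]; ring⟩

theorem swapElt_mul_self : swapElt n * swapElt n = 1 := orthGroup_ext gram_mul_gram

theorem mulVec_single_apply (C : Matrix (Idx n) (Idx n) ℝ) (p q : Idx n) :
    (C *ᵥ Pi.single q 1) p = C p q := by simp

/-- The group `O(b)` is generated by `exp(g_{-1})`, `exp(g_1)`, the block diagonal matrices and the
element exchanging `e_0` and `e_{n+1}`. -/
theorem orthGroup_induction {P : orthGroup n → Prop} (hmul : ∀ C D, P C → P D → P (C * D))
    (hm : ∀ X, P (expElt (gMinus X) (inLieAlg_gMinus X)))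
    (hp : ∀ Z, P (expElt (gPlus Z) (inLieAlg_gPlus Z))) (hs : P (swapElt n))
    (hd : ∀ (C : orthGroup n) (a c : ℝ) (A : Matrix (Fin n) (Fin n) ℝ),
      C.1.1 = blockDiag a A c → P C) (C : orthGroup n) : P C := by
  have b0 : ∀ x : Idx n → ℝ, bForm x (Pi.single (.inl ()) 1) = x (.inr (.inr ())) := fun x => by
    simp [bForm]
  have b2 : ∀ x : Idx n → ℝ, bForm x (Pi.single (.inr (.inr ())) 1) = x (.inl ()) := fun x => by
    simp [bForm]
  -- the stabilizer of both null lines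
  have s1 : ∀ C : orthGroup n, (∃ c : ℝ, C.1.1 *ᵥ Pi.single (.inl ()) 1 = c • Pi.single (.inl ()) 1)
      → (∃ d : ℝ, C.1.1 *ᵥ Pi.single (.inr (.inr ())) 1 = d • Pi.single (.inr (.inr ())) 1)
      → P C := by
    rintro C ⟨c, hc⟩ ⟨d, hd'⟩
    have hcd : d * c = 1 := by
      have := C.2 (Pi.single (.inr (.inr ())) 1) (Pi.single (.inl ()) 1)
      rw [hc, hd', bForm_smul_left, bForm_smul_right, b0] at this
      simpa using this
    have hc0 : c ≠ 0 := right_ne_zero_of_mul_eq_one hcd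
    have hd0 : d ≠ 0 := left_ne_zero_of_mul_eq_one hcd
    have e0 : ∀ p, C.1.1 p (.inl ()) = (c • Pi.single (.inl ()) 1 : Idx n → ℝ) p := fun p => by
      rw [← hc, mulVec_single_apply]
    have e2 : ∀ p, C.1.1 p (.inr (.inr ())) = (d • Pi.single (.inr (.inr ())) 1 : Idx n → ℝ) p :=
      fun p => by rw [← hd', mulVec_single_apply]
    have m0 : ∀ j, C.1.1 (.inl ()) (.inr (.inl j)) = 0 := fun j => by
      have := C.2 (Pi.single (.inr (.inl j)) 1) (Pi.single (.inr (.inr ())) 1)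
      rw [hd', bForm_smul_right, b2, b2, mulVec_single_apply] at this
      simpa [hd0] using this
    have m2 : ∀ j, C.1.1 (.inr (.inr ())) (.inr (.inl j)) = 0 := fun j => by
      have := C.2 (Pi.single (.inr (.inl j)) 1) (Pi.single (.inl ()) 1)
      rw [hc, bForm_smul_right, b0, b0, mulVec_single_apply] at this
      simpa [hc0] using this
    refine hd C c d (Matrix.of fun i j => C.1.1 (.inr (.inl i)) (.inr (.inl j))) ?_
    ext p q
    rcases q with _ | j | _
    · have := e0 p
      rcases p with _ | i | _ <;> simpa [blockDiag] using this
    · rcases p with _ | i | _ <;> simp [blockDiag, m0, m2]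
    · have := e2 p
      rcases p with _ | i | _ <;> simpa [blockDiag] using this
  -- the stabilizer of the null line spanned by `e_0`
  have s2 : ∀ C : orthGroup n, (∃ c : ℝ, C.1.1 *ᵥ Pi.single (.inl ()) 1 = c • Pi.single (.inl ()) 1)
      → P C := by
    rintro C ⟨c, hc⟩
    set y := C.1.1 *ᵥ Pi.single (.inr (.inr ())) 1 with hy
    have h1 : c * y (.inr (.inr ())) = 1 := by
      have := C.2 (Pi.single (.inr (.inr ())) 1) (Pi.single (.inl ()) 1)
      rw [hc, bForm_smul_right, b0, b0, ← hy] at this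
      simpa using this
    have h2 : 2 * y (.inl ()) * y (.inr (.inr ())) + ∑ i, y (.inr (.inl i)) * y (.inr (.inl i))
        = 0 := by
      have := C.2 (Pi.single (.inr (.inr ())) 1) (Pi.single (.inr (.inr ())) 1)
      rw [b2, ← hy] at this
      simp only [bForm] at this
      simp at this
      linarith
    -- As `c` is the inverse of the last entry of `y`, this `Z` makes `exp(gPlus Z)` kill the middle
    -- entries of `y`. The first entry then vanishes too because `y` is null.
    set Z : Fin n → ℝ := fun i => c * y (.inr (.inl i)) with hZ
    have h3 : P (expElt (gPlus Z) (inLieAlg_gPlus Z) * C) := by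
      refine s1 _ ⟨c, ?_⟩ ⟨y (.inr (.inr ())), ?_⟩
      · change (exp (gPlus Z) * C.1.1) *ᵥ _ = _
        rw [← Matrix.mulVec_mulVec, hc]
        funext p
        rcases p with _ | i | _ <;> rw [exp_gPlus_mulVec] <;> simp
      · change (exp (gPlus Z) * C.1.1) *ᵥ _ = _
        rw [← Matrix.mulVec_mulVec, ← hy]
        have e1 : ∑ j, Z j * y (.inr (.inl j))
            = c * ∑ i, y (.inr (.inl i)) * y (.inr (.inl i)) := by
          rw [Finset.mul_sum]; exact Finset.sum_congr rfl fun i _ => by simp only [hZ]; ring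
        have e2 : ∑ j, Z j * Z j = c ^ 2 * ∑ i, y (.inr (.inl i)) * y (.inr (.inl i)) := by
          rw [Finset.mul_sum]; exact Finset.sum_congr rfl fun i _ => by simp only [hZ]; ring
        funext p
        rcases p with _ | i | _ <;> rw [exp_gPlus_mulVec]
        · simp only [e1, e2, eq_neg_of_add_eq_zero_right h2]
          simp
          linear_combination (- y (.inl ()) + y (.inl ()) * c * y (.inr (.inr ()))) * h1
        · simp [hZ]
          linear_combination (- y (.inr (.inl i))) * h1
        · simp
    have h4 := hmul _ _ (hp (-Z)) h3
    rw [← mul_assoc] at h4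
    have h5 : expElt (gPlus (-Z)) (inLieAlg_gPlus (-Z)) * expElt (gPlus Z) (inLieAlg_gPlus Z) = 1 := by
      have e : gPlus Z = - gPlus (-Z) := by
        have := gPlus_smul (-1) Z; simp at this; rw [this, neg_neg]
      have := expElt_neg (gPlus (-Z)) (inLieAlg_gPlus (-Z))
      simp only [← e] at this
      exact this
    rwa [h5, one_mul] at h4
  set x := C.1.1 *ᵥ Pi.single (.inl ()) 1 with hx
  have h2 : 2 * x (.inl ()) * x (.inr (.inr ())) + ∑ i, x (.inr (.inl i)) * x (.inr (.inl i))
      = 0 := by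
    have := C.2 (Pi.single (.inl ()) 1) (Pi.single (.inl ()) 1)
    rw [b0, ← hx] at this
    simp only [bForm] at this
    simp at this
    linarith
  -- If the first entry of the null vector `x` vanishes, so do the middle ones, and the exchange of
  -- `e_0` and `e_{n+1}` brings `x` back to the line of `e_0`. Otherwise `exp(gMinus X)` with `X =
  -- -x_i / x_0` does so.
  by_cases h0 : x (.inl ()) = 0
  · have h3 : ∀ i, x (.inr (.inl i)) = 0 := by
      rw [h0, mul_zero, zero_mul, zero_add, Finset.sum_eq_zero_iff_of_nonneg
        fun i _ => mul_self_nonneg _] at h2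
      exact fun i => mul_self_eq_zero.1 (h2 i (Finset.mem_univ i))
    have h4 := hmul _ _ hs (s2 (swapElt n * C) ⟨x (.inr (.inr ())), by
      change (gram n * C.1.1) *ᵥ _ = _
      rw [← Matrix.mulVec_mulVec, ← hx]
      funext p
      rcases p with _ | i | _ <;> rw [gram_mulVec] <;> simp [h3, h0]⟩)
    rwa [← mul_assoc, swapElt_mul_self, one_mul] at h4
  · set X : Fin n → ℝ := fun i => - x (.inr (.inl i)) / x (.inl ()) with hX
    have h3 : P (expElt (gMinus X) (inLieAlg_gMinus X) * C) := by
      refine s2 _ ⟨x (.inl ()), ?_⟩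
      change (exp (gMinus X) * C.1.1) *ᵥ _ = _
      rw [← Matrix.mulVec_mulVec, ← hx]
      have e1 : ∑ j, X j * x (.inr (.inl j))
          = - (∑ i, x (.inr (.inl i)) * x (.inr (.inl i))) / x (.inl ()) := by
        rw [← Finset.sum_neg_distrib, Finset.sum_div]
        exact Finset.sum_congr rfl fun i _ => by simp only [hX]; ring
      have e2 : ∑ j, X j * X j
          = (∑ i, x (.inr (.inl i)) * x (.inr (.inl i))) / x (.inl ()) ^ 2 := by
        rw [Finset.sum_div]; exact Finset.sum_congr rfl fun i _ => by simp only [hX]; ring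
      funext p
      rcases p with _ | i | _ <;> rw [exp_gMinus_mulVec]
      · simp
      · simp [hX]; field_simp; ring
      · simp only [e1, e2, eq_neg_of_add_eq_zero_right h2]
        simp
        field_simp
        ring
    have h4 := hmul _ _ (hm (-X)) h3
    rw [← mul_assoc] at h4
    have h5 : expElt (gMinus (-X)) (inLieAlg_gMinus (-X)) * expElt (gMinus X) (inLieAlg_gMinus X)
        = 1 := by
      have e : gMinus X = - gMinus (-X) := by
        have := gMinus_smul (-1) X; simp at this; rw [this, neg_neg]
      have := expElt_neg (gMinus (-X)) (inLieAlg_gMinus (-X))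
      simp only [← e] at this
      exact this
    rwa [h5, one_mul] at h4

end Generators

/-! ### A real eigenvalue from an `sl₂` triple. -/

section Sl2

open scoped TensorProduct

attribute [local instance] LieRing.ofAssociativeRing

/-- The neutral element of an `sl₂` triple has a nonnegative integral eigenvalue. -/
theorem exists_nat_eigenvalue {V : Type*} [AddCommGroup V] [Module ℝ V] [FiniteDimensional ℝ V]
    [Nontrivial V] (h e f : Module.End ℝ V) (he : h * e - e * h = (2 : ℝ) • e)
    (hf : h * f - f * h = -((2 : ℝ) • f)) (hef : e * f - f * e = h) :
    ∃ k : ℕ, h.HasEigenvalue (k : ℝ) := by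
  have key : ∃ k : ℕ, Module.End.HasEigenvalue (R := ℂ) (M := ℂ ⊗[ℝ] V)
      (LinearMap.baseChange ℂ h) (k : ℂ) := by
    set H : Module.End ℂ (ℂ ⊗[ℝ] V) := LinearMap.baseChange ℂ h with hH
    set E : Module.End ℂ (ℂ ⊗[ℝ] V) := LinearMap.baseChange ℂ e with hE
    set F : Module.End ℂ (ℂ ⊗[ℝ] V) := LinearMap.baseChange ℂ f with hF
    -- The notion of `sl₂` triple requires a nonzero neutral element; if it vanishes, `0` is an
    -- eigenvalue.
    by_cases h0 : H = 0
    · refine ⟨0, ?_⟩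
      obtain ⟨v, hv⟩ := exists_ne (0 : ℂ ⊗[ℝ] V)
      exact Module.End.hasEigenvalue_of_hasEigenvector (x := v)
        (Module.End.hasEigenvector_iff.2 ⟨Module.End.mem_eigenspace_iff.2 (by simp [h0]), hv⟩)
    have t : IsSl2Triple H E F := by
      refine ⟨h0, ?_, ?_, ?_⟩
      · rw [Ring.lie_def, hE, hF, ← LinearMap.baseChange_mul, ← LinearMap.baseChange_mul,
          ← LinearMap.baseChange_sub, hef]
      · rw [Ring.lie_def, hE, hH, ← LinearMap.baseChange_mul, ← LinearMap.baseChange_mul,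
          ← LinearMap.baseChange_sub, he, two_smul, two_smul, LinearMap.baseChange_add]
      · rw [Ring.lie_def, hF, hH, ← LinearMap.baseChange_mul, ← LinearMap.baseChange_mul,
          ← LinearMap.baseChange_sub, hf, two_smul, two_smul, LinearMap.baseChange_neg,
          LinearMap.baseChange_add]
    -- Over the complex numbers eigenvalues exist. For one with maximal real part, raising would
    -- give the eigenvalue `c + 2`, so an eigenvector is primitive and `c` is a natural number.
    obtain ⟨c, hc, hmax⟩ := Set.exists_max_image {c : ℂ | H.HasEigenvalue c} Complex.re
      H.finite_hasEigenvalue (Module.End.exists_eigenvalue H)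
    obtain ⟨v, hv⟩ := Module.End.HasEigenvalue.exists_hasEigenvector hc
    have hEv : E v = 0 := by
      by_contra hne
      have h1 : H (E v) = (c + 2) • E v := by
        have h2 := DFunLike.congr_fun t.lie_h_e_nsmul v
        rw [Ring.lie_def, LinearMap.sub_apply, Module.End.mul_apply, Module.End.mul_apply,
          hv.apply_eq_smul, map_smul, sub_eq_iff_eq_add] at h2
        rw [h2, add_smul, add_comm, two_smul, two_smul, LinearMap.add_apply]
      have h3 := hmax (c + 2) (Module.End.hasEigenvalue_of_hasEigenvector (x := E v)
        (Module.End.hasEigenvector_iff.2 ⟨Module.End.mem_eigenspace_iff.2 h1, hne⟩))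
      simp at h3
      linarith
    have P : t.HasPrimitiveVectorWith v c := ⟨hv.2, hv.apply_eq_smul, hEv⟩
    obtain ⟨k, rfl⟩ := P.exists_nat
    exact ⟨k, hc⟩
  obtain ⟨k, hk⟩ := key
  refine ⟨k, ?_⟩
  -- The characteristic polynomial is unchanged by complexification, and the root found is real.
  rw [Module.End.hasEigenvalue_iff_isRoot_charpoly] at hk ⊢
  rw [LinearMap.charpoly_baseChange] at hk
  refine Polynomial.IsRoot.of_map (f := algebraMap ℝ ℂ) ?_ (algebraMap ℝ ℂ).injective
  simpa using hk

end Sl2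
end
end ConformalBGG

open scoped Manifold ContDiff Bundle Topology
open Filter
namespace ConformalBGG
noncomputable section
set_option linter.unusedSectionVars false

/-! ### The decomposition of an irreducible representation under the grading element. -/

section Grading

variable {n : ℕ} {V : Type*} [NormedAddCommGroup V] [NormedSpace ℝ V] [FiniteDimensional ℝ V]
  {ρ : Representation ℝ (orthGroup n) V}

open Matrix

theorem irreducible_eq_top (hirr : ρ.IsIrreducible) (W : Submodule ℝ V) (h0 : W ≠ ⊥)
    (hW : ∀ C, ∀ v ∈ W, ρ C v ∈ W) : W = ⊤ := by
  let S : Subrepresentation ρ := ⟨W, fun C v hv => hW C v hv⟩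
  rcases hirr.eq_bot_or_eq_top S with h | h
  · exact absurd (congrArg Subrepresentation.toSubmodule h) h0
  · exact congrArg Subrepresentation.toSubmodule h

theorem nontrivial_of_irreducible (hirr : ρ.IsIrreducible) : Nontrivial V := by
  by_contra h
  rw [not_nontrivial_iff_subsingleton] at h
  have := hirr.exists_pair_ne
  obtain ⟨S, T, hne⟩ := this
  exact hne (Subrepresentation.toSubmodule_injective (Subsingleton.elim _ _))

theorem mem_gradePart {j : ℤ} {v : V} :
    v ∈ gradePart ρ j ↔ infAct ρ (gradingElt n) v = (lowestWeight ρ + j) • v :=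
  Module.End.mem_eigenspace_iff

/-- The action of `B` with `[E, B] = d B` shifts the eigenvalues of `E` by `d`. -/
theorem infAct_shift (hρ : IsSmoothRep ρ) {B : Matrix (Idx n) (Idx n) ℝ} (hB : InLieAlg B)
    {d : ℝ} (h : gradingElt n * B - B * gradingElt n = d • B) {c : ℝ} {v : V}
    (hv : infAct ρ (gradingElt n) v = c • v) :
    infAct ρ (gradingElt n) (infAct ρ B v) = (c + d) • infAct ρ B v := by
  have h1 := infAct_bracket hρ inLieAlg_gradingElt hB v
  rw [h, infAct_smul hρ d hB, hv, map_smul, _root_.smul_apply, eq_sub_iff_add_eq] at h1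
  rw [← h1, add_smul, add_comm]

theorem gMinus_shift (hρ : IsSmoothRep ρ) (X : Fin n → ℝ) {c : ℝ} {v : V}
    (hv : infAct ρ (gradingElt n) v = c • v) :
    infAct ρ (gradingElt n) (infAct ρ (gMinus X) v) = (c - 1) • infAct ρ (gMinus X) v :=
  infAct_shift hρ (inLieAlg_gMinus X) (by rw [gradingElt_bracket_gMinus]; simp) hv

theorem gPlus_shift (hρ : IsSmoothRep ρ) (Z : Fin n → ℝ) {c : ℝ} {v : V}
    (hv : infAct ρ (gradingElt n) v = c • v) :
    infAct ρ (gradingElt n) (infAct ρ (gPlus Z) v) = (c + 1) • infAct ρ (gPlus Z) v :=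
  infAct_shift hρ (inLieAlg_gPlus Z) (by rw [gradingElt_bracket_gPlus]; simp) hv

theorem gOrth_shift (hρ : IsSmoothRep ρ) {A : Matrix (Fin n) (Fin n) ℝ}
    (hA : ∀ i j, A i j = - A j i) {c : ℝ} {v : V} (hv : infAct ρ (gradingElt n) v = c • v) :
    infAct ρ (gradingElt n) (infAct ρ (gOrth A) v) = c • infAct ρ (gOrth A) v := by
  have := infAct_shift hρ (inLieAlg_gOrth hA) (d := 0)
    (by rw [gOrth, gradingElt_bracket_blockDiag, zero_smul]) hv
  rwa [add_zero] at this

theorem rep_blockDiag_shift (hρ : IsSmoothRep ρ) {C : orthGroup n} {a c : ℝ}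
    {A : Matrix (Fin n) (Fin n) ℝ} (hC : C.1.1 = blockDiag a A c) {μ : ℝ} {v : V}
    (hv : infAct ρ (gradingElt n) v = μ • v) :
    infAct ρ (gradingElt n) (ρ C v) = μ • ρ C v := by
  have h1 : C.1.1 * gradingElt n * (C⁻¹).1.1 = gradingElt n := by
    have h2 := gradingElt_bracket_blockDiag (n := n) a c A
    rw [← hC, sub_eq_zero] at h2
    rw [← h2, Matrix.mul_assoc, ← Units.val_mul, ← Subgroup.coe_mul, mul_inv_cancel]
    simp
  have := infAct_conj' hρ inLieAlg_gradingElt C v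
  rw [h1, hv, map_smul] at this
  exact this

theorem swapElt_shift (hρ : IsSmoothRep ρ) {μ : ℝ} {v : V}
    (hv : infAct ρ (gradingElt n) v = μ • v) :
    infAct ρ (gradingElt n) (ρ (swapElt n) v) = (-μ) • ρ (swapElt n) v := by
  have h1 : (swapElt n).1.1 * gradingElt n * ((swapElt n)⁻¹).1.1 = - gradingElt n := by
    change gram n * gradingElt n * gram n = - gradingElt n
    rw [Matrix.ext_iff_mulVec]
    intro x
    rw [← Matrix.mulVec_mulVec, ← Matrix.mulVec_mulVec, Matrix.neg_mulVec]
    funext p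
    rw [gram_mulVec]
    rcases p with _ | p | _ <;>
      simp [gradingElt, blockDiag, mulVec, dotProduct, Fintype.sum_sum_type] <;>
      simp [gram]
  have := infAct_conj' hρ inLieAlg_gradingElt (swapElt n) v
  rw [h1, hv, map_smul, infAct_neg hρ inLieAlg_gradingElt, _root_.neg_apply, neg_eq_iff_eq_neg]
    at this
  rw [this, neg_smul]

/-- For a unit coordinate vector, `e` in `g_1` and `f` in `g_{-1}` satisfy `[e, f] = E`, `[E, e] =
e` and `[E, f] = -f`. Hence `(2E, 2e, f)` acts as an `sl₂` triple and `2E` has a natural number as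
eigenvalue. In particular `E` has a real eigenvalue on the real space `V`. -/
theorem exists_weight (hn : 0 < n) (hρ : IsSmoothRep ρ) (hirr : ρ.IsIrreducible) :
    ∃ k : ℕ, Module.End.HasEigenvalue (infAct ρ (gradingElt n)).toLinearMap ((k : ℝ) / 2) := by
  have := nontrivial_of_irreducible hirr
  set x : Fin n → ℝ := Pi.single ⟨0, hn⟩ 1
  have hb : gPlus x * gMinus x - gMinus x * gPlus x = gradingElt n := by
    rw [gPlus_bracket_gMinus]
    have e1 : ∑ i, x i * x i = 1 := by simp [x, Pi.single_apply]
    have e2 : (Matrix.of fun i j => x i * x j - x i * x j) = 0 := by ext; simp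
    have e3 : gOrth (0 : Matrix (Fin n) (Fin n) ℝ) = 0 := by simpa using gOrth_smul 0 0
    rw [e1, e2, e3]; simp
  set E := (infAct ρ (gradingElt n)).toLinearMap with hE
  set e := (infAct ρ (gPlus x)).toLinearMap with he
  set f := (infAct ρ (gMinus x)).toLinearMap with hf
  have h1 : E * e - e * E = e := by
    ext v
    have := infAct_bracket hρ inLieAlg_gradingElt (inLieAlg_gPlus x) v
    rw [gradingElt_bracket_gPlus] at this
    exact this.symm
  have h2 : E * f - f * E = -f := by
    ext v
    have := infAct_bracket hρ inLieAlg_gradingElt (inLieAlg_gMinus x) v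
    rw [gradingElt_bracket_gMinus, infAct_neg hρ (inLieAlg_gMinus x)] at this
    exact this.symm
  have h3 : e * f - f * e = E := by
    ext v
    have := infAct_bracket hρ (inLieAlg_gPlus x) (inLieAlg_gMinus x) v
    rw [hb] at this
    exact this.symm
  obtain ⟨k, hk⟩ := exists_nat_eigenvalue ((2 : ℝ) • E) ((2 : ℝ) • e) f
    (by rw [smul_mul_smul_comm, smul_mul_smul_comm, ← smul_sub, h1, smul_smul])
    (by rw [smul_mul_assoc, mul_smul_comm, ← smul_sub, h2, smul_neg])
    (by rw [smul_mul_assoc, mul_smul_comm, ← smul_sub, h3])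
  refine ⟨k, ?_⟩
  obtain ⟨v, hv⟩ := hk.exists_hasEigenvector
  refine Module.End.hasEigenvalue_of_hasEigenvector (x := v)
    (Module.End.hasEigenvector_iff.2 ⟨Module.End.mem_eigenspace_iff.2 ?_, hv.2⟩)
  have h4 := hv.apply_eq_smul
  rw [LinearMap.smul_apply] at h4
  rw [div_eq_inv_mul, mul_smul, ← h4, smul_smul]; norm_num

/-- The grading of an irreducible representation. -/
theorem exists_grading (hn : 0 < n) (hρ : IsSmoothRep ρ) (hirr : ρ.IsIrreducible) :
    iSupIndep (gradePart ρ) ∧ (⨆ j : ℤ, gradePart ρ j) = ⊤ ∧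
      ∃ N : ℕ, ∀ j : ℤ, j < 0 ∨ (N : ℤ) < j → gradePart ρ j = ⊥ := by
  obtain ⟨k, hk⟩ := exists_weight hn hρ hirr
  set E : Module.End ℝ V := (infAct ρ (gradingElt n)).toLinearMap with hE
  have hind := E.eigenspaces_iSupIndep
  -- The sum of the eigenspaces with eigenvalues in `k/2 + ℤ`. It is nonzero by `exists_weight` and
  -- will be shown to be invariant.
  set W : Submodule ℝ V := ⨆ j : ℤ, E.eigenspace ((k : ℝ) / 2 + j) with hW
  have hmem : ∀ (j : ℤ) (v : V), infAct ρ (gradingElt n) v = ((k : ℝ) / 2 + j) • v → v ∈ W :=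
    fun j v hv => Submodule.mem_iSup_of_mem j (Module.End.mem_eigenspace_iff.2 hv)
  have hstab : ∀ T : V →ₗ[ℝ] V, (∀ (j : ℤ) (v : V), infAct ρ (gradingElt n) v
      = ((k : ℝ) / 2 + j) • v → T v ∈ W) → ∀ v ∈ W, T v ∈ W := by
    intro T hT v hv
    have : W ≤ W.comap T := iSup_le fun j v hv => hT j v (Module.End.mem_eigenspace_iff.1 hv)
    exact this hv
  have hne : W ≠ ⊥ := by
    obtain ⟨v, hv⟩ := hk.exists_hasEigenvector
    intro h
    have h1 := hmem 0 v (hv.apply_eq_smul.trans (by simp))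
    rw [h] at h1
    exact hv.2 (by simpa using h1)
  have htop : W = ⊤ := by
    refine irreducible_eq_top hirr W hne fun C => ?_
    refine orthGroup_induction (P := fun C => ∀ v ∈ W, ρ C v ∈ W) ?_ ?_ ?_ ?_ ?_ C
    · intro C D hC hD v hv
      rw [map_mul]
      exact hC _ (hD _ hv)
    · intro X v hv
      refine rep_expElt_mem hρ _ W ?_ hv
      refine hstab (infAct ρ (gMinus X)).toLinearMap fun j v hv => hmem (j - 1) _ ?_
      refine (gMinus_shift hρ X hv).trans ?_
      push_cast; rw [add_sub_assoc]
    · intro X v hv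
      refine rep_expElt_mem hρ _ W ?_ hv
      refine hstab (infAct ρ (gPlus X)).toLinearMap fun j v hv => hmem (j + 1) _ ?_
      refine (gPlus_shift hρ X hv).trans ?_
      push_cast; rw [add_assoc]
    -- The exchange of `e_0` and `e_{n+1}` turns `E` into `-E`, and the coset `k/2 + ℤ` is symmetric
    -- under sign because `k` is an integer.
    · refine hstab _ fun j v hv => hmem (-k - j) _ ?_
      refine (swapElt_shift hρ hv).trans ?_
      congr 1; push_cast; ring
    · intro C a c A hC
      exact hstab _ fun j v hv => hmem j _ (rep_blockDiag_shift hρ hC hv)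
  -- Eigenspaces are independent, so once `W` is everything there is no room for an eigenvalue
  -- outside the coset.
  have heig : ∀ ν : ℝ, E.HasEigenvalue ν → ∃ j : ℤ, ν = (k : ℝ) / 2 + j := by
    intro ν hν
    by_contra! hcon
    have h1 := hind ν
    have h2 : W ≤ ⨆ μ, ⨆ _ : μ ≠ ν, E.eigenspace μ :=
      iSup_le fun j => le_iSup₂_of_le ((k : ℝ) / 2 + j) (hcon j).symm le_rfl
    rw [htop, top_le_iff] at h2
    rw [h2, disjoint_top] at h1
    exact hν h1
  set T : Set ℝ := {μ : ℝ | E.HasEigenvalue μ} with hT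
  have hfin : T.Finite := E.finite_hasEigenvalue
  have hlow : lowestWeight ρ ∈ T := Set.Nonempty.csInf_mem ⟨_, hk⟩ hfin
  obtain ⟨j0, hj0⟩ := heig _ hlow
  have hlow_le : ∀ μ ∈ T, lowestWeight ρ ≤ μ := fun μ hμ => csInf_le hfin.bddBelow hμ
  obtain ⟨b, hb⟩ := hfin.bddAbove
  have hpart : ∀ j, gradePart ρ j = E.eigenspace (lowestWeight ρ + j) := fun j => rfl
  -- Here `b` is an upper bound of the eigenvalues; the last components may be zero.
  refine ⟨?_, ?_, ⌈b - lowestWeight ρ⌉₊, ?_⟩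
  · refine hind.comp (f := fun j : ℤ => lowestWeight ρ + (j : ℝ)) fun i j hij => ?_
    simpa using hij
  · rw [← htop, hW]
    refine (Equiv.addLeft j0).iSup_congr fun j => ?_
    rw [hpart, hj0]
    congr 1
    simp [add_assoc]
  · intro j hj
    rw [hpart]
    by_contra hcon
    have h1 : E.HasEigenvalue (lowestWeight ρ + j) := hcon
    rcases hj with hj | hj
    · have := hlow_le _ h1
      have : (j : ℝ) < 0 := by exact_mod_cast hj
      linarith
    · have h2 := hb h1
      have h3 := Nat.le_ceil (b - lowestWeight ρ)
      have h4 : ((⌈b - lowestWeight ρ⌉₊ : ℤ) : ℝ) < j := by exact_mod_cast hj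
      push_cast at h4
      linarith

theorem exists_isInternal (hn : 0 < n) (hρ : IsSmoothRep ρ) (hirr : ρ.IsIrreducible) :
    ∃ N : ℕ, DirectSum.IsInternal fun j : Fin (N + 1) => gradePart ρ (j : ℕ) := by
  obtain ⟨hind, htop, N, hN⟩ := exists_grading hn hρ hirr
  refine ⟨N, (DirectSum.isInternal_submodule_iff_iSupIndep_and_iSup_eq_top _).2 ⟨?_, ?_⟩⟩
  · refine hind.comp (f := fun j : Fin (N + 1) => ((j : ℕ) : ℤ)) fun i j hij => ?_
    exact Fin.ext (by simpa using hij)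
  · rw [← htop]
    refine le_antisymm (iSup_le fun j => le_iSup (gradePart ρ) ((j : ℕ) : ℤ)) (iSup_le fun j => ?_)
    by_cases h : j < 0 ∨ (N : ℤ) < j
    · rw [hN j h]; exact bot_le
    · push Not at h
      obtain ⟨m, rfl⟩ := Int.eq_ofNat_of_zero_le h.1
      exact le_iSup (fun j : Fin (N + 1) => gradePart ρ (j : ℕ)) ⟨m, by omega⟩

theorem gradePart_isCompl (hind : iSupIndep (gradePart ρ)) (htop : (⨆ j : ℤ, gradePart ρ j) = ⊤)
    (j : ℤ) : IsCompl (gradePart ρ j) (⨆ i : ℤ, ⨆ _ : i ≠ j, gradePart ρ i) := by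
  refine ⟨hind j, codisjoint_iff.2 (top_le_iff.1 ?_)⟩
  rw [← htop]
  refine iSup_le fun i => ?_
  by_cases h : i = j
  · subst h; exact le_sup_left
  · exact le_sup_of_le_right (le_iSup₂_of_le i h le_rfl)

theorem gradeProj_of_mem (hind : iSupIndep (gradePart ρ)) (htop : (⨆ j : ℤ, gradePart ρ j) = ⊤)
    (i j : ℤ) {v : V} (hv : v ∈ gradePart ρ i) : gradeProj ρ j v = if i = j then v else 0 := by
  have h := gradePart_isCompl hind htop j
  rw [gradeProj, dif_pos h]
  split_ifs with hij
  · subst hij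
    simpa using congrArg Subtype.val (Submodule.projectionOnto_apply_left h ⟨v, hv⟩)
  · have hv' : v ∈ ⨆ i : ℤ, ⨆ _ : i ≠ j, gradePart ρ i :=
      (le_iSup₂_of_le i hij le_rfl : gradePart ρ i ≤ _) hv
    simpa using congrArg Subtype.val (Submodule.projectionOnto_apply_right h ⟨v, hv'⟩)

theorem grade_ext {F : Type*} [AddCommGroup F] [Module ℝ F]
    (htop : (⨆ j : ℤ, gradePart ρ j) = ⊤) {S T : V →ₗ[ℝ] F}
    (h : ∀ i, ∀ v ∈ gradePart ρ i, S v = T v) (v : V) : S v = T v := by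
  have : (⊤ : Submodule ℝ V) ≤ LinearMap.eqLocus S T := by
    rw [← htop]
    exact iSup_le fun i v hv => h i v hv
  exact this trivial

/-- An operator of degree `d` shifts the projections on the components. -/
theorem gradeProj_shift (hind : iSupIndep (gradePart ρ)) (htop : (⨆ j : ℤ, gradePart ρ j) = ⊤)
    {T : V →ₗ[ℝ] V} {d : ℤ} (hT : ∀ i, ∀ v ∈ gradePart ρ i, T v ∈ gradePart ρ (i + d)) (j : ℤ)
    (v : V) : gradeProj ρ (j + d) (T v) = T (gradeProj ρ j v) := by
  refine grade_ext (S := gradeProj ρ (j + d) ∘ₗ T) (T := T ∘ₗ gradeProj ρ j) htop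
    (fun i v hv => ?_) v
  rw [LinearMap.comp_apply, LinearMap.comp_apply, gradeProj_of_mem hind htop i j hv,
    gradeProj_of_mem hind htop (i + d) (j + d) (hT i v hv)]
  by_cases h : i = j <;> simp [h]

theorem gradeProj_gMinus (hρ : IsSmoothRep ρ) (hind : iSupIndep (gradePart ρ))
    (htop : (⨆ j : ℤ, gradePart ρ j) = ⊤) (X : Fin n → ℝ) (j : ℤ) (v : V) :
    gradeProj ρ j (infAct ρ (gMinus X) v) = infAct ρ (gMinus X) (gradeProj ρ (j + 1) v) := by
  have := gradeProj_shift hind htop (T := (infAct ρ (gMinus X)).toLinearMap) (d := -1)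
    (fun i v hv => ?_) (j + 1) v
  · simpa using this
  · rw [mem_gradePart] at hv ⊢
    refine (gMinus_shift hρ X hv).trans ?_
    push_cast; rw [add_sub_assoc, sub_eq_add_neg]

theorem gradeProj_gPlus (hρ : IsSmoothRep ρ) (hind : iSupIndep (gradePart ρ))
    (htop : (⨆ j : ℤ, gradePart ρ j) = ⊤) (Z : Fin n → ℝ) (j : ℤ) (v : V) :
    gradeProj ρ j (infAct ρ (gPlus Z) v) = infAct ρ (gPlus Z) (gradeProj ρ (j - 1) v) := by
  have := gradeProj_shift hind htop (T := (infAct ρ (gPlus Z)).toLinearMap) (d := 1)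
    (fun i v hv => ?_) (j - 1) v
  · simpa using this
  · rw [mem_gradePart] at hv ⊢
    refine (gPlus_shift hρ Z hv).trans ?_
    push_cast; rw [add_assoc]

theorem gradeProj_gOrth (hρ : IsSmoothRep ρ) (hind : iSupIndep (gradePart ρ))
    (htop : (⨆ j : ℤ, gradePart ρ j) = ⊤) {A : Matrix (Fin n) (Fin n) ℝ}
    (hA : ∀ i j, A i j = - A j i) (j : ℤ) (v : V) :
    gradeProj ρ j (infAct ρ (gOrth A) v) = infAct ρ (gOrth A) (gradeProj ρ j v) := by
  have := gradeProj_shift hind htop (T := (infAct ρ (gOrth A)).toLinearMap) (d := 0)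
    (fun i v hv => ?_) j v
  · simpa using this
  · rw [add_zero]
    rw [mem_gradePart] at hv ⊢
    exact gOrth_shift hρ hA hv

end Grading

/-! ### Faithfulness of a nonzero infinitesimal action. -/

section Faithful

variable {n : ℕ} {V : Type*} [NormedAddCommGroup V] [NormedSpace ℝ V] [FiniteDimensional ℝ V]
  {ρ : Representation ℝ (orthGroup n) V}

open Matrix

theorem infAct_bracket_eq_zero (hρ : IsSmoothRep ρ) {A B : Matrix (Idx n) (Idx n) ℝ}
    (hA : InLieAlg A) (hB : InLieAlg B) (h : infAct ρ A = 0) : infAct ρ (A * B - B * A) = 0 := by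
  ext v
  rw [infAct_bracket hρ hA hB, h]; simp

/-- The kernel is an ideal, and `E` generates `o(b)` as an ideal: brackets with `E` give `g_{-1}`
and `g_1`, and the brackets of these give `o(n)` modulo `E`. -/
theorem infAct_eq_zero_of_gradingElt (hρ : IsSmoothRep ρ) (h : infAct ρ (gradingElt n) = 0)
    {B : Matrix (Idx n) (Idx n) ℝ} (hB : InLieAlg B) : infAct ρ B = 0 := by
  have hm : ∀ X : Fin n → ℝ, infAct ρ (gMinus X) = 0 := fun X => by
    have := infAct_bracket_eq_zero hρ inLieAlg_gradingElt (inLieAlg_gMinus X) h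
    rw [gradingElt_bracket_gMinus, infAct_neg hρ (inLieAlg_gMinus X)] at this
    simpa using this
  have hp : ∀ Z : Fin n → ℝ, infAct ρ (gPlus Z) = 0 := fun Z => by
    have := infAct_bracket_eq_zero hρ inLieAlg_gradingElt (inLieAlg_gPlus Z) h
    rwa [gradingElt_bracket_gPlus] at this
  have hsk : ∀ Z X : Fin n → ℝ, InLieAlg
      (gOrth (Matrix.of fun i j => Z i * X j - X i * Z j)) := fun Z X =>
    inLieAlg_gOrth fun i j => by simp only [Matrix.of_apply]; ring
  have ho : ∀ Z X : Fin n → ℝ,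
      infAct ρ (gOrth (Matrix.of fun i j => Z i * X j - X i * Z j)) = 0 := fun Z X => by
    have := infAct_bracket_eq_zero hρ (inLieAlg_gPlus Z) (inLieAlg_gMinus X) (hp Z)
    rw [gPlus_bracket_gMinus, infAct_add hρ (inLieAlg_gradingElt.smul _) (hsk Z X),
      infAct_smul hρ _ inLieAlg_gradingElt, h] at this
    simpa using this
  obtain ⟨a, A, X, Z, hA, rfl⟩ := hB.decompose
  have h1 : infAct ρ (gOrth A) = 0 := by
    -- A skew matrix is half the sum of the wedges of the coordinate vectors `e_i` with its rows,
    -- and each such wedge is the `o(n)`-part of a bracket of `g_1` with `g_{-1}`.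
    have e : gOrth A = ∑ i, (1 / 2 : ℝ) • gOrth (Matrix.of fun k l =>
        (Pi.single i 1 : Fin n → ℝ) k * A i l - A i k * (Pi.single i 1 : Fin n → ℝ) l) := by
      ext p q
      simp only [Matrix.sum_apply, Matrix.smul_apply]
      rcases p with _ | k | _ <;> rcases q with _ | l | _ <;>
        simp [gOrth, blockDiag, Pi.single_apply, mul_sub, Finset.sum_sub_distrib]
      rw [hA l k]; ring
    rw [e, infAct_sum hρ fun i _ => (hsk (Pi.single i 1) (A i)).smul _]
    refine Finset.sum_eq_zero fun i _ => ?_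
    rw [infAct_smul hρ _ (hsk (Pi.single i 1) (A i)), ho, smul_zero]
  rw [infAct_add hρ (((inLieAlg_gradingElt.smul a).add (inLieAlg_gOrth hA)).add
      (inLieAlg_gMinus X)) (inLieAlg_gPlus Z),
    infAct_add hρ ((inLieAlg_gradingElt.smul a).add (inLieAlg_gOrth hA)) (inLieAlg_gMinus X),
    infAct_add hρ (inLieAlg_gradingElt.smul a) (inLieAlg_gOrth hA),
    infAct_smul hρ a inLieAlg_gradingElt, h, h1, hm, hp]
  simp

/-- The bracket of `gPlus Z` with `gMinus Z` is `|Z|² E`, which acts by zero only if `Z = 0`. -/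
theorem eq_zero_of_infAct_gPlus (hρ : IsSmoothRep ρ) (hne : infAct ρ (gradingElt n) ≠ 0)
    {Z : Fin n → ℝ} (h : infAct ρ (gPlus Z) = 0) : Z = 0 := by
  have h1 := infAct_bracket_eq_zero hρ (inLieAlg_gPlus Z) (inLieAlg_gMinus Z) h
  have e2 : (Matrix.of fun i j => Z i * Z j - Z i * Z j) = 0 := by ext; simp
  have e3 : gOrth (0 : Matrix (Fin n) (Fin n) ℝ) = 0 := by simpa using gOrth_smul 0 0
  rw [gPlus_bracket_gMinus, e2, e3, add_zero, infAct_smul hρ _ inLieAlg_gradingElt,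
    smul_eq_zero, or_iff_left hne, Finset.sum_eq_zero_iff_of_nonneg fun i _ => mul_self_nonneg _]
    at h1
  funext i
  exact mul_self_eq_zero.1 (h1 i (Finset.mem_univ i))

theorem eq_zero_of_infAct_gMinus (hρ : IsSmoothRep ρ) (hne : infAct ρ (gradingElt n) ≠ 0)
    {X : Fin n → ℝ} (h : infAct ρ (gMinus X) = 0) : X = 0 := by
  have h1 := infAct_bracket_eq_zero hρ (inLieAlg_gMinus X) (inLieAlg_gPlus X) h
  have e2 : (Matrix.of fun i j => X i * X j - X i * X j) = 0 := by ext; simp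
  have e3 : gOrth (0 : Matrix (Fin n) (Fin n) ℝ) = 0 := by simpa using gOrth_smul 0 0
  rw [← neg_sub, gPlus_bracket_gMinus, e2, e3, add_zero,
    infAct_neg hρ (inLieAlg_gradingElt.smul _), infAct_smul hρ _ inLieAlg_gradingElt, neg_eq_zero,
    smul_eq_zero, or_iff_left hne, Finset.sum_eq_zero_iff_of_nonneg fun i _ => mul_self_nonneg _]
    at h1
  funext i
  exact mul_self_eq_zero.1 (h1 i (Finset.mem_univ i))

/-- If the infinitesimal action does not vanish, it is injective on `o(n) ⊕ g_1`. -/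
theorem infAct_faithful (hρ : IsSmoothRep ρ)
    (hne : ∃ B : Matrix (Idx n) (Idx n) ℝ, InLieAlg B ∧ infAct ρ B ≠ 0)
    {A : Matrix (Fin n) (Fin n) ℝ} (hA : ∀ i j, A i j = - A j i) {Z : Fin n → ℝ}
    (h : infAct ρ (gOrth A) = infAct ρ (gPlus Z)) : A = 0 ∧ Z = 0 := by
  have hE : infAct ρ (gradingElt n) ≠ 0 := by
    obtain ⟨B, hB, hB0⟩ := hne
    exact fun h => hB0 (infAct_eq_zero_of_gradingElt hρ h hB)
  have hZ : Z = 0 := by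
    refine eq_zero_of_infAct_gPlus hρ hE ?_
    -- The difference `gOrth A - gPlus Z` lies in the kernel, and its bracket with `E` isolates the
    -- part in `g_1`, since `E` commutes with `o(n)`.
    have h1 := infAct_bracket_eq_zero hρ ((inLieAlg_gOrth hA).sub (inLieAlg_gPlus Z))
      inLieAlg_gradingElt (by
        rw [infAct_sub hρ (inLieAlg_gOrth hA) (inLieAlg_gPlus Z), h, sub_self])
    have e : (gOrth A - gPlus Z) * gradingElt n - gradingElt n * (gOrth A - gPlus Z) = gPlus Z := by
      have e1 := gradingElt_bracket_blockDiag (n := n) 0 0 A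
      have e2 := gradingElt_bracket_gPlus Z
      rw [Matrix.sub_mul, Matrix.mul_sub, gOrth]
      rw [sub_eq_iff_eq_add] at e1 e2
      rw [e1, e2]; abel
    rwa [e] at h1
  refine ⟨?_, hZ⟩
  have h0 : infAct ρ (gOrth A) = 0 := by
    rw [h, hZ]
    have : gPlus (0 : Fin n → ℝ) = 0 := by simpa using gPlus_smul 0 0
    rw [this, infAct_zero hρ]
  -- Bracketing `gOrth A` with `gMinus X` gives `gMinus (A X)`, so `A X = 0` for all `X`.
  rw [Matrix.ext_iff_mulVec]
  intro X
  rw [Matrix.zero_mulVec]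
  refine eq_zero_of_infAct_gMinus hρ hE ?_
  have h1 := infAct_bracket_eq_zero hρ (inLieAlg_gOrth hA) (inLieAlg_gMinus X) h0
  rwa [gOrth_bracket_gMinus A hA] at h1

end Faithful
end
end ConformalBGG

open scoped Manifold ContDiff Bundle Topology
open Filter
namespace ConformalBGG
noncomputable section
set_option linter.unusedSectionVars false

/-! ### The conformal Cartan connection and its structure equation. -/

section Cartan

variable {n : ℕ} {M : Type*} [TopologicalSpace M]
  [ChartedSpace (EuclideanSpace ℝ (Fin n)) M] [IsManifold (𝓡 n) ∞ M]

local notation "⟦" X ", " Y "⟧" => VectorField.mlieBracket (𝓡 n) X Y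

/-- `e` is a smooth orthonormal frame near `x`. -/
structure IsFrameNear (g : MetricField n M) (e : Fin n → RoughField n M) (x : M) : Prop where
  near : ∀ i, FieldNear (e i) x
  orth : ∀ᶠ y in 𝓝 x, ∀ i j, g y (e i y) (e j y) = if i = j then 1 else 0

/-- The connection form `ω(X)` in the frame `e`. -/
def connForm (g : MetricField n M) (e : Fin n → RoughField n M) (X : RoughField n M) (y : M) :
    Matrix (Fin n) (Fin n) ℝ :=
  Matrix.of fun i j => g y (leviCivita g X (e j) y) (e i y)

/-- The coordinates of `X` in the frame `e`. -/
def coframe (g : MetricField n M) (e : Fin n → RoughField n M) (X : RoughField n M) (y : M) :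
    Fin n → ℝ := fun i => g y (X y) (e i y)

/-- The coordinates of `P(X)` in the frame `e`. -/
def schoutenForm (g : MetricField n M) (e : Fin n → RoughField n M) (X : RoughField n M) (y : M) :
    Fin n → ℝ := fun i => schouten g y (X y) (e i y)

/-- The conformal Cartan connection in the frame `e`. -/
def cartanMat (g : MetricField n M) (e : Fin n → RoughField n M) (X : RoughField n M) (y : M) :
    Matrix (Idx n) (Idx n) ℝ :=
  gOrth (connForm g e X y) + gMinus (coframe g e X y) - gPlus (schoutenForm g e X y)

variable {g : MetricField n M} {x : M} {X Y Z : RoughField n M} {e : Fin n → RoughField n M}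

theorem IsFrameNear.eventually (he : IsFrameNear g e x) : ∀ᶠ y in 𝓝 x, IsFrameNear g e y := by
  filter_upwards [eventually_all.2 fun i => (he.near i).eventually,
    eventually_eventually_nhds.2 he.orth] with y h1 h2
  exact ⟨h1, h2⟩

theorem smoothNear_coframe (hg : MetricNear g x) (he : IsFrameNear g e x) (hX : FieldNear X x)
    (i : Fin n) : SmoothNear n (fun y => coframe g e X y i) x :=
  hg.self.smooth X (e i) hX (he.near i)

theorem smoothNear_connForm (hg : MetricNear g x) (he : IsFrameNear g e x) (hX : FieldNear X x)
    (i j : Fin n) : SmoothNear n (fun y => connForm g e X y i j) x :=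
  hg.self.smooth _ (e i) (hX.nabla hg (he.near j)) (he.near i)

theorem smoothNear_schoutenForm (hg : MetricNear g x) (he : IsFrameNear g e x)
    (hX : FieldNear X x) (i : Fin n) : SmoothNear n (fun y => schoutenForm g e X y i) x :=
  smoothNear_schouten hg hX (he.near i)

theorem connForm_skew (hg : MetricNear g x) (he : IsFrameNear g e x) (hX : FieldNear X x)
    (i j : Fin n) : connForm g e X x i j = - connForm g e X x j i := by
  have h1 := dirDeriv_ip hg hX (he.near i) (he.near j)
  have h2 : dirDeriv X (ip g (e i) (e j)) x = 0 := by
    rw [dirDeriv_congr (t := fun _ => if i = j then (1 : ℝ) else 0), dirDeriv_const]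
    filter_upwards [he.orth] with y hy
    exact hy i j
  rw [h2, hg.self.symm (e i x)] at h1
  simp only [connForm, Matrix.of_apply]
  linarith

/-- Metric compatibility, with the derivative of `e_i` expanded in the frame and the skew symmetry
of `ω` used to transpose its matrix. -/
theorem dirDeriv_coframe (hg : MetricNear g x) (he : IsFrameNear g e x) (hX : FieldNear X x)
    (hY : FieldNear Y x) (i : Fin n) :
    dirDeriv X (fun y => coframe g e Y y i) x = coframe g e (leviCivita g X Y) x i
      - ∑ k, connForm g e X x i k * coframe g e Y x k := by
  have h1 := dirDeriv_ip hg hX hY (he.near i)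
  rw [← hg.self.sum_inner he.orth.self_of_nhds (Y x)] at h1
  refine h1.trans ?_
  rw [sub_eq_add_neg, ← Finset.sum_neg_distrib]
  congr 1
  refine Finset.sum_congr rfl fun k _ => ?_
  rw [connForm_skew hg he hX]
  simp only [connForm, coframe, Matrix.of_apply]; ring

/-- Cartan's first structure equation; the left-hand side is the torsion in the frame. -/
theorem coframe_structure (hg : MetricNear g x) (he : IsFrameNear g e x) (hX : FieldNear X x)
    (hY : FieldNear Y x) (i : Fin n) :
    dirDeriv X (fun y => coframe g e Y y i) x - dirDeriv Y (fun y => coframe g e X y i) x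
      - coframe g e ⟦X, Y⟧ x i + (∑ k, connForm g e X x i k * coframe g e Y x k
        - ∑ k, connForm g e Y x i k * coframe g e X x k) = 0 := by
  rw [dirDeriv_coframe hg he hX hY, dirDeriv_coframe hg he hY hX]
  have : coframe g e ⟦X, Y⟧ x i = coframe g e (leviCivita g X Y) x i
      - coframe g e (leviCivita g Y X) x i := by
    simp only [coframe]
    rw [torsion_free hg hX hY, map_sub, _root_.sub_apply]
  rw [this]; ring

/-- Cartan's second structure equation, obtained by applying `dirDeriv_coframe` to the fields `∇_Y
e_j` and `∇_X e_j`. -/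
theorem connForm_structure (hg : MetricNear g x) (he : IsFrameNear g e x) (hX : FieldNear X x)
    (hY : FieldNear Y x) (i j : Fin n) :
    dirDeriv X (fun y => connForm g e Y y i j) x - dirDeriv Y (fun y => connForm g e X y i j) x
      - connForm g e ⟦X, Y⟧ x i j + (∑ k, connForm g e X x i k * connForm g e Y x k j
        - ∑ k, connForm g e Y x i k * connForm g e X x k j)
      = g x (riemann g x (X x) (Y x) (e j x)) (e i x) := by
  have h1 := dirDeriv_coframe hg he hX (hY.nabla hg (he.near j)) i
  have h2 := dirDeriv_coframe hg he hY (hX.nabla hg (he.near j)) i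
  rw [riemann_eq hg hX hY (he.near j), curvatureField, map_sub, map_sub, _root_.sub_apply,
    _root_.sub_apply]
  simp only [coframe] at h1 h2
  simp only [connForm, Matrix.of_apply] at h1 h2 ⊢
  rw [h1, h2]; ring

theorem schoutenForm_structure (hg : MetricNear g x) (he : IsFrameNear g e x) (hX : FieldNear X x)
    (hY : FieldNear Y x) (i : Fin n) :
    dirDeriv X (fun y => schoutenForm g e Y y i) x - dirDeriv Y (fun y => schoutenForm g e X y i) x
      - schoutenForm g e ⟦X, Y⟧ x i + (∑ k, connForm g e X x i k * schoutenForm g e Y x k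
        - ∑ k, connForm g e Y x i k * schoutenForm g e X x k) = cotton g X Y x (e i x) := by
  have key : ∀ {X Y : RoughField n M}, FieldNear X x → FieldNear Y x →
      schouten g x (Y x) (leviCivita g X (e i) x)
        = - ∑ k, connForm g e X x i k * schoutenForm g e Y x k := by
    intro X Y hX hY
    have hl := schouten_linear hg (Y x)
    have hs : ∀ v, schouten g x (Y x) v = hl.mk' _ v := fun _ => rfl
    conv_lhs => rw [hg.self.expand he.orth.self_of_nhds (leviCivita g X (e i) x)]
    rw [hs, map_sum, ← Finset.sum_neg_distrib]
    refine Finset.sum_congr rfl fun k _ => ?_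
    rw [map_smul, connForm_skew hg he hX, neg_mul, neg_neg]
    rfl
  rw [cotton_eq X Y (e i) hX hY (he.near i) hg, key hX hY, key hY hX]
  simp only [schoutenForm]; ring

/-- The correction terms agree with the `o(n)`-parts in `gPlus_bracket_gMinus`. For this reason the
curvature of the Cartan connection contains `W` in place of `R`. -/
theorem weyl_inner (hg : MetricNear g x) (i j : Fin n) :
    g x (weyl g x (X x) (Y x) (e j x)) (e i x)
      = g x (riemann g x (X x) (Y x) (e j x)) (e i x)
        + (schoutenForm g e Y x i * coframe g e X x j - coframe g e X x i * schoutenForm g e Y x j)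
        - (schoutenForm g e X x i * coframe g e Y x j
          - coframe g e Y x i * schoutenForm g e X x j) := by
  rw [weyl, map_add, map_sub, _root_.add_apply, _root_.sub_apply,
    inner_braceAct hg.self (schouten_linear hg _), inner_braceAct hg.self (schouten_linear hg _),
    schouten_symm hg (w := X x)]
  simp only [coframe, schoutenForm]
  rw [hg.self.symm (e j x) (X x), hg.self.symm (e j x) (Y x)]
  ring

section Brackets

open Matrix

theorem gOrth_bracket_gPlus {A : Matrix (Fin n) (Fin n) ℝ} (hA : ∀ i j, A i j = - A j i)
    (Z : Fin n → ℝ) : gOrth A * gPlus Z - gPlus Z * gOrth A = gPlus (A *ᵥ Z) := by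
  ext p q
  rcases p with _ | i | _ <;> rcases q with _ | j | _ <;>
    simp [gOrth, blockDiag, gPlus, Matrix.mul_apply, Fintype.sum_sum_type, mulVec, dotProduct]
  rw [← Finset.sum_neg_distrib]
  exact Finset.sum_congr rfl fun i _ => by rw [hA j i]; ring

theorem gOrth_bracket_gOrth (A B : Matrix (Fin n) (Fin n) ℝ) :
    gOrth A * gOrth B - gOrth B * gOrth A = gOrth (A * B - B * A) := by
  ext p q
  rcases p with _ | i | _ <;> rcases q with _ | j | _ <;>
    simp [gOrth, blockDiag, Matrix.mul_apply, Fintype.sum_sum_type]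

theorem gMinus_bracket_gMinus (X Y : Fin n → ℝ) :
    gMinus X * gMinus Y - gMinus Y * gMinus X = 0 := by
  ext p q
  rcases p with _ | i | _ <;> rcases q with _ | j | _ <;>
    simp [gMinus, Matrix.mul_apply, Fintype.sum_sum_type, mul_comm]

theorem gPlus_bracket_gPlus (X Y : Fin n → ℝ) :
    gPlus X * gPlus Y - gPlus Y * gPlus X = 0 := by
  ext p q
  rcases p with _ | i | _ <;> rcases q with _ | j | _ <;>
    simp [gPlus, Matrix.mul_apply, Fintype.sum_sum_type, mul_comm]

theorem graded_bracket {A A' : Matrix (Fin n) (Fin n) ℝ} (hA : ∀ i j, A i j = - A j i)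
    (hA' : ∀ i j, A' i j = - A' j i) (θ θ' P P' : Fin n → ℝ) :
    (gOrth A + gMinus θ - gPlus P) * (gOrth A' + gMinus θ' - gPlus P')
      - (gOrth A' + gMinus θ' - gPlus P') * (gOrth A + gMinus θ - gPlus P)
      = gOrth (A * A' - A' * A) + gMinus (A *ᵥ θ') - gMinus (A' *ᵥ θ)
        - gPlus (A *ᵥ P') + gPlus (A' *ᵥ P)
        + ((∑ i, P' i * θ i) • gradingElt n
          + gOrth (Matrix.of fun i j => P' i * θ j - θ i * P' j))
        - ((∑ i, P i * θ' i) • gradingElt n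
          + gOrth (Matrix.of fun i j => P i * θ' j - θ' i * P j)) := by
  rw [← gOrth_bracket_gOrth, ← gOrth_bracket_gMinus A hA, ← gOrth_bracket_gMinus A' hA',
    ← gOrth_bracket_gPlus hA, ← gOrth_bracket_gPlus hA', ← gPlus_bracket_gMinus,
    ← gPlus_bracket_gMinus]
  have h1 := gMinus_bracket_gMinus θ θ'
  have h2 := gPlus_bracket_gPlus P P'
  rw [sub_eq_zero] at h1 h2
  simp only [Matrix.add_mul, Matrix.mul_add, Matrix.sub_mul, Matrix.mul_sub, h1, h2]
  abel

theorem gMinus_sub (X Y : Fin n → ℝ) : gMinus (X - Y) = gMinus X - gMinus Y := by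
  rw [eq_sub_iff_add_eq, ← gMinus_add, sub_add_cancel]

theorem gPlus_sub (X Y : Fin n → ℝ) : gPlus (X - Y) = gPlus X - gPlus Y := by
  rw [eq_sub_iff_add_eq, ← gPlus_add, sub_add_cancel]

theorem gOrth_sub (A B : Matrix (Fin n) (Fin n) ℝ) : gOrth (A - B) = gOrth A - gOrth B := by
  rw [eq_sub_iff_add_eq, ← gOrth_add, sub_add_cancel]

/-- The three components of the structure equation. -/
theorem graded_structure {A A' D₁ D₂ D₃ W : Matrix (Fin n) (Fin n) ℝ}
    (hA : ∀ i j, A i j = - A j i) (hA' : ∀ i j, A' i j = - A' j i)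
    {θ θ' P P' t₁ t₂ t₃ p₁ p₂ p₃ c : Fin n → ℝ} (h0 : ∑ i, P' i * θ i = ∑ i, P i * θ' i)
    (h1 : t₁ - t₂ - t₃ + (A *ᵥ θ' - A' *ᵥ θ) = 0)
    (h2 : W = D₁ - D₂ - D₃ + (A * A' - A' * A) + (Matrix.of fun i j => P' i * θ j - θ i * P' j)
      - (Matrix.of fun i j => P i * θ' j - θ' i * P j))
    (h3 : c = p₁ - p₂ - p₃ + (A *ᵥ P' - A' *ᵥ P)) :
    (gOrth D₁ + gMinus t₁ - gPlus p₁) - (gOrth D₂ + gMinus t₂ - gPlus p₂)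
      - (gOrth D₃ + gMinus t₃ - gPlus p₃)
      + ((gOrth A + gMinus θ - gPlus P) * (gOrth A' + gMinus θ' - gPlus P')
        - (gOrth A' + gMinus θ' - gPlus P') * (gOrth A + gMinus θ - gPlus P))
      = gOrth W - gPlus c := by
  have h1' := congrArg gMinus h1
  have hz : gMinus (0 : Fin n → ℝ) = 0 := by simpa using gMinus_smul 0 0
  rw [hz, gMinus_add, gMinus_sub, gMinus_sub, gMinus_sub] at h1'
  rw [graded_bracket hA hA', h0, h2, h3]
  simp only [gOrth_add, gOrth_sub, gPlus_add, gPlus_sub]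
  rw [← sub_eq_zero, ← h1']
  abel

end Brackets

theorem dirDeriv_cartanMat (p q : Idx n) :
    dirDeriv X (fun y => cartanMat g e Y y p q) x
      = (gOrth (Matrix.of fun i j => dirDeriv X (fun y => connForm g e Y y i j) x)
        + gMinus (fun i => dirDeriv X (fun y => coframe g e Y y i) x)
        - gPlus (fun i => dirDeriv X (fun y => schoutenForm g e Y y i) x)) p q := by
  rcases p with _ | i | _ <;> rcases q with _ | j | _ <;>
    simp [cartanMat, gOrth, blockDiag, gMinus, gPlus, dirDeriv_const, dirDeriv_neg]

theorem smoothNear_cartanMat (hg : MetricNear g x) (he : IsFrameNear g e x) (hX : FieldNear X x)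
    (p q : Idx n) : SmoothNear n (fun y => cartanMat g e X y p q) x := by
  rcases p with _ | i | _ <;> rcases q with _ | j | _ <;>
    simp [cartanMat, gOrth, blockDiag, gMinus, gPlus, SmoothNear.const,
      smoothNear_connForm hg he hX, smoothNear_coframe hg he hX, smoothNear_schoutenForm hg he hX,
      SmoothNear.neg (smoothNear_coframe hg he hX _),
      SmoothNear.neg (smoothNear_schoutenForm hg he hX _)]

/-- The structure equation of the conformal Cartan connection: its curvature has components
the Weyl curvature and the Cotton-York tensor. -/
theorem cartan_structure (hg : MetricNear g x) (he : IsFrameNear g e x) (hX : FieldNear X x)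
    (hY : FieldNear Y x) (p q : Idx n) :
    dirDeriv X (fun y => cartanMat g e Y y p q) x - dirDeriv Y (fun y => cartanMat g e X y p q) x
      - cartanMat g e ⟦X, Y⟧ x p q
      + (cartanMat g e X x * cartanMat g e Y x - cartanMat g e Y x * cartanMat g e X x) p q
      = (gOrth (Matrix.of fun i j => g x (weyl g x (X x) (Y x) (e j x)) (e i x))
        - gPlus (fun i => cotton g X Y x (e i x))) p q := by
  -- Symmetry of the Schouten tensor, which makes the `E`-component of the curvature vanish.
  have h0 : ∑ i, schoutenForm g e Y x i * coframe g e X x i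
      - ∑ i, schoutenForm g e X x i * coframe g e Y x i = 0 := by
    have key : ∀ X Y : RoughField n M, ∑ i, schoutenForm g e Y x i * coframe g e X x i
        = schouten g x (Y x) (X x) := fun X Y => by
      have hl := schouten_linear hg (Y x)
      have hs : ∀ v, schouten g x (Y x) v = hl.mk' _ v := fun _ => rfl
      conv_rhs => rw [hg.self.expand he.orth.self_of_nhds (X x)]
      rw [hs, map_sum]
      refine Finset.sum_congr rfl fun k _ => ?_
      rw [map_smul, mul_comm]; rfl
    rw [key, key, schouten_symm hg, sub_self]
  rw [dirDeriv_cartanMat, dirDeriv_cartanMat]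
  refine congrFun (congrFun (graded_structure (connForm_skew hg he hX) (connForm_skew hg he hY)
    (sub_eq_zero.1 h0) (funext fun i => coframe_structure hg he hX hY i) ?_
    (funext fun i => (schoutenForm_structure hg he hX hY i).symm)) p) q
  ext i j
  refine (weyl_inner hg i j).trans ?_
  rw [← connForm_structure hg he hX hY i j]
  rfl

theorem weyl_skew (hg : MetricNear g x) (i j : Fin n) : g x (weyl g x (X x) (Y x) (e j x)) (e i x)
      = - g x (weyl g x (X x) (Y x) (e i x)) (e j x) := by
  rw [weyl_inner hg, weyl_inner hg, riemann_skew hg]; ring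

end Cartan
end
end ConformalBGG

open scoped Manifold ContDiff Bundle Topology
open Filter
namespace ConformalBGG
noncomputable section
set_option linter.unusedSectionVars false

/-! ### The subgroup `O(n)` and its adjoint action on the graded parts. -/

section BlockDiag

variable {n : ℕ}

open Matrix

theorem blockDiag_mul (a a' c c' : ℝ) (A A' : Matrix (Fin n) (Fin n) ℝ) :
    blockDiag a A c * blockDiag a' A' c' = blockDiag (a * a') (A * A') (c * c') := by
  ext p q
  rcases p with _ | i | _ <;> rcases q with _ | j | _ <;>
    simp [blockDiag, Matrix.mul_apply, Fintype.sum_sum_type]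

theorem blockDiag_one : blockDiag 1 (1 : Matrix (Fin n) (Fin n) ℝ) 1 = 1 := by
  ext p q
  rcases p with _ | i | _ <;> rcases q with _ | j | _ <;> simp [blockDiag, Matrix.one_apply]

/-- The element `diag(1, A, 1)` of `O(n) ⊂ O(b)`. -/
def rotation (A : Matrix (Fin n) (Fin n) ℝ) (h : A * Aᵀ = 1) : orthGroup n :=
  ⟨⟨blockDiag 1 A 1, blockDiag 1 Aᵀ 1, by rw [blockDiag_mul, h, mul_one, blockDiag_one],
    by rw [blockDiag_mul, mul_eq_one_comm.1 h, mul_one, blockDiag_one]⟩, fun x y => by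
    have h' : Aᵀ * A = 1 := mul_eq_one_comm.1 h
    have e : ∀ z : Idx n → ℝ, ∀ i, (blockDiag 1 A 1 *ᵥ z) (.inr (.inl i))
        = (A *ᵥ fun j => z (.inr (.inl j))) i := fun z i => by
      simp [blockDiag, mulVec, dotProduct, Fintype.sum_sum_type]
    have e0 : ∀ z : Idx n → ℝ, (blockDiag 1 A 1 *ᵥ z) (.inl ()) = z (.inl ()) := fun z => by
      simp [blockDiag, mulVec, dotProduct, Fintype.sum_sum_type]
    have e1 : ∀ z : Idx n → ℝ, (blockDiag 1 A 1 *ᵥ z) (.inr (.inr ())) = z (.inr (.inr ())) :=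
      fun z => by simp [blockDiag, mulVec, dotProduct, Fintype.sum_sum_type]
    simp only [bForm, e, e0, e1]
    congr 1
    change (A *ᵥ _) ⬝ᵥ (A *ᵥ _) = _
    rw [Matrix.dotProduct_mulVec, Matrix.vecMul_mulVec, h', Matrix.vecMul_one]
    rfl⟩

theorem rotation_coe (A : Matrix (Fin n) (Fin n) ℝ) (h : A * Aᵀ = 1) :
    (rotation A h).1.1 = blockDiag 1 A 1 := rfl

theorem rotation_inv_coe (A : Matrix (Fin n) (Fin n) ℝ) (h : A * Aᵀ = 1) :
    ((rotation A h)⁻¹).1.1 = blockDiag 1 Aᵀ 1 := rfl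

theorem rotation_conj_gOrth {A : Matrix (Fin n) (Fin n) ℝ} (h : A * Aᵀ = 1)
    (B : Matrix (Fin n) (Fin n) ℝ) :
    (rotation A h).1.1 * gOrth B * ((rotation A h)⁻¹).1.1 = gOrth (A * B * Aᵀ) := by
  rw [rotation_coe, rotation_inv_coe, gOrth, blockDiag_mul, blockDiag_mul, gOrth]; simp

theorem rotation_conj_gMinus {A : Matrix (Fin n) (Fin n) ℝ} (h : A * Aᵀ = 1) (X : Fin n → ℝ) :
    (rotation A h).1.1 * gMinus X * ((rotation A h)⁻¹).1.1 = gMinus (A *ᵥ X) := by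
  rw [rotation_coe, rotation_inv_coe]
  ext p q
  rcases p with _ | i | _ <;> rcases q with _ | j | _ <;>
    simp [blockDiag, gMinus, Matrix.mul_apply, Fintype.sum_sum_type, mulVec, dotProduct, mul_comm]

theorem rotation_conj_gPlus {A : Matrix (Fin n) (Fin n) ℝ} (h : A * Aᵀ = 1) (Z : Fin n → ℝ) :
    (rotation A h).1.1 * gPlus Z * ((rotation A h)⁻¹).1.1 = gPlus (A *ᵥ Z) := by
  rw [rotation_coe, rotation_inv_coe]
  ext p q
  rcases p with _ | i | _ <;> rcases q with _ | j | _ <;>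
    simp [blockDiag, gPlus, Matrix.mul_apply, Fintype.sum_sum_type, mulVec, dotProduct, mul_comm]

end BlockDiag

/-! ### Change of frame and the induced Levi-Civita connection. -/

section Frames

variable {n : ℕ} {M : Type*} [TopologicalSpace M]
  [ChartedSpace (EuclideanSpace ℝ (Fin n)) M] [IsManifold (𝓡 n) ∞ M]
  {V : Type*} [NormedAddCommGroup V] [NormedSpace ℝ V] [FiniteDimensional ℝ V]
  {ρ : Representation ℝ (orthGroup n) V} {g : MetricField n M} {x : M}

open Matrix

/-- The vector fields of a frame. -/
def frameFields (e : ∀ y : M, Frame g y) (i : Fin n) : RoughField n M := fun y => (e y).1 i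

theorem SmoothFrameOn.isFrameNear {e : ∀ y : M, Frame g y} {U : Set M} (h : SmoothFrameOn e U)
    (hU : IsOpen U) (hx : x ∈ U) : IsFrameNear g (frameFields e) x := by
  refine ⟨fun i => ?_, Eventually.of_forall fun y => (e y).2⟩
  filter_upwards [hU.mem_nhds hx] with y hy
  exact (h i).contMDiffAt (hU.mem_nhds hy)

theorem IsFrameNear.exists_open {e : ∀ y : M, Frame g y} (h : IsFrameNear g (frameFields e) x) :
    ∃ U, IsOpen U ∧ x ∈ U ∧ SmoothFrameOn e U := by
  obtain ⟨U, hU, hUo, hxU⟩ := eventually_nhds_iff.1 (eventually_all.2 h.near)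
  exact ⟨U, hUo, hxU, fun i y hy => (hU y hy i).contMDiffWithinAt⟩

theorem exists_frame_through (hg : ∀ y, MetricNear g y) (u : Frame g x) :
    ∃ e : ∀ y : M, Frame g y, IsFrameNear g (frameFields e) x ∧ e x = u := by
  obtain ⟨e, he, heu, horth⟩ := (hg x).exists_frame u.1 u.2
  -- The local fields are orthonormal only near `x`. Elsewhere an arbitrary frame is chosen, since a
  -- frame has to be given at every point.
  have hex : ∀ y, ∃ w : Frame g y,
      (∀ i j, g y (e i y) (e j y) = if i = j then 1 else 0) → ∀ i, w.1 i = e i y := fun y => by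
    by_cases h : ∀ i j, g y (e i y) (e j y) = if i = j then 1 else 0
    · exact ⟨⟨fun i => e i y, h⟩, fun _ _ => rfl⟩
    · obtain ⟨w, hw⟩ := (hg y).self.exists_orthonormal
      exact ⟨⟨w, hw⟩, fun h' => absurd h' h⟩
  choose E hE using hex
  refine ⟨E, ⟨fun i => (he i).congr ?_, Eventually.of_forall fun y => (E y).2⟩, ?_⟩
  · filter_upwards [horth] with y hy
    exact hE y hy i
  · exact Subtype.ext (funext fun i => (hE x horth.self_of_nhds i).trans (heu i))

/-- Every frame at a point is the value of a frame that is smooth near it, so identities on the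
frame bundle may be checked along such local frames. -/
theorem frameFun_ext (hg : ∀ y, MetricNear g y) {s t : FrameFun g V}
    (h : ∀ (x : M) (e : ∀ y : M, Frame g y), IsFrameNear g (frameFields e) x →
      s x (e x) = t x (e x)) : s = t := by
  funext x u
  obtain ⟨e, he, rfl⟩ := exists_frame_through hg u
  exact h x e he

/-- The matrix of the frame `u'` with respect to the frame `u`. -/
def rotMat (u u' : Frame g x) : Matrix (Fin n) (Fin n) ℝ :=
  Matrix.of fun i j => g x (u'.1 j) (u.1 i)

theorem rotMat_transpose (hg : MetricNear g x) (u u' : Frame g x) :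
    (rotMat u u')ᵀ = rotMat u' u := by
  ext i j
  exact hg.self.symm _ _

theorem rotMat_mul (hg : MetricNear g x) (u u' u'' : Frame g x) :
    rotMat u u' * rotMat u' u'' = rotMat u u'' := by
  ext i j
  rw [Matrix.mul_apply]
  simp only [rotMat, Matrix.of_apply]
  rw [← hg.self.sum_inner u'.2 (u''.1 j) (u.1 i)]
  refine Finset.sum_congr rfl fun k _ => ?_
  rw [mul_comm, hg.self.symm (u'.1 k) (u.1 i)]

theorem rotMat_self (u : Frame g x) : rotMat u u = 1 := by
  ext i j
  rw [rotMat, Matrix.of_apply, u.2, Matrix.one_apply]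
  simp [eq_comm]

theorem rotMat_orth (hg : MetricNear g x) (u u' : Frame g x) :
    rotMat u u' * (rotMat u u')ᵀ = 1 := by
  rw [rotMat_transpose hg, rotMat_mul hg, rotMat_self]

theorem frame_expand (hg : MetricNear g x) (u u' : Frame g x) (j : Fin n) :
    u'.1 j = ∑ i, rotMat u u' i j • u.1 i := hg.self.expand u.2 (u'.1 j)

theorem rotMat_unique {u u' : Frame g x} {A : Matrix (Fin n) (Fin n) ℝ}
    (h : ∀ j, u'.1 j = ∑ i, A i j • u.1 i) : A = rotMat u u' := by
  ext i j
  rw [rotMat, Matrix.of_apply, h j]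
  simp [u.2]

/-- The element of `O(n) ⊂ O(b)` relating two frames. -/
def rotElt (hg : MetricNear g x) (u u' : Frame g x) : orthGroup n :=
  rotation (rotMat u u') (rotMat_orth hg u u')

theorem rotElt_mul (hg : MetricNear g x) (u u' u'' : Frame g x) :
    rotElt hg u u' * rotElt hg u' u'' = rotElt hg u u'' := by
  apply orthGroup_ext
  change blockDiag 1 _ 1 * blockDiag 1 _ 1 = blockDiag 1 _ 1
  rw [blockDiag_mul, rotMat_mul hg]; simp

theorem rotElt_self (hg : MetricNear g x) (u : Frame g x) : rotElt hg u u = 1 := by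
  apply orthGroup_ext
  change blockDiag 1 _ 1 = 1
  rw [rotMat_self, blockDiag_one]

theorem isSection_equivariant_iff (hg : ∀ y, MetricNear g y) {s : FrameFun g V} :
    (∀ (x : M) (u u' : Frame g x) (A : Matrix (Fin n) (Fin n) ℝ) (C : orthGroup n),
      C.1.1 = blockDiag 1 A 1 → (∀ j, u'.1 j = ∑ i, A i j • u.1 i) → ρ C (s x u') = s x u)
    ↔ ∀ (x : M) (u u' : Frame g x), ρ (rotElt (hg x) u u') (s x u') = s x u := by
  constructor
  · intro h x u u'
    exact h x u u' _ _ (rotation_coe _ _) (frame_expand (hg x) u u')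
  · intro h x u u' A C hC hA
    have : C = rotElt (hg x) u u' := orthGroup_ext (by rw [hC, rotMat_unique hA]; rfl)
    rw [this, h]

theorem IsSection.rot {s : FrameFun g V} (hg : ∀ y, MetricNear g y) (hs : IsSection ρ s)
    (u u' : Frame g x) : ρ (rotElt (hg x) u u') (s x u') = s x u :=
  (isSection_equivariant_iff hg).1 hs.equivariant x u u'

theorem IsSection.near {s : FrameFun g V} (hs : IsSection ρ s) {e : ∀ y : M, Frame g y}
    (he : IsFrameNear g (frameFields e) x) : SmoothNear n (fun y => s y (e y)) x := by
  obtain ⟨U, hU, hx, heU⟩ := he.exists_open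
  exact (hs.smooth U e hU heU).smoothNear hU hx

theorem isSection_of (hg : ∀ y, MetricNear g y) {s : FrameFun g V}
    (h1 : ∀ (x : M) (u u' : Frame g x), ρ (rotElt (hg x) u u') (s x u') = s x u)
    (h2 : ∀ (x : M) (e : ∀ y : M, Frame g y), IsFrameNear g (frameFields e) x →
      SmoothNear n (fun y => s y (e y)) x) : IsSection ρ s :=
  ⟨(isSection_equivariant_iff hg).2 h1, fun _ e hU he y hy =>
    ((h2 y e (he.isFrameNear hU hy)).self).contMDiffWithinAt⟩

/-- The derivative of the representation along a family of elements of `O(b)`. -/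
theorem dirDeriv_rep (hρ : IsSmoothRep ρ) {C : M → orthGroup n}
    (hC : ∀ p q, SmoothNear n (fun y => (C y).1.1 p q) x) :
    SmoothNear n (fun y => LinearMap.toContinuousLinearMap (ρ (C y))) x ∧
    (C x = 1 → ∀ {X : RoughField n M} {B : Matrix (Idx n) (Idx n) ℝ}, InLieAlg B →
      (∀ p q, dirDeriv X (fun y => (C y).1.1 p q) x = B p q) →
      dirDeriv X (fun y => LinearMap.toContinuousLinearMap (ρ (C y))) x = infAct ρ B) := by
  obtain ⟨F, hF, hFC⟩ := hρ
  have h1 : SmoothNear n (fun (y : M) (p q : Idx n) => (C y).1.1 p q) x :=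
    SmoothNear.pi fun p => SmoothNear.pi fun q => hC p q
  have e : (fun y => LinearMap.toContinuousLinearMap (ρ (C y)))
      = fun y => F (fun p q => (C y).1.1 p q) := funext fun y => (hFC _).symm
  rw [e]
  refine ⟨h1.comp_contDiffAt (Eventually.of_forall fun y => hF.contDiffAt), fun hx X B hB h => ?_⟩
  have hd : HasFDerivAt F (fderiv ℝ F fun p q => (1 : Matrix (Idx n) (Idx n) ℝ) p q)
      (fun p q => (C x).1.1 p q) := by
    rw [hx]
    exact (hF.differentiable (by simp)).differentiableAt.hasFDerivAt
  rw [dirDeriv_comp h1 hd, (infAct_extension hF hFC hB).1]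
  congr 1
  funext p q
  rw [← h p q]
  have a1 := dirDeriv_clm (X := X) (ContinuousLinearMap.proj (R := ℝ) (φ := fun _ => Idx n → ℝ) p) h1
  have a2 := dirDeriv_clm (X := X) (ContinuousLinearMap.proj (R := ℝ) (φ := fun _ => ℝ) q)
    (h1.clm (ContinuousLinearMap.proj (R := ℝ) (φ := fun _ => Idx n → ℝ) p))
  rw [a1] at a2
  exact a2.symm

theorem smoothNear_infAct (hρ : IsSmoothRep ρ) {B : M → Matrix (Idx n) (Idx n) ℝ}
    (hB : ∀ᶠ y in 𝓝 x, InLieAlg (B y)) (hs : ∀ p q, SmoothNear n (fun y => B y p q) x) :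
    SmoothNear n (fun y => infAct ρ (B y)) x := by
  obtain ⟨L, hL⟩ := exists_infAct hρ
  have h1 : SmoothNear n (fun (y : M) (p q : Idx n) => B y p q) x :=
    SmoothNear.pi fun p => SmoothNear.pi fun q => hs p q
  exact (h1.clm L).congr (hB.mono fun y hy => (hL _ hy).1)

theorem dirDeriv_infAct (hρ : IsSmoothRep ρ) {B : M → Matrix (Idx n) (Idx n) ℝ}
    (hB : ∀ᶠ y in 𝓝 x, InLieAlg (B y)) (hs : ∀ p q, SmoothNear n (fun y => B y p q) x)
    {X : RoughField n M} {B' : Matrix (Idx n) (Idx n) ℝ} (hB' : InLieAlg B')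
    (h : ∀ p q, dirDeriv X (fun y => B y p q) x = B' p q) :
    dirDeriv X (fun y => infAct ρ (B y)) x = infAct ρ B' := by
  obtain ⟨L, hL⟩ := exists_infAct hρ
  have h1 : SmoothNear n (fun (y : M) (p q : Idx n) => B y p q) x :=
    SmoothNear.pi fun p => SmoothNear.pi fun q => hs p q
  rw [dirDeriv_congr (t := fun y => L fun p q => B y p q)
    (hB.mono fun y hy => (hL _ hy).1), dirDeriv_clm L h1, (hL _ hB').1]
  congr 1
  funext p q
  rw [← h p q]
  have a1 := dirDeriv_clm (X := X) (ContinuousLinearMap.proj (R := ℝ) (φ := fun _ => Idx n → ℝ) p) h1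
  have a2 := dirDeriv_clm (X := X) (ContinuousLinearMap.proj (R := ℝ) (φ := fun _ => ℝ) q)
    (h1.clm (ContinuousLinearMap.proj (R := ℝ) (φ := fun _ => Idx n → ℝ) p))
  rw [a1] at a2
  exact a2.symm

theorem smoothNear_rotMat (hg : MetricNear g x) {e e' : ∀ y : M, Frame g y}
    (he : IsFrameNear g (frameFields e) x) (he' : IsFrameNear g (frameFields e') x) (i j : Fin n) :
    SmoothNear n (fun y => rotMat (e y) (e' y) i j) x :=
  hg.self.smooth _ _ (he'.near j) (he.near i)

theorem smoothNear_blockDiag {A : M → Matrix (Fin n) (Fin n) ℝ} (a c : ℝ)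
    (hA : ∀ i j, SmoothNear n (fun y => A y i j) x) (p q : Idx n) :
    SmoothNear n (fun y => blockDiag a (A y) c p q) x := by
  rcases p with _ | i | _ <;> rcases q with _ | j | _ <;>
    simp [blockDiag, SmoothNear.const, hA]

theorem dirDeriv_blockDiag {X : RoughField n M} {A : M → Matrix (Fin n) (Fin n) ℝ} (a c : ℝ)
    (p q : Idx n) : dirDeriv X (fun y => blockDiag a (A y) c p q) x
      = gOrth (Matrix.of fun i j => dirDeriv X (fun y => A y i j) x) p q := by
  rcases p with _ | i | _ <;> rcases q with _ | j | _ <;>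
    simp [blockDiag, gOrth, dirDeriv_const]

/-- The change of the connection form under a change of the frame. -/
theorem connForm_change (hg : ∀ y, MetricNear g y) {e e' : ∀ y : M, Frame g y}
    (he : IsFrameNear g (frameFields e) x) (he' : IsFrameNear g (frameFields e') x)
    {X : RoughField n M} (hX : FieldNear X x) :
    connForm g (frameFields e') X x = (rotMat (e x) (e' x))ᵀ *
        (Matrix.of fun i j => dirDeriv X (fun y => rotMat (e y) (e' y) i j) x)
      + (rotMat (e x) (e' x))ᵀ * connForm g (frameFields e) X x * rotMat (e x) (e' x) := by
  ext k j
  have h1 : leviCivita g X (frameFields e' j) x = ∑ i,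
      (rotMat (e x) (e' x) i j • leviCivita g X (frameFields e i) x
        + dirDeriv X (fun y => rotMat (e y) (e' y) i j) x • (e x).1 i) := by
    rw [leviCivita_congr_right (Y' := ∑ i, (fun y => rotMat (e y) (e' y) i j) • frameFields e i),
      leviCivita_sum_right (hg x) hX]
    · refine Finset.sum_congr rfl fun i _ => ?_
      rw [leviCivita_smul_right (hg x) hX (smoothNear_rotMat (hg x) he he' i j) (he.near i)]
      rfl
    · exact fun i => (he.near i).smul (smoothNear_rotMat (hg x) he he' i j)
    · refine Eventually.of_forall fun y => ?_
      rw [Finset.sum_apply]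
      exact frame_expand (hg y) (e y) (e' y) j
  rw [Matrix.add_apply, Matrix.mul_apply, Matrix.mul_assoc, Matrix.mul_apply]
  simp only [connForm, Matrix.of_apply, Matrix.transpose_apply, h1, Matrix.mul_apply]
  rw [map_sum, _root_.sum_apply]
  simp only [map_add, map_smul, _root_.add_apply, _root_.smul_apply, smul_eq_mul,
    Finset.sum_add_distrib]
  rw [add_comm]
  congr 1
  · refine Finset.sum_congr rfl fun i _ => ?_
    rw [mul_comm, (hg x).self.symm]
    rfl
  · simp only [Finset.mul_sum]
    rw [Finset.sum_comm]
    refine Finset.sum_congr rfl fun i _ => ?_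
    have : frameFields e' k x = ∑ l, rotMat (e x) (e' x) l k • frameFields e l x :=
      frame_expand (hg x) (e x) (e' x) k
    rw [this, map_sum, Finset.mul_sum]
    refine Finset.sum_congr rfl fun l _ => ?_
    rw [map_smul, smul_eq_mul]; ring

theorem covDerivIn_eq {e : ∀ y : M, Frame g y} (X : RoughField n M) (s : FrameFun g V) :
    covDerivIn ρ e X s x = dirDeriv X (fun y => s y (e y)) x
      + infAct ρ (gOrth (connForm g (frameFields e) X x)) (s x (e x)) := rfl

/-- Differentiating `s(e) = ρ(A) s(e')`, with `A` the rotation between the frames, produces the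
action of `A⁻¹ dA`. This is the inhomogeneous term in the transformation of the connection form, so
the two contributions cancel. -/
theorem covDerivIn_change (hg : ∀ y, MetricNear g y) (hρ : IsSmoothRep ρ)
    {e e' : ∀ y : M, Frame g y} (he : IsFrameNear g (frameFields e) x)
    (he' : IsFrameNear g (frameFields e') x) {X : RoughField n M} (hX : FieldNear X x)
    {s : FrameFun g V} (hs : IsSection ρ s) :
    ρ (rotElt (hg x) (e x) (e' x)) (covDerivIn ρ e' X s x) = covDerivIn ρ e X s x := by
  set A := rotMat (e x) (e' x) with hA
  set A' : Matrix (Fin n) (Fin n) ℝ :=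
    Matrix.of fun i j => dirDeriv X (fun y => rotMat (e y) (e' y) i j) x with hA'
  set c := rotElt (hg x) (e x) (e' x) with hc
  have hAo : A * Aᵀ = 1 := rotMat_orth (hg x) _ _
  have hAo' : Aᵀ * A = 1 := mul_eq_one_comm.1 hAo
  have hκ := connForm_change hg he he' hX
  have sk := connForm_skew (hg x) he hX
  have sk' := connForm_skew (hg x) he' hX
  set κ := connForm g (frameFields e) X x
  set κ' := connForm g (frameFields e') X x
  rw [← hA, ← hA'] at hκ
  have skt : ∀ (B : Matrix (Fin n) (Fin n) ℝ), (∀ i j, B i j = - B j i) ↔ Bᵀ = -B := fun B =>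
    ⟨fun h => by ext i j; exact h j i, fun h i j => by
      have := congrFun (congrFun h j) i; simpa using this⟩
  have sk2 : ∀ i j, (Aᵀ * κ * A) i j = - (Aᵀ * κ * A) j i := by
    rw [skt] at sk ⊢
    rw [Matrix.transpose_mul, Matrix.transpose_mul, sk, Matrix.transpose_transpose,
      ← Matrix.mul_assoc]; simp
  have sk1 : ∀ i j, (Aᵀ * A') i j = - (Aᵀ * A') j i := by
    have : Aᵀ * A' = κ' - Aᵀ * κ * A := by rw [hκ]; abel
    intro i j
    rw [this, Matrix.sub_apply, Matrix.sub_apply, sk', sk2]; ring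
  -- the family of rotations, normalized at `x`
  set C : M → orthGroup n := fun y => c⁻¹ * rotElt (hg y) (e y) (e' y) with hC
  have hCx : C x = 1 := inv_mul_cancel _
  have hCe : ∀ y, (C y).1.1 = blockDiag 1 (Aᵀ * rotMat (e y) (e' y)) 1 := fun y => by
    change blockDiag 1 Aᵀ 1 * blockDiag 1 (rotMat (e y) (e' y)) 1 = _
    rw [blockDiag_mul]; simp
  have hsm : ∀ i j, SmoothNear n (fun y => (Aᵀ * rotMat (e y) (e' y)) i j) x := fun i j => by
    simp only [Matrix.mul_apply]
    exact SmoothNear.sum fun k _ => (SmoothNear.const _).mul (smoothNear_rotMat (hg x) he he' k j)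
  obtain ⟨h1, h2⟩ := dirDeriv_rep (x := x) (C := C) hρ fun p q => by
    simp only [hCe]; exact smoothNear_blockDiag 1 1 hsm p q
  have h3 := h2 hCx (X := X) (inLieAlg_gOrth sk1) fun p q => by
    simp only [hCe]
    rw [dirDeriv_blockDiag]
    congr 2
    ext i j
    simp only [Matrix.of_apply, Matrix.mul_apply]
    rw [dirDeriv_sum fun k _ => (SmoothNear.const _).mul (smoothNear_rotMat (hg x) he he' k j)]
    refine Finset.sum_congr rfl fun k _ => ?_
    rw [dirDeriv_mul (SmoothNear.const _) (smoothNear_rotMat (hg x) he he' k j), dirDeriv_const]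
    simp [hA']
  have h4 : dirDeriv X (fun y => s y (e y)) x
      = ρ c (dirDeriv X (fun y => s y (e' y)) x + infAct ρ (gOrth (Aᵀ * A')) (s x (e' x))) := by
    have h5 : (fun y => s y (e y)) = fun y => LinearMap.toContinuousLinearMap (ρ c)
        (LinearMap.toContinuousLinearMap (ρ (C y)) (s y (e' y))) := by
      funext y
      rw [← hs.rot hg (e y) (e' y)]
      simp only [LinearMap.coe_toContinuousLinearMap', hC]
      rw [← Module.End.mul_apply, ← map_mul, mul_inv_cancel_left]
    rw [h5, dirDeriv_clm _ (h1.clm_apply (hs.near he')), dirDeriv_clm_apply h1 (hs.near he'), h3,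
      hCx, map_one]
    rfl
  have h6 : infAct ρ (gOrth κ) (s x (e x)) = ρ c (infAct ρ (gOrth (Aᵀ * κ * A)) (s x (e' x))) := by
    rw [← infAct_conj' hρ (inLieAlg_gOrth sk2), hs.rot hg]
    congr 2
    rw [hc, rotElt, rotation_conj_gOrth]
    congr 1
    rw [← hA, ← Matrix.mul_assoc, ← Matrix.mul_assoc, hAo, Matrix.one_mul, Matrix.mul_assoc, hAo,
      Matrix.mul_one]
  rw [covDerivIn_eq, covDerivIn_eq, h4, h6, ← map_add]
  congr 1
  change _ + infAct ρ (gOrth κ') _ = _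
  rw [hκ, gOrth_add, infAct_add hρ (inLieAlg_gOrth sk1) (inLieAlg_gOrth sk2), _root_.add_apply]
  abel

/-- The frame chosen in the definition agrees with `e` at `x`, so the rotation relating them there
is trivial and `covDerivIn_change` makes the choice irrelevant. -/
theorem covDeriv_eq (hg : ∀ y, MetricNear g y) (hρ : IsSmoothRep ρ)
    {e : ∀ y : M, Frame g y} (he : IsFrameNear g (frameFields e) x) {X : RoughField n M}
    (hX : FieldNear X x) {s : FrameFun g V} (hs : IsSection ρ s) :
    covDeriv ρ X s x (e x) = covDerivIn ρ e X s x := by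
  have h : ∃ e' : ∀ y : M, Frame g y,
      (∃ U, IsOpen U ∧ x ∈ U ∧ SmoothFrameOn e' U) ∧ e' x = e x := ⟨e, he.exists_open, rfl⟩
  rw [covDeriv, dif_pos h]
  obtain ⟨⟨U, hU, hx, hUe⟩, h2⟩ := h.choose_spec
  have h3 := covDerivIn_change hg hρ he (hUe.isFrameNear hU hx) hX hs
  rw [h2, rotElt_self, map_one] at h3
  exact h3

end Frames
end
end ConformalBGG

open scoped Manifold ContDiff Bundle Topology
open Filter
namespace ConformalBGG
noncomputable section
set_option linter.unusedSectionVars false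

/-! ### The twisted connection on sections, and its curvature. -/

section Sections

variable {n : ℕ} {M : Type*} [TopologicalSpace M]
  [ChartedSpace (EuclideanSpace ℝ (Fin n)) M] [IsManifold (𝓡 n) ∞ M]
  {V : Type*} [NormedAddCommGroup V] [NormedSpace ℝ V] [FiniteDimensional ℝ V]
  {ρ : Representation ℝ (orthGroup n) V} {g : MetricField n M} {x : M}

local notation "⟦" X ", " Y "⟧" => VectorField.mlieBracket (𝓡 n) X Y

open Matrix

theorem IsSection.zero : IsSection ρ (0 : FrameFun g V) :=
  ⟨fun _ _ _ _ _ _ _ => map_zero _, fun _ _ _ _ => contMDiffOn_const⟩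

theorem IsSection.add {s t : FrameFun g V} (hs : IsSection ρ s) (ht : IsSection ρ t) :
    IsSection ρ (s + t) :=
  ⟨fun x u u' A C hC hA => by
    rw [Pi.add_apply, Pi.add_apply, Pi.add_apply, map_add, hs.equivariant x u u' A C hC hA,
      ht.equivariant x u u' A C hC hA],
    fun U e hU he => (hs.smooth U e hU he).add (ht.smooth U e hU he)⟩

theorem IsSection.neg {s : FrameFun g V} (hs : IsSection ρ s) : IsSection ρ (-s) :=
  ⟨fun x u u' A C hC hA => by
    rw [Pi.neg_apply, Pi.neg_apply, Pi.neg_apply, map_neg, hs.equivariant x u u' A C hC hA],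
    fun U e hU he => (hs.smooth U e hU he).neg⟩

theorem IsSection.smul {s : FrameFun g V} (hs : IsSection ρ s) {f : M → ℝ}
    (hf : ContMDiff (𝓡 n) 𝓘(ℝ, ℝ) ∞ f) : IsSection ρ (fun x u => f x • s x u) :=
  ⟨fun x u u' A C hC hA => by
    rw [map_smul, hs.equivariant x u u' A C hC hA],
    fun U e hU he => hf.contMDiffOn.smul (hs.smooth U e hU he)⟩

variable (ρ g) in
/-- The additive group of smooth sections of `𝒱M`. -/
def sectionGroup : AddSubgroup (FrameFun g V) where
  carrier := {s | IsSection ρ s}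
  zero_mem' := IsSection.zero
  add_mem' := IsSection.add
  neg_mem' := IsSection.neg

theorem inLieAlg_cartanMat (hg : MetricNear g x) {e : Fin n → RoughField n M}
    (he : IsFrameNear g e x) {X : RoughField n M} (hX : FieldNear X x) :
    InLieAlg (cartanMat g e X x) :=
  ((inLieAlg_gOrth (connForm_skew hg he hX)).add (inLieAlg_gMinus _)).sub (inLieAlg_gPlus _)

/-- In a frame the twisted connection is the derivative plus the action of the Cartan connection.
The Leibniz rules, smoothness and curvature below all follow from this formula. -/
theorem twisted_eq (hg : ∀ y, MetricNear g y) (hρ : IsSmoothRep ρ) {e : ∀ y : M, Frame g y}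
    (he : IsFrameNear g (frameFields e) x) {X : RoughField n M} (hX : FieldNear X x)
    {s : FrameFun g V} (hs : IsSection ρ s) :
    twistedDeriv ρ X s x (e x) = dirDeriv X (fun y => s y (e y)) x
      + infAct ρ (cartanMat g (frameFields e) X x) (s x (e x)) := by
  have h1 := inLieAlg_gOrth (connForm_skew (hg x) he hX)
  rw [cartanMat, infAct_sub hρ (h1.add (inLieAlg_gMinus _)) (inLieAlg_gPlus _),
    infAct_add hρ h1 (inLieAlg_gMinus _), _root_.sub_apply, _root_.add_apply, ← add_sub_assoc,
    ← add_assoc, ← covDerivIn_eq, ← covDeriv_eq hg hρ he hX hs]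
  rfl

theorem twisted_eventually_eq (hg : ∀ y, MetricNear g y) (hρ : IsSmoothRep ρ)
    {e : ∀ y : M, Frame g y} (he : IsFrameNear g (frameFields e) x) {X : RoughField n M}
    (hX : FieldNear X x) {s : FrameFun g V} (hs : IsSection ρ s) :
    (fun y => twistedDeriv ρ X s y (e y)) =ᶠ[𝓝 x] fun y => dirDeriv X (fun y => s y (e y)) y
      + infAct ρ (cartanMat g (frameFields e) X y) (s y (e y)) := by
  filter_upwards [he.eventually, hX.eventually] with y h1 h2
  exact twisted_eq hg hρ h1 h2 hs

theorem smoothNear_infAct_cartanMat (hg : ∀ y, MetricNear g y) (hρ : IsSmoothRep ρ)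
    {e : Fin n → RoughField n M} (he : IsFrameNear g e x) {X : RoughField n M}
    (hX : FieldNear X x) : SmoothNear n (fun y => infAct ρ (cartanMat g e X y)) x := by
  refine smoothNear_infAct hρ ?_ (smoothNear_cartanMat (hg x) he hX)
  filter_upwards [he.eventually, hX.eventually] with y h1 h2
  exact inLieAlg_cartanMat (hg y) h1 h2

theorem coframe_rot (hg : MetricNear g x) (u u' : Frame g x) (v : TangentSpace (𝓡 n) x) :
    rotMat u u' *ᵥ (fun i => g x v (u'.1 i)) = fun i => g x v (u.1 i) := by
  funext i
  rw [← hg.self.sum_inner u'.2 v (u.1 i)]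
  simp only [mulVec, dotProduct, rotMat, Matrix.of_apply]
  refine Finset.sum_congr rfl fun k _ => ?_
  rw [hg.self.symm (u'.1 k), mul_comm]

theorem oneForm_rot (hg : MetricNear g x) (u u' : Frame g x) {α : TangentSpace (𝓡 n) x → ℝ}
    (hα : IsLinearMap ℝ α) :
    rotMat u u' *ᵥ (fun i => α (u'.1 i)) = fun i => α (u.1 i) := by
  funext i
  have hs : ∀ v, α v = hα.mk' _ v := fun _ => rfl
  conv_rhs => rw [hg.self.expand u'.2 (u.1 i)]
  rw [hs, map_sum]
  simp only [mulVec, dotProduct, rotMat, Matrix.of_apply, map_smul]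
  refine Finset.sum_congr rfl fun k _ => ?_
  rw [hg.self.symm (u'.1 k)]; rfl

theorem IsSection.twisted (hg : ∀ y, MetricNear g y) (hρ : IsSmoothRep ρ) {X : RoughField n M}
    (hX : ∀ x, FieldNear X x) {s : FrameFun g V} (hs : IsSection ρ s) :
    IsSection ρ (twistedDeriv ρ X s) := by
  refine isSection_of hg (fun x u u' => ?_) fun x e he => ?_
  · have h1 : ρ (rotElt (hg x) u u') (covDeriv ρ X s x u') = covDeriv ρ X s x u := by
      obtain ⟨e, he, rfl⟩ := exists_frame_through hg u
      obtain ⟨e', he', rfl⟩ := exists_frame_through hg u'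
      rw [covDeriv_eq hg hρ he (hX x) hs, covDeriv_eq hg hρ he' (hX x) hs]
      exact covDerivIn_change hg hρ he he' (hX x) hs
    have h2 : ρ (rotElt (hg x) u u') (actField ρ X s x u') = actField ρ X s x u := by
      rw [actField, ← infAct_conj' hρ (inLieAlg_gMinus _), hs.rot hg, rotElt,
        rotation_conj_gMinus, coframe_rot (hg x)]
      rfl
    have h3 : ρ (rotElt (hg x) u u') (actForm ρ (fun x => schouten g x (X x)) s x u')
        = actForm ρ (fun x => schouten g x (X x)) s x u := by
      rw [actForm, ← infAct_conj' hρ (inLieAlg_gPlus _), hs.rot hg, rotElt,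
        rotation_conj_gPlus, oneForm_rot (hg x) u u' (schouten_linear (hg x) _)]
      rfl
    change ρ _ (covDeriv ρ X s x u' + actField ρ X s x u' - _) = _
    rw [map_sub, map_add, h1, h2, h3]
    rfl
  · refine SmoothNear.congr ?_ (twisted_eventually_eq hg hρ he (hX x) hs)
    exact ((hs.near he).dirDeriv (hX x)).add
      ((smoothNear_infAct_cartanMat hg hρ he (hX x)).clm_apply (hs.near he))

theorem cartanMat_add (hg : MetricNear g x) {e : Fin n → RoughField n M} (he : IsFrameNear g e x)
    {X Y : RoughField n M} (hX : FieldNear X x) (hY : FieldNear Y x) :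
    cartanMat g e (X + Y) x = cartanMat g e X x + cartanMat g e Y x := by
  have h1 : connForm g e (X + Y) x = connForm g e X x + connForm g e Y x := by
    ext i j
    simp only [connForm, Matrix.of_apply, Matrix.add_apply]
    rw [leviCivita_add_left hg hX hY (he.near j), map_add]; rfl
  have h2 : coframe g e (X + Y) x = coframe g e X x + coframe g e Y x := by
    funext i
    simp only [coframe, Pi.add_apply, map_add]; rfl
  have h3 : schoutenForm g e (X + Y) x = schoutenForm g e X x + schoutenForm g e Y x := by
    funext i
    exact (schouten_linear_left hg (e i x)).map_add _ _
  rw [cartanMat, h1, h2, h3, gOrth_add, gMinus_add, gPlus_add, cartanMat, cartanMat]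
  abel

theorem cartanMat_smul (hg : MetricNear g x) {e : Fin n → RoughField n M} (he : IsFrameNear g e x)
    {X : RoughField n M} {f : M → ℝ} (hf : SmoothNear n f x) (hX : FieldNear X x) :
    cartanMat g e (f • X) x = f x • cartanMat g e X x := by
  have h1 : connForm g e (f • X) x = f x • connForm g e X x := by
    ext i j
    simp only [connForm, Matrix.of_apply, Matrix.smul_apply]
    rw [leviCivita_smul_left hg hf hX (he.near j), map_smul]; rfl
  have h2 : coframe g e (f • X) x = f x • coframe g e X x := by
    funext i
    simp only [coframe, Pi.smul_apply', map_smul]; rfl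
  have h3 : schoutenForm g e (f • X) x = f x • schoutenForm g e X x := by
    funext i
    exact (schouten_linear_left hg (e i x)).map_smul _ _
  rw [cartanMat, h1, h2, h3, gOrth_smul, gMinus_smul, gPlus_smul, cartanMat, smul_sub, smul_add]

section Rules

variable {X Y : RoughField n M} {s t : FrameFun g V} {f : M → ℝ}

theorem twisted_add_section (hg : ∀ y, MetricNear g y) (hρ : IsSmoothRep ρ)
    (hX : ∀ x, FieldNear X x) (hs : IsSection ρ s) (ht : IsSection ρ t) :
    twistedDeriv ρ X (s + t) = twistedDeriv ρ X s + twistedDeriv ρ X t := by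
  refine frameFun_ext hg fun x e he => ?_
  rw [Pi.add_apply, Pi.add_apply, twisted_eq hg hρ he (hX x) (hs.add ht),
    twisted_eq hg hρ he (hX x) hs, twisted_eq hg hρ he (hX x) ht]
  have := dirDeriv_add (X := X) (hs.near he) (ht.near he)
  simp only [Pi.add_apply, map_add, this]
  abel

theorem twisted_smul_section (hg : ∀ y, MetricNear g y) (hρ : IsSmoothRep ρ)
    (hX : ∀ x, FieldNear X x) (hf : ContMDiff (𝓡 n) 𝓘(ℝ, ℝ) ∞ f) (hs : IsSection ρ s) :
    twistedDeriv ρ X (fun x u => f x • s x u)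
      = (fun x u => f x • twistedDeriv ρ X s x u) + fun x u => dirDeriv X f x • s x u := by
  refine frameFun_ext hg fun x e he => ?_
  have hf' : SmoothNear n f x := hf.contMDiffOn.smoothNear isOpen_univ trivial
  rw [Pi.add_apply, Pi.add_apply, twisted_eq hg hρ he (hX x) (hs.smul hf),
    twisted_eq hg hρ he (hX x) hs, dirDeriv_smul hf' (hs.near he), map_smul, smul_add]
  abel

theorem twisted_add_field (hg : ∀ y, MetricNear g y) (hρ : IsSmoothRep ρ)
    (hX : ∀ x, FieldNear X x) (hY : ∀ x, FieldNear Y x) (hs : IsSection ρ s) :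
    twistedDeriv ρ (X + Y) s = twistedDeriv ρ X s + twistedDeriv ρ Y s := by
  refine frameFun_ext hg fun x e he => ?_
  rw [Pi.add_apply, Pi.add_apply, twisted_eq hg hρ he ((hX x).add (hY x)) hs,
    twisted_eq hg hρ he (hX x) hs, twisted_eq hg hρ he (hY x) hs, dirDeriv_add_field,
    cartanMat_add (hg x) he (hX x) (hY x), infAct_add hρ (inLieAlg_cartanMat (hg x) he (hX x))
      (inLieAlg_cartanMat (hg x) he (hY x)), _root_.add_apply]
  abel

theorem twisted_smul_field (hg : ∀ y, MetricNear g y) (hρ : IsSmoothRep ρ)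
    (hX : ∀ x, FieldNear X x) (hf : ContMDiff (𝓡 n) 𝓘(ℝ, ℝ) ∞ f) (hs : IsSection ρ s) :
    twistedDeriv ρ (f • X) s = fun x u => f x • twistedDeriv ρ X s x u := by
  refine frameFun_ext hg fun x e he => ?_
  have hf' : SmoothNear n f x := hf.contMDiffOn.smoothNear isOpen_univ trivial
  rw [twisted_eq hg hρ he ((hX x).smul hf') hs,
    twisted_eq hg hρ he (hX x) hs, dirDeriv_smul_field,
    cartanMat_smul (hg x) he hf' (hX x), infAct_smul hρ _ (inLieAlg_cartanMat (hg x) he (hX x)),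
    _root_.smul_apply, smul_add]

/-- The entrywise derivative of the Cartan connection is again in `o(b)`, because skew symmetry of
`ω` holds near `x`. So differentiation passes through the infinitesimal action. -/
theorem dirDeriv_infAct_cartanMat (hg : ∀ y, MetricNear g y) (hρ : IsSmoothRep ρ)
    {e : Fin n → RoughField n M} (he : IsFrameNear g e x)
    (hY : FieldNear Y x) :
    ∃ B, InLieAlg B ∧ (∀ p q, B p q = dirDeriv X (fun y => cartanMat g e Y y p q) x) ∧
      dirDeriv X (fun y => infAct ρ (cartanMat g e Y y)) x = infAct ρ B := by
  have hsk : ∀ i j, (Matrix.of fun i j => dirDeriv X (fun y => connForm g e Y y i j) x) i j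
      = - (Matrix.of fun i j => dirDeriv X (fun y => connForm g e Y y i j) x) j i := fun i j => by
    rw [Matrix.of_apply, Matrix.of_apply, ← dirDeriv_neg]
    refine dirDeriv_congr ?_
    filter_upwards [he.eventually, hY.eventually] with y h1 h2
    exact connForm_skew (hg y) h1 h2 i j
  have hB := ((inLieAlg_gOrth hsk).add
    (inLieAlg_gMinus (fun i => dirDeriv X (fun y => coframe g e Y y i) x))).sub
    (inLieAlg_gPlus (fun i => dirDeriv X (fun y => schoutenForm g e Y y i) x))
  refine ⟨_, hB, fun p q => (dirDeriv_cartanMat p q).symm, ?_⟩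
  refine dirDeriv_infAct hρ ?_ (smoothNear_cartanMat (hg x) he hY) hB fun p q =>
    dirDeriv_cartanMat p q
  filter_upwards [he.eventually, hY.eventually] with y h1 h2
  exact inLieAlg_cartanMat (hg y) h1 h2

/-- The curvature of the twisted connection. -/
theorem twisted_curvature (hg : ∀ y, MetricNear g y) (hρ : IsSmoothRep ρ)
    (hX : ∀ x, FieldNear X x) (hY : ∀ x, FieldNear Y x) (hs : IsSection ρ s) :
    twistedDeriv ρ X (twistedDeriv ρ Y s) - twistedDeriv ρ Y (twistedDeriv ρ X s)
      - twistedDeriv ρ ⟦X, Y⟧ s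
      = actSkew ρ (fun x => weyl g x (X x) (Y x)) s - actForm ρ (cotton g X Y) s := by
  refine frameFun_ext hg fun x e he => ?_
  -- Here `B` is the derivative of `Ω(Y)` along `X`. After skew-symmetrisation the terms with one
  -- derivative of `s` cancel, and the operator left over is the curvature of `Ω`.
  have key : ∀ {X Y : RoughField n M}, (∀ x, FieldNear X x) → (∀ x, FieldNear Y x) →
      ∃ B, InLieAlg B ∧
      (∀ p q, B p q = dirDeriv X (fun y => cartanMat g (frameFields e) Y y p q) x) ∧
      twistedDeriv ρ X (twistedDeriv ρ Y s) x (e x)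
        = dirDeriv X (dirDeriv Y fun y => s y (e y)) x
        + (infAct ρ (cartanMat g (frameFields e) Y x) (dirDeriv X (fun y => s y (e y)) x)
          + infAct ρ B (s x (e x)))
        + infAct ρ (cartanMat g (frameFields e) X x) (dirDeriv Y (fun y => s y (e y)) x
          + infAct ρ (cartanMat g (frameFields e) Y x) (s x (e x))) := by
    intro X Y hX hY
    obtain ⟨B, hB, hB', h⟩ := dirDeriv_infAct_cartanMat (X := X) hg hρ he (hY x)
    refine ⟨B, hB, hB', ?_⟩
    rw [twisted_eq hg hρ he (hX x) (hs.twisted hg hρ hY),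
      dirDeriv_congr (twisted_eventually_eq hg hρ he (hY x) hs),
      dirDeriv_add ((hs.near he).dirDeriv (hY x))
        ((smoothNear_infAct_cartanMat hg hρ he (hY x)).clm_apply (hs.near he)),
      dirDeriv_clm_apply (smoothNear_infAct_cartanMat hg hρ he (hY x)) (hs.near he), h,
      twisted_eq hg hρ he (hY x) hs]
  obtain ⟨B, hB, hB', h1⟩ := key hX hY
  obtain ⟨C, hC, hC', h2⟩ := key hY hX
  have h3 := dirDeriv_bracket_vec (hs.near he) (hX x) (hY x)
  have hXY := (hX x).bracket (hY x)
  have iX := inLieAlg_cartanMat (hg x) he (hX x)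
  have iY := inLieAlg_cartanMat (hg x) he (hY x)
  have iXY := inLieAlg_cartanMat (hg x) he hXY
  have hsk : ∀ i j, (Matrix.of fun i j => g x (weyl g x (X x) (Y x) (frameFields e j x))
      (frameFields e i x)) i j = - (Matrix.of fun i j => g x (weyl g x (X x) (Y x)
      (frameFields e j x)) (frameFields e i x)) j i := fun i j =>
    weyl_skew (e := frameFields e) (hg x) i j
  have h4 : B - C - cartanMat g (frameFields e) ⟦X, Y⟧ x
      + (cartanMat g (frameFields e) X x * cartanMat g (frameFields e) Y x
        - cartanMat g (frameFields e) Y x * cartanMat g (frameFields e) X x)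
      = gOrth (Matrix.of fun i j => g x (weyl g x (X x) (Y x) (frameFields e j x))
          (frameFields e i x)) - gPlus (fun i => cotton g X Y x (frameFields e i x)) := by
    ext p q
    rw [← cartan_structure (hg x) he (hX x) (hY x) p q, ← hB', ← hC']
    rfl
  have h5 := congrArg (fun C => infAct ρ C (s x (e x))) h4
  beta_reduce at h5
  rw [infAct_add hρ ((hB.sub hC).sub iXY) (iX.bracket iY), infAct_sub hρ (hB.sub hC) iXY,
    infAct_sub hρ hB hC, infAct_sub hρ (inLieAlg_gOrth hsk) (inLieAlg_gPlus _), _root_.add_apply,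
    infAct_bracket hρ iX iY, _root_.sub_apply, _root_.sub_apply, _root_.sub_apply] at h5
  change _ - _ - _ = infAct ρ (gOrth _) (s x (e x)) - infAct ρ (gPlus _) (s x (e x))
  rw [h1, h2, twisted_eq hg hρ he hXY hs, h3]
  refine Eq.trans ?_ h5
  simp only [map_add]
  abel

end Rules

end Sections
end
end ConformalBGG

open scoped Manifold ContDiff Bundle Topology
open Filter
namespace ConformalBGG
noncomputable section
set_option linter.unusedSectionVars false

/-! ### Bundle-valued forms as alternating maps, and formulas (1) and (2). -/

section Forms

variable {n : ℕ} {M : Type*} [TopologicalSpace M]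
  [ChartedSpace (EuclideanSpace ℝ (Fin n)) M] [IsManifold (𝓡 n) ∞ M]
  {V : Type*} [NormedAddCommGroup V] [NormedSpace ℝ V] [FiniteDimensional ℝ V]
  {ρ : Representation ℝ (orthGroup n) V} {g : MetricField n M} {x : M}

/-- The Lie algebra of vector fields. -/
instance vectorFieldsLieRing : LieRing (VectorFields n M) where
  bracket := bracket
  add_lie X Y Z := by
    ext x
    exact bracket_add_left (VectorFields.near X x) (VectorFields.near Y x)
  lie_add X Y Z := by
    ext x
    exact bracket_add_right (VectorFields.near Y x) (VectorFields.near Z x)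
  lie_self X := by
    ext x
    have h := bracket_swap (X := fun y => X y) (Y := fun y => X y) (x := x)
    have h2 : (2 : ℝ) • (bracket X X) x = 0 := by
      rw [two_smul]
      exact eq_neg_iff_add_eq_zero.1 h
    exact (smul_eq_zero.1 h2).resolve_left two_ne_zero
  leibniz_lie X Y Z := by
    ext x
    exact bracket_jacobi (VectorFields.near X x) (VectorFields.near Y x) (VectorFields.near Z x)

/-- The derivative of a smooth function along a smooth vector field. -/
def fieldDeriv (X : VectorFields n M) (f : C^∞⟮𝓡 n, M; 𝓘(ℝ, ℝ), ℝ⟯) :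
    C^∞⟮𝓡 n, M; 𝓘(ℝ, ℝ), ℝ⟯ :=
  ⟨dirDeriv (fun x => X x) f, fun x =>
    ((f.contMDiff.contMDiffOn.smoothNear isOpen_univ (Set.mem_univ x)).dirDeriv
      (VectorFields.near X x)).self⟩

theorem lie_fieldSMul (X Y : VectorFields n M) (f : C^∞⟮𝓡 n, M; 𝓘(ℝ, ℝ), ℝ⟯) :
    ⁅X, fieldSMul f Y⁆ = fieldSMul f ⁅X, Y⁆ + fieldSMul (fieldDeriv X f) Y := by
  ext x
  have h := bracket_smul_right (X := fun y => X y)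
    (f.contMDiff.contMDiffOn.smoothNear isOpen_univ (Set.mem_univ x)) (VectorFields.near Y x)
  refine h.trans (add_comm _ _)

/-- Multiplication of vector fields by a function. -/
def fieldSMulHom (f : C^∞⟮𝓡 n, M; 𝓘(ℝ, ℝ), ℝ⟯) : VectorFields n M →+ VectorFields n M :=
  AddMonoidHom.mk' (fieldSMul f) fun X Y => by
    ext x
    exact smul_add (f x) (X x) (Y x)

/-- Multiplication of sections by a function. -/
def sectionSMulHom (ρ : Representation ℝ (orthGroup n) V) (g : MetricField n M)
    (f : C^∞⟮𝓡 n, M; 𝓘(ℝ, ℝ), ℝ⟯) : sectionGroup ρ g →+ sectionGroup ρ g :=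
  AddMonoidHom.mk' (fun s => ⟨fun x u => f x • s.1 x u, s.2.smul f.contMDiff⟩) fun s t => by
    refine Subtype.ext (funext fun x => funext fun u => ?_)
    exact smul_add (f x) (s.1 x u) (t.1 x u)

/-- The twisted connection as a biadditive map. -/
def twistedHom (hg : ∀ y, MetricNear g y) (hρ : IsSmoothRep ρ) :
    VectorFields n M →+ sectionGroup ρ g →+ sectionGroup ρ g :=
  AddMonoidHom.mk' (fun X => AddMonoidHom.mk' (fun s =>
      ⟨twistedDeriv ρ (fun x => X x) s.1, s.2.twisted hg hρ (VectorFields.near X)⟩)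
      fun s t => Subtype.ext (twisted_add_section hg hρ (VectorFields.near X) s.2 t.2))
    fun X Y => AddMonoidHom.ext fun s => Subtype.ext
      (twisted_add_field hg hρ (VectorFields.near X) (VectorFields.near Y) s.2)

theorem curvOp_coe (hg : ∀ y, MetricNear g y) (hρ : IsSmoothRep ρ) (X Y : VectorFields n M)
    (s : sectionGroup ρ g) :
    ((curvOp (twistedHom hg hρ) X Y s : sectionGroup ρ g) : FrameFun g V)
      = actSkew ρ (fun x => weyl g x (X x) (Y x)) s
        - actForm ρ (cotton g (fun x => X x) (fun x => Y x)) s :=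
  twisted_curvature hg hρ (VectorFields.near X) (VectorFields.near Y) s.2

variable {k : ℕ} {φ : PreForm g V k}

/-- A form with values in `𝒱M` as an alternating map. -/
def IsForm.toAlt (hφ : IsForm ρ k φ) : VectorFields n M [⋀^Fin k]→ₗ[ℤ] sectionGroup ρ g :=
  { MultilinearMap.mk' (R := ℤ) (M₁ := fun _ : Fin k => VectorFields n M)
      (fun ξ => (⟨φ ξ, hφ.isSection ξ⟩ : sectionGroup ρ g))
      (fun ξ i X Y => Subtype.ext (hφ.map_add ξ i X Y))
      (fun ξ i c X => map_zsmul (AddMonoidHom.mk' (fun X =>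
        (⟨φ (Function.update ξ i X), hφ.isSection _⟩ : sectionGroup ρ g))
        fun X Y => Subtype.ext (hφ.map_add ξ i X Y)) c X) with
    map_eq_zero_of_eq' := fun ξ i j hij hne => Subtype.ext (hφ.alternating ξ i j hij hne) }

theorem neg_one_pow_zsmul {A : Type*} [AddCommGroup A] [Module ℝ A] (m : ℕ) (s : A) :
    (-1 : ℤ) ^ m • s = (-1 : ℝ) ^ m • s := by
  rcases neg_one_pow_eq_or ℤ m with h | h <;> rcases Nat.even_or_odd m with h' | h' <;>
    simp_all [Odd.neg_one_pow]

/-- The bridge to the algebraic part: the twisted derivative on forms is the covariant exterior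
derivative over the Lie ring of vector fields, with coefficients in the group of sections. -/
theorem dTwisted_eq (hg : ∀ y, MetricNear g y) (hρ : IsSmoothRep ρ) (hφ : IsForm ρ k φ)
    (ξ : Fin (k + 1) → VectorFields n M) :
    dTwisted ρ φ ξ = (extAlt (twistedHom hg hρ) hφ.toAlt ξ : FrameFun g V) := by
  rw [extAlt_apply, extFormula, AddSubgroup.coe_add]
  change altSum _ φ ξ + bracketSum φ ξ = _
  congr 1
  · rw [AddSubgroup.val_finsetSum]
    refine Finset.sum_congr rfl fun i _ => ?_
    rw [AddSubgroup.coe_zsmul, neg_one_pow_zsmul]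
    rfl
  · cases k with
    | zero => rfl
    | succ k =>
      simp only [bracketTerm, bracketSum]
      rw [AddSubgroup.val_finsetSum]
      refine Finset.sum_congr rfl fun l _ => ?_
      rw [AddSubgroup.val_finsetSum]
      refine Finset.sum_congr rfl fun j _ => ?_
      rw [AddSubgroup.coe_zsmul, neg_one_pow_zsmul]
      rfl

theorem IsForm.dTwisted (hg : ∀ y, MetricNear g y) (hρ : IsSmoothRep ρ) (hφ : IsForm ρ k φ) :
    IsForm ρ (k + 1) (dTwisted ρ φ) := by
  refine ⟨fun ξ => ?_, fun ξ i X Y => ?_, fun ξ i f X x u => ?_, fun ξ i j hij hne => ?_⟩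
  · rw [dTwisted_eq hg hρ hφ]; exact Subtype.prop _
  · rw [dTwisted_eq hg hρ hφ, dTwisted_eq hg hρ hφ, dTwisted_eq hg hρ hφ,
      AlternatingMap.map_update_add]
    rfl
  · have h := extAlt_linear (twistedHom hg hρ) (fieldSMulHom f) (sectionSMulHom ρ g f)
      (fun Z Y => fieldSMul (fieldDeriv Z f) Y) (fun Z => sectionSMulHom ρ g (fieldDeriv Z f))
      (fun X s => Subtype.ext (twisted_smul_field hg hρ (VectorFields.near X) f.contMDiff s.2))
      (fun X s => Subtype.ext (twisted_smul_section hg hρ (VectorFields.near X) f.contMDiff s.2))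
      (fun X Y => lie_fieldSMul X Y f) hφ.toAlt
      (fun ξ i Y => Subtype.ext (funext fun x => funext fun u => hφ.map_smul ξ i f Y x u))
      (fun ξ i Z Y => Subtype.ext (funext fun x => funext fun u =>
        hφ.map_smul ξ i (fieldDeriv Z f) Y x u)) ξ i X
    have h' := congrArg (fun s : sectionGroup ρ g => s.1 x u) h
    rw [dTwisted_eq hg hρ hφ, dTwisted_eq hg hρ hφ]
    exact h'
  · rw [dTwisted_eq hg hρ hφ, AlternatingMap.map_eq_zero_of_eq _ ξ hij hne]
    rfl

/-- The square of the twisted exterior derivative. -/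
theorem dTwisted_dTwisted (hg : ∀ y, MetricNear g y) (hρ : IsSmoothRep ρ) (hφ : IsForm ρ k φ)
    (ξ : Fin (k + 2) → VectorFields n M) :
    dTwisted ρ (dTwisted ρ φ) ξ = ∑ l : Fin (k + 2), ∑ j : Fin (k + 1) with Fin.castSucc j < l,
      (-1 : ℝ) ^ ((j : ℕ) + (l : ℕ) + 1) •
        (actSkew ρ (fun x => weyl g x (ξ j.castSucc x) (ξ l x)) (φ (omitTwo ξ j l))
          - actForm ρ (cotton g (fun x => ξ j.castSucc x) (fun x => ξ l x))
            (φ (omitTwo ξ j l))) := by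
  have h1 : (hφ.dTwisted hg hρ).toAlt = extAlt (twistedHom hg hρ) hφ.toAlt := by
    ext1 η
    exact Subtype.ext (dTwisted_eq hg hρ hφ η)
  rw [dTwisted_eq hg hρ (hφ.dTwisted hg hρ), h1, extAlt_extAlt, AddSubgroup.val_finsetSum]
  refine Finset.sum_congr rfl fun l _ => ?_
  rw [AddSubgroup.val_finsetSum]
  refine Finset.sum_congr rfl fun j _ => ?_
  rw [AddSubgroup.coe_zsmul, neg_one_pow_zsmul, curvOp_coe]
  rfl

theorem altSum_apply (D : VectorFields n M → FrameFun g V → FrameFun g V) (φ : PreForm g V k)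
    (ξ : Fin (k + 1) → VectorFields n M) (x : M) (u : Frame g x) : altSum D φ ξ x u
      = ∑ i : Fin (k + 1), (-1 : ℝ) ^ (i : ℕ) • D (ξ i) (φ fun l => ξ (i.succAbove l)) x u := by
  simp [altSum, Finset.sum_apply]

/-- The bracket terms do not involve the connection and are absorbed in `dNabla`; the rest is
additivity, valid without any condition on `φ`. -/
theorem dTwisted_eq_add_sub (φ : PreForm g V k) :
    dTwisted ρ φ = dNabla ρ φ + del ρ φ - delP ρ φ := by
  funext ξ x u
  change altSum _ φ ξ x u + bracketSum φ ξ x u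
    = (altSum _ φ ξ x u + bracketSum φ ξ x u) + altSum _ φ ξ x u - altSum _ φ ξ x u
  simp only [altSum_apply, twistedDeriv, Pi.add_apply, Pi.sub_apply, smul_add, smul_sub,
    Finset.sum_add_distrib, Finset.sum_sub_distrib]
  abel

section Components

theorem component_apply (j : ℤ) (φ : PreForm g V k) (ξ : Fin k → VectorFields n M) (x : M)
    (u : Frame g x) : component ρ j φ ξ x u = gradeProj ρ j (φ ξ x u) := rfl

/-- The frame chosen in `covDeriv` does not depend on the section, so both sides are computed in the
same frame. The connection form acts through `o(n)`, which preserves the degree. -/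
theorem gradeProj_covDeriv (hg : ∀ y, MetricNear g y) (hρ : IsSmoothRep ρ)
    (hind : iSupIndep (gradePart ρ)) (htop : (⨆ j : ℤ, gradePart ρ j) = ⊤)
    {X : RoughField n M} (hX : ∀ x, FieldNear X x) {s : FrameFun g V} (hs : IsSection ρ s) (j : ℤ)
    (x : M) (u : Frame g x) :
    gradeProj ρ j (covDeriv ρ X s x u) = covDeriv ρ X (fun x u => gradeProj ρ j (s x u)) x u := by
  unfold covDeriv
  split_ifs with h
  · obtain ⟨U, hU, hx, hUe⟩ := h.choose_spec.1
    have he := hUe.isFrameNear hU hx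
    rw [covDerivIn_eq, covDerivIn_eq, map_add,
      gradeProj_gOrth hρ hind htop (connForm_skew (hg x) he (hX x))]
    congr 1
    exact (dirDeriv_clm (LinearMap.toContinuousLinearMap (gradeProj ρ j)) (hs.near he)).symm
  · exact map_zero _

theorem bracketSum_apply_map (T : V →ₗ[ℝ] V) (φ : PreForm g V k)
    (ξ : Fin (k + 1) → VectorFields n M) (x : M) (u : Frame g x) :
    T (bracketSum φ ξ x u) = bracketSum (fun ξ x u => T (φ ξ x u)) ξ x u := by
  cases k with
  | zero => exact map_zero T
  | succ k => simp [bracketSum, Finset.sum_apply, map_sum]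

theorem component_dTwisted (hg : ∀ y, MetricNear g y) (hρ : IsSmoothRep ρ)
    (hind : iSupIndep (gradePart ρ)) (htop : (⨆ j : ℤ, gradePart ρ j) = ⊤)
    (hφ : IsForm ρ k φ) (i : ℤ) :
    component ρ i (dTwisted ρ φ) = dNabla ρ (component ρ i φ) + del ρ (component ρ (i + 1) φ)
      - delP ρ (component ρ (i - 1) φ) := by
  rw [dTwisted_eq_add_sub]
  funext ξ x u
  change gradeProj ρ i ((altSum _ φ ξ x u + bracketSum φ ξ x u) + altSum _ φ ξ x u
      - altSum _ φ ξ x u)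
    = (altSum _ (component ρ i φ) ξ x u + bracketSum (component ρ i φ) ξ x u)
      + altSum _ (component ρ (i + 1) φ) ξ x u - altSum _ (component ρ (i - 1) φ) ξ x u
  rw [map_sub, map_add, map_add, bracketSum_apply_map]
  simp only [altSum_apply, map_sum, map_smul]
  congr 1
  · congr 1
    · congr 1
      refine Finset.sum_congr rfl fun l _ => ?_
      rw [gradeProj_covDeriv hg hρ hind htop (VectorFields.near (ξ l)) (hφ.isSection _)]
      rfl
    · refine Finset.sum_congr rfl fun l _ => ?_
      rw [actField, gradeProj_gMinus hρ hind htop]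
      rfl
  · refine Finset.sum_congr rfl fun l _ => ?_
    rw [actForm, gradeProj_gPlus hρ hind htop]
    rfl

theorem component_dTwisted_dTwisted (hg : ∀ y, MetricNear g y) (hρ : IsSmoothRep ρ)
    (hind : iSupIndep (gradePart ρ)) (htop : (⨆ j : ℤ, gradePart ρ j) = ⊤)
    (hφ : IsForm ρ k φ) (i : ℤ) (ξ : Fin (k + 2) → VectorFields n M) :
    component ρ i (dTwisted ρ (dTwisted ρ φ)) ξ =
      ∑ l : Fin (k + 2), ∑ j : Fin (k + 1) with Fin.castSucc j < l,
        (-1 : ℝ) ^ ((j : ℕ) + (l : ℕ) + 1) •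
          (actSkew ρ (fun x => weyl g x (ξ j.castSucc x) (ξ l x))
              (component ρ i φ (omitTwo ξ j l))
            - actForm ρ (cotton g (fun x => ξ j.castSucc x) (fun x => ξ l x))
              (component ρ (i - 1) φ (omitTwo ξ j l))) := by
  funext x u
  rw [component_apply, dTwisted_dTwisted hg hρ hφ]
  simp only [Finset.sum_apply, map_sum, Pi.smul_apply, map_smul, Pi.sub_apply, map_sub]
  refine Finset.sum_congr rfl fun l _ => Finset.sum_congr rfl fun j _ => ?_
  congr 2
  · rw [actSkew, gradeProj_gOrth hρ hind htop]
    · rfl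
    · exact weyl_skew (X := fun x => ξ j.castSucc x) (Y := fun x => ξ l x)
        (e := fun i => ext (u.1 i)) (hg x) |> fun h i j => by simpa only [ext_self] using h i j
  · rw [actForm, gradeProj_gPlus hρ hind htop]
    rfl

end Components

end Forms
end
end ConformalBGG

open scoped Manifold ContDiff Bundle Topology
open Filter
namespace ConformalBGG
noncomputable section
set_option linter.unusedSectionVars false

/-! ### Coordinate fields and functions in the standard chart. -/

section Charts

variable {n : ℕ} {M : Type*} [TopologicalSpace M]
  [ChartedSpace (EuclideanSpace ℝ (Fin n)) M] [IsManifold (𝓡 n) ∞ M]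
local notation "⟦" X ", " Y "⟧" => VectorField.mlieBracket (𝓡 n) X Y

/-- The vector field which is constant in the standard chart at `x`. -/
def coordField (x : M) (v : EuclideanSpace ℝ (Fin n)) : RoughField n M :=
  VectorField.mpullback (𝓡 n) 𝓘(ℝ, EuclideanSpace ℝ (Fin n)) (extChartAt (𝓡 n) x) (fun _ => v)

theorem coordField_add (x : M) (v w : EuclideanSpace ℝ (Fin n)) :
    coordField x (v + w) = coordField x v + coordField x w := by
  funext y
  exact map_add _ _ _

theorem coordField_smul (x : M) (c : ℝ) (v : EuclideanSpace ℝ (Fin n)) :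
    coordField x (c • v) = (fun _ : M => c) • coordField x v := by
  funext y
  exact map_smul _ _ _

theorem smoothNear_extChartAt (x : M) :
    SmoothNear n (fun y => extChartAt (𝓡 n) x y) x := by
  filter_upwards [(chartAt (EuclideanSpace ℝ (Fin n)) x).open_source.mem_nhds (mem_chart_source _ x)]
    with y hy
  exact contMDiffAt_extChartAt' hy

theorem coordField_near (x : M) : ∀ᶠ y in 𝓝 x, ∀ v : EuclideanSpace ℝ (Fin n),
    FieldNear (n := n) (coordField x v) y := by
  filter_upwards [(chartAt (EuclideanSpace ℝ (Fin n)) x).open_source.mem_nhds (mem_chart_source _ x)]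
    with y hy v
  filter_upwards [(chartAt (EuclideanSpace ℝ (Fin n)) x).open_source.mem_nhds hy] with y hy
  have hc : ContMDiffAt 𝓘(ℝ, EuclideanSpace ℝ (Fin n)) 𝓘(ℝ, EuclideanSpace ℝ (Fin n)).tangent ∞
      (fun z => (⟨z, v⟩ : TangentBundle 𝓘(ℝ, EuclideanSpace ℝ (Fin n)) (EuclideanSpace ℝ (Fin n))))
      (extChartAt (𝓡 n) x y) :=
    contMDiffAt_vectorSpace_iff_contDiffAt.2 contDiffAt_const
  exact hc.mpullback_vectorField_preimage (contMDiffAt_extChartAt' hy)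
    (isInvertible_mfderiv_extChartAt (by rwa [extChartAt_source])) (m := ∞) (n := ∞) (by simp)

theorem dirDeriv_coordField (x : M) : ∀ᶠ y in 𝓝 x, ∀ v : EuclideanSpace ℝ (Fin n),
    dirDeriv (coordField x v) (fun y => extChartAt (𝓡 n) x y) y = v := by
  filter_upwards [(chartAt (EuclideanSpace ℝ (Fin n)) x).open_source.mem_nhds (mem_chart_source _ x)]
    with y hy v
  have h := isInvertible_mfderiv_extChartAt (I := 𝓡 n) (x := x) (y := y)
    (by rwa [extChartAt_source])
  exact congrArg (fun T : TangentSpace _ _ →L[ℝ] TangentSpace _ _ => T v) h.self_comp_inverse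

theorem coordField_dirDeriv (x : M) : ∀ᶠ y in 𝓝 x, ∀ X : RoughField n M,
    coordField x (dirDeriv X (fun y => extChartAt (𝓡 n) x y) y) y = X y := by
  filter_upwards [(chartAt (EuclideanSpace ℝ (Fin n)) x).open_source.mem_nhds (mem_chart_source _ x)]
    with y hy X
  have h := isInvertible_mfderiv_extChartAt (I := 𝓡 n) (x := x) (y := y)
    (by rwa [extChartAt_source])
  exact congrArg (fun T : TangentSpace _ _ →L[ℝ] TangentSpace _ _ => T (X y)) h.inverse_comp_self

/-- Pullback under a chart respects brackets, and constant fields commute. -/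
theorem coordField_bracket (x : M) : ∀ᶠ y in 𝓝 x, ∀ v w : EuclideanSpace ℝ (Fin n),
    ⟦coordField x v, coordField x w⟧ y = 0 := by
  filter_upwards [(chartAt (EuclideanSpace ℝ (Fin n)) x).open_source.mem_nhds (mem_chart_source _ x)]
    with y hy v w
  have hc : ∀ v : EuclideanSpace ℝ (Fin n),
      MDifferentiableAt 𝓘(ℝ, EuclideanSpace ℝ (Fin n)) 𝓘(ℝ, EuclideanSpace ℝ (Fin n)).tangent
      (fun z => (⟨z, v⟩ : TangentBundle 𝓘(ℝ, EuclideanSpace ℝ (Fin n)) (EuclideanSpace ℝ (Fin n))))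
      (extChartAt (𝓡 n) x y) := fun v =>
    (contMDiffAt_vectorSpace_iff_contDiffAt (n := ∞).2 contDiffAt_const).mdifferentiableAt (by simp)
  have : IsManifold (𝓡 n) (minSmoothness ℝ 3) M := by
    rw [minSmoothness_of_isRCLikeNormedField]
    exact IsManifold.of_le (n := ∞) (WithTop.coe_le_coe.2 le_top)
  have h := VectorField.mpullback_mlieBracket (I := 𝓡 n)
    (I' := 𝓘(ℝ, EuclideanSpace ℝ (Fin n))) (n := ∞) (hc v) (hc w) (contMDiffAt_extChartAt' hy) (by
      rw [minSmoothness_of_isRCLikeNormedField]; exact WithTop.coe_le_coe.2 le_top)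
  refine h.symm.trans ?_
  have h0 : ∀ V W : (∀ z : EuclideanSpace ℝ (Fin n), TangentSpace (𝓡 n) z), V = (fun _ => v) →
      W = (fun _ => w) → ∀ z, VectorField.mlieBracket (𝓡 n) V W z = 0 := by
    intro V W hV hW z
    rw [← VectorField.mlieBracketWithin_univ]
    refine (congrFun VectorField.mlieBracketWithin_eq_lieBracketWithin z).trans ?_
    subst hV hW
    simp [VectorField.lieBracketWithin]
    rfl
  rw [VectorField.mpullback_apply, h0 _ _ rfl rfl]
  exact map_zero _

variable {F : Type*} [NormedAddCommGroup F] [NormedSpace ℝ F] {x : M} {f : M → F}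

theorem tendsto_extChartAt_symm (x : M) :
    Tendsto (extChartAt (𝓡 n) x).symm (𝓝 (extChartAt (𝓡 n) x x)) (𝓝 x) := by
  simpa using (continuousAt_extChartAt_symm (I := 𝓡 n) x).tendsto

theorem tendsto_extChartAt (x : M) :
    Tendsto (extChartAt (𝓡 n) x) (𝓝 x) (𝓝 (extChartAt (𝓡 n) x x)) :=
  (continuousAt_extChartAt (I := 𝓡 n) x).tendsto

theorem extChartAt_right_inv (x : M) : ∀ᶠ z in 𝓝 (extChartAt (𝓡 n) x x),
    extChartAt (𝓡 n) x ((extChartAt (𝓡 n) x).symm z) = z := by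
  filter_upwards [extChartAt_target_mem_nhds (I := 𝓡 n) x] with z hz
  exact (extChartAt (𝓡 n) x).right_inv hz

/-- A smooth function in the standard chart, and its derivative. -/
theorem eventually_chart (F : Type*) [NormedAddCommGroup F] [NormedSpace ℝ F] (x : M) :
    ∀ᶠ z in 𝓝 (extChartAt (𝓡 n) x x), ∀ f : M → F,
    SmoothNear n f ((extChartAt (𝓡 n) x).symm z) →
    ContDiffAt ℝ ∞ (fun z => f ((extChartAt (𝓡 n) x).symm z)) z ∧
    ∀ v, fderiv ℝ (fun z => f ((extChartAt (𝓡 n) x).symm z)) z v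
      = dirDeriv (coordField x v) f ((extChartAt (𝓡 n) x).symm z) := by
  have hT := tendsto_extChartAt_symm (n := n) x
  have hs : ∀ᶠ z in 𝓝 (extChartAt (𝓡 n) x x),
      (extChartAt (𝓡 n) x).symm z ∈ (chartAt (EuclideanSpace ℝ (Fin n)) x).source :=
    hT ((chartAt (EuclideanSpace ℝ (Fin n)) x).open_source.mem_nhds (mem_chart_source _ x))
  filter_upwards [extChartAt_target_mem_nhds (I := 𝓡 n) x, hs,
    hT.eventually (dirDeriv_coordField (n := n) x), hT.eventually (smoothNear_extChartAt (n := n) x).eventually,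
    extChartAt_right_inv (n := n) x] with z h2 h3 h4 h5 h6 f h1
  have hsm : ContDiffAt ℝ ∞ (fun z => f ((extChartAt (𝓡 n) x).symm z)) z := by
    rw [← contMDiffAt_iff_contDiffAt]
    have h7 : ContMDiffAt 𝓘(ℝ, EuclideanSpace ℝ (Fin n)) (𝓡 n) ∞ (extChartAt (𝓡 n) x).symm z :=
      (contMDiffOn_extChartAt_symm x).contMDiffAt
        ((isOpen_extChartAt_target (I := 𝓡 n) x).mem_nhds h2)
    exact ContMDiffAt.comp z h1.self h7
  refine ⟨hsm, fun v => ?_⟩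
  have hd := (hsm.differentiableAt (by simp)).hasFDerivAt
  rw [← h6] at hd
  have h8 := dirDeriv_comp (X := coordField x v) h5 hd
  rw [h4, h6] at h8
  rw [← h8]
  refine dirDeriv_congr ?_
  filter_upwards [(chartAt (EuclideanSpace ℝ (Fin n)) x).open_source.mem_nhds h3] with y hy
  rw [(extChartAt (𝓡 n) x).left_inv (by rwa [extChartAt_source])]

/-- A function whose derivative vanishes is locally constant. -/
theorem SmoothNear.eventually_const (hf : SmoothNear n f x)
    (h0 : ∀ᶠ y in 𝓝 x, ∀ X : RoughField n M, FieldNear X y → ConformalBGG.dirDeriv X f y = 0) :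
    ∀ᶠ y in 𝓝 x, f y = f x := by
  have hT := tendsto_extChartAt_symm (n := n) x
  have hc : ∀ᶠ z in 𝓝 (extChartAt (𝓡 n) x x), ∀ v : EuclideanSpace ℝ (Fin n), ConformalBGG.dirDeriv (coordField x v) f
      ((extChartAt (𝓡 n) x).symm z) = 0 := by
    filter_upwards [hT.eventually h0, hT.eventually (coordField_near (n := n) x)] with z h1 h2 v
    exact h1 _ (h2 v)
  obtain ⟨r, hr, hall⟩ := Metric.eventually_nhds_iff_ball.1 
    (((hT.eventually hf.eventually).and (eventually_chart F x)).and hc)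
  have hk : ∀ z ∈ Metric.ball (extChartAt (𝓡 n) x x) r, f ((extChartAt (𝓡 n) x).symm z) = f x := by
    intro z hz
    have hd : DifferentiableOn ℝ (fun z => f ((extChartAt (𝓡 n) x).symm z))
        (Metric.ball (extChartAt (𝓡 n) x x) r) := fun w hw =>
      (((hall w hw).1.2 f (hall w hw).1.1).1.differentiableAt (by simp)).differentiableWithinAt
    have := Metric.isOpen_ball.is_const_of_fderiv_eq_zero (𝕜 := ℝ)
      (convex_ball (extChartAt (𝓡 n) x x) r).isPreconnected hd (fun w hw => by
        ext v
        rw [((hall w hw).1.2 f (hall w hw).1.1).2 v, (hall w hw).2 v]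
        rfl) hz (Metric.mem_ball_self hr)
    simpa using this
  filter_upwards [(tendsto_extChartAt (n := n) x).eventually (Metric.ball_mem_nhds _ hr),
    (chartAt (EuclideanSpace ℝ (Fin n)) x).open_source.mem_nhds (mem_chart_source _ x)] with y h1 h2
  have := hk _ h1
  rwa [(extChartAt (𝓡 n) x).left_inv (by rwa [extChartAt_source])] at this

end Charts
end
end ConformalBGG

open scoped Manifold ContDiff Bundle Topology
open Filter
namespace ConformalBGG
noncomputable section
set_option linter.unusedSectionVars false

/-! ### Flatness of the Cartan connection and its parallel frames. -/

section Parallel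

variable {n : ℕ} {M : Type*} [TopologicalSpace M]
  [ChartedSpace (EuclideanSpace ℝ (Fin n)) M] [IsManifold (𝓡 n) ∞ M]
  {g : MetricField n M} {x : M} {e : Fin n → RoughField n M} {X Y : RoughField n M}
local notation "⟦" X ", " Y "⟧" => VectorField.mlieBracket (𝓡 n) X Y

theorem cartanMat_congr (hg : MetricNear g x) (he : IsFrameNear g e x) (hX : FieldNear X x)
    (hY : FieldNear Y x) (h : X x = Y x) : cartanMat g e X x = cartanMat g e Y x :=
  tensorial_pointwise (fun X => cartanMat g e X x) (fun _ _ h1 h2 => cartanMat_add hg he h1 h2)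
    (fun _ _ hf h => cartanMat_smul hg he hf h) hX hY h

theorem cartanMat_eq_zero (hg : MetricNear g x) (he : IsFrameNear g e x) (hX : FieldNear X x)
    (h : X x = 0) : cartanMat g e X x = 0 := by
  have h1 : X x = (X + X) x := by simp [h]
  have h2 := cartanMat_congr hg he hX (hX.add hX) h1
  rw [cartanMat_add hg he hX hX] at h2
  simpa using h2

/-- The conformal Cartan connection in the standard chart, along a constant vector. -/
def chartCartan (g : MetricField n M) (e : Fin n → RoughField n M) (x : M)
    (z v : EuclideanSpace ℝ (Fin n)) : Matrix (Idx n) (Idx n) ℝ :=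
  cartanMat g e (coordField x v) ((extChartAt (𝓡 n) x).symm (extChartAt (𝓡 n) x x + z))

variable {A : Type*} [NormedRing A] [NormedAlgebra ℝ A]
  (φ : Matrix (Idx n) (Idx n) ℝ ≃ₐ[ℝ] A)

/-- The conformal Cartan connection in the standard chart, for matrices in a normed algebra. -/
def chartConn (g : MetricField n M) (e : Fin n → RoughField n M) (x : M)
    (z : EuclideanSpace ℝ (Fin n)) : EuclideanSpace ℝ (Fin n) →L[ℝ] A :=
  ∑ i, (EuclideanSpace.proj i : EuclideanSpace ℝ (Fin n) →L[ℝ] ℝ).smulRight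
    (φ (chartCartan g e x z (EuclideanSpace.single i 1)))

theorem tendsto_chart_shift (x : M) : Tendsto
    (fun z => (extChartAt (𝓡 n) x).symm (extChartAt (𝓡 n) x x + z)) (𝓝 0) (𝓝 x) := by
  refine (tendsto_extChartAt_symm (n := n) x).comp ?_
  have h : Continuous fun z => extChartAt (𝓡 n) x x + z := by fun_prop
  simpa using h.tendsto 0

/-- Expanding over the standard basis makes `chartConn` a continuous linear map at every point. It
agrees with the Cartan connection where the latter is known to be linear, which is the case near the
origin. -/
theorem chartConn_apply (hg : MetricNear g x) (he : IsFrameNear g e x) :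
    ∀ᶠ z in 𝓝 (0 : EuclideanSpace ℝ (Fin n)), ∀ v, chartConn φ g e x z v
      = φ (chartCartan g e x z v) := by
  have hT := tendsto_chart_shift (n := n) x
  filter_upwards [hT.eventually hg.eventually, hT.eventually he.eventually,
    hT.eventually (coordField_near (n := n) x)] with z h1 h2 h3 v
  let L : EuclideanSpace ℝ (Fin n) →ₗ[ℝ] Matrix (Idx n) (Idx n) ℝ :=
    { toFun := chartCartan g e x z
      map_add' := fun v w => by
        rw [chartCartan, coordField_add, cartanMat_add h1 h2 (h3 v) (h3 w)]
        rfl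
      map_smul' := fun c v => by
        rw [chartCartan, coordField_smul, cartanMat_smul h1 h2 (.const c) (h3 v)]
        rfl }
  have hv : v = ∑ i, v i • EuclideanSpace.single i (1 : ℝ) := by
    ext j
    simp [Finset.sum_apply, Pi.single_apply]
  have h4 : L v = ∑ i, v i • L (EuclideanSpace.single i 1) := by
    conv_lhs => rw [hv]
    rw [map_sum]
    simp only [map_smul]
  have h5 := congrArg φ h4
  rw [map_sum] at h5
  simp only [map_smul] at h5
  rw [chartConn, _root_.sum_apply]
  exact h5.symm

/-- An entry of a matrix, as a continuous linear map. -/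
def entryCLM [FiniteDimensional ℝ A] (p q : Idx n) : A →L[ℝ] ℝ :=
  LinearMap.toContinuousLinearMap
    ((Matrix.entryLinearMap ℝ ℝ p q).comp φ.symm.toLinearMap)

theorem entryCLM_apply [FiniteDimensional ℝ A] (p q : Idx n) (a : A) :
    entryCLM φ p q a = φ.symm a p q := rfl

theorem chartCartan_chart (hg : MetricNear g x) (he : IsFrameNear g e x) :
    ∀ᶠ z in 𝓝 (0 : EuclideanSpace ℝ (Fin n)), ∀ (w : EuclideanSpace ℝ (Fin n)) (p q : Idx n),
      ContDiffAt ℝ ∞ (fun z => chartCartan g e x z w p q) z ∧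
      ∀ v, fderiv ℝ (fun z => chartCartan g e x z w p q) z v
        = dirDeriv (coordField x v) (fun y => cartanMat g e (coordField x w) y p q)
          ((extChartAt (𝓡 n) x).symm (extChartAt (𝓡 n) x x + z)) := by
  have hs : Tendsto (fun z => extChartAt (𝓡 n) x x + z) (𝓝 0) (𝓝 (extChartAt (𝓡 n) x x)) := by
    have h : Continuous fun z => extChartAt (𝓡 n) x x + z := by fun_prop
    simpa using h.tendsto 0
  have hT := tendsto_chart_shift (n := n) x
  filter_upwards [hT.eventually hg.eventually, hT.eventually he.eventually,
    hT.eventually (coordField_near (n := n) x), hs.eventually (eventually_chart (n := n) ℝ x)]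
    with z h1 h2 h3 h4 w p q
  have hz := h4 _ (smoothNear_cartanMat h1 h2 (h3 w) p q)
  refine ⟨hz.1.comp z (contDiffAt_const.add contDiffAt_id), fun v => ?_⟩
  rw [← hz.2 v]
  exact congrArg (fun T : EuclideanSpace ℝ (Fin n) →L[ℝ] ℝ => T v)
    (fderiv_comp_add_left (𝕜 := ℝ) (f := fun z => cartanMat g e (coordField x w)
      ((extChartAt (𝓡 n) x).symm z) p q) (extChartAt (𝓡 n) x x))

theorem chartConn_contDiffAt (hg : MetricNear g x) (he : IsFrameNear g e x) :
    ∀ᶠ z in 𝓝 (0 : EuclideanSpace ℝ (Fin n)), ContDiffAt ℝ ∞ (chartConn φ g e x) z := by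
  filter_upwards [chartCartan_chart hg he] with z hz
  refine ContDiffAt.sum fun i _ => contDiffAt_const.smulRight ?_
  have e1 : (fun z => φ (chartCartan g e x z (EuclideanSpace.single i 1))) = fun z => ∑ p, ∑ q,
      chartCartan g e x z (EuclideanSpace.single i 1) p q • φ (Matrix.single p q (1 : ℝ)) := by
    funext z
    conv_lhs => rw [Matrix.matrix_eq_sum_single (chartCartan g e x z (EuclideanSpace.single i 1))]
    simp only [map_sum, ← map_smul, Matrix.smul_single, smul_eq_mul, mul_one]
  rw [e1]
  exact ContDiffAt.sum fun p _ => ContDiffAt.sum fun q _ => (hz _ p q).1.smul contDiffAt_const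

theorem chartConn_deriv [FiniteDimensional ℝ A] (hg : MetricNear g x) (he : IsFrameNear g e x) :
    ∀ᶠ z in 𝓝 (0 : EuclideanSpace ℝ (Fin n)), ∀ v w p q,
      φ.symm (fderiv ℝ (chartConn φ g e x) z v w) p q
        = dirDeriv (coordField x v) (fun y => cartanMat g e (coordField x w) y p q)
          ((extChartAt (𝓡 n) x).symm (extChartAt (𝓡 n) x x + z)) := by
  filter_upwards [chartConn_contDiffAt φ hg he, (chartConn_apply φ hg he).eventually_nhds,
    chartCartan_chart hg he] with z h1 h2 h3 v w p q
  have hd := (h1.differentiableAt (by simp)).hasFDerivAt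
  have h4 := ((entryCLM φ p q).comp (ContinuousLinearMap.apply ℝ A w)).hasFDerivAt.comp z hd
  have h5 : (fun z => chartCartan g e x z w p q)
      =ᶠ[𝓝 z] ((entryCLM φ p q).comp (ContinuousLinearMap.apply ℝ A w)) ∘ chartConn φ g e x := by
    filter_upwards [h2] with z hz
    simp [entryCLM_apply, hz]
  rw [← (h3 w p q).2 v, h5.fderiv_eq, h4.fderiv]
  rfl

/-- The structure equation for coordinate fields: they commute, so the term with the bracket drops,
and the right-hand side vanishes with `W` and `Y`. -/
theorem chartConn_flat [FiniteDimensional ℝ A] (hg : MetricNear g x) (he : IsFrameNear g e x)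
    (hW : ∀ᶠ y in 𝓝 x, ∀ u v w : TangentSpace (𝓡 n) y, weyl g y u v w = 0)
    (hC : ∀ᶠ y in 𝓝 x, ∀ X Y : RoughField n M, FieldNear X y → FieldNear Y y →
      ∀ w : TangentSpace (𝓡 n) y, cotton g X Y y w = 0) :
    ∀ᶠ z in 𝓝 (0 : EuclideanSpace ℝ (Fin n)), ∀ v w,
      fderiv ℝ (chartConn φ g e x) z v w - fderiv ℝ (chartConn φ g e x) z w v
      + (chartConn φ g e x z v * chartConn φ g e x z w
        - chartConn φ g e x z w * chartConn φ g e x z v) = 0 := by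
  have hT := tendsto_chart_shift (n := n) x
  filter_upwards [hT.eventually hg.eventually, hT.eventually he.eventually,
    hT.eventually (coordField_near (n := n) x), hT.eventually (coordField_bracket (n := n) x),
    hT.eventually hW, hT.eventually hC, chartConn_deriv φ hg he, chartConn_apply φ hg he]
    with z h1 h2 h3 h4 h5 h6 h7 h8 v w
  refine φ.symm.injective ?_
  ext p q
  have hs := cartan_structure h1 h2 (h3 v) (h3 w) p q
  rw [cartanMat_eq_zero h1 h2 ((h3 v).bracket (h3 w)) (h4 v w)] at hs
  have h0 : (gOrth (Matrix.of fun i j : Fin n => (0 : ℝ)) - gPlus (fun _ : Fin n => (0 : ℝ))) p q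
      = 0 := by
    rcases p with p | p | p <;> rcases q with q | q | q <;> simp [gOrth, gPlus, blockDiag]
  simp only [h5, h6 _ _ (h3 v) (h3 w), map_zero, _root_.zero_apply, h0] at hs
  rw [map_add, map_sub, Matrix.add_apply, Matrix.sub_apply, h7, h7, h8, h8]
  simpa [chartCartan] using hs

/-- If the Weyl and Cotton tensors vanish, the conformal Cartan connection has a parallel frame. -/
theorem exists_parallel_frame (hg : MetricNear g x) (he : IsFrameNear g e x)
    (hW : ∀ᶠ y in 𝓝 x, ∀ u v w : TangentSpace (𝓡 n) y, weyl g y u v w = 0)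
    (hC : ∀ᶠ y in 𝓝 x, ∀ X Y : RoughField n M, FieldNear X y → FieldNear Y y →
      ∀ w : TangentSpace (𝓡 n) y, cotton g X Y y w = 0) :
    ∃ T : M → Matrix (Idx n) (Idx n) ℝ, T x = 1 ∧ (∀ p q, SmoothNear n (fun y => T y p q) x) ∧
      ∀ᶠ y in 𝓝 x, ∀ X : RoughField n M, FieldNear X y → ∀ p q,
        dirDeriv X (fun y => T y p q) y = - (cartanMat g e X y * T y) p q := by
  let _ : NormedRing (Matrix (Idx n) (Idx n) ℝ) := Matrix.linftyOpNormedRing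
  let _ : NormedAlgebra ℝ (Matrix (Idx n) (Idx n) ℝ) := Matrix.linftyOpNormedAlgebra
  -- The auxiliary norm on matrices is used only through an isomorphic abstract normed algebra,
  -- which keeps it apart from the entrywise statements.
  suffices h : ∀ {A : Type} [NormedRing A] [NormedAlgebra ℝ A] [FiniteDimensional ℝ A]
      (φ : Matrix (Idx n) (Idx n) ℝ ≃ₐ[ℝ] A), ∃ T : M → Matrix (Idx n) (Idx n) ℝ, T x = 1 ∧
        (∀ p q, SmoothNear n (fun y => T y p q) x) ∧
      ∀ᶠ y in 𝓝 x, ∀ X : RoughField n M, FieldNear X y → ∀ p q,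
        dirDeriv X (fun y => T y p q) y = - (cartanMat g e X y * T y) p q from
    h (A := Matrix (Idx n) (Idx n) ℝ) AlgEquiv.refl
  intro A _ _ _ φ
  have : CompleteSpace A := FiniteDimensional.complete ℝ A
  obtain ⟨s, hs0, hs⟩ := exists_parallel (chartConn_contDiffAt φ hg he)
    (chartConn_flat φ hg he hW hC) 1
  have hψ : Tendsto (fun y => extChartAt (𝓡 n) x y - extChartAt (𝓡 n) x x) (𝓝 x) (𝓝 0) := by
    have := (tendsto_extChartAt (n := n) x).sub_const (extChartAt (𝓡 n) x x)
    simpa using this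
  have hψs : SmoothNear n (fun y => extChartAt (𝓡 n) x y - extChartAt (𝓡 n) x x) x :=
    (smoothNear_extChartAt x).sub (.const _)
  refine ⟨fun y => φ.symm (s (extChartAt (𝓡 n) x y - extChartAt (𝓡 n) x x)), ?_, fun p q => ?_, ?_⟩
  · simp [hs0]
  · refine hψs.comp_contDiffAt (φ := fun z => entryCLM φ p q (s z)) ?_
    exact (hψ.eventually hs).mono fun z hz => (entryCLM φ p q).contDiff.contDiffAt.comp _ hz.1
  · filter_upwards [hψ.eventually hs, hψ.eventually (chartConn_apply φ hg he),
      (smoothNear_extChartAt (n := n) x).eventually, coordField_dirDeriv (n := n) x,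
      coordField_near (n := n) x, hg.eventually, he.eventually,
      (chartAt (EuclideanSpace ℝ (Fin n)) x).open_source.mem_nhds (mem_chart_source _ x)]
      with y h1 h2 h3 h4 h5 h6 h7 h8 X hX p q
    have h9 := (entryCLM φ p q).hasFDerivAt.comp _ h1.2
    have h10 := dirDeriv_comp (X := X) (h3.sub (.const (extChartAt (𝓡 n) x x))) h9
    rw [dirDeriv_sub h3 (.const _), dirDeriv_const, sub_zero] at h10
    refine h10.trans ?_
    -- The coordinate field with the components of `X` at `y` has the same value there as `X`, and
    -- the Cartan connection is tensorial.
    have h11 : chartCartan g e x (extChartAt (𝓡 n) x y - extChartAt (𝓡 n) x x)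
        (dirDeriv X (fun y => extChartAt (𝓡 n) x y) y) = cartanMat g e X y := by
      rw [chartCartan, add_sub_cancel, (extChartAt (𝓡 n) x).left_inv (by rwa [extChartAt_source])]
      exact cartanMat_congr h6 h7 (h5 _) hX (h4 X)
    rw [ContinuousLinearMap.comp_apply, parallelDeriv_apply, h2, h11, entryCLM_apply, map_neg,
      map_mul, AlgEquiv.symm_apply_apply]
    rfl

end Parallel
end
end ConformalBGG

open scoped Manifold ContDiff Bundle Topology
open Filter
namespace ConformalBGG
noncomputable section
set_option linter.unusedSectionVars false

/-! ### The conformal factor obtained from a null parallel tractor. -/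

section ConformalFactor

variable {n : ℕ} {M : Type*} [TopologicalSpace M]
  [ChartedSpace (EuclideanSpace ℝ (Fin n)) M] [IsManifold (𝓡 n) ∞ M]
  {g : MetricField n M} {x : M} {e : Fin n → RoughField n M} {X Y : RoughField n M}

/-- A parallel section of the standard tractor bundle, in terms of its components. -/
structure IsParallelTractor (g : MetricField n M) (e : Fin n → RoughField n M)
    (a σ : M → ℝ) (m : Fin n → M → ℝ) (x : M) : Prop where
  top : ∀ X : RoughField n M, FieldNear X x →
    dirDeriv X a x = ∑ j, schoutenForm g e X x j * m j x
  mid : ∀ X : RoughField n M, FieldNear X x → ∀ i,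
    dirDeriv X (m i) x = - (∑ k, connForm g e X x i k * m k x) - coframe g e X x i * a x
      - schoutenForm g e X x i * σ x
  bot : ∀ X : RoughField n M, FieldNear X x →
    dirDeriv X σ x = ∑ j, coframe g e X x j * m j x

/-- The last column of a parallel frame that is the identity at `x`; its value there is the null
vector `e_{n+1}`. -/
theorem exists_parallel_tractor (hg : MetricNear g x) (he : IsFrameNear g e x)
    (hW : ∀ᶠ y in 𝓝 x, ∀ u v w : TangentSpace (𝓡 n) y, weyl g y u v w = 0)
    (hC : ∀ᶠ y in 𝓝 x, ∀ X Y : RoughField n M, FieldNear X y → FieldNear Y y →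
      ∀ w : TangentSpace (𝓡 n) y, cotton g X Y y w = 0) :
    ∃ (a σ : M → ℝ) (m : Fin n → M → ℝ), SmoothNear n a x ∧ SmoothNear n σ x ∧
      (∀ i, SmoothNear n (m i) x) ∧ a x = 0 ∧ σ x = 1 ∧ (∀ i, m i x = 0) ∧
      ∀ᶠ y in 𝓝 x, IsParallelTractor g e a σ m y := by
  obtain ⟨T, hT0, hT, hp⟩ := exists_parallel_frame hg he hW hC
  refine ⟨fun y => T y (.inl ()) (.inr (.inr ())), fun y => T y (.inr (.inr ())) (.inr (.inr ())),
    fun i y => T y (.inr (.inl i)) (.inr (.inr ())), hT _ _, hT _ _, fun i => hT _ _,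
    by simp [hT0], by simp [hT0], fun i => by simp [hT0], ?_⟩
  filter_upwards [hp] with y hy
  refine ⟨fun X hX => ?_, fun X hX i => ?_, fun X hX => ?_⟩ <;> rw [hy X hX] <;>
    simp [cartanMat, Matrix.mul_apply, Fintype.sum_sum_type, gOrth, gMinus, gPlus, blockDiag,
      Finset.sum_neg_distrib]
  ring

/-- The function is the square of the tractor with respect to `b`, and the connection takes values
in `o(b)`, so parallel tractors have constant square. -/
theorem IsParallelTractor.norm_deriv {a σ : M → ℝ} {m : Fin n → M → ℝ} (hg : MetricNear g x)
    (he : IsFrameNear g e x) (ha : SmoothNear n a x) (hσ : SmoothNear n σ x)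
    (hm : ∀ i, SmoothNear n (m i) x) (h : IsParallelTractor g e a σ m x) (hX : FieldNear X x) :
    dirDeriv X (fun y => 2 * (a y * σ y) + ∑ i, m i y * m i y) x = 0 := by
  have h1 : ∀ i ∈ Finset.univ, SmoothNear n (fun y => m i y * m i y) x :=
    fun i _ => (hm i).mul (hm i)
  have h2 : SmoothNear n (fun y => a y * σ y) x := ha.mul hσ
  rw [dirDeriv_add ((SmoothNear.const 2).mul h2) (.sum h1), dirDeriv_sum h1,
    dirDeriv_mul (.const 2) h2, dirDeriv_const, dirDeriv_mul ha hσ, h.top X hX, h.bot X hX]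
  have h3 : ∀ i, dirDeriv X (fun y => m i y * m i y) x
      = 2 * (m i x * (- (∑ k, connForm g e X x i k * m k x) - coframe g e X x i * a x
      - schoutenForm g e X x i * σ x)) := by
    intro i
    rw [dirDeriv_mul (hm i) (hm i), h.mid X hX i]
    ring
  simp only [h3]
  have h4 : ∑ i, m i x * ∑ k, connForm g e X x i k * m k x = 0 := by
    have h5 : ∑ i, m i x * ∑ k, connForm g e X x i k * m k x
        = - ∑ i, m i x * ∑ k, connForm g e X x i k * m k x := by
      simp only [Finset.mul_sum, ← Finset.sum_neg_distrib]
      rw [Finset.sum_comm]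
      refine Finset.sum_congr rfl fun i _ => Finset.sum_congr rfl fun k _ => ?_
      rw [connForm_skew hg he hX k i]
      ring
    linarith
  have h6 : ∑ i, 2 * (m i x * (- (∑ k, connForm g e X x i k * m k x) - coframe g e X x i * a x
      - schoutenForm g e X x i * σ x)) = 2 * (- (∑ i, m i x * ∑ k, connForm g e X x i k * m k x)
        - a x * (∑ j, coframe g e X x j * m j x) - σ x * ∑ j, schoutenForm g e X x j * m j x) := by
    rw [← Finset.mul_sum]
    congr 1
    rw [Finset.mul_sum, Finset.mul_sum, ← Finset.sum_neg_distrib, ← Finset.sum_sub_distrib,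
      ← Finset.sum_sub_distrib]
    exact Finset.sum_congr rfl fun i _ => by ring
  rw [h6, h4]
  ring

/-- The gradient of the logarithm of the inverse conformal scale. -/
def scaleGradient (e : Fin n → RoughField n M) (σ : M → ℝ) (m : Fin n → M → ℝ) : RoughField n M :=
  ∑ i, (fun y => - (m i y * (σ y)⁻¹)) • e i

theorem coframe_scaleGradient {σ : M → ℝ} {m : Fin n → M → ℝ} {y : M}
    (horth : ∀ i j, g y (e i y) (e j y) = if i = j then 1 else 0) (i : Fin n) :
    coframe g e (scaleGradient e σ m) y i = - (m i y * (σ y)⁻¹) := by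
  have : scaleGradient e σ m y = ∑ i, (- (m i y * (σ y)⁻¹)) • e i y := by
    simp [scaleGradient, Finset.sum_apply]
  rw [coframe, this]
  simp [_root_.sum_apply, horth]

theorem inner_eq_coframe (hg : IsMetricAt g x)
    (horth : ∀ i j, g x (e i x) (e j x) = if i = j then 1 else 0) (X Y : RoughField n M) :
    g x (X x) (Y x) = ∑ i, coframe g e X x i * coframe g e Y x i :=
  (hg.sum_inner horth (X x) (Y x)).symm

/-- The bottom equation says that the gradient of `σ` is `m`, so that of `-log σ` is `-m / σ`. -/
theorem isGradient_scale {a σ : M → ℝ} {m : Fin n → M → ℝ} (hg : MetricNear g x)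
    (he : IsFrameNear g e x) (hσ : SmoothNear n σ x) (hm : ∀ i, SmoothNear n (m i) x)
    (hσ0 : 0 < σ x) (h : ∀ᶠ y in 𝓝 x, IsParallelTractor g e a σ m y) :
    IsGradient g (fun y => - Real.log (σ y)) (scaleGradient e σ m) x := by
  refine ⟨.sum fun i _ => .smul ((hm i).mul (hσ.inv hσ0.ne')).neg (he.near i), ?_⟩
  filter_upwards [hg.eventually, he.eventually, hσ.eventually,
    hσ.self.continuousAt.eventually (lt_mem_nhds hσ0), h] with y h1 h2 h3 h4 h5 X
  have h6 : dirDeriv X (fun y => - Real.log (σ y)) y = - ((σ y)⁻¹ * dirDeriv X σ y) := by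
    have := dirDeriv_comp (X := X) h3 ((Real.hasDerivAt_log h4.ne').neg.hasFDerivAt)
    refine this.trans ?_
    simp
    ring
  have h7 : dirDeriv X σ y = dirDeriv (ext (X y)) σ y := dirDeriv_field_congr (by simp)
  rw [h6, h7, h5.bot _ (FieldNear.ext _), ip, inner_eq_coframe h1.self h2.orth.self_of_nhds,
    Finset.mul_sum, ← Finset.sum_neg_distrib]
  refine Finset.sum_congr rfl fun i _ => ?_
  rw [coframe_scaleGradient h2.orth.self_of_nhds, coframe, coframe, ext_self]
  ring

/-- With `f = -log σ` and gradient `G = -m / σ`, the middle equation gives `∇G = P + (a / σ) g + df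
⊗ df`. Nullity of the tractor says `a / σ = -|df|² / 2`, so the terms subtracted and added in
`confHess` leave exactly `P`. -/
theorem confHess_scale {a σ : M → ℝ} {m : Fin n → M → ℝ} (hg : MetricNear g x)
    (he : IsFrameNear g e x) (hσ : SmoothNear n σ x) (hm : ∀ i, SmoothNear n (m i) x)
    (hσ0 : 0 < σ x) (h : IsParallelTractor g e a σ m x)
    (hb : 2 * (a x * σ x) + ∑ i, m i x * m i x = 0) (v w : TangentSpace (𝓡 n) x) :
    confHess g (scaleGradient e σ m) x v w = schouten g x v w := by
  have horth := he.orth.self_of_nhds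
  set G := scaleGradient e σ m
  have hG : FieldNear G x := .sum fun i _ => .smul ((hm i).mul (hσ.inv hσ0.ne')).neg (he.near i)
  have hv : FieldNear (ext v) x := FieldNear.ext v
  have hGi : ∀ i, coframe g e G x i = - (m i x * (σ x)⁻¹) := coframe_scaleGradient horth
  have hinv : dirDeriv (ext v) (fun y => (σ y)⁻¹) x
      = - ((σ x)⁻¹ * (σ x)⁻¹) * dirDeriv (ext v) σ x := by
    have := dirDeriv_comp (X := ext v) hσ (hasDerivAt_inv hσ0.ne').hasFDerivAt
    refine this.trans ?_
    simp
    field_simp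
  have hnab : ∀ i, coframe g e (leviCivita g (ext v) G) x i
      = (σ x)⁻¹ * (coframe g e (ext v) x i * a x) + schoutenForm g e (ext v) x i
        + m i x * ((σ x)⁻¹ * (σ x)⁻¹) * ∑ j, coframe g e (ext v) x j * m j x := by
    intro i
    have h1 := dirDeriv_coframe hg he hv hG i
    have h2 : dirDeriv (ext v) (fun y => coframe g e G y i) x
        = dirDeriv (ext v) (fun y => - (m i y * (σ y)⁻¹)) x :=
      dirDeriv_congr (he.orth.mono fun y hy => coframe_scaleGradient hy i)
    rw [h2, dirDeriv_neg, dirDeriv_mul (hm i) (hσ.inv hσ0.ne'), hinv, h.bot _ hv,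
      h.mid _ hv i] at h1
    have h3 : ∑ k, connForm g e (ext v) x i k * coframe g e G x k
        = - (σ x)⁻¹ * ∑ k, connForm g e (ext v) x i k * m k x := by
      rw [Finset.mul_sum]
      exact Finset.sum_congr rfl fun k _ => by rw [hGi]; ring
    rw [h3] at h1
    have h4 : (σ x)⁻¹ * σ x = 1 := inv_mul_cancel₀ hσ0.ne'
    linear_combination -h1 + schoutenForm g e (ext v) x i * h4
  have hGv : g x (G x) v = - (σ x)⁻¹ * ∑ j, coframe g e (ext v) x j * m j x := by
    have := inner_eq_coframe hg.self horth G (ext v)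
    rw [ext_self] at this
    rw [this, Finset.mul_sum]
    exact Finset.sum_congr rfl fun k _ => by rw [hGi]; ring
  have hGG : g x (G x) (G x) = (σ x)⁻¹ * (σ x)⁻¹ * ∑ i, m i x * m i x := by
    rw [inner_eq_coframe hg.self horth G G, Finset.mul_sum]
    exact Finset.sum_congr rfl fun k _ => by rw [hGi]; ring
  have key : ∀ i, confHess g G x v (e i x) = schouten g x v (e i x) := by
    intro i
    have h1 := confHess_eq hg hG hv (e i x)
    rw [ext_self] at h1
    rw [h1]
    have h2 := hnab i
    have h3 := hGi i
    have h4 : coframe g e (ext v) x i = g x v (e i x) := by rw [coframe, ext_self]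
    have h5 : schoutenForm g e (ext v) x i = schouten g x v (e i x) := by
      rw [schoutenForm, ext_self]
    rw [h5, h4] at h2
    simp only [coframe] at h2 h3
    rw [h2, h3, hGv, hGG]
    have h6 : (σ x)⁻¹ * σ x = 1 := inv_mul_cancel₀ hσ0.ne'
    simp only [coframe, ext_self]
    linear_combination (g x v (e i x) * ((σ x)⁻¹ * (σ x)⁻¹) / 2) * hb
      + (- g x v (e i x) * (σ x)⁻¹ * a x) * h6
  rw [hg.self.expand horth w]
  have l1 := confHess_linear (g := g) (G := G) v
  have l2 := schouten_linear hg v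
  have e1 := map_sum (l1.mk' _) (fun i => g x w (e i x) • e i x) Finset.univ
  have e2 := map_sum (l2.mk' _) (fun i => g x w (e i x) • e i x) Finset.univ
  simp only [IsLinearMap.mk'_apply] at e1 e2
  rw [e1, e2]
  refine Finset.sum_congr rfl fun i _ => ?_
  rw [l1.map_smul, l2.map_smul, key]

/-- A metric with vanishing Weyl and Cotton tensors is conformally flat. -/
theorem isConformallyFlat_of_weyl_cotton (hg : ∀ y, MetricNear g y)
    (hW : ∀ (y : M) (u v w : TangentSpace (𝓡 n) y), weyl g y u v w = 0)
    (hC : ∀ (y : M) (X Y : RoughField n M), FieldNear X y → FieldNear Y y →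
      ∀ w : TangentSpace (𝓡 n) y, cotton g X Y y w = 0) : IsConformallyFlat g := by
  intro x
  obtain ⟨e, he1, he2⟩ := (hg x).exists_orthonormal_frame
  have he : IsFrameNear g e x := ⟨he1, he2⟩
  obtain ⟨a, σ, m, ha, hσ, hm, ha0, hσ0, hm0, hp⟩ :=
    exists_parallel_tractor (hg x) he (.of_forall hW) (.of_forall hC)
  -- The square of the tractor is locally constant and vanishes at `x`.
  have hnorm : ∀ᶠ y in 𝓝 x, 2 * (a y * σ y) + ∑ i, m i y * m i y = 0 := by
    have hs : SmoothNear n (fun y => 2 * (a y * σ y) + ∑ i, m i y * m i y) x :=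
      ((SmoothNear.const 2).mul (ha.mul hσ)).add (.sum fun i _ => (hm i).mul (hm i))
    have h1 := hs.eventually_const (by
      filter_upwards [he.eventually, ha.eventually, hσ.eventually,
        eventually_all.2 fun i => (hm i).eventually, hp] with y h1 h2 h3 h4 h5 X hX
      exact h5.norm_deriv (hg y) h1 h2 h3 h4 hX)
    filter_upwards [h1] with y hy
    rw [hy, ha0]
    simp [hm0]
  have hpos : 0 < σ x := by rw [hσ0]; exact one_pos
  have hall : ∀ᶠ y in 𝓝 x, SmoothNear n (fun y => - Real.log (σ y)) y ∧
      ∀ u v w : TangentSpace (𝓡 n) y,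
        riemann (fun z => Real.exp (2 * (- Real.log (σ z))) • g z) y u v w = 0 := by
    filter_upwards [he.eventually, hσ.eventually, eventually_all.2 fun i => (hm i).eventually,
      hp.eventually_nhds, hσ.self.continuousAt.eventually (lt_mem_nhds hpos), hnorm]
      with y h1 h2 h3 h4 h5 h6
    have hf : SmoothNear n (fun y => - Real.log (σ y)) y := (h2.log h5.ne').neg
    refine ⟨hf, fun u v w => ?_⟩
    have h7 := riemann_confMetric (hg y) hf (isGradient_scale (hg y) h1 h2 h3 h5 h4) u v w
    refine h7.trans ?_
    -- With this tensor equal to `P`, the curvature of the new metric is the defining expression of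
    -- `W`.
    have h8 : ∀ v, confHess g (scaleGradient e σ m) y v = schouten g y v := fun v =>
      funext fun w => confHess_scale (hg y) h1 h2 h3 h5 h4.self_of_nhds h6 v w
    rw [h8, h8]
    exact hW y u v w
  obtain ⟨U, hU, hUo, hxU⟩ := eventually_nhds_iff.1 hall
  exact ⟨U, hUo, hxU, _, fun y hy => (hU y hy).1.self.contMDiffWithinAt, fun y hy => (hU y hy).2⟩

end ConformalFactor
end
end ConformalBGG

open scoped Manifold ContDiff Bundle Topology
open Filter
namespace ConformalBGG
noncomputable section
set_option linter.unusedSectionVars false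

/-! ### The complex condition and conformal flatness. -/

section Complex

variable {n : ℕ} {M : Type*} [TopologicalSpace M]
  [ChartedSpace (EuclideanSpace ℝ (Fin n)) M] [IsManifold (𝓡 n) ∞ M]
  {V : Type*} [NormedAddCommGroup V] [NormedSpace ℝ V] [FiniteDimensional ℝ V]
  {ρ : Representation ℝ (orthGroup n) V} {g : MetricField n M} {x : M}
  {X Y X' Y' : RoughField n M}

theorem weyl_linear (hg : MetricNear g x) (u v : TangentSpace (𝓡 n) x) :
    IsLinearMap ℝ (weyl g x u v) := by
  have h1 := (schouten_linear hg u)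
  have h2 := (schouten_linear hg v)
  constructor
  · intro w z
    simp only [weyl, braceAct, riemann_add_right hg, h1.map_add, h2.map_add, map_add,
      _root_.add_apply, add_smul, smul_add]
    abel
  · intro c w
    simp only [weyl, braceAct, riemann_smul_right hg, h1.map_smul, h2.map_smul, map_smul,
      _root_.smul_apply, smul_eq_mul, mul_smul, smul_sub, smul_add, smul_comm c]

theorem dirDeriv_schouten_add (hg : MetricNear g x) (hY : FieldNear Y x) {Z Z' : RoughField n M}
    (hZ : FieldNear Z x) (hZ' : FieldNear Z' x) :
    dirDeriv X (fun y => schouten g y (Y y) ((Z + Z') y)) x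
      = dirDeriv X (fun y => schouten g y (Y y) (Z y)) x
        + dirDeriv X (fun y => schouten g y (Y y) (Z' y)) x := by
  rw [← dirDeriv_add (smoothNear_schouten hg hY hZ) (smoothNear_schouten hg hY hZ')]
  exact dirDeriv_congr (hg.eventually.mono fun y hy => (schouten_linear hy (Y y)).map_add _ _)

theorem dirDeriv_schouten_smul (hg : MetricNear g x) (hY : FieldNear Y x) {Z : RoughField n M}
    (hZ : FieldNear Z x) (c : ℝ) :
    dirDeriv X (fun y => schouten g y (Y y) ((c • Z) y)) x
      = c * dirDeriv X (fun y => schouten g y (Y y) (Z y)) x := by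
  have h := dirDeriv_mul (X := X) (SmoothNear.const c) (smoothNear_schouten hg hY hZ)
  rw [dirDeriv_const, zero_mul, add_zero] at h
  rw [← h]
  exact dirDeriv_congr (hg.eventually.mono fun y hy => (schouten_linear hy (Y y)).map_smul _ _)

theorem cotton_linear (hg : MetricNear g x) (hX : FieldNear X x) (hY : FieldNear Y x) :
    IsLinearMap ℝ (cotton g X Y x) := by
  have key : ∀ Z, FieldNear Z x → _ := fun Z hZ => cotton_eq X Y Z hX hY hZ hg
  have hl := fun v => schouten_linear hg v
  constructor
  · intro v w
    have hv := FieldNear.ext v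
    have hw := FieldNear.ext w
    have h1 := key (ext v + ext w) (hv.add hw)
    have h2 := key (ext v) hv
    have h3 := key (ext w) hw
    rw [dirDeriv_schouten_add hg hY hv hw, dirDeriv_schouten_add hg hX hv hw,
      leviCivita_add_right hg hX hv hw, leviCivita_add_right hg hY hv hw] at h1
    simp only [Pi.add_apply, ext_self, (hl _).map_add] at h1 h2 h3
    rw [h1, h2, h3]
    ring
  · intro c v
    have hv := FieldNear.ext v
    have h1 := key (c • ext v) (hv.const_smul c)
    have h2 := key (ext v) hv
    have h4 : ∀ {X : RoughField n M}, FieldNear X x →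
        leviCivita g X (c • ext v) x = c • leviCivita g X (ext v) x := by
      intro X hX
      have := leviCivita_smul_right hg hX (SmoothNear.const c) hv
      rw [dirDeriv_const, zero_smul, add_zero] at this
      exact this
    rw [dirDeriv_schouten_smul hg hY hv, dirDeriv_schouten_smul hg hX hv, h4 hX, h4 hY] at h1
    simp only [Pi.smul_apply, ext_self, (hl _).map_smul, smul_eq_mul] at h1 h2
    rw [h1, h2, smul_eq_mul]
    ring

theorem cotton_congr (hg : MetricNear g x) (hX : FieldNear X x) (hY : FieldNear Y x)
    (hX' : ∀ᶠ y in 𝓝 x, X' y = X y) (hY' : ∀ᶠ y in 𝓝 x, Y' y = Y y) :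
    cotton g X' Y' x = cotton g X Y x := by
  funext w
  have h1 := hX.congr hX'
  have h2 := hY.congr hY'
  simp only [cotton, leviCivitaForm]
  rw [bracket_congr hX' hY', leviCivita_congr_left hg h1 hX (.ext w) hX'.self_of_nhds,
    leviCivita_congr_left hg h2 hY (.ext w) hY'.self_of_nhds, hX'.self_of_nhds, hY'.self_of_nhds,
    dirDeriv_field_congr hX'.self_of_nhds, dirDeriv_field_congr hY'.self_of_nhds,
    dirDeriv_congr (s := fun y => schouten g y (X' y) (ext w y))
      (hX'.mono fun y hy => congrArg (fun v => schouten g y v (ext w y)) hy),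
    dirDeriv_congr (s := fun y => schouten g y (Y' y) (ext w y))
      (hY'.mono fun y hy => congrArg (fun v => schouten g y v (ext w y)) hy)]

/-- Cut-off functions supported where `p` holds: their product with an object that is smooth only
there is smooth everywhere. -/
theorem exists_bump [T2Space M] {p : M → Prop} (hp : ∀ᶠ y in 𝓝 x, p y) :
    ∃ χ : M → ℝ, ContMDiff (𝓡 n) 𝓘(ℝ, ℝ) ∞ χ ∧ (∀ᶠ y in 𝓝 x, χ y = 1) ∧
      ∀ y, p y ∨ ∀ᶠ z in 𝓝 y, χ z = 0 := by
  obtain ⟨χ, -, hχ⟩ := (SmoothBumpFunction.nhds_basis_tsupport (I := 𝓡 n) x).mem_iff.1 hp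
  refine ⟨χ, χ.contMDiff, χ.eventuallyEq_one, fun y => ?_⟩
  by_cases hy : y ∈ tsupport χ
  · exact .inl (hχ hy)
  · exact .inr (notMem_tsupport_iff_eventuallyEq.1 hy)

/-- Every local vector field extends to a global one. -/
theorem exists_global_field [T2Space M] (hX : FieldNear X x) :
    ∃ Z : VectorFields n M, ∀ᶠ y in 𝓝 x, Z y = X y := by
  obtain ⟨χ, hs, h1, h0⟩ := exists_bump (n := n) hX.eventually
  refine ⟨⟨fun y => χ y • X y, fun y => ?_⟩, h1.mono fun y hy => ?_⟩
  · rcases h0 y with h | h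
    · exact (FieldNear.smul (hs.contMDiffOn.smoothNear isOpen_univ (Set.mem_univ y)) h).self_of_nhds
    · have : FieldNear (fun y => χ y • X y) y :=
        FieldNear.zero.congr (h.mono fun z hz => by simp [hz])
      exact this.self_of_nhds
  · change χ y • X y = X y
    rw [hy, one_smul]

/-- Sections of the bundle with a prescribed value. -/
theorem exists_section [T2Space M] (hg : ∀ y, MetricNear g y) (hρ : IsSmoothRep ρ)
    {e : ∀ y : M, Frame g y} (he : IsFrameNear g (frameFields e) x) (v : V) :
    ∃ s : FrameFun g V, IsSection ρ s ∧ s x (e x) = v := by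
  obtain ⟨χ, hs, h1, h0⟩ := exists_bump (n := n) he.eventually
  -- The section that is constant equal to `v` in the frame `e`, cut off to where `e` is smooth.
  -- Equivariance is the cocycle rule `rotElt_mul`.
  refine ⟨fun y u => χ y • ρ (rotElt (hg y) u (e y)) v, isSection_of hg (fun y u u' => ?_)
    (fun y e' he' => ?_), ?_⟩
  · rw [map_smul, ← Module.End.mul_apply, ← map_mul, rotElt_mul]
  · rcases h0 y with h | h
    · refine SmoothNear.smul (hs.contMDiffOn.smoothNear isOpen_univ (Set.mem_univ y)) ?_
      have hC : ∀ p q, SmoothNear n (fun z => (rotElt (hg z) (e' z) (e z)).1.1 p q) y := fun p q =>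
        smoothNear_blockDiag 1 1 (fun i j => smoothNear_rotMat (hg y) he' h i j) p q
      exact (dirDeriv_rep hρ hC).1.clm_apply (.const v)
    · exact (SmoothNear.const 0).congr (h.mono fun z hz => by simp [hz])
  · change χ x • ρ (rotElt (hg x) (e x) (e x)) v = v
    rw [h1.self_of_nhds, one_smul, rotElt_self, map_one]
    rfl

theorem isForm_zero_degree {s : FrameFun g V} (hs : IsSection ρ s) :
    IsForm ρ 0 (fun _ => s : PreForm g V 0) :=
  ⟨fun _ => hs, fun _ i => i.elim0, fun _ i => i.elim0, fun _ i => i.elim0⟩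

theorem dTwisted_dTwisted_section (hg : ∀ y, MetricNear g y) (hρ : IsSmoothRep ρ)
    {s : FrameFun g V} (hs : IsSection ρ s) (X Y : VectorFields n M) :
    dTwisted ρ (dTwisted ρ (fun _ => s : PreForm g V 0)) ![X, Y]
      = actSkew ρ (fun x => weyl g x (X x) (Y x)) s
        - actForm ρ (cotton g (fun x => X x) (fun x => Y x)) s := by
  rw [dTwisted_dTwisted hg hρ (isForm_zero_degree hs), Fin.sum_univ_two]
  simp [Finset.filter_singleton]

/-- Degree zero suffices: sections take arbitrary values at `x`, so `d² = 0` equates two operators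
on `V`, one from `o(n)` and one from `g_1`, and `infAct_faithful` forces both elements to vanish. -/
theorem weyl_cotton_eq_zero_of_complex [T2Space M] (hg : ∀ y, MetricNear g y) (hρ : IsSmoothRep ρ)
    (hne : ∃ B : Matrix (Idx n) (Idx n) ℝ, InLieAlg B ∧ infAct ρ B ≠ 0)
    (h : TwistedIsComplex g ρ) (hX : FieldNear X x) (hY : FieldNear Y x) :
    (∀ w, weyl g x (X x) (Y x) w = 0) ∧ ∀ w, cotton g X Y x w = 0 := by
  obtain ⟨Z₁, h1⟩ := exists_global_field hX
  obtain ⟨Z₂, h2⟩ := exists_global_field hY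
  obtain ⟨u, hu⟩ := (hg x).self.exists_orthonormal
  obtain ⟨e, he, heu⟩ := exists_frame_through hg ⟨u, hu⟩
  have hact : infAct ρ (gOrth (Matrix.of fun i j => g x (weyl g x (X x) (Y x) (u j)) (u i)))
      = infAct ρ (gPlus fun i => cotton g X Y x (u i)) := by
    ext v
    obtain ⟨s, hs, hsv⟩ := exists_section hg hρ he v
    have h3 := congrFun (congrFun ((dTwisted_dTwisted_section hg hρ hs Z₁ Z₂).symm.trans
      (congrFun (h 0 _ (isForm_zero_degree hs)).2 ![Z₁, Z₂])) x) (e x)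
    have h4 := sub_eq_zero.1 h3
    simp only [actSkew, actForm, hsv, h1.self_of_nhds, h2.self_of_nhds,
      cotton_congr (hg x) hX hY h1 h2] at h4
    rw [heu] at h4
    exact h4
  have hskew : ∀ i j, (Matrix.of fun i j => g x (weyl g x (X x) (Y x) (u j)) (u i)) i j
      = - (Matrix.of fun i j => g x (weyl g x (X x) (Y x) (u j)) (u i)) j i := by
    intro i j
    have := weyl_skew (X := X) (Y := Y) (e := fun i => ext (u i)) (hg x) i j
    simp only [ext_self] at this
    exact this
  obtain ⟨hW, hC⟩ := infAct_faithful hρ hne hskew hact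
  constructor
  · intro w
    have h5 : ∀ j, weyl g x (X x) (Y x) (u j) = 0 := by
      intro j
      rw [(hg x).self.expand hu (weyl g x (X x) (Y x) (u j))]
      refine Finset.sum_eq_zero fun i _ => ?_
      have := congrFun (congrFun hW i) j
      rw [Matrix.of_apply] at this
      rw [this]
      exact zero_smul _ _
    have l := weyl_linear (hg x) (X x) (Y x)
    rw [(hg x).self.expand hu w]
    refine (map_sum (l.mk' _) _ _).trans (Finset.sum_eq_zero fun i _ => ?_)
    rw [map_smul, IsLinearMap.mk'_apply, h5, smul_zero]
  · intro w
    have l := cotton_linear (hg x) hX hY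
    rw [(hg x).self.expand hu w]
    refine (map_sum (l.mk' _) _ _).trans (Finset.sum_eq_zero fun i _ => ?_)
    have h6 : cotton g X Y x (u i) = 0 := congrFun hC i
    rw [map_smul, IsLinearMap.mk'_apply, h6, smul_zero]

theorem isComplex_of_weyl_cotton (hg : ∀ y, MetricNear g y) (hρ : IsSmoothRep ρ)
    (hW : ∀ (y : M) (u v w : TangentSpace (𝓡 n) y), weyl g y u v w = 0)
    (hC : ∀ (y : M) (X Y : RoughField n M), FieldNear X y → FieldNear Y y →
      ∀ w : TangentSpace (𝓡 n) y, cotton g X Y y w = 0) : TwistedIsComplex g ρ := by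
  refine fun k φ hφ => ⟨hφ.dTwisted hg hρ, ?_⟩
  funext ξ
  rw [dTwisted_dTwisted hg hρ hφ]
  refine Finset.sum_eq_zero fun l _ => Finset.sum_eq_zero fun j _ => ?_
  funext x u
  have h1 : gOrth (Matrix.of fun _ _ : Fin n => (0 : ℝ)) = 0 := by
    ext p q
    rcases p with p | p | p <;> rcases q with q | q | q <;> simp [gOrth, blockDiag]
  have h2 : gPlus (fun _ : Fin n => (0 : ℝ)) = 0 := by
    ext p q
    rcases p with p | p | p <;> rcases q with q | q | q <;> simp [gPlus]
  simp [actSkew, actForm, hW, hC x _ _ (VectorFields.near _ x) (VectorFields.near _ x), h1, h2,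
    infAct_zero hρ]

theorem isComplex_iff_isConformallyFlat [T2Space M] (hn : 3 ≤ n) (hg : ∀ y, MetricNear g y)
    (hρ : IsSmoothRep ρ) (hne : ∃ B : Matrix (Idx n) (Idx n) ℝ, InLieAlg B ∧ infAct ρ B ≠ 0) :
    TwistedIsComplex g ρ ↔ IsConformallyFlat g := by
  constructor
  · intro h
    refine isConformallyFlat_of_weyl_cotton hg (fun y u v w => ?_) fun y X Y hX hY =>
      (weyl_cotton_eq_zero_of_complex hg hρ hne h hX hY).2
    have := (weyl_cotton_eq_zero_of_complex hg hρ hne h (FieldNear.ext u) (FieldNear.ext v)).1 w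
    simpa only [ext_self] using this
  · intro h
    have h0 : ∀ y : M, (∀ u v w : TangentSpace (𝓡 n) y, weyl g y u v w = 0) ∧
        ∀ X Y : RoughField n M, FieldNear X y → FieldNear Y y →
          ∀ w : TangentSpace (𝓡 n) y, cotton g X Y y w = 0 := by
      intro y
      obtain ⟨U, hU, hy, f, hf, hflat⟩ := h y
      exact weyl_cotton_eq_zero hn (hg y) (hf.smoothNear hU hy)
        (Filter.eventually_of_mem (hU.mem_nhds hy) hflat)
    exact isComplex_of_weyl_cotton hg hρ (fun y => (h0 y).1) fun y => (h0 y).2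

end Complex
end
end ConformalBGG
theorem proposition2p6 {n : ℕ} (hn : 3 ≤ n)
    {M : Type*} [TopologicalSpace M] [T2Space M] [SecondCountableTopology M]
    [ChartedSpace (EuclideanSpace ℝ (Fin n)) M] [IsManifold (𝓡 n) ∞ M]
    (g : Bundle.ContMDiffRiemannianMetric (𝓡 n) ∞ (EuclideanSpace ℝ (Fin n))
      (fun x : M => TangentSpace (𝓡 n) x))
    {V : Type*} [NormedAddCommGroup V] [NormedSpace ℝ V] [FiniteDimensional ℝ V]
    (ρ : Representation ℝ (orthGroup n) V) (hsmooth : IsSmoothRep ρ) (hirr : ρ.IsIrreducible) :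
    -- the decomposition of `V` into the components `V_0, …, V_N`
    (∃ N : ℕ, DirectSum.IsInternal fun j : Fin (N + 1) => gradePart ρ (j : ℕ)) ∧
    (∀ (k : ℕ) (φ : PreForm g.inner V k), IsForm ρ k φ →
      -- (1)
      dTwisted ρ φ = dNabla ρ φ + del ρ φ - delP ρ φ ∧
      (∀ i : ℤ, component ρ i (dTwisted ρ φ) =
        dNabla ρ (component ρ i φ) + del ρ (component ρ (i + 1) φ)
          - delP ρ (component ρ (i - 1) φ)) ∧
      -- (2)
      (∀ (i : ℤ) (ξ : Fin (k + 2) → VectorFields n M),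
        component ρ i (dTwisted ρ (dTwisted ρ φ)) ξ =
          ∑ l : Fin (k + 2), ∑ j : Fin (k + 1) with Fin.castSucc j < l,
            (-1 : ℝ) ^ ((j : ℕ) + (l : ℕ) + 1) •
              (actSkew ρ (fun x => weyl g.inner x (ξ j.castSucc x) (ξ l x))
                  (component ρ i φ (omitTwo ξ j l))
                - actForm ρ (cotton g.inner (fun x => ξ j.castSucc x) (fun x => ξ l x))
                  (component ρ (i - 1) φ (omitTwo ξ j l))))) ∧
    -- the twisted de Rham sequence is a complex if and only if `g` is conformally flat
    ((∃ B : Matrix (Idx n) (Idx n) ℝ, InLieAlg B ∧ infAct ρ B ≠ 0) →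
      (TwistedIsComplex g.inner ρ ↔ IsConformallyFlat g.inner)) := by
  have hg : ∀ y, MetricNear g.inner y := fun y => metricNear_of_contMDiff g y
  obtain ⟨hind, htop, -⟩ := exists_grading (by omega) hsmooth hirr
  refine ⟨exists_isInternal (by omega) hsmooth hirr, fun k φ hφ => ⟨dTwisted_eq_add_sub φ,
    fun i => component_dTwisted hg hsmooth hind htop hφ i,
    fun i ξ => component_dTwisted_dTwisted hg hsmooth hind htop hφ i ξ⟩,
    fun hne => isComplex_iff_isConformallyFlat hn hg hsmooth hne⟩
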